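/- **Setting.** A game structure is a finite directed graph $(V,E)$ without deadlock whose vertices are partitioned into $V_1$ (vertices of player 1) and $V_2$ (vertices of player 2). A play is an infinite path $\pi=\pi[0]\pi[1]\ldots$, and $\pi[i,\infty]$ denotes its suffix from position $i$. Let $p_1,\ldots,p_n\colon V\to\{0,\ldots,d\}$ be priority functions, $d$ even. For priorities write $c\preceq c'$ if $c$ is even and $c\le c'$. For a priority function $p$ and $\lambda\ge 1$ let - $\mathsf{DirFixPR}(\lambda,p)$ be the set of plays with $\forall j\,\exists l<\lambda:\ p(\pi[j+l])\preceq p(\pi[j])$, - $\mathsf{DirFixWP}(\lambda,p)$ be the set of plays with $\forall j\,\exists l<\lambda\,\forall k\le l:\ p(\pi[j+l])\preceq p(\pi[j+k])$. For $\mathsf X\in\{\mathsf{PR},\mathsf{WP}\}$ let $\mathsf{DirBndX}(p)=\bigcup_{\lambda\ge1}\mathsf{DirFixX}(\lambda,p)$, and let $\mathsf{BndX}(p)$ be the set of plays with a suffix in $\mathsf{DirBndX}(p)$. For families $(Rq_i),(Rp_i)$ of subsets of $V$, $\mathsf{DirBndRR}((Rq_i,Rp_i)_i)$ is the set of plays for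 which there is a bound $\lambda\ge1$ such that, for all $i$, each visit to $Rq_i$ is followed within $\lambda$ steps by a visit to $Rp_i$; $\mathsf{BndRR}$ is the set of plays with a suffix in $\mathsf{DirBndRR}$. An objective is a set of plays; player 1 wants the play to be in it, player 2 wants it to be outside. A strategy has memory $k$ if it is encoded by a Moore machine with $k$ states. **Statement.** Let $\mathsf X\in\{\mathsf{PR},\mathsf{WP}\}$ and $b=|V|\cdot 2^{n\cdot\frac d2}\cdot n\cdot\frac d2$. 0. (Reduction.) Consider the $n\cdot\frac d2$ pairs $Rq_{m,c}=\{v: p_m(v)=c\}$, $Rp_{m,c}=\{v: p_m(v)\preceq c\}$ for $1\le m\le n$ and odd $c\le d$. Then $\bigcap_m\mathsf{DirBndX}(p_m)=\mathsf{DirBndRR}((Rq_{m,c},Rp_{m,c})_{m,c})$ and $\bigcap_m\mathsf{BndX}(p_m)=\mathsf{BndRR}((Rq_{m,c},Rp_{m,c})_{m,c})$, so that these games are (direct) bounded request-response games on the same game structure. 1. (Direct.) For the objective $\bigcap_{m=1}^n\mathsf{DirBndX}(p_m)$, deciding the winner from a given initial vertex $v_0$ (i.e. telling which of the two players has a winning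 strategy from $v_0$) can be done in time $O(b^2)$, and exponential-memory strategies suffice for both players: there is a polynomial $q$ such that a player who has a winning strategy from $v_0$ has one with at most $2^{q(|V|+n+d)}$ memory states. 2. (Undirect.) For the objective $\bigcap_{m=1}^n\mathsf{BndX}(p_m)$, deciding the winner from $v_0$ can be done in time $O(|V|\cdot b^2)$, and exponential-memory strategies suffice for player 1 in the same sense. Player 2 needs infinite memory: for every $n\ge1$ there is a game with $n$ priority functions and $d=2$ and an initial vertex from which player 2 has a winning strategy but no finite-memory winning strategy. Running times are those of a single program for a random access machine with unit cost and words of $O(\log(|V|+n+d+b))$ bits whose input (adjacency matrix, owners of the vertices, priorities, $n$, $d$, $v_0$) lies in memory; when $b=0$ (no odd priority or no dimension) both time bounds are to be read as $O(1)$. -/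

import Mathlib

/-- The two players. -/
inductive Player where
  | one
  | two

/-- A game structure on the vertex set `V`: a directed graph without deadlock, whose vertices are
partitioned between the two players. Finiteness of `V` is a separate assumption. -/
structure GameStructure (V : Type*) where
  owner : V → Player
  E : V → V → Prop
  no_deadlock : ∀ v, ∃ w, E v w

namespace GameStructure

variable {V : Type*} (G : GameStructure V)

/-- The plays: infinite paths of the graph. -/
def Plays : Set (ℕ → V) := {π | ∀ k, G.E (π k) (π (k + 1))}

/-- A strategy of player `i`. `next ρ v` is the successor chosen after the history `ρ v`; only its
values at the vertices `v` of player `i` matter. -/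
structure Strategy (i : Player) where
  next : List V → V → V
  legal : ∀ ρ v, G.owner v = i → G.E v (next ρ v)

variable {G}

/-- The strategy `σ` is encoded by a deterministic Moore machine with at most `k` memory states. -/
def Strategy.HasMemory {i : Player} (σ : G.Strategy i) (k : ℕ) : Prop :=
  ∃ (M : Type) (_ : Fintype M) (m₀ : M) (upd : M → V → M) (act : M → V → V),
    Fintype.card M ≤ k ∧ ∀ ρ v, G.owner v = i → σ.next ρ v = act (ρ.foldl upd m₀) v

/-- The strategy `σ` is a finite-memory strategy. -/
def Strategy.FiniteMemory {i : Player} (σ : G.Strategy i) : Prop := ∃ k, σ.HasMemory k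

/-- The history of length `k + 1` played from `v₀`, split into the first `k` vertices and the
last one. -/
def outcomeHist (v₀ : V) (σ₁ : G.Strategy .one) (σ₂ : G.Strategy .two) : ℕ → List V × V
  | 0 => ([], v₀)
  | k + 1 =>
    let h := outcomeHist v₀ σ₁ σ₂ k
    (h.1 ++ [h.2],
      match G.owner h.2 with
      | .one => σ₁.next h.1 h.2
      | .two => σ₂.next h.1 h.2)

/-- The outcome: the unique play from `v₀` consistent with both strategies. -/
def outcome (v₀ : V) (σ₁ : G.Strategy .one) (σ₂ : G.Strategy .two) (k : ℕ) : V :=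
  (outcomeHist v₀ σ₁ σ₂ k).2

/-- `σ₁` is a winning strategy of player one from `v₀` for his objective `Obj`. -/
def Winning₁ (Obj : Set (ℕ → V)) (v₀ : V) (σ₁ : G.Strategy .one) : Prop :=
  ∀ σ₂ : G.Strategy .two, outcome v₀ σ₁ σ₂ ∈ Obj

/-- `σ₂` is a winning strategy of player two from `v₀` when `Obj` is the objective of player one,
so that player two wants to realize the complement of `Obj` in the set of plays. -/
def Winning₂ (Obj : Set (ℕ → V)) (v₀ : V) (σ₂ : G.Strategy .two) : Prop :=
  ∀ σ₁ : G.Strategy .one, outcome v₀ σ₁ σ₂ ∈ G.Plays \ Obj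

end GameStructure

/-! ### Objectives -/

/-- The partial order on priorities: `c` is even and `c ≤ c'`. -/
def PrioLE (c c' : ℕ) : Prop := Even c ∧ c ≤ c'

/-- The suffix of a sequence from position `i` on. -/
def suffixFrom {V : Type*} (π : ℕ → V) (i : ℕ) : ℕ → V := fun k => π (i + k)

/-- The two families of objectives: parity-response and window parity. -/
inductive ObjKind where
  | PR
  | WP

namespace GameStructure

variable {V : Type*} (G : GameStructure V)

/-- The direct fixed objectives with bound `L`. -/
def DirFix (X : ObjKind) (L : ℕ) (p : V → ℕ) : Set (ℕ → V) :=
  match X with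
  | .PR => {π | π ∈ G.Plays ∧ ∀ j, ∃ l < L, PrioLE (p (π (j + l))) (p (π j))}
  | .WP => {π | π ∈ G.Plays ∧
      ∀ j, ∃ l < L, ∀ k ≤ l, PrioLE (p (π (j + l))) (p (π (j + k)))}

/-- The direct bounded objectives. -/
def DirBnd (X : ObjKind) (p : V → ℕ) : Set (ℕ → V) :=
  {π | π ∈ G.Plays ∧ ∃ L, 0 < L ∧ π ∈ G.DirFix X L p}

/-- The (undirect) bounded objectives. -/
def Bnd (X : ObjKind) (p : V → ℕ) : Set (ℕ → V) :=
  {π | π ∈ G.Plays ∧ ∃ i, suffixFrom π i ∈ G.DirBnd X p}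

/-- The direct bounded request-response objective: for some bound, every request is followed by a
corresponding response within that many steps. -/
def DirBndRR {ι : Type*} (Rq Rp : ι → Set V) : Set (ℕ → V) :=
  {π | π ∈ G.Plays ∧ ∃ L, 0 < L ∧ ∀ i j, π j ∈ Rq i → ∃ l ≤ L, π (j + l) ∈ Rp i}

/-- The bounded request-response objective: eventually the direct one. -/
def BndRR {ι : Type*} (Rq Rp : ι → Set V) : Set (ℕ → V) :=
  {π | π ∈ G.Plays ∧ ∃ i, suffixFrom π i ∈ G.DirBndRR Rq Rp}

end GameStructure

/-- A multi-dimension game: a game structure with `n` priority functions into `{0, …, d}`,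
`d` even. -/
structure MultiGame (V : Type*) extends GameStructure V where
  n : ℕ
  d : ℕ
  d_even : Even d
  p : Fin n → V → ℕ
  p_le : ∀ m v, p m v ≤ d

namespace MultiGame

variable {V : Type*} (G : MultiGame V)

/-- The conjunction over all dimensions of the direct bounded objectives. -/
def DirBndObj (X : ObjKind) : Set (ℕ → V) :=
  {π | π ∈ G.Plays ∧ ∀ m, π ∈ G.DirBnd X (G.p m)}

/-- The conjunction over all dimensions of the bounded objectives. -/
def BndObj (X : ObjKind) : Set (ℕ → V) :=
  {π | π ∈ G.Plays ∧ ∀ m, π ∈ G.Bnd X (G.p m)}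

/-- The number of pairs (dimension, odd priority). -/
def r : ℕ := G.n * (G.d / 2)

/-- The parameter `b = |V| · 2 ^ (n · d / 2) · (n · d / 2)`. -/
noncomputable def b : ℕ := Nat.card V * 2 ^ G.r * G.r

/-- Requests of the pair `(m, c)`, for the odd priority `2 * c + 1` in dimension `m`. -/
def request (i : Fin G.n × Fin (G.d / 2)) : Set V := {v | G.p i.1 v = 2 * i.2.1 + 1}

/-- Responses of the pair `(m, c)`. -/
def response (i : Fin G.n × Fin (G.d / 2)) : Set V := {v | PrioLE (G.p i.1 v) (2 * i.2.1 + 1)}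

/-- The size of the game, as far as exponential bounds are concerned. -/
noncomputable def size : ℕ := Nat.card V + G.n + G.d

end MultiGame

/-! ### Random access machine with unit cost and words of bounded length -/

/-- The arithmetic operations (truncated subtraction, division rounding down). -/
inductive ArithOp where
  | add
  | sub
  | mul
  | div

def ArithOp.eval : ArithOp → ℕ → ℕ → ℕ
  | .add, a, c => a + c
  | .sub, a, c => a - c
  | .mul, a, c => a * c
  | .div, a, c => a / c

/-- A configuration: registers and memory cells. -/
structure RamState where
  reg : ℕ → ℕ
  mem : ℕ → ℕ

/-- Programs. Registers are named by numbers fixed in the program; memory cells are addressed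
indirectly, through the contents of registers. -/
inductive RamProg where
  /-- do nothing -/
  | skip
  /-- `reg x := c` -/
  | const (x c : ℕ)
  /-- `reg x := reg y o reg z` -/
  | op (o : ArithOp) (x y z : ℕ)
  /-- `reg x := mem (reg y)` -/
  | load (x y : ℕ)
  /-- `mem (reg x) := reg y` -/
  | store (x y : ℕ)
  /-- first `P`, then `Q` -/
  | seq (P Q : RamProg)
  /-- if `reg x < reg y` then `P` else `Q` -/
  | ifLt (x y : ℕ) (P Q : RamProg)
  /-- while `reg x < reg y` do `P` -/
  | whileLt (x y : ℕ) (P : RamProg)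

/-- `RamRuns W P s s' t`: started in `s`, the program `P` halts in `s'` after `t` elementary steps,
and no number greater than `W` is computed on the way. Every elementary instruction and every test
of a condition costs one step. -/
inductive RamRuns (W : ℕ) : RamProg → RamState → RamState → ℕ → Prop
  | skip (s : RamState) : RamRuns W .skip s s 1
  | const (s : RamState) (x c : ℕ) (h : c ≤ W) :
      RamRuns W (.const x c) s ⟨Function.update s.reg x c, s.mem⟩ 1
  | op (s : RamState) (o : ArithOp) (x y z : ℕ) (h : o.eval (s.reg y) (s.reg z) ≤ W) :
      RamRuns W (.op o x y z) s
        ⟨Function.update s.reg x (o.eval (s.reg y) (s.reg z)), s.mem⟩ 1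
  | load (s : RamState) (x y : ℕ) :
      RamRuns W (.load x y) s ⟨Function.update s.reg x (s.mem (s.reg y)), s.mem⟩ 1
  | store (s : RamState) (x y : ℕ) :
      RamRuns W (.store x y) s ⟨s.reg, Function.update s.mem (s.reg x) (s.reg y)⟩ 1
  | seq {P Q : RamProg} {s₁ s₂ s₃ : RamState} {t₁ t₂ : ℕ}
      (h₁ : RamRuns W P s₁ s₂ t₁) (h₂ : RamRuns W Q s₂ s₃ t₂) :
      RamRuns W (.seq P Q) s₁ s₃ (t₁ + t₂)
  | if_true {x y : ℕ} {P Q : RamProg} {s₁ s₂ : RamState} {t : ℕ}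
      (hc : s₁.reg x < s₁.reg y) (h : RamRuns W P s₁ s₂ t) :
      RamRuns W (.ifLt x y P Q) s₁ s₂ (1 + t)
  | if_false {x y : ℕ} {P Q : RamProg} {s₁ s₂ : RamState} {t : ℕ}
      (hc : ¬ s₁.reg x < s₁.reg y) (h : RamRuns W Q s₁ s₂ t) :
      RamRuns W (.ifLt x y P Q) s₁ s₂ (1 + t)
  | while_true {x y : ℕ} {P : RamProg} {s₁ s₂ s₃ : RamState} {t₁ t₂ : ℕ}
      (hc : s₁.reg x < s₁.reg y) (h₁ : RamRuns W P s₁ s₂ t₁)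
      (h₂ : RamRuns W (.whileLt x y P) s₂ s₃ t₂) :
      RamRuns W (.whileLt x y P) s₁ s₃ (1 + t₁ + t₂)
  | while_false {x y : ℕ} {P : RamProg} {s : RamState}
      (hc : ¬ s.reg x < s.reg y) :
      RamRuns W (.whileLt x y P) s s 1

namespace MultiGame

open Classical in
/-- The words describing a game with vertices `0, …, N - 1`: first the owners of the vertices
(0 for player one, 1 for player two), then the adjacency matrix row by row, then the priority
functions one after the other. -/
noncomputable def inputWords {N : ℕ} (G : MultiGame (Fin N)) : List ℕ :=
  List.ofFn (fun v : Fin N => match G.owner v with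
    | .one => 0
    | .two => 1) ++
  List.ofFn (fun e : Fin (N * N) =>
    if G.E (finProdFinEquiv.symm e).1 (finProdFinEquiv.symm e).2 then 1 else 0) ++
  List.ofFn (fun e : Fin (G.n * N) => G.p (finProdFinEquiv.symm e).1 (finProdFinEquiv.symm e).2)

/-- The initial configuration on the game `G` and the initial vertex `v₀`: the registers 0 to 3 hold
the number of vertices, `n`, `d` and `v₀`, and the memory holds the description of the game. -/
noncomputable def input {N : ℕ} (G : MultiGame (Fin N)) (v₀ : Fin N) : RamState where
  reg := fun x => [N, G.n, G.d, v₀.1].getD x 0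
  mem := fun a => G.inputWords.getD a 0

end MultiGame

/-- There is one program that, on every multi-dimension game `G` and initial vertex `v₀`, halts within
`O(time G)` steps, using only words of `O(log (size + b))` bits, with the winner for the objective
`Obj G` from `v₀` in register 0: the value 1 if player one has a winning strategy, the value 0 if player
two has one. The summand `1` only matters if `time G = 0`. -/
def WinnerDecidableInTime (Obj : ∀ {N : ℕ}, MultiGame (Fin N) → Set (ℕ → Fin N))
    (time : ∀ {N : ℕ}, MultiGame (Fin N) → ℕ) : Prop :=
  ∃ (P : RamProg) (C k : ℕ), ∀ (N : ℕ) (G : MultiGame (Fin N)) (v₀ : Fin N),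
    ∃ (s : RamState) (t : ℕ),
      RamRuns ((G.size + G.b + 2) ^ k) P (G.input v₀) s t ∧
      t ≤ C * (time G + 1) ∧
      ((s.reg 0 = 1 ∧ ∃ σ : G.Strategy .one, GameStructure.Winning₁ (Obj G) v₀ σ) ∨
       (s.reg 0 = 0 ∧ ∃ σ : G.Strategy .two, GameStructure.Winning₂ (Obj G) v₀ σ))

/-! ### Bounded objectives as request-response objectives -/

namespace GameStructure

variable {V : Type*} (G : GameStructure V)

/-! Reduction. An even priority answers itself, so only odd priorities act as requests. If every
priority is answered within `L` steps, then all windows close within a bounded time, by induction on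
the priority (`window_of_response`); hence the two kinds of bounded objectives agree. Finitely many
dimensions have a common bound and a common suffix.

Direct game. With `r` request-response pairs, consider the triples of a vertex, a set of pending
requests and one awaited request; the awaited request moves on cyclically whenever it is found not
to be pending, and these nodes form a Büchi set. The product has `|V| * 2 ^ r * r` nodes, which is
the number `b`. Finite Büchi games are determined with certificates (`exists_buchiSolution`): a rank
for player one that drops off the Büchi set, or a rank for player two that never rises and drops on
it. The first rank is bounded by finiteness, so every request is answered in bounded time
(`exists_bound_of_run`). The second makes one request pending forever, which violates every bound.
Both strategies remember only the pending set and the awaited request, that is `2 ^ r * r` memory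
states.

Undirect game. Player one may discard any prefix, so a vertex is won as soon as some node over it is
won in the product, whatever is pending there. The vertices found become winning sinks, and the
product is solved again until nothing new appears (`HasLayers`). Outside the final set player two
wins the product from every node. He plays in rounds, each starting with no pending request, and
ends round `m` when a request has waited for `m` steps (`exists_winning₂_bndRR`). In `delayGame`
infinite memory is unavoidable: finite memory makes the play ultimately periodic, hence its waiting
times bounded.

Time. The classical algorithm for Büchi games takes time nodes times edges, which is too slow here.
Instead traps of player two are sought at levels `k = 1, 2, 4, ...`, where only edges listed in rows
with at most `k` entries are used; a test costs `O(k * M)` for `M` nodes, up to terms `O(M)`. A trap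
found at level `k`, after level `k / 2` has failed, leads to the removal of more than `k / 2` nodes,
so that the total is `O(M ^ 2)` (`solveLoop_spec`). The undirect game takes at most `|V| + 1` such
rounds. The programs are written in a small structured language compiled to the machine and verified
in a calculus of total correctness with time (`Wp`). -/

theorem suffixFrom_mem_plays {G : GameStructure V} {π : ℕ → V} (h : π ∈ G.Plays) (i : ℕ) :
    suffixFrom π i ∈ G.Plays := fun k => h (i + k)

/-- In a play in which every priority is answered within `L` steps, minimal windows close after
boundedly many steps. -/
theorem window_of_response {p : V → ℕ} {π : ℕ → V} {L : ℕ}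
    (h : ∀ j, ∃ l < L, PrioLE (p (π (j + l))) (p (π j))) (c : ℕ) :
    ∀ j, p (π j) ≤ c →
      ∃ l < (c + 1) * L, ∀ k ≤ l, PrioLE (p (π (j + l))) (p (π (j + k))) := by
  induction c with
  | zero =>
    intro j hj
    obtain ⟨l, hl, he, hle⟩ := h j
    refine ⟨0, by omega, fun k hk => ?_⟩
    obtain rfl : k = 0 := by omega
    refine ⟨?_, le_rfl⟩
    simp only [Nat.add_zero]
    rw [Nat.le_zero.mp hj]
    exact Even.zero
  | succ c ih =>
    intro j hj
    obtain ⟨l, hl, he, hle⟩ := h j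
    obtain ⟨k, hk, hmin⟩ := Finset.exists_min_image (Finset.range (l + 1))
      (fun k => p (π (j + k))) ⟨0, by simp⟩
    simp only [Finset.mem_range] at hk hmin
    have hmul : (c + 1 + 1) * L = (c + 1) * L + L := by ring
    -- If the response is itself minimal on its stretch, it closes the window. Otherwise the minimum
    -- has smaller priority than the start, and the window opened at the minimum, bounded by
    -- induction, closes the present one too.
    by_cases hkl : p (π (j + l)) ≤ p (π (j + k))
    · exact ⟨l, by omega, fun i hi => ⟨he, hkl.trans (hmin i (by omega))⟩⟩
    · obtain ⟨l', hl', hw⟩ := ih (j + k) (by omega)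
      refine ⟨k + l', by omega, fun i hi => ?_⟩
      rw [← Nat.add_assoc]
      by_cases hik : i ≤ k
      · have h0 := hw 0 (by omega)
        exact ⟨h0.1, h0.2.trans (by simpa using hmin i (by omega))⟩
      · have h1 := hw (i - k) (by omega)
        rwa [show j + k + (i - k) = j + i by omega] at h1

/-- The case `k = 0` of a closed window is a response. Conversely all priorities are at most `d`, so
`window_of_response` bounds all windows by `(d + 1) * L`. -/
theorem dirBnd_eq_PR (X : ObjKind) {p : V → ℕ} {d : ℕ} (hp : ∀ v, p v ≤ d) :
    G.DirBnd X p = G.DirBnd .PR p := by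
  cases X with
  | PR => rfl
  | WP =>
    ext π
    constructor
    · rintro ⟨hπ, L, hL, -, h⟩
      exact ⟨hπ, L, hL, hπ, fun j => (h j).imp fun l hl => ⟨hl.1, by simpa using hl.2 0 (by omega)⟩⟩
    · rintro ⟨hπ, L, hL, -, h⟩
      exact ⟨hπ, (d + 1) * L, by positivity, hπ, fun j => window_of_response h d j (hp _)⟩

theorem dirBndRR_reindex {ι κ : Type*} (e : κ ≃ ι) (Rq Rp : ι → Set V) :
    G.DirBndRR (fun k => Rq (e k)) (fun k => Rp (e k)) = G.DirBndRR Rq Rp := by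
  ext π
  refine and_congr_right fun _ => exists_congr fun L => and_congr_right fun _ => ?_
  exact e.forall_congr_left.trans (by simp)

theorem bndRR_reindex {ι κ : Type*} (e : κ ≃ ι) (Rq Rp : ι → Set V) :
    G.BndRR (fun k => Rq (e k)) (fun k => Rp (e k)) = G.BndRR Rq Rp := by
  unfold BndRR
  rw [dirBndRR_reindex]

end GameStructure

namespace MultiGame

open GameStructure

variable {V : Type*} (G : MultiGame V)

theorem mem_dirBnd_iff_request (X : ObjKind) (m : Fin G.n) {π : ℕ → V} (hπ : π ∈ G.Plays) :
    π ∈ G.DirBnd X (G.p m) ↔ ∃ L, 0 < L ∧ ∀ (c : Fin (G.d / 2)) (j : ℕ),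
      π j ∈ G.request (m, c) → ∃ l ≤ L, π (j + l) ∈ G.response (m, c) := by
  rw [G.dirBnd_eq_PR X (G.p_le m)]
  constructor
  · rintro ⟨-, L, hL, -, h⟩
    refine ⟨L, hL, fun c j hj => ?_⟩
    obtain ⟨l, hl, hr⟩ := h j
    have hj' : G.p m (π j) = 2 * c.1 + 1 := hj
    exact ⟨l, hl.le, by rw [hj'] at hr; exact hr⟩
  · rintro ⟨L, hL, h⟩
    -- `DirFix` asks for fewer than its bound of steps, `DirBndRR` for at most that many.
    refine ⟨hπ, L + 1, by omega, hπ, fun j => ?_⟩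
    rcases Nat.even_or_odd' (G.p m (π j)) with ⟨c, hc | hc⟩
    · exact ⟨0, by omega, by rw [Nat.add_zero, hc]; exact even_two_mul c, le_rfl⟩
    · have hd := G.p_le m (π j)
      obtain ⟨e, he⟩ := G.d_even
      obtain ⟨l, hl, hr⟩ := h ⟨c, by omega⟩ j hc
      exact ⟨l, by omega, by rw [hc]; exact hr⟩

theorem dirBndObj_eq (X : ObjKind) : G.DirBndObj X = G.DirBndRR G.request G.response := by
  ext π
  refine and_congr_right fun hπ => ?_
  simp only [G.mem_dirBnd_iff_request X _ hπ]
  constructor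
  · intro h
    choose L hL h using h
    -- The sum of the bounds serves all dimensions; the `+ 1` keeps it positive if there are none.
    refine ⟨∑ m, L m + 1, by omega, fun i j hj => ?_⟩
    obtain ⟨l, hl, hr⟩ := h i.1 i.2 j hj
    have := Finset.single_le_sum (f := L) (fun _ _ => Nat.zero_le _) (Finset.mem_univ i.1)
    exact ⟨l, by omega, hr⟩
  · rintro ⟨L, hL, h⟩ m
    exact ⟨L, hL, fun c => h (m, c)⟩

theorem bndObj_eq (X : ObjKind) : G.BndObj X = G.BndRR G.request G.response := by
  ext π
  refine and_congr_right fun hπ => ?_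
  constructor
  · intro h
    choose hp i h using h
    -- Beyond the sum of the starting positions every dimension is in its direct part, since this
    -- part is closed under suffixes.
    refine ⟨∑ m, i m, ?_⟩
    rw [← dirBndObj_eq G X]
    refine ⟨suffixFrom_mem_plays hπ _, fun m => ?_⟩
    have hle := Finset.single_le_sum (f := i) (fun _ _ => Nat.zero_le _) (Finset.mem_univ m)
    have hm := h m
    rw [G.mem_dirBnd_iff_request X m (suffixFrom_mem_plays hπ _)] at hm ⊢
    obtain ⟨L, hL, hm⟩ := hm
    refine ⟨L, hL, fun c j hj => ?_⟩
    obtain ⟨l, hl, hr⟩ := hm c (∑ m, i m - i m + j) (by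
      rw [suffixFrom, show i m + (∑ m, i m - i m + j) = ∑ m, i m + j by omega]; exact hj)
    refine ⟨l, hl, ?_⟩
    rw [suffixFrom, show i m + (∑ m, i m - i m + j + l) = ∑ m, i m + (j + l) by omega] at hr
    exact hr
  · rintro ⟨i, hi⟩ m
    rw [← dirBndObj_eq G X] at hi
    exact ⟨hπ, i, hi.2 m⟩

end MultiGame

/-! ### Certificates for Büchi games -/

/-- The nodes from which player one can force the next node to be in `X`. -/
def CPre₁ {Q : Type*} (own₁ : Q → Prop) (E : Q → Q → Prop) (X : Set Q) : Set Q :=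
  {q | (own₁ q → ∃ x, E q x ∧ x ∈ X) ∧ (¬ own₁ q → ∀ x, E q x → x ∈ X)}

/-- The nodes from which player two can force the next node to be in `X`. -/
def CPre₂ {Q : Type*} (own₁ : Q → Prop) (E : Q → Q → Prop) (X : Set Q) : Set Q :=
  {q | (own₁ q → ∀ x, E q x → x ∈ X) ∧ (¬ own₁ q → ∃ x, E q x ∧ x ∈ X)}

/-- Player one can stay in `A` forever and visit `B` again and again: off `B` the rank decreases. -/
def BuchiCert {Q : Type*} (own₁ : Q → Prop) (E : Q → Q → Prop) (B A : Set Q) (ρ : Q → ℕ) : Prop :=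
  ∀ q ∈ A, q ∈ CPre₁ own₁ E {x | x ∈ A ∧ (q ∉ B → ρ x < ρ q)}

/-- Player two can stay in `C` forever and visit `B` only finitely often: the rank never increases
and decreases on `B`. -/
def CoBuchiCert {Q : Type*} (own₁ : Q → Prop) (E : Q → Q → Prop) (B C : Set Q) (κ : Q → ℕ) : Prop :=
  ∀ q ∈ C, q ∈ CPre₂ own₁ E {x | x ∈ C ∧ κ x ≤ κ q ∧ (q ∈ B → κ x < κ q)}

section Certificates

variable {Q : Type*} {own₁ : Q → Prop} {E : Q → Q → Prop} {B : Set Q}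

theorem CPre₁.mono {X Y : Set Q} (h : X ⊆ Y) : CPre₁ own₁ E X ⊆ CPre₁ own₁ E Y :=
  fun _ hq => ⟨fun h1 => (hq.1 h1).imp fun _ hx => ⟨hx.1, h hx.2⟩, fun h1 x hx => h (hq.2 h1 x hx)⟩

theorem CPre₂.mono {X Y : Set Q} (h : X ⊆ Y) : CPre₂ own₁ E X ⊆ CPre₂ own₁ E Y :=
  fun _ hq => ⟨fun h1 x hx => h (hq.1 h1 x hx), fun h1 => (hq.2 h1).imp fun _ hx => ⟨hx.1, h hx.2⟩⟩

theorem not_mem_cpre₁_iff {X : Set Q} {q : Q} : q ∉ CPre₁ own₁ E X ↔ q ∈ CPre₂ own₁ E Xᶜ := by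
  by_cases h : own₁ q <;> simp [CPre₁, CPre₂, h]

theorem coBuchiCert_empty : CoBuchiCert own₁ E B ∅ (fun _ => 0) := fun _ h => h.elim

theorem exists_rank_bound [Finite Q] (f : Q → ℕ) : ∃ D, ∀ q, f q < D := by
  obtain ⟨D, hD⟩ := (Set.finite_range f).bddAbove
  exact ⟨D + 1, fun q => Nat.lt_succ_of_le (hD ⟨q, rfl⟩)⟩

/-- A set off `B` in which player two can stay, or leave to `C`, extends a co-Büchi certificate. -/
theorem CoBuchiCert.union_of_bounded {C T : Set Q} {κ : Q → ℕ} {D : ℕ} (hD : ∀ q ∈ C, κ q < D)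
    (h : CoBuchiCert own₁ E B C κ) (hT : ∀ q ∈ T, q ∉ B ∧ q ∈ CPre₂ own₁ E (C ∪ T)) :
    ∃ κ', CoBuchiCert own₁ E B (C ∪ T) κ' ∧ ∀ q ∈ C ∪ T, κ' q < D + 1 := by
  classical
  -- All of `T` gets the one rank `D`, above the ranks in `C`: a move inside `T` keeps the rank, a
  -- move to `C` lowers it, and no drop is due in `T`, which avoids `B`.
  refine ⟨fun q => if q ∈ C then κ q else D, fun q hq => ?_, fun q hq => ?_⟩
  · by_cases hqC : q ∈ C
    · refine CPre₂.mono ?_ (h q hqC)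
      rintro x ⟨hx, h1, h2⟩
      refine ⟨Or.inl hx, ?_⟩
      simpa [hx, hqC] using ⟨h1, h2⟩
    · have hqT : q ∈ T := hq.resolve_left hqC
      refine CPre₂.mono ?_ (hT q hqT).2
      intro x hx
      refine ⟨hx, ?_, fun hB => absurd hB (hT q hqT).1⟩
      by_cases hxC : x ∈ C
      · simpa [hxC, hqC] using (hD x hxC).le
      · simp [hxC, hqC]
  · by_cases hqC : q ∈ C
    · simpa [hqC] using (hD q hqC).trans (Nat.lt_succ_self D)
    · simp [hqC]

/-- A node from which player two can force a visit to `C` extends a co-Büchi certificate. -/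
theorem CoBuchiCert.insert_of_bounded {C : Set Q} {κ : Q → ℕ} {D : ℕ} (hD : ∀ q ∈ C, κ q < D)
    (h : CoBuchiCert own₁ E B C κ) {a : Q} (ha : a ∈ CPre₂ own₁ E C) :
    ∃ κ', CoBuchiCert own₁ E B (insert a C) κ' ∧ ∀ q ∈ insert a C, κ' q < D + 1 := by
  classical
  -- The new node is left for `C` at once and `D` exceeds every rank there, so `a` may even lie in
  -- `B`.
  refine ⟨fun q => if q ∈ C then κ q else D, fun q hq => ?_, fun q hq => ?_⟩
  · by_cases hqC : q ∈ C
    · refine CPre₂.mono ?_ (h q hqC)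
      rintro x ⟨hx, h1, h2⟩
      refine ⟨Or.inr hx, ?_⟩
      simpa [hx, hqC] using ⟨h1, h2⟩
    · obtain rfl : q = a := hq.resolve_right hqC
      refine CPre₂.mono ?_ ha
      intro x hx
      refine ⟨Or.inr hx, ?_⟩
      simpa [hx, hqC] using ⟨(hD x hx).le, fun _ => hD x hx⟩
  · by_cases hqC : q ∈ C
    · simpa [hqC] using (hD q hqC).trans (Nat.lt_succ_self D)
    · simp [hqC]

/-- `C` has a bounded co-Büchi certificate. -/
def WinsCoBuchi (own₁ : Q → Prop) (E : Q → Q → Prop) (B C : Set Q) : Prop :=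
  ∃ (κ : Q → ℕ) (D : ℕ), CoBuchiCert own₁ E B C κ ∧ ∀ q ∈ C, κ q < D

theorem winsCoBuchi_empty : WinsCoBuchi own₁ E B ∅ := ⟨_, 0, coBuchiCert_empty, fun _ h => h.elim⟩

theorem WinsCoBuchi.union {C T : Set Q} (h : WinsCoBuchi own₁ E B C)
    (hT : ∀ q ∈ T, q ∉ B ∧ q ∈ CPre₂ own₁ E (C ∪ T)) : WinsCoBuchi own₁ E B (C ∪ T) := by
  obtain ⟨κ, D, h, hD⟩ := h
  obtain ⟨κ', h', hD'⟩ := h.union_of_bounded hD hT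
  exact ⟨κ', D + 1, h', hD'⟩

theorem WinsCoBuchi.insert {C : Set Q} (h : WinsCoBuchi own₁ E B C) {a : Q}
    (ha : a ∈ CPre₂ own₁ E C) : WinsCoBuchi own₁ E B (insert a C) := by
  obtain ⟨κ, D, h, hD⟩ := h
  obtain ⟨κ', h', hD'⟩ := h.insert_of_bounded hD ha
  exact ⟨κ', D + 1, h', hD'⟩

/-- If player one can stay in the finite set `A` and player two cannot stay in a nonempty part of it
off `B`, then `A` has a Büchi certificate. -/
theorem exists_buchiCert {A : Set Q} (hfin : A.Finite) (hA : A ⊆ CPre₁ own₁ E A)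
    (hT : ∀ T ⊆ A \ B, T ⊆ CPre₂ own₁ E (Aᶜ ∪ T) → T = ∅) :
    ∃ ρ, BuchiCert own₁ E B A ρ := by
  classical
  -- `P U` says that player one can force a visit to `B` inside `U`, with a bounded rank as a clock.
  -- A maximal such `U` is his attractor to `A ∩ B` within `A`; what it misses is a trap of player
  -- two off `B`, hence empty.
  let P : Set Q → Prop := fun U => U ⊆ A ∧ ∃ (ρ : Q → ℕ) (D : ℕ), (∀ q ∈ U, ρ q < D) ∧
    ∀ q ∈ U, q ∉ B → q ∈ CPre₁ own₁ E {x | x ∈ U ∧ ρ x < ρ q}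
  have hP0 : P (A ∩ B) :=
    ⟨Set.inter_subset_left, fun _ => 0, 1, by simp, fun q hq hB => absurd hq.2 hB⟩
  have hPfin : {U | A ∩ B ⊆ U ∧ P U}.Finite := hfin.finite_subsets.subset fun U hU => hU.2.1
  obtain ⟨U, hU, hmax⟩ := Set.Finite.exists_maximal hPfin ⟨A ∩ B, subset_rfl, hP0⟩
  obtain ⟨hBU, hUA, ρ, D, hD, hρ⟩ := hU
  have hUeq : A \ U = ∅ := by
    refine hT _ (fun q hq => ⟨hq.1, fun hB => hq.2 (hBU ⟨hq.1, hB⟩)⟩) fun q hq => ?_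
    have hnot : q ∉ CPre₁ own₁ E U := by
      intro hcp
      have hPI : P (Insert.insert q U) := by
        refine ⟨Set.insert_subset hq.1 hUA, fun x => if x ∈ U then ρ x else D, D + 1, ?_, ?_⟩
        · intro x hx
          by_cases hxU : x ∈ U
          · simpa [hxU] using (hD x hxU).trans (Nat.lt_succ_self D)
          · simp [hxU]
        · intro x hx hxB
          by_cases hxU : x ∈ U
          · refine CPre₁.mono ?_ (hρ x hxU hxB)
            rintro y ⟨hy, hlt⟩
            exact ⟨Or.inr hy, by simpa [hy, hxU] using hlt⟩
          · obtain rfl : x = q := hx.resolve_right hxU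
            refine CPre₁.mono ?_ hcp
            intro y hy
            exact ⟨Or.inr hy, by simpa [hy, hxU] using hD y hy⟩
      have := hmax ⟨hBU.trans (Set.subset_insert _ _), hPI⟩ (Set.subset_insert _ _)
      exact hq.2 (this (Set.mem_insert _ _))
    rw [not_mem_cpre₁_iff] at hnot
    refine CPre₂.mono ?_ hnot
    intro x hx
    by_cases hxA : x ∈ A
    · exact Or.inr ⟨hxA, hx⟩
    · exact Or.inl hxA
  have hAU : A = U := Set.Subset.antisymm (Set.sdiff_eq_empty.mp hUeq) hUA
  subst hAU
  refine ⟨ρ, fun q hq => ?_⟩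
  by_cases hB : q ∈ B
  · refine CPre₁.mono ?_ (hA hq)
    exact fun x hx => ⟨hx, fun h => absurd hB h⟩
  · refine CPre₁.mono ?_ (hρ q hq hB)
    exact fun x hx => ⟨hx.1, fun _ => hx.2⟩

/-- The winning regions of a Büchi game, with certificates. -/
def BuchiSolution (own₁ : Q → Prop) (E : Q → Q → Prop) (B A : Set Q) : Prop :=
  (∃ ρ, BuchiCert own₁ E B A ρ) ∧ ∃ κ, CoBuchiCert own₁ E B Aᶜ κ

/-- Determinacy of finite Büchi games. Take a maximal set won by player two with a certificate. By
maximality no further node can be forced into it and no trap off the Büchi set can be joined to it,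
which are the two hypotheses of `exists_buchiCert` for the complement. -/
theorem exists_buchiSolution [Finite Q] (own₁ : Q → Prop) (E : Q → Q → Prop) (B : Set Q) :
    ∃ A, BuchiSolution own₁ E B A := by
  obtain ⟨C, hC, hmax⟩ := Set.Finite.exists_maximal (Set.toFinite {C | WinsCoBuchi own₁ E B C})
    ⟨∅, winsCoBuchi_empty⟩
  refine ⟨Cᶜ, exists_buchiCert (Set.toFinite _) (fun q hq => ?_) (fun T hT hT2 => ?_), ?_⟩
  · by_contra hcp
    rw [not_mem_cpre₁_iff, compl_compl] at hcp
    exact hq (hmax (WinsCoBuchi.insert hC hcp) (Set.subset_insert _ _) (Set.mem_insert _ _))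
  · rw [compl_compl] at hT2
    have := hmax (WinsCoBuchi.union hC (T := T) fun q hq => ⟨(hT hq).2, hT2 hq⟩)
      Set.subset_union_left
    ext q
    simp only [Set.mem_empty_iff_false, iff_false]
    exact fun hq => (hT hq).1 (this (Or.inr hq))
  · obtain ⟨κ, D, h, -⟩ := hC
    exact ⟨κ, by rwa [compl_compl]⟩

end Certificates

/-! ### Strategies given by Moore machines with an arbitrary set of memory states -/

namespace GameStructure

variable {V : Type*} {G : GameStructure V}

/-- The strategy encoded by a Moore machine, whose memory may be infinite. -/
def mooreStrategy {i : Player} {M : Type*} (m₀ : M) (upd : M → V → M) (act : M → V → V)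
    (h : ∀ m v, G.owner v = i → G.E v (act m v)) : G.Strategy i where
  next ρ v := act (ρ.foldl upd m₀) v
  legal _ v hv := h _ v hv

theorem mooreStrategy_hasMemory {i : Player} {M : Type} [Fintype M] (m₀ : M) (upd : M → V → M)
    (act : M → V → V) (h : ∀ m v, G.owner v = i → G.E v (act m v)) {k : ℕ}
    (hk : Fintype.card M ≤ k) : (mooreStrategy m₀ upd act h).HasMemory k :=
  ⟨M, inferInstance, m₀, upd, act, hk, fun _ _ _ => rfl⟩

theorem outcome_mem_plays (v₀ : V) (σ₁ : G.Strategy .one) (σ₂ : G.Strategy .two) :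
    outcome v₀ σ₁ σ₂ ∈ G.Plays := by
  intro k
  change G.E (outcomeHist v₀ σ₁ σ₂ k).2 _
  simp only [outcome, outcomeHist]
  split
  · exact σ₁.legal _ _ ‹_›
  · exact σ₂.legal _ _ ‹_›

theorem outcome_succ_one (v₀ : V) (σ₁ : G.Strategy .one) (σ₂ : G.Strategy .two) (k : ℕ)
    (h : G.owner (outcome v₀ σ₁ σ₂ k) = .one) :
    outcome v₀ σ₁ σ₂ (k + 1) =
      σ₁.next (outcomeHist v₀ σ₁ σ₂ k).1 (outcome v₀ σ₁ σ₂ k) := by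
  unfold outcome at h ⊢
  simp only [outcomeHist, h]

theorem outcome_succ_two (v₀ : V) (σ₁ : G.Strategy .one) (σ₂ : G.Strategy .two) (k : ℕ)
    (h : G.owner (outcome v₀ σ₁ σ₂ k) = .two) :
    outcome v₀ σ₁ σ₂ (k + 1) =
      σ₂.next (outcomeHist v₀ σ₁ σ₂ k).1 (outcome v₀ σ₁ σ₂ k) := by
  unfold outcome at h ⊢
  simp only [outcomeHist, h]

/-- Replaces histories by the sequence of memory states. `μ k` is the memory before the vertex at
time `k` is read, so the action at time `k` depends on `μ k` and on that vertex. -/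
theorem exists_moore_run_one {M : Type*} (m₀ : M) (upd : M → V → M) (act : M → V → V)
    (h : ∀ m v, G.owner v = .one → G.E v (act m v)) (v₀ : V) (σ₂ : G.Strategy .two) :
    ∃ μ : ℕ → M, μ 0 = m₀ ∧ ∀ k,
      μ (k + 1) = upd (μ k) (outcome v₀ (mooreStrategy m₀ upd act h) σ₂ k) ∧
      (G.owner (outcome v₀ (mooreStrategy m₀ upd act h) σ₂ k) = .one →
        outcome v₀ (mooreStrategy m₀ upd act h) σ₂ (k + 1) =
          act (μ k) (outcome v₀ (mooreStrategy m₀ upd act h) σ₂ k)) := by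
  refine ⟨fun k => (outcomeHist v₀ (mooreStrategy m₀ upd act h) σ₂ k).1.foldl upd m₀, rfl,
    fun k => ⟨?_, fun ho => ?_⟩⟩
  · simp only [outcomeHist, List.foldl_append, List.foldl_cons, List.foldl_nil]
    rfl
  · rw [outcome_succ_one _ _ _ _ ho]
    rfl

theorem exists_moore_run_two {M : Type*} (m₀ : M) (upd : M → V → M) (act : M → V → V)
    (h : ∀ m v, G.owner v = .two → G.E v (act m v)) (v₀ : V) (σ₁ : G.Strategy .one) :
    ∃ μ : ℕ → M, μ 0 = m₀ ∧ ∀ k,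
      μ (k + 1) = upd (μ k) (outcome v₀ σ₁ (mooreStrategy m₀ upd act h) k) ∧
      (G.owner (outcome v₀ σ₁ (mooreStrategy m₀ upd act h) k) = .two →
        outcome v₀ σ₁ (mooreStrategy m₀ upd act h) (k + 1) =
          act (μ k) (outcome v₀ σ₁ (mooreStrategy m₀ upd act h) k)) := by
  refine ⟨fun k => (outcomeHist v₀ σ₁ (mooreStrategy m₀ upd act h) k).1.foldl upd m₀, rfl,
    fun k => ⟨?_, fun ho => ?_⟩⟩
  · simp only [outcomeHist, List.foldl_append, List.foldl_cons, List.foldl_nil]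
    rfl
  · rw [outcome_succ_two _ _ _ _ ho]
    rfl

theorem nonempty_strategy (G : GameStructure V) (i : Player) : ∃ σ : G.Strategy i, σ.HasMemory 1 := by
  choose f hf using G.no_deadlock
  exact ⟨mooreStrategy () (fun _ _ => ()) (fun _ v => f v) (fun _ v _ => hf v),
    mooreStrategy_hasMemory _ _ _ _ (by simp)⟩

theorem owner_ne_one {v : V} : ¬ G.owner v = .one ↔ G.owner v = .two := by
  cases G.owner v <;> simp

theorem not_winning_both {Obj : Set (ℕ → V)} {v₀ : V} {σ₁ : G.Strategy .one} {σ₂ : G.Strategy .two}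
    (h₁ : Winning₁ Obj v₀ σ₁) (h₂ : Winning₂ Obj v₀ σ₂) : False :=
  (h₂ σ₁).2 (h₁ σ₂)

/-! ### The product of a request-response game with the pending requests -/

/-- A vertex, the requests that are pending there, and the request whose response is awaited. -/
abbrev RRNode (V : Type*) (r : ℕ) := V × (Fin r → Fin 2) × Fin r

variable {r : ℕ} [NeZero r]

/-- The awaited request changes when it is not pending. -/
def nextAwaited (S : Fin r → Fin 2) (i : Fin r) : Fin r := if S i = 0 then i + 1 else i

variable (Rq Rp : Fin r → Set V)

open Classical in
/-- The pending requests after a visit to `v`. -/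
noncomputable def pendingAt (v : V) (S : Fin r → Fin 2) : Fin r → Fin 2 :=
  fun i => if v ∈ Rp i then 0 else if v ∈ Rq i then 1 else S i

/-- The node reached from `q` by a move to `w`. -/
noncomputable def rrSucc (q : RRNode V r) (w : V) : RRNode V r :=
  (w, pendingAt Rq Rp w q.2.1, nextAwaited q.2.1 q.2.2)

/-- The edges of the product; the nodes over `W` are sinks. -/
def ProductEdge (G : GameStructure V) (W : Set V) (q q' : RRNode V r) : Prop :=
  (q.1 ∈ W ∧ q' = q) ∨ (q.1 ∉ W ∧ ∃ w, G.E q.1 w ∧ q' = rrSucc Rq Rp q w)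

/-- The Büchi set of the product. -/
def productTarget (W : Set V) : Set (RRNode V r) := {q | q.1 ∈ W ∨ q.2.1 q.2.2 = 0}

/-- `A` is the winning region of player one in the product with sinks over `W`. -/
def ProductSolution (G : GameStructure V) (W : Set V) (A : Set (RRNode V r)) : Prop :=
  BuchiSolution (fun q : RRNode V r => G.owner q.1 = .one) (ProductEdge Rq Rp G W)
    (productTarget W) A

variable {Rq Rp}

/-- A run of the product in which the rank decreases while the awaited request is pending answers
all requests within bounded time. -/
theorem exists_bound_of_run {q : ℕ → RRNode V r} {ρ : RRNode V r → ℕ} {D : ℕ}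
    (hD : ∀ x, ρ x < D) (hq : ∀ t, q (t + 1) = rrSucc Rq Rp (q t) (q (t + 1)).1)
    (hρ : ∀ t, (q t).2.1 (q t).2.2 ≠ 0 → ρ (q (t + 1)) < ρ (q t))
    (h0 : ∃ S, (q 0).2.1 = pendingAt Rq Rp (q 0).1 S) :
    ∃ L, 0 < L ∧ ∀ i j, (q j).1 ∈ Rq i → ∃ l ≤ L, (q (j + l)).1 ∈ Rp i := by
  have hS : ∀ t, (q (t + 1)).2.1 = pendingAt Rq Rp (q (t + 1)).1 (q t).2.1 := fun t => by
    conv_lhs => rw [hq t]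
    rfl
  have hc : ∀ t, (q (t + 1)).2.2 = nextAwaited (q t).2.1 (q t).2.2 := fun t => by
    conv_lhs => rw [hq t]
    rfl
  have hstep : ∀ n t, ρ (q t) ≤ n → ∃ l ≤ n, (q (t + l)).2.2 = (q t).2.2 ∧
      (q (t + l)).2.1 (q (t + l)).2.2 = 0 := by
    intro n
    induction n with
    | zero =>
      intro t ht
      refine ⟨0, le_rfl, rfl, ?_⟩
      by_contra hne
      have := hρ t hne
      omega
    | succ n ih =>
      intro t ht
      by_cases hz : (q t).2.1 (q t).2.2 = 0
      · exact ⟨0, by omega, rfl, hz⟩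
      · have hlt := hρ t hz
        obtain ⟨l, hl, h1, h2⟩ := ih (t + 1) (by omega)
        refine ⟨l + 1, by omega, ?_, ?_⟩
        · rw [show t + (l + 1) = t + 1 + l by omega, h1, hc, nextAwaited, if_neg hz]
        · rw [show t + (l + 1) = t + 1 + l by omega]
          exact h2
  have hcyc : ∀ k t : ℕ, ∃ l ≤ (k + 1) * (D + 1), (q (t + l)).2.2 = (q t).2.2 + (Fin.ofNat r k) ∧
      (q (t + l)).2.1 (q (t + l)).2.2 = 0 := by
    intro k
    induction k with
    | zero =>
      intro t
      obtain ⟨l, hl, h1, h2⟩ := hstep D t (hD _).le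
      refine ⟨l, by omega, ?_, h2⟩
      rw [h1]
      have : (Fin.ofNat r 0) = 0 := rfl
      rw [this, add_zero]
    | succ k ih =>
      intro t
      obtain ⟨l, hl, h1, h2⟩ := ih t
      obtain ⟨l', hl', h1', h2'⟩ := hstep D (t + l + 1) (hD _).le
      refine ⟨l + 1 + l', ?_, ?_, ?_⟩
      · have : (k + 1 + 1) * (D + 1) = (k + 1) * (D + 1) + (D + 1) := by ring
        omega
      · rw [show t + (l + 1 + l') = t + l + 1 + l' by omega, h1', hc, nextAwaited, if_pos h2, h1,
          add_assoc]
        congr 1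
        ext
        simp [Fin.val_add]
      · rw [show t + (l + 1 + l') = t + l + 1 + l' by omega]
        exact h2'
  -- Whatever is awaited at time `j`, fewer than `r` advances lead to the index `i`.
  refine ⟨(r + 1) * (D + 1), by positivity, fun i j hj => ?_⟩
  by_cases hresp : (q j).1 ∈ Rp i
  · exact ⟨0, by omega, hresp⟩
  have hpend : (q j).2.1 i ≠ 0 := by
    have hex : ∃ S, (q j).2.1 = pendingAt Rq Rp (q j).1 S := by
      cases j with
      | zero => exact h0
      | succ j => exact ⟨_, hS j⟩
    obtain ⟨S, hS'⟩ := hex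
    rw [hS', pendingAt, if_neg hresp, if_pos hj]
    exact one_ne_zero
  obtain ⟨l, hl, h1, h2⟩ := hcyc (i - (q j).2.2).val j
  have h3 : (q j).2.2 + Fin.ofNat r (i - (q j).2.2).val = i := by
    rw [Fin.ofNat_val_eq_self]
    abel
  rw [h1, h3] at h2
  have hex : ∃ l, (q (j + l)).2.1 i = 0 := ⟨l, h2⟩
  classical
  -- When the bit of `i` is zero for the first time it has just been cleared, and only a visit to
  -- `Rp i` clears it.
  have hle : Nat.find hex ≤ l := Nat.find_min' hex h2
  have hspec := Nat.find_spec hex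
  have hpos : 0 < Nat.find hex := by
    rcases Nat.eq_zero_or_pos (Nat.find hex) with h | h
    · rw [h] at hspec
      exact absurd hspec hpend
    · exact h
  refine ⟨Nat.find hex, ?_, ?_⟩
  · have hlt := (i - (q j).2.2).isLt
    have : ((i - (q j).2.2).val + 1) * (D + 1) ≤ (r + 1) * (D + 1) :=
      Nat.mul_le_mul_right _ (by omega)
    omega
  · have hprev : (q (j + (Nat.find hex - 1))).2.1 i ≠ 0 :=
      fun h => absurd (Nat.find_min' hex h) (by omega)
    have heq : j + Nat.find hex = j + (Nat.find hex - 1) + 1 := by omega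
    by_contra hno
    rw [heq] at hspec hno
    rw [hS, pendingAt, if_neg hno] at hspec
    split_ifs at hspec with h
    · exact one_ne_zero hspec
    · exact hprev hspec

/-- The moves that player one is content with at `q`: to a vertex of lower rank over which there is a
node of `A`, or along the product with progress towards the awaited response. -/
def GoodMove (Rq Rp : Fin r → Set V) (rank : V → ℕ) (A : Set (RRNode V r)) (ρ : RRNode V r → ℕ)
    (q : RRNode V r) (w : V) : Prop :=
  (rank w < rank q.1 ∧ ∃ x ∈ A, x.1 = w) ∨
    (rank w = rank q.1 ∧ rrSucc Rq Rp q w ∈ A ∧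
      (q.2.1 q.2.2 ≠ 0 → ρ (rrSucc Rq Rp q w) < ρ q))

/-- Player one can stay in `A` with good moves. -/
def LayeredCert (G : GameStructure V) (Rq Rp : Fin r → Set V) (rank : V → ℕ) (A : Set (RRNode V r))
    (ρ : RRNode V r → ℕ) : Prop :=
  ∀ q ∈ A, (G.owner q.1 = .one → ∃ w, G.E q.1 w ∧ GoodMove Rq Rp rank A ρ q w) ∧
    (G.owner q.1 = .two → ∀ w, G.E q.1 w → GoodMove Rq Rp rank A ρ q w)

/-- The memory holds the pending set and the awaited request. If they give a node of `A` over the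
current vertex, that node is used; otherwise the strategy jumps to an arbitrary node of `A` over it.
After the start a jump can only follow a move to lower rank, because good moves of equal rank end at
a node of `A` in the product. The last clause says that a play whose initial node is in `A` starts
without a jump. -/
theorem LayeredCert.exists_strategy {rank : V → ℕ} {A : Set (RRNode V r)} {ρ : RRNode V r → ℕ}
    (h : LayeredCert G Rq Rp rank A ρ) :
    ∃ σ : G.Strategy .one, σ.HasMemory (2 ^ r * r) ∧ ∀ v₀, (∃ x ∈ A, x.1 = v₀) →
      ∀ σ₂ : G.Strategy .two, ∃ q : ℕ → RRNode V r,
        (∀ t, (q t).1 = outcome v₀ σ σ₂ t) ∧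
        (∀ t, rank (q (t + 1)).1 < rank (q t).1 ∨
          (rank (q (t + 1)).1 = rank (q t).1 ∧ q (t + 1) = rrSucc Rq Rp (q t) (q (t + 1)).1 ∧
            ((q t).2.1 (q t).2.2 ≠ 0 → ρ (q (t + 1)) < ρ (q t)))) ∧
        ((v₀, pendingAt Rq Rp v₀ 0, 0) ∈ A → q 0 = (v₀, pendingAt Rq Rp v₀ 0, 0)) := by
  classical
  -- `cur m v` is the node in use: the one given by the memory if it lies in `A`, else some node of
  -- `A` over `v` if there is one.
  have hcur : ∀ (m : (Fin r → Fin 2) × Fin r) (v : V), ∃ q : RRNode V r, q.1 = v ∧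
      ((v, pendingAt Rq Rp v m.1, m.2) ∈ A → q = (v, pendingAt Rq Rp v m.1, m.2)) ∧
      ((∃ x ∈ A, x.1 = v) → q ∈ A) := by
    intro m v
    by_cases h1 : (v, pendingAt Rq Rp v m.1, m.2) ∈ A
    · exact ⟨_, rfl, fun _ => rfl, fun _ => h1⟩
    · by_cases h2 : ∃ x ∈ A, x.1 = v
      · obtain ⟨x, hx, hxv⟩ := h2
        exact ⟨x, hxv, fun h => absurd h h1, fun _ => hx⟩
      · exact ⟨_, rfl, fun _ => rfl, fun h => absurd h h2⟩
  choose cur hcur1 hcur2 hcur3 using hcur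
  have hact : ∀ (m : (Fin r → Fin 2) × Fin r) (v : V), ∃ w, G.E v w ∧
      (G.owner v = .one → cur m v ∈ A → GoodMove Rq Rp rank A ρ (cur m v) w) := by
    intro m v
    by_cases h1 : G.owner v = .one ∧ cur m v ∈ A
    · obtain ⟨w, hw, hg⟩ := (h _ h1.2).1 (by rw [hcur1]; exact h1.1)
      rw [hcur1] at hw
      exact ⟨w, hw, fun _ _ => hg⟩
    · obtain ⟨w, hw⟩ := G.no_deadlock v
      exact ⟨w, hw, fun h2 h3 => absurd ⟨h2, h3⟩ h1⟩
  choose act hactE hactG using hact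
  refine ⟨mooreStrategy (0, 0)
    (fun m v => ((cur m v).2.1, nextAwaited (cur m v).2.1 (cur m v).2.2)) act
    (fun m v _ => hactE m v), mooreStrategy_hasMemory _ _ _ _ (by simp), fun v₀ hv₀ σ₂ => ?_⟩
  obtain ⟨μ, hμ0, hμ⟩ := exists_moore_run_one (0, 0)
    (fun (m : (Fin r → Fin 2) × Fin r) v =>
      ((cur m v).2.1, nextAwaited (cur m v).2.1 (cur m v).2.2)) act
    (fun m v _ => hactE m v) v₀ σ₂
  set π := outcome v₀ (mooreStrategy (0, 0)
    (fun (m : (Fin r → Fin 2) × Fin r) v =>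
      ((cur m v).2.1, nextAwaited (cur m v).2.1 (cur m v).2.2)) act
    (fun m v _ => hactE m v)) σ₂ with hπ
  have hplay : π ∈ G.Plays := outcome_mem_plays _ _ _
  have hπ0 : π 0 = v₀ := rfl
  have hgood : ∀ t, cur (μ t) (π t) ∈ A → GoodMove Rq Rp rank A ρ (cur (μ t) (π t)) (π (t + 1)) := by
    intro t ht
    by_cases ho : G.owner (π t) = .one
    · rw [(hμ t).2 ho]
      exact hactG _ _ ho ht
    · refine (h _ ht).2 ?_ _ ?_
      · rw [hcur1]
        exact owner_ne_one.mp ho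
      · rw [hcur1]
        exact hplay t
  have hA : ∀ t, cur (μ t) (π t) ∈ A := by
    intro t
    induction t with
    | zero => exact hcur3 _ _ (by rw [hπ0]; exact hv₀)
    | succ t ih =>
      refine hcur3 _ _ ?_
      rcases hgood t ih with ⟨-, hx⟩ | ⟨-, hx, -⟩
      · exact hx
      · exact ⟨_, hx, rfl⟩
  refine ⟨fun t => cur (μ t) (π t), fun t => hcur1 _ _, fun t => ?_, fun h0 => ?_⟩
  · simp only [hcur1]
    rcases hgood t (hA t) with ⟨hlt, -⟩ | ⟨he, hx, hr⟩
    · rw [hcur1] at hlt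
      exact Or.inl hlt
    · rw [hcur1] at he
      have heq : cur (μ (t + 1)) (π (t + 1)) = rrSucc Rq Rp (cur (μ t) (π t)) (π (t + 1)) := by
        have hm : μ (t + 1) = _ := (hμ t).1
        rw [hcur2 _ _ (by rw [hm]; exact hx), hm]
        rfl
      exact Or.inr ⟨he, heq, fun hp => by rw [heq]; exact hr hp⟩
  · have := hcur2 (μ 0) (π 0)
    rw [hμ0, hπ0] at this
    change cur (μ 0) (π 0) = _
    rw [hμ0, hπ0]
    exact this h0

/-- Player one wins the direct game from the vertices whose initial node is winning in the product. -/
theorem exists_winning₁_dirBndRR [Finite V] {A : Set (RRNode V r)} {ρ : RRNode V r → ℕ}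
    (h : BuchiCert (fun q : RRNode V r => G.owner q.1 = .one) (ProductEdge Rq Rp G ∅)
      (productTarget ∅) A ρ) {v₀ : V} (hv₀ : (v₀, pendingAt Rq Rp v₀ 0, 0) ∈ A) :
    ∃ σ : G.Strategy .one, Winning₁ (G.DirBndRR Rq Rp) v₀ σ ∧ σ.HasMemory (2 ^ r * r) := by
  -- With a constant vertex rank no good move is a jump, so the play follows the product from its
  -- initial node.
  have hcert : LayeredCert G Rq Rp (fun _ => 0) A ρ := by
    intro q hq
    have := h q hq
    refine ⟨fun ho => ?_, fun ho w hw => ?_⟩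
    · obtain ⟨x, hx | ⟨-, w, hw, rfl⟩, hxA, hρ⟩ := this.1 ho
      · exact absurd hx.1 (Set.notMem_empty _)
      · refine ⟨w, hw, Or.inr ⟨rfl, hxA, fun hp => hρ ?_⟩⟩
        simpa [productTarget] using hp
    · obtain ⟨hxA, hρ⟩ := this.2 (owner_ne_one.mpr ho) _ (Or.inr ⟨Set.notMem_empty _, w, hw, rfl⟩)
      refine Or.inr ⟨rfl, hxA, fun hp => hρ ?_⟩
      simpa [productTarget] using hp
  obtain ⟨σ, hσ, hrun⟩ := hcert.exists_strategy
  refine ⟨σ, fun σ₂ => ?_, hσ⟩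
  obtain ⟨q, hqπ, hq, hq0⟩ := hrun v₀ ⟨_, hv₀, rfl⟩ σ₂
  obtain ⟨D, hD⟩ := exists_rank_bound ρ
  have hstep := fun t => (hq t).resolve_left (lt_irrefl _)
  refine ⟨outcome_mem_plays _ _ _, ?_⟩
  simp only [← hqπ]
  exact exists_bound_of_run hD (fun t => (hstep t).2.1) (fun t => (hstep t).2.2)
    ⟨0, by rw [hq0 hv₀]⟩

/-- Player one wins the undirect game from the vertices below a layered certificate. -/
theorem LayeredCert.exists_winning₁_bndRR [Finite V] {rank : V → ℕ} {A : Set (RRNode V r)}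
    {ρ : RRNode V r → ℕ} (h : LayeredCert G Rq Rp rank A ρ) {v₀ : V} (hv₀ : ∃ x ∈ A, x.1 = v₀) :
    ∃ σ : G.Strategy .one, Winning₁ (G.BndRR Rq Rp) v₀ σ ∧ σ.HasMemory (2 ^ r * r) := by
  obtain ⟨σ, hσ, hrun⟩ := h.exists_strategy
  refine ⟨σ, fun σ₂ => ?_, hσ⟩
  obtain ⟨q, hqπ, hq, -⟩ := hrun v₀ hv₀ σ₂
  obtain ⟨D, hD⟩ := exists_rank_bound ρ
  have hplay : outcome v₀ σ σ₂ ∈ G.Plays := outcome_mem_plays _ _ _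
  -- The vertex rank never rises along the run. From a position of minimal rank on it is constant,
  -- and the run follows the product.
  obtain ⟨t₀, ht₀⟩ : ∃ t₀, ∀ t, rank (q t₀).1 ≤ rank (q t).1 := by
    obtain ⟨t₀, ht₀⟩ := exists_minimalFor_of_wellFoundedLT (fun _ : ℕ => True)
      (fun t => rank (q t).1) ⟨0, trivial⟩
    exact ⟨t₀, fun t => not_lt.mp fun hlt => absurd (ht₀.2 trivial hlt.le) (not_le.mpr hlt)⟩
  have hconst : ∀ t, rank (q (t₀ + t)).1 = rank (q t₀).1 := by
    intro t
    induction t with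
    | zero => rfl
    | succ t ih =>
      have := ht₀ (t₀ + t + 1)
      have hs := hq (t₀ + t)
      rw [← Nat.add_assoc]
      omega
  have hstep : ∀ t, q (t₀ + t + 1) = rrSucc Rq Rp (q (t₀ + t)) (q (t₀ + t + 1)).1 ∧
      ((q (t₀ + t)).2.1 (q (t₀ + t)).2.2 ≠ 0 → ρ (q (t₀ + t + 1)) < ρ (q (t₀ + t))) := by
    intro t
    refine ((hq (t₀ + t)).resolve_left ?_).2
    have h1 := hconst t
    have h2 := hconst (t + 1)
    rw [← Nat.add_assoc] at h2
    omega
  -- The suffix starts one step after `t₀`: the node there is a product successor, so its pending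
  -- set accounts for the requests at its own vertex, as `exists_bound_of_run` demands of the first
  -- node.
  refine ⟨hplay, t₀ + 1, suffixFrom_mem_plays hplay _, ?_⟩
  have := exists_bound_of_run (q := fun t => q (t₀ + 1 + t)) (ρ := ρ) (Rq := Rq) (Rp := Rp) hD
    (fun t => by
      have := (hstep (t + 1)).1
      rwa [show t₀ + (t + 1) + 1 = t₀ + 1 + (t + 1) by omega,
        show t₀ + (t + 1) = t₀ + 1 + t by omega] at this)
    (fun t => by
      have := (hstep (t + 1)).2
      rwa [show t₀ + (t + 1) + 1 = t₀ + 1 + (t + 1) by omega,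
        show t₀ + (t + 1) = t₀ + 1 + t by omega] at this)
    ⟨(q t₀).2.1, by
      have := (hstep 0).1
      simp only [Nat.add_zero] at this ⊢
      conv_lhs => rw [this]
      rfl⟩
  simp only [hqπ] at this
  exact this

end GameStructure

/-! ### Strategies of player two from co-Büchi certificates -/

namespace GameStructure

variable {V : Type*} {G : GameStructure V} {r : ℕ} {Rq Rp : Fin r → Set V}

theorem pendingAt_ne_zero {v : V} {S : Fin r → Fin 2} {i : Fin r}
    (h : pendingAt Rq Rp v S i ≠ 0) : v ∉ Rp i ∧ (v ∈ Rq i ∨ S i ≠ 0) := by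
  unfold pendingAt at h
  split_ifs at h with h1 h2
  · exact absurd rfl h
  · exact ⟨h1, Or.inl h2⟩
  · exact ⟨h1, Or.inr h⟩

variable [NeZero r]

/-- A rank that never increases and decreases whenever the awaited request is not pending forces some
request to be awaited forever. -/
theorem exists_awaited_forever {q : ℕ → RRNode V r} {κ : RRNode V r → ℕ}
    (hq : ∀ t, (q (t + 1)).2.2 = nextAwaited (q t).2.1 (q t).2.2)
    (hκ : ∀ t, κ (q (t + 1)) ≤ κ (q t) ∧ ((q t).2.1 (q t).2.2 = 0 → κ (q (t + 1)) < κ (q t))) :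
    ∃ t₀, ∀ t, (q (t₀ + t)).2.1 (q (t₀ + t)).2.2 ≠ 0 ∧ (q (t₀ + t)).2.2 = (q t₀).2.2 := by
  obtain ⟨t₀, ht₀⟩ : ∃ t₀, ∀ t, κ (q t₀) ≤ κ (q t) := by
    obtain ⟨t₀, ht₀⟩ := exists_minimalFor_of_wellFoundedLT (fun _ : ℕ => True)
      (fun t => κ (q t)) ⟨0, trivial⟩
    exact ⟨t₀, fun t => not_lt.mp fun hlt => absurd (ht₀.2 trivial hlt.le) (not_le.mpr hlt)⟩
  have hle : ∀ t, κ (q (t₀ + t)) ≤ κ (q t₀) := by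
    intro t
    induction t with
    | zero => exact le_rfl
    | succ t ih => exact ((hκ (t₀ + t)).1).trans ih
  have hne : ∀ t, (q (t₀ + t)).2.1 (q (t₀ + t)).2.2 ≠ 0 := by
    intro t h0
    have h1 := (hκ (t₀ + t)).2 h0
    have h2 := ht₀ (t₀ + t + 1)
    have h3 := hle t
    omega
  refine ⟨t₀, fun t => ⟨hne t, ?_⟩⟩
  induction t with
  | zero => rfl
  | succ t ih =>
    rw [← Nat.add_assoc, hq, nextAwaited, if_neg (hne t), ih]

theorem productEdge_of_not_mem {W : Set V} {q : RRNode V r} (hq : q.1 ∉ W) {w : V}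
    (hw : G.E q.1 w) : ProductEdge Rq Rp G W q (rrSucc Rq Rp q w) := Or.inr ⟨hq, w, hw, rfl⟩

theorem exists_of_productEdge {W : Set V} {q x : RRNode V r} (hq : q.1 ∉ W)
    (h : ProductEdge Rq Rp G W q x) : ∃ w, G.E q.1 w ∧ x = rrSucc Rq Rp q w :=
  h.elim (fun h => absurd h.1 hq) fun h => h.2

/-- A co-Büchi certificate yields moves of player two at the nodes outside the sinks. -/
theorem exists_move_of_coBuchiCert {W : Set V} {C : Set (RRNode V r)} {κ : RRNode V r → ℕ}
    (h : CoBuchiCert (fun q : RRNode V r => G.owner q.1 = .one) (ProductEdge Rq Rp G W)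
      (productTarget W) C κ) :
    ∃ mv : RRNode V r → V, (∀ q, G.E q.1 (mv q)) ∧ ∀ q ∈ C, q.1 ∉ W → ∀ w, G.E q.1 w →
      (G.owner q.1 = .two → w = mv q) → rrSucc Rq Rp q w ∈ C ∧ κ (rrSucc Rq Rp q w) ≤ κ q ∧
        (q.2.1 q.2.2 = 0 → κ (rrSucc Rq Rp q w) < κ q) := by
  have hex : ∀ q : RRNode V r, ∃ w, G.E q.1 w ∧ (q ∈ C → q.1 ∉ W → G.owner q.1 = .two →
      rrSucc Rq Rp q w ∈ C ∧ κ (rrSucc Rq Rp q w) ≤ κ q ∧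
        (q.2.1 q.2.2 = 0 → κ (rrSucc Rq Rp q w) < κ q)) := by
    intro q
    by_cases hc : q ∈ C ∧ q.1 ∉ W ∧ G.owner q.1 = .two
    · obtain ⟨x, hx, hxC, h1, h2⟩ := (h q hc.1).2 (owner_ne_one.mpr hc.2.2)
      obtain ⟨w, hw, rfl⟩ := exists_of_productEdge hc.2.1 hx
      exact ⟨w, hw, fun _ _ _ => ⟨hxC, h1, fun h0 => h2 (Or.inr h0)⟩⟩
    · obtain ⟨w, hw⟩ := G.no_deadlock q.1
      exact ⟨w, hw, fun h1 h2 h3 => absurd ⟨h1, h2, h3⟩ hc⟩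
  choose mv hmvE hmv using hex
  refine ⟨mv, hmvE, fun q hq hqW w hw hw2 => ?_⟩
  by_cases ho : G.owner q.1 = .one
  · obtain ⟨hxC, h1, h2⟩ := (h q hq).1 ho _ (productEdge_of_not_mem hqW hw)
    exact ⟨hxC, h1, fun h0 => h2 (Or.inr h0)⟩
  · rw [hw2 (owner_ne_one.mp ho)]
    exact hmv q hq hqW (owner_ne_one.mp ho)

/-- Player two wins the direct game from the vertices whose initial node is losing for player one in
the product. -/
theorem exists_winning₂_dirBndRR {C : Set (RRNode V r)} {κ : RRNode V r → ℕ}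
    (h : CoBuchiCert (fun q : RRNode V r => G.owner q.1 = .one) (ProductEdge Rq Rp G ∅)
      (productTarget ∅) C κ) {v₀ : V} (hv₀ : (v₀, pendingAt Rq Rp v₀ 0, 0) ∈ C) :
    ∃ σ : G.Strategy .two, Winning₂ (G.DirBndRR Rq Rp) v₀ σ ∧ σ.HasMemory (2 ^ r * r) := by
  classical
  obtain ⟨mv, hmvE, hmv⟩ := exists_move_of_coBuchiCert h
  let cur : (Fin r → Fin 2) × Fin r → V → RRNode V r := fun m v => (v, pendingAt Rq Rp v m.1, m.2)
  let upd : (Fin r → Fin 2) × Fin r → V → (Fin r → Fin 2) × Fin r :=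
    fun m v => ((cur m v).2.1, nextAwaited (cur m v).2.1 (cur m v).2.2)
  have hact : ∀ (m : (Fin r → Fin 2) × Fin r) (v : V), G.owner v = .two → G.E v (mv (cur m v)) :=
    fun m v _ => hmvE (cur m v)
  refine ⟨mooreStrategy (0, 0) upd (fun m v => mv (cur m v)) hact, fun σ₁ => ?_,
    mooreStrategy_hasMemory _ _ _ _ (by simp)⟩
  obtain ⟨μ, hμ0, hμ⟩ := exists_moore_run_two (0, 0) upd (fun m v => mv (cur m v)) hact v₀ σ₁
  set π := outcome v₀ σ₁ (mooreStrategy (0, 0) upd (fun m v => mv (cur m v)) hact) with hπ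
  have hplay : π ∈ G.Plays := outcome_mem_plays _ _ _
  refine ⟨hplay, ?_⟩
  rintro ⟨-, L, hL, hans⟩
  have hsucc : ∀ t, cur (μ (t + 1)) (π (t + 1)) = rrSucc Rq Rp (cur (μ t) (π t)) (π (t + 1)) := by
    intro t
    rw [(hμ t).1]
    rfl
  have hmove : ∀ t, cur (μ t) (π t) ∈ C → _ := fun t ht =>
    hmv (cur (μ t) (π t)) ht (Set.notMem_empty _) (π (t + 1)) (hplay t) fun ho => (hμ t).2 ho
  have hC : ∀ t, cur (μ t) (π t) ∈ C := by
    intro t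
    induction t with
    | zero => rw [hμ0]; exact hv₀
    | succ t ih => rw [hsucc]; exact (hmove t ih).1
  -- The rank of player two drops only finitely often, so from `t₀` on one and the same request is
  -- awaited and pending.
  obtain ⟨t₀, ht₀⟩ := exists_awaited_forever (q := fun t => cur (μ t) (π t)) (κ := κ)
    (fun t => by simp only [hsucc]; rfl)
    (fun t => by simp only [hsucc]; exact (hmove t (hC t)).2)
  set i := (cur (μ t₀) (π t₀)).2.2 with hi
  have hpend : ∀ t, (cur (μ (t₀ + t)) (π (t₀ + t))).2.1 i ≠ 0 := by
    intro t
    have := ht₀ t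
    rw [this.2] at this
    exact this.1
  -- A pending bit goes back to a request unanswered up to now, since initially nothing is pending.
  have hreq : ∀ t, (cur (μ t) (π t)).2.1 i ≠ 0 →
      ∃ j ≤ t, π j ∈ Rq i ∧ ∀ l, j + l ≤ t → π (j + l) ∉ Rp i := by
    intro t
    induction t with
    | zero =>
      intro h0
      obtain ⟨h1, h2⟩ := pendingAt_ne_zero h0
      refine ⟨0, le_rfl, h2.resolve_right ?_, fun l hl => ?_⟩
      · rw [hμ0]; exact fun h => h rfl
      · obtain rfl : l = 0 := by omega
        exact h1
    | succ t ih =>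
      intro h0
      obtain ⟨h1, h2⟩ := pendingAt_ne_zero h0
      rcases h2 with h2 | h2
      · refine ⟨t + 1, le_rfl, h2, fun l hl => ?_⟩
        obtain rfl : l = 0 := by omega
        exact h1
      · rw [(hμ t).1] at h2
        obtain ⟨j, hj, hj1, hj2⟩ := ih h2
        refine ⟨j, by omega, hj1, fun l hl => ?_⟩
        rcases Nat.lt_or_ge (j + l) (t + 1) with hlt | hge
        · exact hj2 l (by omega)
        · rw [show j + l = t + 1 by omega]
          exact h1
  obtain ⟨j, hj, hj1, hj2⟩ := hreq t₀ (hpend 0)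
  obtain ⟨l, hl, hresp⟩ := hans i j hj1
  rcases Nat.lt_or_ge t₀ (j + l) with hlt | hge
  · obtain ⟨t, ht⟩ : ∃ t, j + l = t₀ + t := ⟨j + l - t₀, by omega⟩
    have := pendingAt_ne_zero (hpend t)
    rw [ht] at hresp
    exact this.1 hresp
  · exact hj2 l hge hresp

/-- Player two wins the undirect game from the vertices outside `W` if he can avoid `W` and violate
the request-response objective from each of them: he plays in rounds, in the `L`-th of which some
request waits for `L` steps. -/
theorem exists_winning₂_bndRR {W : Set V} {κ : RRNode V r → ℕ}
    (h : CoBuchiCert (fun q : RRNode V r => G.owner q.1 = .one) (ProductEdge Rq Rp G W)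
      (productTarget W) {q | q.1 ∉ W} κ) {v₀ : V} (hv₀ : v₀ ∉ W) :
    ∃ σ : G.Strategy .two, Winning₂ (G.BndRR Rq Rp) v₀ σ := by
  classical
  obtain ⟨mv, hmvE, hmv⟩ := exists_move_of_coBuchiCert h
  let M := ((Fin r → Fin 2) × Fin r) × ℕ × ℕ
  let cur : M → V → RRNode V r := fun m v => (v, pendingAt Rq Rp v m.1.1, m.1.2)
  let upd : M → V → M := fun m v =>
    if (cur m v).2.1 (cur m v).2.2 = 0 then
      (((cur m v).2.1, nextAwaited (cur m v).2.1 (cur m v).2.2), 0, m.2.2)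
    else if m.2.1 < m.2.2 then
      (((cur m v).2.1, nextAwaited (cur m v).2.1 (cur m v).2.2), m.2.1 + 1, m.2.2)
    else ((0, 0), 0, m.2.2 + 1)
  have hact : ∀ (m : M) (v : V), G.owner v = .two → G.E v (mv (cur m v)) :=
    fun m v _ => hmvE (cur m v)
  refine ⟨mooreStrategy ((0, 0), 0, 0) upd (fun m v => mv (cur m v)) hact, fun σ₁ => ?_⟩
  obtain ⟨μ, hμ0, hμ⟩ := exists_moore_run_two ((0, 0), 0, 0) upd (fun m v => mv (cur m v)) hact v₀ σ₁
  set π := outcome v₀ σ₁ (mooreStrategy ((0, 0), 0, 0) upd (fun m v => mv (cur m v)) hact) with hπ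
  have hplay : π ∈ G.Plays := outcome_mem_plays _ _ _
  refine ⟨hplay, ?_⟩
  rintro ⟨-, i₀, -, L, hL, hans⟩
  have hmove : ∀ t, π t ∉ W → _ := fun t ht =>
    hmv (cur (μ t) (π t)) ht ht (π (t + 1)) (hplay t) fun ho => (hμ t).2 ho
  have hC : ∀ t, π t ∉ W := by
    intro t
    induction t with
    | zero => exact hv₀
    | succ t ih => exact (hmove t ih).1
  set q : ℕ → RRNode V r := fun t => cur (μ t) (π t) with hq
  have hnoreset : ∀ t, (μ (t + 1)).2.2 = (μ t).2.2 → q (t + 1) = rrSucc Rq Rp (q t) (π (t + 1)) := by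
    intro t ht
    have h1 : μ (t + 1) = upd (μ t) (π t) := (hμ t).1
    change cur (μ (t + 1)) (π (t + 1)) = _
    rw [h1] at ht ⊢
    simp only [upd] at ht ⊢
    split_ifs at ht ⊢
    · rfl
    · rfl
    · exact absurd ht (Nat.succ_ne_self _)
  have hmono : ∀ t, (μ t).2.2 ≤ (μ (t + 1)).2.2 ∧ (μ (t + 1)).2.2 ≤ (μ t).2.2 + 1 := by
    intro t
    rw [(hμ t).1]
    simp only [upd]
    split_ifs <;> simp
  -- every round ends
  have hinc : ∀ t, ∃ t' ≥ t, (μ (t' + 1)).2.2 = (μ t').2.2 + 1 ∧ (μ t').2.2 = (μ t).2.2 := by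
    intro t
    by_contra hno
    -- If the round never ended, the run would follow the product without a reset, one request would
    -- be awaited forever, and the counter would pass the number of the round.
    have hcon : ∀ k, (μ (t + k)).2.2 = (μ t).2.2 := by
      intro k
      induction k with
      | zero => rfl
      | succ k ih =>
        by_contra hne
        refine hno ⟨t + k, by omega, ?_, ih⟩
        have := hmono (t + k)
        rw [← Nat.add_assoc] at hne
        omega
    have hs : ∀ k, q (t + k + 1) = rrSucc Rq Rp (q (t + k)) (π (t + k + 1)) := fun k =>
      hnoreset _ (by rw [hcon k, Nat.add_assoc, hcon (k + 1)])
    obtain ⟨t₀, ht₀⟩ := exists_awaited_forever (q := fun k => q (t + k)) (κ := κ)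
      (fun k => by rw [← Nat.add_assoc, hs k]; rfl)
      (fun k => by rw [← Nat.add_assoc, hs k]; exact (hmove (t + k) (hC _)).2)
    have hcount : ∀ k, k ≤ (μ (t + t₀ + k)).2.1 := by
      intro k
      induction k with
      | zero => exact Nat.zero_le _
      | succ k ih =>
        have h1 := (hμ (t + t₀ + k)).1
        have h2 := (ht₀ k).1
        have h3 := hcon (t₀ + k)
        have h4 := hcon (t₀ + k + 1)
        simp only [← Nat.add_assoc] at h2 h3 h4 ⊢
        rw [h1] at h4 ⊢
        simp only [upd] at h4 ⊢
        rw [if_neg h2] at h4 ⊢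
        split_ifs at h4 ⊢
        · simpa using ih
        · simp only at h4
          omega
    have hk := hcount ((μ t).2.2 + 1)
    have h1 := hcon (t₀ + ((μ t).2.2 + 1))
    have h2 := hcon (t₀ + ((μ t).2.2 + 1) + 1)
    have h3 := (hμ (t + t₀ + ((μ t).2.2 + 1))).1
    have h4 := (ht₀ ((μ t).2.2 + 1)).1
    simp only [← Nat.add_assoc] at h1 h2 h3 h4 hk
    rw [h3] at h2
    simp only [upd] at h2
    rw [if_neg h4, if_neg (by omega)] at h2
    simp only at h2
    omega
  have hall : ∀ k, ∃ t, (μ t).2.2 = k := by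
    intro k
    induction k with
    | zero => exact ⟨0, by rw [hμ0]⟩
    | succ k ih =>
      obtain ⟨t, ht⟩ := ih
      obtain ⟨t', -, h1, h2⟩ := hinc t
      exact ⟨t' + 1, by rw [h1, h2, ht]⟩
  have hround : ∀ t, (μ t).2.2 ≤ t := by
    intro t
    induction t with
    | zero => rw [hμ0]
    | succ t ih => exact (hmono t).2.trans (by omega)
  -- Round `m` does not begin before time `m` (`hround`), so every request pending in it was made at
  -- a position at least `m`. The conditional term says that the awaited request is at least as old
  -- as the counter.
  have hreq : ∀ t i, (q t).2.1 i ≠ 0 →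
      ∃ j ≥ (μ t).2.2, π j ∈ Rq i ∧ j + (if i = (q t).2.2 then (μ t).2.1 else 0) ≤ t ∧
        ∀ l, j + l ≤ t → π (j + l) ∉ Rp i := by
    intro t
    induction t with
    | zero =>
      intro i h0
      obtain ⟨h1, h2⟩ := pendingAt_ne_zero h0
      refine ⟨0, by rw [hμ0], h2.resolve_right ?_, by rw [hμ0]; simp, fun l hl => ?_⟩
      · rw [hμ0]; exact fun h => h rfl
      · obtain rfl : l = 0 := by omega
        exact h1
    | succ t ih =>
      intro i h0
      have hr := hround (t + 1)
      obtain ⟨h1, h2⟩ := pendingAt_ne_zero h0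
      have hstep : μ (t + 1) = upd (μ t) (π t) := (hμ t).1
      by_cases hfresh : (μ (t + 1)).1.1 i = 0
      · have h2' := h2.resolve_right (fun h => h hfresh)
        refine ⟨t + 1, hr, h2', ?_, fun l hl => ?_⟩
        · have : (μ (t + 1)).2.1 = 0 ∨ (μ (t + 1)).1.1 (μ (t + 1)).1.2 ≠ 0 := by
            rw [hstep]
            simp only [upd]
            split_ifs with ha hb
            · exact Or.inl rfl
            · refine Or.inr ?_
              simp only [nextAwaited, if_neg ha]
              exact ha
            · exact Or.inl rfl
          split_ifs with hi
          · have hi' : i = (μ (t + 1)).1.2 := hi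
            rw [← hi'] at this
            have := this.resolve_right (fun h => h hfresh)
            omega
          · omega
        · obtain rfl : l = 0 := by omega
          exact h1
      · have hext : ∀ j, (∀ l, j + l ≤ t → π (j + l) ∉ Rp i) →
            ∀ l, j + l ≤ t + 1 → π (j + l) ∉ Rp i := by
          intro j hj l hl
          rcases Nat.lt_or_ge (j + l) (t + 1) with hlt | hge
          · exact hj l (by omega)
          · rw [show j + l = t + 1 by omega]
            exact h1
        change ∃ j ≥ _, _ ∧ j + (if i = (μ (t + 1)).1.2 then _ else 0) ≤ t + 1 ∧ _
        rw [hstep] at hfresh ⊢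
        simp only [upd] at hfresh ⊢
        split_ifs at hfresh ⊢ with ha hb hc hc'
        · obtain ⟨j, hj1, hj2, hj3, hj4⟩ := ih i hfresh
          exact ⟨j, hj1, hj2, by simp only; omega, hext j hj4⟩
        · obtain ⟨j, hj1, hj2, hj3, hj4⟩ := ih i hfresh
          exact ⟨j, hj1, hj2, by omega, hext j hj4⟩
        · obtain ⟨j, hj1, hj2, hj3, hj4⟩ := ih i hfresh
          simp only [nextAwaited, if_neg ha] at hc'
          have : i = (q t).2.2 := hc'
          rw [if_pos this] at hj3
          exact ⟨j, hj1, hj2, by simp only; omega, hext j hj4⟩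
        · obtain ⟨j, hj1, hj2, hj3, hj4⟩ := ih i hfresh
          exact ⟨j, hj1, hj2, by omega, hext j hj4⟩
        · exact absurd rfl hfresh
        · exact absurd rfl hfresh
  -- The end of round `i₀ + L` refutes the bound `L` on the suffix from `i₀`: the request that ends
  -- it was made at or after `i₀` and has been unanswered for at least `L` steps.
  obtain ⟨t, ht⟩ := hall (i₀ + L)
  obtain ⟨t', -, h1, h2⟩ := hinc t
  rw [(hμ t').1] at h1
  simp only [upd] at h1
  split_ifs at h1 with ha hb
  · simp only at h1; omega
  · simp only at h1; omega
  · obtain ⟨j, hj1, hj2, hj3, hj4⟩ := hreq t' _ ha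
    have hjj : i₀ + (j - i₀) = j := by omega
    obtain ⟨l, hl, hl2⟩ := hans (cur (μ t') (π t')).2.2 (j - i₀) (by rw [suffixFrom, hjj]; exact hj2)
    rw [suffixFrom, ← Nat.add_assoc, hjj] at hl2
    refine hj4 l ?_ hl2
    rw [if_pos rfl] at hj3
    omega

end GameStructure

/-! ### The iterated winning region of the undirect game -/

namespace GameStructure

variable {V : Type*} {G : GameStructure V} {r : ℕ} [NeZero r] {Rq Rp : Fin r → Set V}

/-- Player one can win the undirect game from the vertices of `W`. -/
def HasLayers (G : GameStructure V) (Rq Rp : Fin r → Set V) (W : Set V) : Prop :=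
  ∃ (rank : V → ℕ) (A : Set (RRNode V r)) (ρ : RRNode V r → ℕ),
    LayeredCert G Rq Rp rank A ρ ∧ W = {v | ∃ x ∈ A, x.1 = v}

theorem hasLayers_empty : HasLayers G Rq Rp ∅ :=
  ⟨fun _ => 0, ∅, fun _ => 0, fun _ h => h.elim, by simp⟩

/-- The new vertices get a rank above all old ones. Over `W` the old certificate is kept; from a new
node, a move into `W` is a good move to lower rank, whatever node the product reaches there, and a
move elsewhere follows the Büchi certificate. -/
theorem HasLayers.union [Finite V] {W : Set V} (h : HasLayers G Rq Rp W) {A : Set (RRNode V r)}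
    (hA : ProductSolution Rq Rp G W A) : HasLayers G Rq Rp (W ∪ {v | ∃ x ∈ A, x.1 = v}) := by
  classical
  obtain ⟨rank, A₀, ρ₀, h₀, hW⟩ := h
  obtain ⟨⟨ρ, hρ⟩, -⟩ := hA
  obtain ⟨D, hD⟩ := exists_rank_bound rank
  have hAW : ∀ x ∈ A₀, x.1 ∈ W := fun x hx => by rw [hW]; exact ⟨x, hx, rfl⟩
  have hWA : ∀ v ∈ W, ∃ x ∈ A₀, x.1 = v := fun v hv => by rw [hW] at hv; exact hv
  refine ⟨fun v => if v ∈ W then rank v else D, A₀ ∪ {q | q ∈ A ∧ q.1 ∉ W},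
    fun q => if q.1 ∈ W then ρ₀ q else ρ q, ?_, ?_⟩
  · rintro q (hq | ⟨hq, hqW⟩)
    · have hqW := hAW q hq
      have key : ∀ w, GoodMove Rq Rp rank A₀ ρ₀ q w → GoodMove Rq Rp
          (fun v => if v ∈ W then rank v else D) (A₀ ∪ {q | q ∈ A ∧ q.1 ∉ W})
          (fun q => if q.1 ∈ W then ρ₀ q else ρ q) q w := by
        rintro w (⟨hlt, x, hx, rfl⟩ | ⟨he, hx, hp⟩)
        · have := hAW x hx
          exact Or.inl ⟨by simpa [hqW, this] using hlt, x, Or.inl hx, rfl⟩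
        · have hw : w ∈ W := hAW _ hx
          refine Or.inr ⟨by simpa [hqW, hw] using he, Or.inl hx, fun h => ?_⟩
          have h1 : (rrSucc Rq Rp q w).1 ∈ W := hw
          simpa [hqW, h1] using hp h
      exact ⟨fun ho => ((h₀ q hq).1 ho).imp fun w hw => ⟨hw.1, key w hw.2⟩,
        fun ho w hw => key w ((h₀ q hq).2 ho w hw)⟩
    · have key : ∀ w, rrSucc Rq Rp q w ∈ A → (q ∉ productTarget W → ρ (rrSucc Rq Rp q w) < ρ q) →
          GoodMove Rq Rp (fun v => if v ∈ W then rank v else D) (A₀ ∪ {q | q ∈ A ∧ q.1 ∉ W})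
          (fun q => if q.1 ∈ W then ρ₀ q else ρ q) q w := by
        intro w hx hp
        by_cases hw : w ∈ W
        · obtain ⟨x, hx, hxw⟩ := hWA w hw
          exact Or.inl ⟨by simpa [hqW, hw] using hD w, x, Or.inl hx, hxw⟩
        · have h1 : (rrSucc Rq Rp q w).1 ∉ W := hw
          refine Or.inr ⟨by simp [hqW, hw], Or.inr ⟨hx, hw⟩, fun h => ?_⟩
          simpa [hqW, h1] using hp (by simpa [productTarget, hqW] using h)
      refine ⟨fun ho => ?_, fun ho w hw => ?_⟩
      · obtain ⟨x, hx, hxA, hp⟩ := (hρ q hq).1 ho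
        obtain ⟨w, hw, rfl⟩ := exists_of_productEdge hqW hx
        exact ⟨w, hw, key w hxA hp⟩
      · obtain ⟨hxA, hp⟩ := (hρ q hq).2 (owner_ne_one.mpr ho) _ (productEdge_of_not_mem hqW hw)
        exact key w hxA hp
  · ext v
    constructor
    · rintro (hv | ⟨x, hx, rfl⟩)
      · obtain ⟨x, hx, rfl⟩ := hWA v hv
        exact ⟨x, Or.inl hx, rfl⟩
      · by_cases hxW : x.1 ∈ W
        · obtain ⟨y, hy, hyx⟩ := hWA _ hxW
          exact ⟨y, Or.inl hy, hyx⟩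
        · exact ⟨x, Or.inr ⟨hx, hxW⟩, rfl⟩
    · rintro ⟨x, hx | hx, rfl⟩
      · exact Or.inl (hAW x hx)
      · exact Or.inr ⟨x, hx.1, rfl⟩

/-- If solving the product with sinks over `W` yields no new vertices, then player two wins the
undirect game outside `W`. -/
theorem ProductSolution.exists_winning₂_bndRR {W : Set V} {A : Set (RRNode V r)}
    (hA : ProductSolution Rq Rp G W A) (hAW : ∀ x ∈ A, x.1 ∈ W) {v₀ : V} (hv₀ : v₀ ∉ W) :
    ∃ σ : G.Strategy .two, Winning₂ (G.BndRR Rq Rp) v₀ σ := by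
  obtain ⟨-, κ, hκ⟩ := hA
  -- A node over `W` is a sink in the Büchi set: a rank of player two would have to drop along its
  -- loop. So all these nodes are in `A`, and by `hAW` no others are.
  have hC : Aᶜ = {q | q.1 ∉ W} := by
    ext q
    refine ⟨fun hq hqW => ?_, fun hq hqA => hq (hAW q hqA)⟩
    have hself : ∀ x, ProductEdge Rq Rp G W q x → x = q := fun x hx =>
      hx.elim (fun h => h.2) fun h => absurd hqW h.1
    have hB : q ∈ productTarget W := Or.inl hqW
    by_cases ho : G.owner q.1 = .one
    · exact lt_irrefl _ (((hκ q hq).1 ho q (Or.inl ⟨hqW, rfl⟩)).2.2 hB)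
    · obtain ⟨x, hx, -, -, hlt⟩ := (hκ q hq).2 ho
      rw [hself x hx] at hlt
      exact lt_irrefl _ (hlt hB)
  rw [hC] at hκ
  exact GameStructure.exists_winning₂_bndRR hκ hv₀

theorem HasLayers.exists_winning₁_bndRR [Finite V] {W : Set V} (h : HasLayers G Rq Rp W) {v₀ : V}
    (hv₀ : v₀ ∈ W) :
    ∃ σ : G.Strategy .one, Winning₁ (G.BndRR Rq Rp) v₀ σ ∧ σ.HasMemory (2 ^ r * r) := by
  obtain ⟨rank, A, ρ, h, rfl⟩ := h
  exact h.exists_winning₁_bndRR hv₀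

theorem ProductSolution.exists_winning₁_dirBndRR [Finite V] {A : Set (RRNode V r)}
    (hA : ProductSolution Rq Rp G ∅ A) {v₀ : V} (hv₀ : (v₀, pendingAt Rq Rp v₀ 0, 0) ∈ A) :
    ∃ σ : G.Strategy .one, Winning₁ (G.DirBndRR Rq Rp) v₀ σ ∧ σ.HasMemory (2 ^ r * r) := by
  obtain ⟨⟨ρ, hρ⟩, -⟩ := hA
  exact GameStructure.exists_winning₁_dirBndRR hρ hv₀

theorem ProductSolution.exists_winning₂_dirBndRR {A : Set (RRNode V r)}
    (hA : ProductSolution Rq Rp G ∅ A) {v₀ : V} (hv₀ : (v₀, pendingAt Rq Rp v₀ 0, 0) ∉ A) :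
    ∃ σ : G.Strategy .two, Winning₂ (G.DirBndRR Rq Rp) v₀ σ ∧ σ.HasMemory (2 ^ r * r) := by
  obtain ⟨-, κ, hκ⟩ := hA
  exact GameStructure.exists_winning₂_dirBndRR hκ hv₀

/-- The existence behind the iteration in `solveUndirect`: for a maximal `W`, `HasLayers.union` adds
nothing, so every node won in the product with sinks over `W` lies over `W`. -/
theorem exists_hasLayers_maximal [Finite V] (G : GameStructure V) (Rq Rp : Fin r → Set V) :
    ∃ W A, HasLayers G Rq Rp W ∧ ProductSolution Rq Rp G W A ∧ ∀ x ∈ A, x.1 ∈ W := by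
  obtain ⟨W, hW, hmax⟩ := Set.Finite.exists_maximal (Set.toFinite {W | HasLayers G Rq Rp W})
    ⟨∅, hasLayers_empty⟩
  obtain ⟨A, hA⟩ := exists_buchiSolution (fun q : RRNode V r => G.owner q.1 = .one)
    (ProductEdge Rq Rp G W) (productTarget W)
  exact ⟨W, A, hW, hA, fun x hx =>
    hmax (HasLayers.union hW hA) Set.subset_union_left (Or.inr ⟨x, hx, rfl⟩)⟩

end GameStructure

/-! ### Memory bounds for the multi-dimension games -/

namespace MultiGame

open GameStructure

variable {V : Type*} (G : MultiGame V)

/-- The requests, numbered. -/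
def rq (i : Fin G.r) : Set V := G.request (finProdFinEquiv.symm i)

/-- The responses, numbered. -/
def rp (i : Fin G.r) : Set V := G.response (finProdFinEquiv.symm i)

theorem dirBndObj_eq_rr (X : ObjKind) : G.DirBndObj X = G.DirBndRR G.rq G.rp := by
  rw [dirBndObj_eq]
  exact (G.dirBndRR_reindex finProdFinEquiv.symm _ _).symm

theorem bndObj_eq_rr (X : ObjKind) : G.BndObj X = G.BndRR G.rq G.rp := by
  rw [bndObj_eq]
  exact (G.bndRR_reindex finProdFinEquiv.symm _ _).symm

theorem dirBndObj_eq_plays (X : ObjKind) (h : G.r = 0) : G.DirBndObj X = G.Plays := by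
  rw [dirBndObj_eq_rr]
  have : IsEmpty (Fin G.r) := by rw [h]; infer_instance
  ext π
  exact ⟨fun h => h.1, fun h => ⟨h, 1, by omega, fun i => this.elim i⟩⟩

theorem bndObj_eq_plays (X : ObjKind) (h : G.r = 0) : G.BndObj X = G.Plays := by
  rw [bndObj_eq_rr]
  have : IsEmpty (Fin G.r) := by rw [h]; infer_instance
  ext π
  exact ⟨fun h => h.1, fun h => ⟨h, 0, suffixFrom_mem_plays h _, 1, by omega, fun i => this.elim i⟩⟩

variable {G} in
theorem winning₁_plays {v₀ : V} (σ : G.Strategy .one) : Winning₁ G.Plays v₀ σ :=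
  fun _ => outcome_mem_plays _ _ _

variable {G} in
theorem not_winning₂_plays {v₀ : V} (σ : G.Strategy .two) : ¬ Winning₂ G.Plays v₀ σ := fun h => by
  obtain ⟨σ₁, -⟩ := nonempty_strategy G.toGameStructure .one
  exact (h σ₁).2 (outcome_mem_plays _ _ _)

/-- A polynomial whose exponential bounds the memory of the product strategies. -/
noncomputable def memoryPoly : Polynomial ℕ := 2 * Polynomial.X ^ 2

/-- As `r < 2 ^ r`, the left side is at most `2 ^ (2 * r)`; and `r = n * (d / 2)` is at most the
square of the size. -/
theorem two_pow_mul_le : 2 ^ G.r * G.r ≤ 2 ^ memoryPoly.eval G.size := by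
  have h1 : G.r ≤ G.size ^ 2 := by
    have hd : G.d / 2 ≤ G.size := (Nat.div_le_self _ _).trans (Nat.le_add_left _ _)
    have hn : G.n ≤ G.size := by unfold size; omega
    calc G.r = G.n * (G.d / 2) := rfl
      _ ≤ G.size * G.size := Nat.mul_le_mul hn hd
      _ = G.size ^ 2 := by ring
  calc 2 ^ G.r * G.r ≤ 2 ^ G.r * 2 ^ G.r := Nat.mul_le_mul_left _ Nat.lt_two_pow_self.le
    _ = 2 ^ (2 * G.r) := by rw [← pow_add]; congr 1; ring
    _ ≤ 2 ^ memoryPoly.eval G.size := by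
      refine Nat.pow_le_pow_right (by norm_num) ?_
      simp only [memoryPoly, Polynomial.eval_mul, Polynomial.eval_ofNat, Polynomial.eval_pow,
        Polynomial.eval_X]
      omega

theorem one_le_two_pow_memoryPoly : 1 ≤ 2 ^ memoryPoly.eval G.size := Nat.one_le_two_pow

theorem _root_.GameStructure.Strategy.HasMemory.mono {G : GameStructure V} {i : Player}
    {σ : G.Strategy i} {k l : ℕ} (h : σ.HasMemory k) (hkl : k ≤ l) : σ.HasMemory l := by
  obtain ⟨M, hM, m₀, upd, act, hk, h⟩ := h
  exact ⟨M, hM, m₀, upd, act, hk.trans hkl, h⟩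

theorem dirBnd_memory (X : ObjKind) [Finite V] (v₀ : V) :
    ((∃ σ : G.Strategy .one, Winning₁ (G.DirBndObj X) v₀ σ) →
      ∃ σ : G.Strategy .one, Winning₁ (G.DirBndObj X) v₀ σ ∧
        σ.HasMemory (2 ^ memoryPoly.eval G.size)) ∧
    ((∃ σ : G.Strategy .two, Winning₂ (G.DirBndObj X) v₀ σ) →
      ∃ σ : G.Strategy .two, Winning₂ (G.DirBndObj X) v₀ σ ∧
        σ.HasMemory (2 ^ memoryPoly.eval G.size)) := by
  -- Without requests nothing can be awaited and the product has no nodes; but then player one wins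
  -- every play.
  by_cases hr : G.r = 0
  · rw [G.dirBndObj_eq_plays X hr]
    refine ⟨fun _ => ?_, fun ⟨σ, hσ⟩ => absurd hσ (not_winning₂_plays σ)⟩
    obtain ⟨σ, hσ⟩ := nonempty_strategy G.toGameStructure .one
    exact ⟨σ, winning₁_plays σ, hσ.mono G.one_le_two_pow_memoryPoly⟩
  · have : NeZero G.r := ⟨hr⟩
    rw [G.dirBndObj_eq_rr X]
    obtain ⟨A, hA⟩ := exists_buchiSolution (fun q : RRNode V G.r => G.owner q.1 = .one)
      (ProductEdge G.rq G.rp G.toGameStructure ∅) (productTarget ∅)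
    have hA : ProductSolution G.rq G.rp G.toGameStructure ∅ A := hA
    by_cases hv : (v₀, pendingAt G.rq G.rp v₀ 0, 0) ∈ A
    · obtain ⟨σ, hσ, hm⟩ := hA.exists_winning₁_dirBndRR hv
      exact ⟨fun _ => ⟨σ, hσ, hm.mono G.two_pow_mul_le⟩,
        fun ⟨σ₂, hσ₂⟩ => (not_winning_both hσ hσ₂).elim⟩
    · obtain ⟨σ, hσ, hm⟩ := hA.exists_winning₂_dirBndRR hv
      exact ⟨fun ⟨σ₁, hσ₁⟩ => (not_winning_both hσ₁ hσ).elim,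
        fun _ => ⟨σ, hσ, hm.mono G.two_pow_mul_le⟩⟩

theorem bnd_memory (X : ObjKind) [Finite V] (v₀ : V)
    (h : ∃ σ : G.Strategy .one, Winning₁ (G.BndObj X) v₀ σ) :
    ∃ σ : G.Strategy .one, Winning₁ (G.BndObj X) v₀ σ ∧
      σ.HasMemory (2 ^ memoryPoly.eval G.size) := by
  by_cases hr : G.r = 0
  · rw [G.bndObj_eq_plays X hr]
    obtain ⟨σ, hσ⟩ := nonempty_strategy G.toGameStructure .one
    exact ⟨σ, winning₁_plays σ, hσ.mono G.one_le_two_pow_memoryPoly⟩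
  · have : NeZero G.r := ⟨hr⟩
    rw [G.bndObj_eq_rr X] at h ⊢
    obtain ⟨W, A, hW, hA, hAW⟩ := exists_hasLayers_maximal G.toGameStructure G.rq G.rp
    by_cases hv : v₀ ∈ W
    · obtain ⟨σ, hσ, hm⟩ := hW.exists_winning₁_bndRR hv
      exact ⟨σ, hσ, hm.mono G.two_pow_mul_le⟩
    · obtain ⟨σ, hσ⟩ := hA.exists_winning₂_bndRR hAW hv
      obtain ⟨σ₁, hσ₁⟩ := h
      exact (not_winning_both hσ₁ hσ).elim

end MultiGame

/-! ### A game in which player two needs infinite memory -/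

namespace MultiGame

open GameStructure

/-- A request at vertex 0, an arbitrarily long stay at the neutral vertex 1, a response at vertex 2;
player two owns all vertices. -/
def delayGame (n : ℕ) : MultiGame (Fin 3) where
  owner _ := .two
  E v w := (v = 0 ∧ w = 1) ∨ (v = 1 ∧ w ≠ 0) ∨ (v = 2 ∧ w = 0)
  no_deadlock := by decide
  n := n
  d := 2
  d_even := even_two
  p _ v := ![1, 2, 0] v
  p_le := by intro _; decide

theorem delayGame_half (n : ℕ) : (delayGame n).d / 2 = 1 := by
  change 2 / 2 = 1
  norm_num

theorem delayGame_request {n : ℕ} (i) (v : Fin 3) : v ∈ (delayGame n).request i ↔ v = 0 := by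
  obtain ⟨m, c, hc⟩ := i
  change ![1, 2, 0] v = 2 * c + 1 ↔ _
  replace hc := hc.trans_eq (delayGame_half n)
  obtain rfl : c = 0 := by omega
  revert v
  decide

theorem delayGame_response {n : ℕ} (i) (v : Fin 3) : v ∈ (delayGame n).response i ↔ v = 2 := by
  obtain ⟨m, c, hc⟩ := i
  change Even (![1, 2, 0] v) ∧ ![1, 2, 0] v ≤ 2 * c + 1 ↔ _
  replace hc := hc.trans_eq (delayGame_half n)
  obtain rfl : c = 0 := by omega
  revert v
  decide

theorem mem_bndObj_delayGame {n : ℕ} (X : ObjKind) {π : ℕ → Fin 3}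
    (hπ : π ∈ (delayGame n).Plays) (i L : ℕ) (hL : 0 < L)
    (h : ∀ j ≥ i, π j = 0 → ∃ l ≤ L, π (j + l) = 2) : π ∈ (delayGame n).BndObj X := by
  rw [bndObj_eq]
  refine ⟨hπ, i, suffixFrom_mem_plays hπ i, L, hL, fun m j hj => ?_⟩
  obtain ⟨l, hl, hr⟩ := h (i + j) (by omega) ((delayGame_request _ _).mp hj)
  exact ⟨l, hl, (delayGame_response _ _).mpr (by rw [suffixFrom, ← Nat.add_assoc]; exact hr)⟩

theorem exists_of_mem_bndObj_delayGame {n : ℕ} (hn : 1 ≤ n) (X : ObjKind) {π : ℕ → Fin 3}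
    (h : π ∈ (delayGame n).BndObj X) :
    ∃ i L, ∀ j ≥ i, π j = 0 → ∃ l ≤ L, π (j + l) = 2 := by
  rw [bndObj_eq] at h
  obtain ⟨-, i, -, L, -, h⟩ := h
  refine ⟨i, L, fun j hj h0 => ?_⟩
  have hij : i + (j - i) = j := by omega
  have hd : 0 < (delayGame n).d / 2 := by change 0 < 2 / 2; norm_num
  obtain ⟨l, hl, hr⟩ := h (⟨0, hn⟩, ⟨0, hd⟩) (j - i)
    ((delayGame_request _ _).mpr (by rw [suffixFrom, hij]; exact h0))
  rw [delayGame_response, suffixFrom, ← Nat.add_assoc, hij] at hr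
  exact ⟨l, hl, hr⟩

/-- Player two owns every vertex, so against a finite-memory strategy vertex and memory repeat and
the play is ultimately periodic. A visit to 0 in the periodic part recurs one period later, and the
only predecessor of 0 is the response 2; hence each late request is answered within a period. -/
theorem delayGame_not_finiteMemory (n : ℕ) (X : ObjKind) (v₀ : Fin 3)
    (σ : (delayGame n).Strategy .two) (hσ : σ.FiniteMemory) :
    ¬ Winning₂ ((delayGame n).BndObj X) v₀ σ := by
  intro hwin
  obtain ⟨σ₁, -⟩ := nonempty_strategy (delayGame n).toGameStructure .one
  obtain ⟨hplay, hnot⟩ := hwin σ₁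
  refine hnot ?_
  obtain ⟨k, M, hM, m₀, upd, act, -, hact⟩ := hσ
  set π := outcome v₀ σ₁ σ with hπ
  let st : ℕ → M × Fin 3 := fun t => ((outcomeHist v₀ σ₁ σ t).1.foldl upd m₀, π t)
  have hst : ∀ t, st (t + 1) = (upd (st t).1 (st t).2, act (st t).1 (st t).2) := by
    intro t
    refine Prod.ext ?_ ?_
    · simp only [st, outcomeHist, List.foldl_append, List.foldl_cons, List.foldl_nil]
      rfl
    · change π (t + 1) = _
      rw [hπ, outcome_succ_two _ _ _ _ rfl, hact _ _ rfl]
  obtain ⟨a, b, hab, heq⟩ := Finite.exists_ne_map_eq_of_infinite st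
  wlog hlt : a < b generalizing a b
  · exact this b a hab.symm heq.symm (by omega)
  have hper : ∀ j ≥ a, st (j + (b - a)) = st j := by
    intro j hj
    induction j, hj using Nat.le_induction with
    | base => rw [show a + (b - a) = b by omega, heq]
    | succ j _ ih => rw [show j + 1 + (b - a) = j + (b - a) + 1 by omega, hst, hst, ih]
  refine mem_bndObj_delayGame X hplay a (b - a) (by omega) fun j hj h0 => ⟨b - a - 1, by omega, ?_⟩
  have h1 : π (j + (b - a - 1) + 1) = 0 := by
    rw [show j + (b - a - 1) + 1 = j + (b - a) by omega, ← h0]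
    exact congrArg (fun x : M × Fin 3 => x.2) (hper j hj)
  have h2 := hplay (j + (b - a - 1))
  rw [h1] at h2
  rcases h2 with ⟨-, h⟩ | ⟨-, h⟩ | ⟨h, -⟩
  · exact absurd h (by decide)
  · exact absurd rfl h
  · exact h

open Classical in
/-- At the neutral vertex, move on so as to arrive at the response at a time that is a power of two. -/
noncomputable def delayStrategy (n : ℕ) : (delayGame n).Strategy .two where
  next ρ v := if v = 0 then 1 else if v = 2 then 0 else
    -- `ρ.length + 1` is the time at which the next vertex is visited.
    if ∃ k, ρ.length + 1 = 2 ^ k then 2 else 1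
  legal ρ v _ := by
    change (v = 0 ∧ _ = _) ∨ (v = 1 ∧ _ ≠ _) ∨ (v = 2 ∧ _ = _)
    split_ifs with h0 h2
    · exact Or.inl ⟨h0, rfl⟩
    · exact Or.inr (Or.inr ⟨h2, rfl⟩)
    · exact Or.inr (Or.inl ⟨by omega, by decide⟩)
    · exact Or.inr (Or.inl ⟨by omega, by decide⟩)

theorem delayStrategy_winning {n : ℕ} (hn : 1 ≤ n) (X : ObjKind) :
    Winning₂ ((delayGame n).BndObj X) 1 (delayStrategy n) := by
  classical
  intro σ₁
  refine ⟨outcome_mem_plays _ _ _, fun hmem => ?_⟩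
  obtain ⟨i, L, h⟩ := exists_of_mem_bndObj_delayGame hn X hmem
  set π := outcome 1 σ₁ (delayStrategy n) with hπ
  have hlen : ∀ t, (outcomeHist 1 σ₁ (delayStrategy n) t).1.length = t := by
    intro t
    induction t with
    | zero => rfl
    | succ t ih => simp [outcomeHist, ih]
  have hstep : ∀ t, π (t + 1) = if π t = 0 then 1 else if π t = 2 then 0 else
      if ∃ k, t + 1 = 2 ^ k then 2 else 1 := by
    intro t
    have h1 : π (t + 1) = _ := outcome_succ_two _ _ _ _ rfl
    rw [h1]
    change (if π t = 0 then _ else if π t = 2 then _ else if ∃ k, _ + 1 = 2 ^ k then _ else _) = _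
    rw [hlen]
  have htwo : ∀ t, π t = 2 → ∃ k, t = 2 ^ k := by
    intro t ht
    cases t with
    | zero => exact absurd ht (by decide : (1 : Fin 3) ≠ 2)
    | succ t =>
      rw [hstep] at ht
      split_ifs at ht with h0 h2 hk
      · exact absurd ht (by decide)
      · exact absurd ht (by decide)
      · exact hk
      · exact absurd ht (by decide)
  -- Otherwise the play would stay at the neutral vertex from some time on, though it leaves it at
  -- the next power of two.
  have hzero : ∀ T, ∃ t ≥ T, π t = 0 := by
    intro T
    by_contra! hno
    have hno2 : ∀ t ≥ T, π t ≠ 2 := fun t ht h2 => hno (t + 1) (by omega) (by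
      rw [hstep, h2, if_neg (by decide), if_pos rfl])
    have hT : T < 2 ^ T := Nat.lt_two_pow_self
    have h1 := hstep (2 ^ T - 1)
    rw [if_neg (hno _ (by omega)), if_neg (hno2 _ (by omega)), if_pos ⟨T, by omega⟩] at h1
    exact hno2 _ (by omega) h1
  obtain ⟨t, ht, h0⟩ := hzero (i + L + 4)
  obtain ⟨s, rfl⟩ : ∃ s, t = s + 1 := ⟨t - 1, by omega⟩
  have hs2 : π s = 2 := by
    have h1 := hstep s
    rw [h0] at h1
    split_ifs at h1 with h2 h3 h4
    · exact absurd h1 (by decide)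
    · exact h3
    · exact absurd h1 (by decide)
    · exact absurd h1 (by decide)
  obtain ⟨k, hk⟩ := htwo s hs2
  obtain ⟨l, hl, hl2⟩ := h (s + 1) (by omega) h0
  obtain ⟨m, hm⟩ := htwo _ hl2
  have hkm : k < m := (Nat.pow_lt_pow_iff_right (by norm_num : 1 < 2)).mp (by omega)
  have h1 : 2 ^ (k + 1) ≤ 2 ^ m := Nat.pow_le_pow_right (by norm_num) hkm
  rw [pow_succ] at h1
  omega

theorem exists_infinite_memory_game (X : ObjKind) (n : ℕ) (hn : 1 ≤ n) :
    ∃ (N : ℕ) (G : MultiGame (Fin N)) (v₀ : Fin N), G.n = n ∧ G.d = 2 ∧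
      (∃ σ : G.Strategy .two, Winning₂ (G.BndObj X) v₀ σ) ∧
      ∀ σ : G.Strategy .two, σ.FiniteMemory → ¬ Winning₂ (G.BndObj X) v₀ σ :=
  ⟨3, delayGame n, 1, rfl, rfl, ⟨_, delayStrategy_winning hn X⟩,
    fun σ hσ => delayGame_not_finiteMemory n X 1 σ hσ⟩

end MultiGame

/-! ### Structured programming on the random access machine -/

namespace RamProg

/-- The memory layout of a structured program: the input occupies the cells below `base`, which hold
`inp`, the word bound is `W`, and all stored values are at most `Bd`. -/
structure Layout where
  W : ℕ
  Bd : ℕ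
  base : ℕ
  inp : ℕ → ℕ
  -- Numerals are at most 32, and an operation at most squares the bound. Eight nested operations,
  -- and two more squarings for the address of an array entry, give the exponent 10.
  pow_le : (Bd + 32) ^ (2 ^ 10) ≤ W
  base_le : base ≤ Bd
  inp_le : ∀ a < base, inp a ≤ Bd

/-- The state of a structured program: 40 variables and 16 two-dimensional arrays. -/
structure HState where
  reg : ℕ → ℕ
  arr : ℕ → ℕ → ℕ → ℕ

/-- Update of a two-dimensional array. -/
def update₂ (f : ℕ → ℕ → ℕ) (a b v : ℕ) : ℕ → ℕ → ℕ :=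
  fun a' b' => if a' = a ∧ b' = b then v else f a' b'

theorem update₂_apply (f : ℕ → ℕ → ℕ) (a b v a' b' : ℕ) :
    update₂ f a b v a' b' = if a' = a ∧ b' = b then v else f a' b' := rfl

namespace HState

def setReg (h : HState) (x v : ℕ) : HState := ⟨Function.update h.reg x v, h.arr⟩

def setArr (h : HState) (j a b v : ℕ) : HState :=
  ⟨h.reg, Function.update h.arr j (update₂ (h.arr j) a b v)⟩

@[simp] theorem setReg_reg (h : HState) (x v y : ℕ) :
    (h.setReg x v).reg y = if y = x then v else h.reg y := by
  simp [setReg, Function.update_apply]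

@[simp] theorem setReg_arr (h : HState) (x v : ℕ) : (h.setReg x v).arr = h.arr := rfl

@[simp] theorem setArr_reg (h : HState) (j a b v : ℕ) : (h.setArr j a b v).reg = h.reg := rfl

@[simp] theorem setArr_arr (h : HState) (j a b v j' : ℕ) :
    (h.setArr j a b v).arr j' = if j' = j then update₂ (h.arr j) a b v else h.arr j' := by
  by_cases hj : j' = j
  · subst hj; simp [setArr]
  · simp [setArr, hj]

/-- `h'` differs from `h` at most in the variables `R` and the arrays `A`. -/
def Frame (h h' : HState) (R A : List ℕ) : Prop :=
  (∀ x, x ∉ R → h'.reg x = h.reg x) ∧ ∀ j, j ∉ A → h'.arr j = h.arr j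

theorem Frame.refl (h : HState) (R A : List ℕ) : h.Frame h R A := ⟨fun _ _ => rfl, fun _ _ => rfl⟩

theorem Frame.trans {h h' h'' : HState} {R A R' A' : List ℕ} (h₁ : h.Frame h' R A)
    (h₂ : h'.Frame h'' R' A') (hR : R ⊆ R') (hA : A ⊆ A') : h.Frame h'' R' A' :=
  ⟨fun x hx => (h₂.1 x hx).trans (h₁.1 x fun h => hx (hR h)),
    fun j hj => (h₂.2 j hj).trans (h₁.2 j fun h => hj (hA h))⟩

theorem Frame.mono {h h' : HState} {R A R' A' : List ℕ} (h₁ : h.Frame h' R A)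
    (hR : R ⊆ R') (hA : A ⊆ A') : h.Frame h' R' A' := h₁.trans (Frame.refl _ _ _) hR hA

theorem Frame.setReg {h h' : HState} {R A : List ℕ} (hf : h.Frame h' R A) {x : ℕ} (hx : x ∈ R)
    (v : ℕ) : h.Frame (h'.setReg x v) R A :=
  ⟨fun y hy => by
    rw [setReg_reg, if_neg (fun e => hy (by rw [e]; exact hx)), hf.1 y hy], hf.2⟩

theorem Frame.setArr {h h' : HState} {R A : List ℕ} (hf : h.Frame h' R A) {j : ℕ} (hj : j ∈ A)
    (a b v : ℕ) : h.Frame (h'.setArr j a b v) R A :=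
  ⟨hf.1, fun y hy => by
    rw [setArr_arr, if_neg (fun e => hy (by rw [e]; exact hj)), hf.2 y hy]⟩

end HState

/-- Expressions: variables, numerals, operations, array entries and words of the input. -/
inductive Ex where
  | var (x : ℕ)
  | num (c : ℕ)
  | op (o : ArithOp) (a b : Ex)
  | get (j : ℕ) (a b : Ex)
  | word (a : Ex)

namespace Ex

instance : Add Ex := ⟨op .add⟩
instance : Sub Ex := ⟨op .sub⟩
instance : Mul Ex := ⟨op .mul⟩
instance : Div Ex := ⟨op .div⟩
instance (n : ℕ) : OfNat Ex n := ⟨num n⟩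

variable (C : Layout) (h : HState)

def eval : Ex → ℕ
  | var x => h.reg x
  | num c => c
  | op o a b => o.eval (eval a) (eval b)
  | get j a b => h.arr j (eval a) (eval b)
  | word a => C.inp (eval a)

@[simp] theorem eval_var (x : ℕ) : (var x).eval C h = h.reg x := rfl
@[simp] theorem eval_num (n : ℕ) : (ofNat(n) : Ex).eval C h = n := rfl
@[simp] theorem eval_add (a b : Ex) : (a + b).eval C h = a.eval C h + b.eval C h := rfl
@[simp] theorem eval_sub (a b : Ex) : (a - b).eval C h = a.eval C h - b.eval C h := rfl
@[simp] theorem eval_mul (a b : Ex) : (a * b).eval C h = a.eval C h * b.eval C h := rfl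
@[simp] theorem eval_div (a b : Ex) : (a / b).eval C h = a.eval C h / b.eval C h := rfl
@[simp] theorem eval_get (j : ℕ) (a b : Ex) :
    (get j a b).eval C h = h.arr j (a.eval C h) (b.eval C h) := rfl
@[simp] theorem eval_word (a : Ex) : (word a).eval C h = C.inp (a.eval C h) := rfl

/-- The input is only read inside its bounds. -/
def Ok : Ex → Prop
  | var _ => True
  | num _ => True
  | op _ a b => Ok a ∧ Ok b
  | get _ a b => Ok a ∧ Ok b
  | word a => Ok a ∧ a.eval C h < C.base

/-- The expression does not read the input. -/
def pure : Ex → Bool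
  | var _ => true
  | num _ => true
  | op _ a b => pure a && pure b
  | get _ a b => pure a && pure b
  | word _ => false

theorem ok_of_pure {e : Ex} (he : e.pure = true) : e.Ok C h := by
  induction e with
  | var x => trivial
  | num c => trivial
  | op o a b iha ihb =>
    simp only [pure, Bool.and_eq_true] at he
    exact ⟨iha he.1, ihb he.2⟩
  | get j a b iha ihb =>
    simp only [pure, Bool.and_eq_true] at he
    exact ⟨iha he.1, ihb he.2⟩
  | word a => simp [pure] at he

def depth : Ex → ℕ
  | var _ => 0
  | num _ => 0
  | op _ a b => max (depth a) (depth b) + 1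
  | get _ a b => max (depth a) (depth b)
  | word a => depth a

def size : Ex → ℕ
  | var _ => 1
  | num _ => 1
  | op _ a b => size a + size b + 1
  | get _ a b => size a + size b + 1
  | word a => size a + 1

def namesOk : Ex → Bool
  | var x => decide (x < 40)
  | num c => decide (c ≤ 32)
  | op _ a b => namesOk a && namesOk b
  | get j a b => decide (j < 16) && namesOk a && namesOk b
  | word a => namesOk a

/-- Variables, arrays and numerals are in range and the expression is small. -/
def wf (e : Ex) : Bool := e.namesOk && decide (e.depth ≤ 8) && decide (e.size ≤ 40)

/-- Replace the values `a` and `b` of the temporaries number `k` and `k + 1` by the address of the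
entry `(a, b)` of array `j`. -/
def address (j k : ℕ) : RamProg :=
  seq (RamProg.op .add (42 + k) (41 + k) (42 + k)) (seq (RamProg.op .mul (42 + k) (42 + k) (42 + k))
    (seq (RamProg.op .add (41 + k) (42 + k) (41 + k)) (seq (const (42 + k) 16)
      (seq (RamProg.op .mul (41 + k) (41 + k) (42 + k)) (seq (RamProg.op .add (41 + k) (41 + k) 40)
        (seq (const (42 + k) j) (RamProg.op .add (41 + k) (41 + k) (42 + k))))))))

/-- Code that evaluates the expression into the temporary number `k`. -/
def comp : Ex → ℕ → RamProg
  -- Copying is adding zero. The variables are the registers below 40, register 40 holds the length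
  -- of the input, and the temporaries start at 41.
  | var x, k => seq (const (41 + k) 0) (RamProg.op .add (41 + k) x (41 + k))
  | num c, k => const (41 + k) c
  | op o a b, k => seq (comp a k) (seq (comp b (k + 1)) (RamProg.op o (41 + k) (41 + k) (42 + k)))
  | get j a b, k => seq (comp a k) (seq (comp b (k + 1)) (seq (address j k) (load (41 + k) (41 + k))))
  | word a, k => seq (comp a k) (load (41 + k) (41 + k))

end Ex

open HState

/-- The address of the entry `(a, b)` of array `j`. -/
def Layout.addr (C : Layout) (j a b : ℕ) : ℕ := 16 * ((a + b) * (a + b) + a) + C.base + j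

/-- The residue modulo 16, after subtracting `base`, gives the array. The number `(a + b) ^ 2 + a`
lies between the squares of `a + b` and `a + b + 1`, so it determines `a + b` and then `a`. -/
theorem Layout.addr_inj (C : Layout) {j j' a a' b b' : ℕ} (hj : j < 16) (hj' : j' < 16) :
    C.addr j a b = C.addr j' a' b' ↔ j = j' ∧ a = a' ∧ b = b' := by
  refine ⟨fun h => ?_, by rintro ⟨rfl, rfl, rfl⟩; rfl⟩
  unfold Layout.addr at h
  have h1 : j = j' := by omega
  have h2 : (a + b) * (a + b) + a = (a' + b') * (a' + b') + a' := by omega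
  have h3 : a + b = a' + b' := by
    rcases lt_trichotomy (a + b) (a' + b') with hlt | heq | hlt
    · have : (a + b + 1) * (a + b + 1) ≤ (a' + b') * (a' + b') := Nat.mul_le_mul hlt hlt
      nlinarith
    · exact heq
    · have : (a' + b' + 1) * (a' + b' + 1) ≤ (a + b) * (a + b) := Nat.mul_le_mul hlt hlt
      nlinarith
  rw [h3] at h2
  exact ⟨h1, by omega, by omega⟩

/-- The machine state `s` represents the state `h`. -/
structure Sim (C : Layout) (h : HState) (s : RamState) : Prop where
  reg : ∀ x < 40, s.reg x = h.reg x
  base : s.reg 40 = C.base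
  inp : ∀ a < C.base, s.mem a = C.inp a
  arr : ∀ j < 16, ∀ a b, s.mem (C.addr j a b) = h.arr j a b
  reg_le : ∀ x < 40, h.reg x ≤ C.Bd
  arr_le : ∀ j < 16, ∀ a b, h.arr j a b ≤ C.Bd

theorem Sim.congr {C : Layout} {h : HState} {s s' : RamState} (hs : Sim C h s)
    (hreg : ∀ x < 41, s'.reg x = s.reg x) (hmem : s'.mem = s.mem) : Sim C h s' where
  reg x hx := by rw [hreg x (by omega), hs.reg x hx]
  base := by rw [hreg 40 (by omega), hs.base]
  inp a ha := by rw [hmem, hs.inp a ha]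
  arr j hj a b := by rw [hmem, hs.arr j hj a b]
  reg_le := hs.reg_le
  arr_le := hs.arr_le

section Bounds

variable (C : Layout)

/-- The bound on the values of expressions of depth `k`. -/
def Layout.lim (k : ℕ) : ℕ := (C.Bd + 32) ^ 2 ^ k

theorem Layout.lim_mono {k l : ℕ} (h : k ≤ l) : C.lim k ≤ C.lim l :=
  Nat.pow_le_pow_right (by omega) (Nat.pow_le_pow_right (by norm_num) h)

theorem Layout.lim_succ (k : ℕ) : C.lim (k + 1) = C.lim k * C.lim k := by
  rw [lim, pow_succ, mul_two, pow_add]; rfl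

theorem Layout.le_lim (k : ℕ) : C.Bd + 32 ≤ C.lim k := Nat.le_self_pow (by positivity) _

theorem Layout.lim_le {k : ℕ} (h : k ≤ 10) : C.lim k ≤ C.W := (C.lim_mono h).trans C.pow_le

/-- The bound squares with each level because of multiplication; a sum fits as well since the bound
is at least 32. -/
theorem _root_.ArithOp.eval_le_lim (o : ArithOp) {k a b : ℕ} (ha : a ≤ C.lim k)
    (hb : b ≤ C.lim k) : o.eval a b ≤ C.lim (k + 1) := by
  have h2 := C.le_lim k
  have h3 : C.lim k * 2 ≤ C.lim k * C.lim k := Nat.mul_le_mul_left _ (by omega)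
  rw [C.lim_succ]
  cases o with
  | add => simp only [ArithOp.eval]; omega
  | sub => simp only [ArithOp.eval]; omega
  | mul => exact Nat.mul_le_mul ha hb
  | div => exact (Nat.div_le_self _ _).trans (by omega)

/-- For `y = C.lim k` the address is of order `y ^ 2`, hence below `y ^ 4 = C.lim (k + 2)` because
`32 ≤ y`. The margin of 16 leaves room for the number of the array. -/
theorem Layout.addr_le {k a b : ℕ} (hk : k ≤ 8) (ha : a ≤ C.lim k)
    (hb : b ≤ C.lim k) : 16 * ((a + b) * (a + b) + a) + C.base + 16 ≤ C.W := by
  refine le_trans ?_ (C.lim_le (k := k + 2) (by omega))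
  have h2 := C.le_lim k
  have h3 := C.base_le
  rw [C.lim_succ, C.lim_succ]
  generalize C.lim k = y at *
  have h4 : (a + b) * (a + b) ≤ (y + y) * (y + y) := Nat.mul_le_mul (by omega) (by omega)
  have h5 : 32 * 32 ≤ y * y := Nat.mul_le_mul (by omega) (by omega)
  have h6 : 1 * y ≤ y * y := Nat.mul_le_mul_right _ (by omega)
  have h7 : (32 * 32) * (y * y) ≤ (y * y) * (y * y) := Nat.mul_le_mul_right _ h5
  nlinarith

end Bounds

variable {C : Layout}

theorem Ex.eval_le_lim {h : HState} {s : RamState} (hs : Sim C h s) {e : Ex}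
    (hn : e.namesOk = true) (hok : e.Ok C h) : e.eval C h ≤ C.lim e.depth := by
  induction e with
  | var x =>
    simp only [namesOk, decide_eq_true_eq] at hn
    exact (hs.reg_le x hn).trans (le_trans (by omega) (C.le_lim _))
  | num c =>
    simp only [namesOk, decide_eq_true_eq] at hn
    exact le_trans (by simp only [eval]; omega) (C.le_lim _)
  | op o a b iha ihb =>
    simp only [namesOk, Bool.and_eq_true] at hn
    exact o.eval_le_lim C ((iha hn.1 hok.1).trans (C.lim_mono (le_max_left _ _)))
      ((ihb hn.2 hok.2).trans (C.lim_mono (le_max_right _ _)))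
  | get j a b iha ihb =>
    simp only [namesOk, Bool.and_eq_true, decide_eq_true_eq] at hn
    exact (hs.arr_le j hn.1.1 _ _).trans (le_trans (by omega) (C.le_lim _))
  | word a iha => exact (C.inp_le _ hok.2).trans (le_trans (by omega) (C.le_lim _))

theorem address_runs {k : ℕ} {s : RamState} {j a b : ℕ} (hj : j < 16)
    (hbase : s.reg 40 = C.base) (ha : s.reg (41 + k) = a) (hb : s.reg (42 + k) = b)
    (hW : 16 * ((a + b) * (a + b) + a) + C.base + 16 ≤ C.W) :
    ∃ s', RamRuns C.W (Ex.address j k) s s' 8 ∧ s'.mem = s.mem ∧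
      s'.reg (41 + k) = C.addr j a b ∧ ∀ x, x < 41 + k → s'.reg x = s.reg x := by
  have e1 : ¬ (41 + k = 42 + k) := by omega
  have e3 : ¬ (40 = 42 + k) := by omega
  have e4 : ¬ (40 = 41 + k) := by omega
  refine ⟨_, .seq (t₁ := 1) (t₂ := 7) (.op _ _ _ _ _ ?_) (.seq (t₁ := 1) (t₂ := 6) (.op _ _ _ _ _ ?_)
    (.seq (t₁ := 1) (t₂ := 5) (.op _ _ _ _ _ ?_) (.seq (t₁ := 1) (t₂ := 4) (.const _ _ _ ?_)
    (.seq (t₁ := 1) (t₂ := 3) (.op _ _ _ _ _ ?_) (.seq (t₁ := 1) (t₂ := 2) (.op _ _ _ _ _ ?_)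
    (.seq (t₁ := 1) (t₂ := 1) (.const _ _ _ ?_) (.op _ _ _ _ _ ?_))))))), rfl, ?_, ?_⟩
  all_goals try simp only [ArithOp.eval, Function.update_self, Function.update_of_ne, ne_eq,
    not_false_eq_true, ha, hb, hbase, Function.update_apply, e1, e3, e4]
  · nlinarith
  · nlinarith
  · nlinarith
  · omega
  · nlinarith
  · nlinarith
  · omega
  · nlinarith
  · unfold Layout.addr
    ring
  · intro x hx
    have h1 : ¬ (x = 41 + k) := by omega
    have h2 : ¬ (x = 42 + k) := by omega
    simp only [h1, h2, if_false]

/-- The frame clause, for the registers below the target, lets the second operand be evaluated into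
temporary `k + 1` without losing the first. The dearest node of an expression is an array access,
which takes nine steps beyond its operands. -/
theorem Ex.comp_runs {h : HState} {e : Ex} (hn : e.namesOk = true) (hd : e.depth ≤ 8)
    (hok : e.Ok C h) (k : ℕ) {s : RamState} (hs : Sim C h s) :
    ∃ s' t, RamRuns C.W (e.comp k) s s' t ∧ t ≤ 10 * e.size ∧ s'.mem = s.mem ∧
      s'.reg (41 + k) = e.eval C h ∧ ∀ x, x < 41 + k → s'.reg x = s.reg x := by
  induction e generalizing k s with
  | var x =>
    simp only [namesOk, decide_eq_true_eq] at hn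
    have hW : h.reg x ≤ C.W :=
      (Ex.eval_le_lim hs (e := var x) (by simpa [namesOk] using hn) trivial).trans
        (C.lim_le (by simp [depth]))
    have e1 : ¬ (x = 41 + k) := by omega
    refine ⟨_, _, .seq (.const _ _ _ (Nat.zero_le _)) (.op _ _ _ _ _ ?_), (by simp [size] : 1 + 1 ≤ _), rfl, ?_, ?_⟩
    · simpa [ArithOp.eval, Function.update_apply, e1, hs.reg x hn] using hW
    · simp [ArithOp.eval, e1, hs.reg x hn, eval]
    · intro y hy
      have e2 : ¬ (y = 41 + k) := by omega
      simp [Function.update_apply, e2]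
  | num c =>
    simp only [namesOk, decide_eq_true_eq] at hn
    have hW : c ≤ C.W := le_trans (by omega) ((C.le_lim 0).trans (C.lim_le (by omega)))
    refine ⟨_, _, .const _ _ _ hW, by simp [size], rfl, by simp [eval], fun y hy => ?_⟩
    have e2 : ¬ (y = 41 + k) := by omega
    simp [e2]
  | op o a b iha ihb =>
    have hW : (op o a b).eval C h ≤ C.W := (Ex.eval_le_lim hs hn hok).trans (C.lim_le (by omega))
    simp only [namesOk, Bool.and_eq_true] at hn
    simp only [depth] at hd
    obtain ⟨s₁, t₁, r₁, ht₁, hm₁, hv₁, hf₁⟩ := iha hn.1 (by omega) hok.1 k hs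
    obtain ⟨s₂, t₂, r₂, ht₂, hm₂, hv₂, hf₂⟩ := ihb hn.2 (by omega) hok.2 (k + 1)
      (hs.congr (fun x hx => hf₁ x (by omega)) hm₁)
    rw [show 41 + (k + 1) = 42 + k by omega] at hv₂
    have hv₁' : s₂.reg (41 + k) = a.eval C h := by rw [hf₂ _ (by omega), hv₁]
    refine ⟨_, _, .seq r₁ (.seq r₂ (.op _ _ _ _ _ ?_)), ?_, ?_, ?_, ?_⟩
    · rw [hv₁', hv₂]; exact hW
    · simp only [size]; omega
    · simp only [hm₂, hm₁]
    · simp [hv₁', hv₂, eval]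
    · intro x hx
      have e2 : ¬ (x = 41 + k) := by omega
      simp only [Function.update_apply, e2, if_false]
      rw [hf₂ x (by omega), hf₁ x hx]
  | get j a b iha ihb =>
    have ha' := fun hn => Ex.eval_le_lim hs (e := a) hn hok.1
    have hb' := fun hn => Ex.eval_le_lim hs (e := b) hn hok.2
    simp only [namesOk, Bool.and_eq_true, decide_eq_true_eq] at hn
    simp only [depth] at hd
    obtain ⟨s₁, t₁, r₁, ht₁, hm₁, hv₁, hf₁⟩ := iha hn.1.2 (by omega) hok.1 k hs
    obtain ⟨s₂, t₂, r₂, ht₂, hm₂, hv₂, hf₂⟩ := ihb hn.2 (by omega) hok.2 (k + 1)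
      (hs.congr (fun x hx => hf₁ x (by omega)) hm₁)
    rw [show 41 + (k + 1) = 42 + k by omega] at hv₂
    obtain ⟨s₃, r₃, hm₃, hv₃, hf₃⟩ := address_runs (C := C) (k := k) (s := s₂) hn.1.1
      (by rw [hf₂ _ (by omega), hf₁ _ (by omega), hs.base])
      (by rw [hf₂ _ (by omega), hv₁]) hv₂
      (C.addr_le (k := 8) le_rfl ((ha' hn.1.2).trans (C.lim_mono (by omega)))
        ((hb' hn.2).trans (C.lim_mono (by omega))))
    refine ⟨_, _, .seq r₁ (.seq r₂ (.seq r₃ (.load _ _ _))), ?_, ?_, ?_, ?_⟩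
    · simp only [size]; omega
    · simp only [hm₃, hm₂, hm₁]
    · simp only [Function.update_self, hv₃, hm₃, hm₂, hm₁, eval]
      exact hs.arr j hn.1.1 _ _
    · intro x hx
      have e2 : ¬ (x = 41 + k) := by omega
      simp only [Function.update_apply, e2, if_false]
      rw [hf₃ x hx, hf₂ x (by omega), hf₁ x hx]
  | word a iha =>
    simp only [namesOk] at hn
    simp only [depth] at hd
    obtain ⟨s₁, t₁, r₁, ht₁, hm₁, hv₁, hf₁⟩ := iha hn hd hok.1 k hs
    refine ⟨_, _, .seq r₁ (.load _ _ _), by simp only [size]; omega, hm₁, ?_, ?_⟩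
    · simp only [Function.update_self, hv₁, hm₁, eval]
      exact hs.inp _ hok.2
    · intro x hx
      have e2 : ¬ (x = 41 + k) := by omega
      simp only [Function.update_apply, e2, if_false]
      exact hf₁ x hx

/-! #### Statements and their rules -/

/-- Total correctness with time: from every representation of `h`, the program `P` runs to a
representation of some `h'` within `2000 * t` steps such that `Q h' t`. -/
def Wp (C : Layout) (P : RamProg) (h : HState) (Q : HState → ℕ → Prop) : Prop :=
  -- One unit of `t` pays for one statement: at most three expressions of size at most 40 are
  -- evaluated, at ten steps per node, and a few instructions follow.
  ∀ s, Sim C h s → ∃ s' n h' t, RamRuns C.W P s s' n ∧ n ≤ 2000 * t ∧ Sim C h' s' ∧ Q h' t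

theorem Wp.mono {P : RamProg} {h : HState} {Q Q' : HState → ℕ → Prop} (hw : Wp C P h Q)
    (hQ : ∀ h' t, Q h' t → Q' h' t) : Wp C P h Q' := fun s hs => by
  obtain ⟨s', n, h', t, hr, hn, hs', hq⟩ := hw s hs
  exact ⟨s', n, h', t, hr, hn, hs', hQ _ _ hq⟩

/-- A sequence of programs. -/
def block : List RamProg → RamProg
  | [] => skip
  | P :: l => seq P (block l)

theorem Wp.nil {h : HState} {Q : HState → ℕ → Prop} (hQ : Q h 1) : Wp C (block []) h Q :=
  fun s hs => ⟨s, 1, h, 1, .skip s, by omega, hs, hQ⟩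

theorem Wp.cons {P : RamProg} {l : List RamProg} {h : HState} {Q : HState → ℕ → Prop}
    (hw : Wp C P h fun h₁ t₁ => Wp C (block l) h₁ fun h₂ t₂ => Q h₂ (t₁ + t₂)) :
    Wp C (block (P :: l)) h Q := fun s hs => by
  obtain ⟨s₁, n₁, h₁, t₁, r₁, hn₁, hs₁, hw₁⟩ := hw s hs
  obtain ⟨s₂, n₂, h₂, t₂, r₂, hn₂, hs₂, hq⟩ := hw₁ s₁ hs₁
  exact ⟨s₂, n₁ + n₂, h₂, t₁ + t₂, .seq r₁ r₂, by omega, hs₂, hq⟩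

/-- The assignment `x := e`. -/
def asg (x : ℕ) (e : Ex) : RamProg := seq (e.comp 0) (seq (const 42 0) (op .add x 41 42))

/-- The assignment to the entry `(a, b)` of array `j`. -/
def put (j : ℕ) (a b e : Ex) : RamProg :=
  seq (e.comp 0) (seq (a.comp 1) (seq (b.comp 2) (seq (Ex.address j 1) (store 42 41))))

/-- If `a < b` then `P` else `Q`. -/
def ite (a b : Ex) (P Q : RamProg) : RamProg := seq (a.comp 0) (seq (b.comp 1) (ifLt 41 42 P Q))

/-- While `a < b` do `P`. -/
def loop (a b : Ex) (P : RamProg) : RamProg :=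
  seq (a.comp 0) (seq (b.comp 1) (whileLt 41 42 (seq P (seq (a.comp 0) (b.comp 1)))))

/-- For `x` from `0` to `e - 1` do `P`. -/
def forLt (x : ℕ) (e : Ex) (P : RamProg) : RamProg :=
  block [asg x 0, loop (.var x) e (block [P, asg x (.var x + 1)])]

theorem Ex.wf_iff {e : Ex} : e.wf = true ↔ e.namesOk = true ∧ e.depth ≤ 8 ∧ e.size ≤ 40 := by
  simp [wf, and_assoc]

theorem Wp.asg {x : ℕ} {e : Ex} {h : HState} {Q : HState → ℕ → Prop}
    (hwf : (e.wf && decide (x < 40)) = true) (hok : e.Ok C h) (hle : e.eval C h ≤ C.Bd)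
    (hQ : Q (h.setReg x (e.eval C h)) 1) : Wp C (asg x e) h Q := fun s hs => by
  simp only [Bool.and_eq_true, Ex.wf_iff, decide_eq_true_eq] at hwf
  obtain ⟨⟨hn, hd, hz⟩, hx⟩ := hwf
  obtain ⟨s₁, t₁, r₁, ht₁, hm₁, hv₁, hf₁⟩ := Ex.comp_runs hn hd hok 0 hs
  have hv₁' : s₁.reg 41 = e.eval C h := hv₁
  have hW : C.Bd ≤ C.W := le_trans (by omega) ((C.le_lim 0).trans (C.lim_le (by omega)))
  refine ⟨_, _, _, 1, .seq r₁ (.seq (.const _ _ _ (Nat.zero_le _)) (.op _ _ _ _ _ ?_)), by omega, ?_, hQ⟩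
  · simp [ArithOp.eval, hv₁']
    omega
  · have hregs : ∀ y < 41, Function.update (Function.update s₁.reg 42 0) x
        (ArithOp.add.eval (Function.update s₁.reg 42 0 41) (Function.update s₁.reg 42 0 42)) y =
        if y = x then e.eval C h else s.reg y := by
      intro y hy
      have h1 : ¬ (y = 42) := by omega
      by_cases hyx : y = x
      · simp [hyx, ArithOp.eval, Function.update_apply, hv₁']
      · simp [hyx, h1, hf₁ y (by omega)]
    refine ⟨fun y hy => ?_, ?_, ?_, ?_, fun y hy => ?_, hs.arr_le⟩
    · exact (hregs y (by omega)).trans (by rw [setReg_reg, hs.reg y hy])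
    · exact (hregs 40 (by omega)).trans (by rw [if_neg (by omega), hs.base])
    · simpa only [hm₁] using hs.inp
    · simpa only [hm₁, setReg_arr] using hs.arr
    · rw [setReg_reg]
      split_ifs
      · exact hle
      · exact hs.reg_le y hy

theorem Wp.put {j : ℕ} {a b e : Ex} {h : HState} {Q : HState → ℕ → Prop}
    (hwf : (e.wf && a.wf && b.wf && e.pure && a.pure && b.pure && decide (j < 16)) = true)
    (hle : e.eval C h ≤ C.Bd)
    (hQ : Q (h.setArr j (a.eval C h) (b.eval C h) (e.eval C h)) 1) : Wp C (put j a b e) h Q :=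
  fun s hs => by
  simp only [Bool.and_eq_true, Ex.wf_iff, decide_eq_true_eq] at hwf
  obtain ⟨⟨⟨⟨⟨⟨⟨hn, hd, hz⟩, hna, hda, hza⟩, hnb, hdb, hzb⟩, hpe⟩, hpa⟩, hpb⟩, hj⟩ := hwf
  have oke := Ex.ok_of_pure C h hpe
  have oka := Ex.ok_of_pure C h hpa
  have okb := Ex.ok_of_pure C h hpb
  obtain ⟨s₁, t₁, r₁, ht₁, hm₁, hv₁, hf₁⟩ := Ex.comp_runs hn hd oke 0 hs
  have hs₁ := hs.congr (fun x hx => hf₁ x (by omega)) hm₁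
  obtain ⟨s₂, t₂, r₂, ht₂, hm₂, hv₂, hf₂⟩ := Ex.comp_runs hna hda oka 1 hs₁
  have hs₂ := hs₁.congr (fun x hx => hf₂ x (by omega)) hm₂
  obtain ⟨s₃, t₃, r₃, ht₃, hm₃, hv₃, hf₃⟩ := Ex.comp_runs hnb hdb okb 2 hs₂
  have hs₃ := hs₂.congr (fun x hx => hf₃ x (by omega)) hm₃
  obtain ⟨s₄, r₄, hm₄, hv₄, hf₄⟩ := address_runs (C := C) (k := 1) (s := s₃) hj
    hs₃.base (by rw [hf₃ _ (by omega), hv₂]) hv₃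
    (C.addr_le (k := 8) le_rfl ((Ex.eval_le_lim hs hna oka).trans (C.lim_mono (by omega)))
      ((Ex.eval_le_lim hs hnb okb).trans (C.lim_mono (by omega))))
  have hs₄ := hs₃.congr (fun x hx => hf₄ x (by omega)) hm₄
  have hv : s₄.reg 41 = e.eval C h := by
    rw [hf₄ 41 (by omega), hf₃ 41 (by omega), hf₂ 41 (by omega)]
    exact hv₁
  have hadr : s₄.reg 42 = C.addr j (a.eval C h) (b.eval C h) := hv₄
  refine ⟨_, _, _, 1, .seq r₁ (.seq r₂ (.seq r₃ (.seq r₄ (.store _ _ _)))), by omega, ?_, hQ⟩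
  rw [hv, hadr]
  refine ⟨hs₄.reg, hs₄.base, fun x hx => ?_, fun j' hj' a' b' => ?_, hs₄.reg_le, fun j' hj' a' b' => ?_⟩
  · have hne : x ≠ C.addr j (a.eval C h) (b.eval C h) := by unfold Layout.addr; omega
    simp only [Function.update_apply, hne, if_false]
    exact hs₄.inp x hx
  · simp only [Function.update_apply, C.addr_inj hj' hj, setArr_arr]
    rcases eq_or_ne j' j with rfl | hne
    · simp only [true_and, update₂_apply, if_true]
      split_ifs
      · rfl
      · exact hs₄.arr _ hj _ _
    · simp only [hne, false_and, if_false]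
      exact hs₄.arr _ hj' _ _
  · rw [setArr_arr]
    split_ifs
    · rw [update₂_apply]
      split_ifs
      · exact hle
      · exact hs.arr_le _ hj _ _
    · exact hs.arr_le _ hj' _ _

theorem comp_pair_runs {a b : Ex} {h : HState} (hwf : (a.wf && b.wf) = true)
    (hok : a.Ok C h ∧ b.Ok C h) {s : RamState} (hs : Sim C h s) :
    ∃ s₁ s₂ t₁ t₂, RamRuns C.W (a.comp 0) s s₁ t₁ ∧ RamRuns C.W (b.comp 1) s₁ s₂ t₂ ∧
      t₁ ≤ 400 ∧ t₂ ≤ 400 ∧ Sim C h s₂ ∧ s₂.reg 41 = a.eval C h ∧ s₂.reg 42 = b.eval C h := by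
  simp only [Bool.and_eq_true, Ex.wf_iff] at hwf
  obtain ⟨⟨hna, hda, hza⟩, hnb, hdb, hzb⟩ := hwf
  obtain ⟨s₁, t₁, r₁, ht₁, hm₁, hv₁, hf₁⟩ := Ex.comp_runs hna hda hok.1 0 hs
  have hs₁ := hs.congr (fun x hx => hf₁ x (by omega)) hm₁
  obtain ⟨s₂, t₂, r₂, ht₂, hm₂, hv₂, hf₂⟩ := Ex.comp_runs hnb hdb hok.2 1 hs₁
  exact ⟨s₁, s₂, t₁, t₂, r₁, r₂, by omega, by omega, hs₁.congr (fun x hx => hf₂ x (by omega)) hm₂,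
    by rw [hf₂ 41 (by omega)]; exact hv₁, hv₂⟩

theorem Wp.ite {a b : Ex} {P Q : RamProg} {h : HState} {R : HState → ℕ → Prop}
    (hwf : (a.wf && b.wf) = true) (hok : a.Ok C h ∧ b.Ok C h)
    (h₁ : a.eval C h < b.eval C h → Wp C P h fun h' t => R h' (t + 1))
    (h₂ : ¬ a.eval C h < b.eval C h → Wp C Q h fun h' t => R h' (t + 1)) :
    Wp C (ite a b P Q) h R := fun s hs => by
  obtain ⟨s₁, s₂, t₁, t₂, r₁, r₂, ht₁, ht₂, hs₂, hva, hvb⟩ := comp_pair_runs hwf hok hs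
  by_cases hc : a.eval C h < b.eval C h
  · obtain ⟨s₃, n, h', t, r₃, hn, hs₃, hR⟩ := h₁ hc s₂ hs₂
    exact ⟨s₃, _, h', t + 1, .seq r₁ (.seq r₂ (.if_true (by rw [hva, hvb]; exact hc) r₃)),
      by omega, hs₃, hR⟩
  · obtain ⟨s₃, n, h', t, r₃, hn, hs₃, hR⟩ := h₂ hc s₂ hs₂
    exact ⟨s₃, _, h', t + 1, .seq r₁ (.seq r₂ (.if_false (by rw [hva, hvb]; exact hc) r₃)),
      by omega, hs₃, hR⟩

/-- The rule for loops, with a potential that pays for the time. -/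
theorem Wp.loop {a b : Ex} {P : RamProg} {h : HState} {R : HState → ℕ → Prop}
    (I : HState → Prop) (Φ : HState → ℕ) (hwf : (a.wf && b.wf && a.pure && b.pure) = true)
    (h0 : I h)
    (hbody : ∀ h, I h → a.eval C h < b.eval C h →
      Wp C P h fun h' t => I h' ∧ Φ h' + t + 1 ≤ Φ h)
    (hexit : ∀ h' t, I h' → ¬ a.eval C h' < b.eval C h' → Φ h' + t ≤ Φ h + 1 → R h' t) :
    Wp C (loop a b P) h R := fun s hs => by
  simp only [Bool.and_eq_true] at hwf
  have hok : ∀ h, a.Ok C h ∧ b.Ok C h := fun h =>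
    ⟨Ex.ok_of_pure C h hwf.1.2, Ex.ok_of_pure C h hwf.2⟩
  have hwf' : (a.wf && b.wf) = true := by simp only [Bool.and_eq_true]; exact hwf.1.1
  -- The slack of 1000 covers the last test of the guard; the first evaluation of the guard is paid
  -- outside.
  have key : ∀ N, ∀ h s, Φ h = N → I h → Sim C h s → s.reg 41 = a.eval C h →
      s.reg 42 = b.eval C h → ∃ s' n h' t,
        RamRuns C.W (whileLt 41 42 (seq P (seq (a.comp 0) (b.comp 1)))) s s' n ∧
        n + 1 ≤ 2000 * t + 1000 ∧ Sim C h' s' ∧ I h' ∧ ¬ a.eval C h' < b.eval C h' ∧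
        Φ h' + t ≤ Φ h := by
    intro N
    induction N using Nat.strong_induction_on with
    | _ N ih =>
      intro h s hN hI hs hva hvb
      by_cases hc : a.eval C h < b.eval C h
      · obtain ⟨s₁, n₁, h₁, t₁, r₁, hn₁, hs₁, hI₁, hΦ⟩ := hbody h hI hc s hs
        obtain ⟨s₂, s₃, m₂, m₃, r₂, r₃, hm₂, hm₃, hs₃, hva₃, hvb₃⟩ := comp_pair_runs hwf' (hok h₁) hs₁
        obtain ⟨s₄, n₄, h₄, t₄, r₄, hn₄, hs₄, hI₄, hc₄, hΦ₄⟩ :=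
          ih (Φ h₁) (by omega) h₁ s₃ rfl hI₁ hs₃ hva₃ hvb₃
        exact ⟨s₄, _, h₄, t₁ + 1 + t₄,
          .while_true (by rw [hva, hvb]; exact hc) (.seq r₁ (.seq r₂ r₃)) r₄,
          by omega, hs₄, hI₄, hc₄, by omega⟩
      · exact ⟨s, 1, h, 0, .while_false (by rw [hva, hvb]; exact hc), by omega, hs, hI, hc, by omega⟩
  obtain ⟨s₁, s₂, t₁, t₂, r₁, r₂, ht₁, ht₂, hs₂, hva, hvb⟩ := comp_pair_runs hwf' (hok h) hs
  obtain ⟨s₃, n, h', t, r₃, hn, hs₃, hI₃, hc₃, hΦ⟩ := key _ h s₂ rfl h0 hs₂ hva hvb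
  exact ⟨s₃, _, h', t + 1, .seq r₁ (.seq r₂ r₃), by omega, hs₃, hexit _ _ hI₃ hc₃ (by omega)⟩

/-- The rule for counting loops. -/
theorem Wp.forLt {x n : ℕ} {e : Ex} {P : RamProg} {h : HState} {R : HState → ℕ → Prop}
    (I : ℕ → HState → Prop) (T : ℕ → ℕ) (hwf : (e.wf && e.pure && decide (x < 40)) = true)
    (hn : n ≤ C.Bd) (hI : ∀ i h, I i h → h.reg x = i ∧ e.eval C h = n)
    (h0 : I 0 (h.setReg x 0))
    (hbody : ∀ i h, i < n → I i h → Wp C P h fun h' t =>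
      h'.reg x = i ∧ I (i + 1) (h'.setReg x (i + 1)) ∧ t ≤ T i)
    (hexit : ∀ h' t, I n h' → t ≤ ∑ i ∈ Finset.range n, (T i + 3) + 3 → R h' t) :
    Wp C (forLt x e P) h R := by
  simp only [Bool.and_eq_true, decide_eq_true_eq] at hwf
  have hx : decide (x < 40) = true := by simpa using hwf.2
  have hwx : (Ex.var x).wf = true := by simp [Ex.wf, Ex.namesOk, Ex.depth, Ex.size, hwf.2]
  have hwx1 : (Ex.var x + 1).wf = true := by
    change (Ex.op .add (Ex.var x) (Ex.num 1)).wf = true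
    simp [Ex.wf, Ex.namesOk, Ex.depth, Ex.size, hwf.2]
  refine Wp.cons (Wp.asg (by simp only [hx, Bool.and_true]; rfl) trivial (Nat.zero_le _) ?_)
  -- Each round pays 3 beyond its body: the increment, the end of the block and the passage of the
  -- loop.
  refine Wp.cons (Wp.loop (fun h => ∃ i ≤ n, I i h)
    (fun h => ∑ i ∈ Finset.Ico (h.reg x) n, (T i + 3)) ?_ ⟨0, Nat.zero_le _, h0⟩ ?_ ?_)
  · simp only [Bool.and_eq_true]
    exact ⟨⟨⟨hwx, hwf.1.1⟩, rfl⟩, hwf.1.2⟩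
  · rintro h ⟨i, hin, hi⟩ hlt
    obtain ⟨hxi, hen⟩ := hI i h hi
    simp only [Ex.eval_var] at hlt
    refine Wp.cons ((hbody i h (by omega) hi).mono ?_)
    rintro h₁ t₁ ⟨hx1, hI1, ht1⟩
    refine Wp.cons (Wp.asg ?_ ⟨trivial, trivial⟩ ?_ ?_)
    · simp only [hwx1, hx, Bool.and_true]
    · simp only [Ex.eval_add, Ex.eval_var, Ex.eval_num, hx1]
      omega
    · simp only [Ex.eval_add, Ex.eval_var, Ex.eval_num, hx1]
      refine Wp.nil ⟨⟨i + 1, by omega, hI1⟩, ?_⟩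
      have h1 := (hI _ _ hI1).1
      rw [h1, hxi, Finset.sum_eq_sum_Ico_succ_bot (by omega : i < n)]
      omega
  · rintro h' t ⟨i, hin, hi⟩ hc hΦ
    obtain ⟨hxi, hen⟩ := hI i h' hi
    simp only [Ex.eval_var] at hc
    obtain rfl : i = n := by omega
    have h1 := (hI _ _ h0).1
    have hev : (Ex.eval C h (0 : Ex)) = 0 := rfl
    rw [hev, h1] at hΦ
    simp only [Nat.Ico_zero_eq_range] at hΦ
    refine Wp.nil (hexit _ _ hi ?_)
    omega

end RamProg

namespace RamProg

open HState

variable {C : Layout}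

/-- `Sim` contains the bounds on the stored values, so they may be assumed when new values are to be
bounded. -/
theorem Wp.of_bounds {P : RamProg} {h : HState} {Q : HState → ℕ → Prop}
    (H : (∀ x, x < 40 → h.reg x ≤ C.Bd) → (∀ j a b, j < 16 → h.arr j a b ≤ C.Bd) → Wp C P h Q) :
    Wp C P h Q := fun s hs => H hs.reg_le (fun j a b hj => hs.arr_le j hj a b) s hs

theorem update₂_row (f : ℕ → ℕ → ℕ) (a b v a' : ℕ) :
    update₂ f a b v a' = if a' = a then Function.update (f a) b v else f a' := by
  funext b'
  by_cases h : a' = a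
  · subst h; by_cases hb : b' = b <;> simp [update₂, hb]
  · simp [update₂, h]

/-! #### Sets stored in the rows of an array -/

/-- The array `lst` lists the set `S` in its first `deg` entries, and `pos` holds the places of the
elements, increased by one, and zeros for the other numbers below `M`. -/
structure RowOK (M : ℕ) (lst pos : ℕ → ℕ) (deg : ℕ) (S : Set ℕ) : Prop where
  lt : ∀ z ∈ S, z < M
  place : ∀ z ∈ S, 0 < pos z ∧ pos z ≤ deg ∧ lst (pos z - 1) = z
  mem : ∀ p < deg, lst p ∈ S ∧ pos (lst p) = p + 1
  absent : ∀ z < M, z ∉ S → pos z = 0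

namespace RowOK

variable {M : ℕ} {lst pos : ℕ → ℕ} {deg : ℕ} {S : Set ℕ}

/-- Only the places have to be cleared; the entries of an empty list may be arbitrary. -/
theorem empty (M : ℕ) (lst : ℕ → ℕ) {pos : ℕ → ℕ} (h : ∀ z < M, pos z = 0) :
    RowOK M lst pos 0 ∅ :=
  ⟨fun _ h => h.elim, fun _ h => h.elim, fun _ h => absurd h (Nat.not_lt_zero _), fun z hz _ => h z hz⟩

theorem pos_iff (h : RowOK M lst pos deg S) {z : ℕ} (hz : z < M) : 0 < pos z ↔ z ∈ S := by
  refine ⟨fun hp => ?_, fun hz => (h.place z hz).1⟩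
  by_contra hS
  rw [h.absent z hz hS] at hp
  exact lt_irrefl _ hp

theorem injOn (h : RowOK M lst pos deg S) : Set.InjOn lst (Finset.range deg) := by
  intro p hp q hq hpq
  have h1 := (h.mem p (by simpa using hp)).2
  have h2 := (h.mem q (by simpa using hq)).2
  rw [hpq] at h1
  omega

/-- The entries are distinct. This turns a small superset of a row into a small row, which makes
small traps visible at low levels. -/
theorem deg_le (h : RowOK M lst pos deg S) (D : Finset ℕ) (hD : ∀ z ∈ S, z ∈ D) : deg ≤ D.card := by
  have := Finset.card_le_card_of_injOn (s := Finset.range deg) (t := D) lst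
    (fun p hp => hD _ (h.mem p (by simpa using hp)).1) h.injOn
  simpa using this

theorem deg_le_bound (h : RowOK M lst pos deg S) : deg ≤ M := by
  simpa using h.deg_le (Finset.range M) fun z hz => Finset.mem_range.mpr (h.lt z hz)

theorem exists_place (h : RowOK M lst pos deg S) {z : ℕ} (hz : z ∈ S) : ∃ p < deg, lst p = z := by
  obtain ⟨h1, h2, h3⟩ := h.place z hz
  exact ⟨pos z - 1, by omega, h3⟩

theorem deg_pos (h : RowOK M lst pos deg S) : 0 < deg ↔ S.Nonempty := by
  refine ⟨fun hd => ⟨_, (h.mem 0 hd).1⟩, fun ⟨z, hz⟩ => ?_⟩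
  obtain ⟨p, hp, -⟩ := h.exists_place hz
  omega

theorem insert (h : RowOK M lst pos deg S) {z : ℕ} (hz : z < M) (hS : z ∉ S) :
    RowOK M (Function.update lst deg z) (Function.update pos z (deg + 1)) (deg + 1)
      (insert z S) := by
  refine ⟨?_, fun x hx => ?_, fun p hp => ?_, fun x hx hxS => ?_⟩
  · rintro x (rfl | hx)
    · exact hz
    · exact h.lt x hx
  · rcases hx with rfl | hx
    · simp
    · have hne : x ≠ z := fun e => hS (e ▸ hx)
      obtain ⟨h1, h2, h3⟩ := h.place x hx
      have hne2 : pos x - 1 ≠ deg := by omega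
      simp only [Function.update_of_ne hne, Function.update_of_ne hne2]
      exact ⟨h1, by omega, h3⟩
  · rcases Nat.lt_or_ge p deg with hlt | hge
    · obtain ⟨h1, h2⟩ := h.mem p hlt
      have hne : p ≠ deg := by omega
      have hne2 : lst p ≠ z := fun e => hS (e ▸ h1)
      rw [Function.update_of_ne hne, Function.update_of_ne hne2]
      exact ⟨Or.inr h1, h2⟩
    · obtain rfl : p = deg := by omega
      simp
  · have hne : x ≠ z := fun e => hxS (Or.inl e)
    rw [Function.update_of_ne hne]
    exact h.absent x hx fun hx => hxS (Or.inr hx)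

/-- Deletion in constant time: the last entry moves into the gap. The place of `z` is set to zero
last, which is also right when `z` is itself the last entry. -/
theorem erase (h : RowOK M lst pos deg S) {z : ℕ} (hz : z ∈ S) :
    RowOK M (Function.update lst (pos z - 1) (lst (deg - 1)))
      (Function.update (Function.update pos (lst (deg - 1)) (pos z)) z 0) (deg - 1)
      (S \ {z}) := by
  obtain ⟨h1, h2, h3⟩ := h.place z hz
  obtain ⟨h4, h5⟩ := h.mem (deg - 1) (by omega)
  refine ⟨fun x hx => h.lt x hx.1, fun x hx => ?_, fun p hp => ?_, fun x hx hxS => ?_⟩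
  · have hxz : x ≠ z := hx.2
    obtain ⟨g1, g2, g3⟩ := h.place x hx.1
    rw [Function.update_of_ne hxz]
    by_cases hl : x = lst (deg - 1)
    · rw [hl, Function.update_self, Function.update_self]
      refine ⟨h1, ?_, rfl⟩
      by_contra hc
      have : pos z = deg := by omega
      rw [this] at h3
      exact hxz (hl.trans h3)
    · rw [Function.update_of_ne hl]
      have hne1 : pos x ≠ pos z := fun e => hxz (by rw [← g3, ← h3, e])
      have hne2 : pos x ≠ deg := fun e => hl (by rw [← g3, e])
      rw [Function.update_of_ne (by omega)]
      exact ⟨g1, by omega, g3⟩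
  · by_cases hpz : p = pos z - 1
    · rw [hpz, Function.update_self]
      have hne : lst (deg - 1) ≠ z := fun e => by rw [e] at h5; omega
      rw [Function.update_of_ne hne, Function.update_self]
      exact ⟨⟨h4, hne⟩, by omega⟩
    · obtain ⟨g1, g2⟩ := h.mem p (by omega)
      have hne : lst p ≠ z := fun e => by rw [e] at g2; omega
      have hne2 : lst p ≠ lst (deg - 1) := fun e => by rw [e] at g2; omega
      rw [Function.update_of_ne hpz, Function.update_of_ne hne, Function.update_of_ne hne2]
      exact ⟨⟨g1, hne⟩, g2⟩
  · by_cases hxz : x = z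
    · rw [hxz, Function.update_self]
    · have hxS' : x ∉ S := fun h => hxS ⟨h, hxz⟩
      have hne : x ≠ lst (deg - 1) := fun e => hxS' (e ▸ h4)
      rw [Function.update_of_ne hxz, Function.update_of_ne hne]
      exact h.absent x hx hxS'

end RowOK

/-- Row `ρ` of the arrays 3 (entries), 4 (places) and 5 (lengths) stores the set `S`. -/
def RowIn (M : ℕ) (h : HState) (ρ : ℕ) (S : Set ℕ) : Prop :=
  RowOK M (h.arr 3 ρ) (h.arr 4 ρ) (h.arr 5 ρ 0) S

/-- The rows other than `ρ` are the same. -/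
def SameRows (h h' : HState) (ρ : ℕ) : Prop :=
  ∀ ρ', ρ' ≠ ρ → h'.arr 3 ρ' = h.arr 3 ρ' ∧ h'.arr 4 ρ' = h.arr 4 ρ' ∧ h'.arr 5 ρ' = h.arr 5 ρ'

/-- Remove the element in variable 15 from the row in variable 17. -/
def eraseElem : RamProg := block [
  asg 18 (.get 5 (.var 17) 0 - 1),
  asg 19 (.get 3 (.var 17) (.var 18)),
  asg 20 (.get 4 (.var 17) (.var 15)),
  put 3 (.var 17) (.var 20 - 1) (.var 19),
  put 4 (.var 17) (.var 19) (.var 20),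
  put 4 (.var 17) (.var 15) 0,
  put 5 (.var 17) 0 (.var 18)]

theorem eraseElem_spec {M : ℕ} {h : HState} {S : Set ℕ} {ρ z : ℕ} (hρ : h.reg 17 = ρ)
    (hz : h.reg 15 = z) (hS : RowIn M h ρ S) (hzS : z ∈ S) :
    Wp C eraseElem h fun h' t => t ≤ 8 ∧ Frame h h' [18, 19, 20] [3, 4, 5] ∧
      RowIn M h' ρ (S \ {z}) ∧ SameRows h h' ρ := by
  refine Wp.of_bounds fun hreg harr => ?_
  refine Wp.cons (Wp.asg rfl ⟨⟨trivial, trivial⟩, trivial⟩ ?_ ?_)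
  · simpa using (Nat.sub_le _ _).trans (harr 5 _ _ (by norm_num))
  refine Wp.cons (Wp.asg rfl ⟨trivial, trivial⟩ ?_ ?_)
  · simpa using harr 3 _ _ (by norm_num)
  refine Wp.cons (Wp.asg rfl ⟨trivial, trivial⟩ ?_ ?_)
  · simpa using harr 4 _ _ (by norm_num)
  refine Wp.cons (Wp.put rfl ?_ ?_)
  · simpa using harr 3 _ _ (by norm_num)
  refine Wp.cons (Wp.put rfl ?_ ?_)
  · simpa using harr 4 _ _ (by norm_num)
  refine Wp.cons (Wp.put rfl ?_ ?_)
  · simp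
  refine Wp.cons (Wp.put rfl ?_ ?_)
  · simpa using (Nat.sub_le _ _).trans (harr 5 _ _ (by norm_num))
  refine Wp.nil ?_
  simp [hρ, hz]
  refine ⟨⟨fun x hx => ?_, fun j hj => ?_⟩, ?_, fun ρ' hρ' => ?_⟩
  · simp at hx
    simp [hx]
  · simp at hj
    simp [hj]
  · have := hS.erase hzS
    simpa [RowIn, update₂_row] using this
  · simp [update₂_row, hρ']

/-- Add the element in variable 15 to the row in variable 17, if it is not there. -/
def insertElem : RamProg :=
  ite (.get 4 (.var 17) (.var 15)) 1 (block [
    asg 18 (.get 5 (.var 17) 0),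
    put 3 (.var 17) (.var 18) (.var 15),
    put 4 (.var 17) (.var 15) (.var 18 + 1),
    put 5 (.var 17) 0 (.var 18 + 1)]) (block [])

theorem insertElem_spec {M : ℕ} {h : HState} {S : Set ℕ} {ρ z : ℕ} (hM : M < C.Bd)
    (hρ : h.reg 17 = ρ) (hz : h.reg 15 = z) (hS : RowIn M h ρ S) (hzM : z < M) :
    Wp C insertElem h fun h' t => t ≤ 6 ∧ Frame h h' [18] [3, 4, 5] ∧
      RowIn M h' ρ (insert z S) ∧ SameRows h h' ρ := by
  refine Wp.of_bounds fun hreg harr => ?_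
  have hdeg := hS.deg_le_bound
  refine Wp.ite rfl ⟨⟨trivial, trivial⟩, trivial⟩ (fun hc => ?_) (fun hc => ?_)
  · simp only [Ex.eval_get, Ex.eval_var, Ex.eval_num, hρ, hz] at hc
    have hzS : z ∉ S := fun h => by
      have := (hS.place z h).1
      omega
    refine Wp.cons (Wp.asg rfl ⟨trivial, trivial⟩ ?_ ?_)
    · simpa using harr 5 _ _ (by norm_num)
    refine Wp.cons (Wp.put rfl ?_ ?_)
    · simpa using hreg 15 (by norm_num)
    refine Wp.cons (Wp.put rfl ?_ ?_)
    · simp [hρ]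
      omega
    refine Wp.cons (Wp.put rfl ?_ ?_)
    · simp [hρ]
      omega
    refine Wp.nil ?_
    simp [hρ, hz]
    refine ⟨⟨fun x hx => ?_, fun j hj => ?_⟩, ?_, fun ρ' hρ' => ?_⟩
    · simp at hx
      simp [hx]
    · simp at hj
      simp [hj]
    · have := hS.insert hzM hzS
      simpa [RowIn, update₂_row] using this
    · simp [update₂_row, hρ']
  · simp only [Ex.eval_get, Ex.eval_var, Ex.eval_num, hρ, hz] at hc
    have hzS : z ∈ S := (RowOK.pos_iff hS hzM).mp (by omega)
    refine Wp.nil ⟨by omega, Frame.refl _ _ _, ?_, fun _ _ => ⟨rfl, rfl, rfl⟩⟩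
    rwa [Set.insert_eq_of_mem hzS]

end RamProg

/-! ### Game arenas in memory and the search for traps -/

namespace RamProg

open HState

variable {C : Layout}

/-- The rule for loops with a potential that need not be a function of the state. -/
theorem Wp.loop_ghost {a b : Ex} {P : RamProg} {h : HState} {R : HState → ℕ → Prop} {n : ℕ}
    (I : ℕ → HState → Prop) (hwf : (a.wf && b.wf && a.pure && b.pure) = true)
    (h0 : I n h)
    (hbody : ∀ n h, I n h → a.eval C h < b.eval C h →
      Wp C P h fun h' t => ∃ n', I n' h' ∧ n' + t + 1 ≤ n)
    (hexit : ∀ h' t n', I n' h' → ¬ a.eval C h' < b.eval C h' → n' + t ≤ n + 1 → R h' t) :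
    Wp C (RamProg.loop a b P) h R := by
  -- The least potential that the invariant admits is a function of the state, so `Wp.loop` applies.
  have hmem : ∀ h, (∃ n, I n h) → I (sInf {n | I n h}) h := fun h hn => Nat.sInf_mem hn
  refine Wp.loop (fun h => ∃ n, I n h) (fun h => sInf {n | I n h}) hwf ⟨n, h0⟩
    (fun h hI hc => ?_) (fun h' t hI hc hΦ => ?_)
  · refine (hbody _ h (hmem h hI) hc).mono ?_
    rintro h' t ⟨n', hn', hle⟩
    have : sInf {n | I n h'} ≤ n' := Nat.sInf_le hn'
    exact ⟨⟨n', hn'⟩, by omega⟩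
  · have : sInf {n | I n h} ≤ n := Nat.sInf_le h0
    exact hexit h' t _ (hmem h' hI) hc (by omega)

/-- A finite game arena on the numbers below `M` with a Büchi set. -/
structure Arena (M : ℕ) where
  own₁ : ℕ → Prop
  E : ℕ → ℕ → Prop
  B : Set ℕ
  lt : ∀ u x, E u x → u < M ∧ x < M
  exists_succ : ∀ u < M, ∃ x, E u x

/-- The arena is stored in memory, restricted to the nodes in `Al`: owners in array 0, Büchi set in
array 1, flags of the dead nodes in array 2, and for every node `u` the alive successors of `u`, if
player one owns `u`, in row `2 * u` and the alive predecessors of `u` that player two owns in row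
`2 * u + 1`. -/
structure ArenaIn {M : ℕ} (A : Arena M) (h : HState) (Al : Set ℕ) : Prop where
  num : h.reg 7 = M
  own : ∀ u < M, (A.own₁ u → h.arr 0 u 0 = 0) ∧ (¬ A.own₁ u → h.arr 0 u 0 = 1)
  target : ∀ u < M, (u ∈ A.B → h.arr 1 u 0 = 1) ∧ (u ∉ A.B → h.arr 1 u 0 = 0)
  alive_lt : ∀ u ∈ Al, u < M
  alive : ∀ u < M, u ∈ Al ↔ h.arr 2 u 0 = 0
  succs : ∀ u < M, RowIn M h (2 * u) {x | A.own₁ u ∧ A.E u x ∧ x ∈ Al}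
  preds : ∀ u < M, RowIn M h (2 * u + 1) {x | ¬ A.own₁ x ∧ A.E x u ∧ x ∈ Al}

theorem ArenaIn.frame {M : ℕ} {A : Arena M} {h h' : HState} {Al : Set ℕ} (hA : ArenaIn A h Al)
    {R As : List ℕ} (hf : Frame h h' R As) (hR : 7 ∉ R) (hAs : ∀ j < 6, j ∉ As) :
    ArenaIn A h' Al := by
  have e := fun j hj => hf.2 j (hAs j hj)
  refine ⟨(hf.1 7 hR).trans hA.num, ?_, ?_, hA.alive_lt, ?_, ?_, ?_⟩
  · rw [e 0 (by norm_num)]; exact hA.own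
  · rw [e 1 (by norm_num)]; exact hA.target
  · rw [e 2 (by norm_num)]; exact hA.alive
  · intro u hu
    unfold RowIn
    rw [e 3 (by norm_num), e 4 (by norm_num), e 5 (by norm_num)]
    exact hA.succs u hu
  · intro u hu
    unfold RowIn
    rw [e 3 (by norm_num), e 4 (by norm_num), e 5 (by norm_num)]
    exact hA.preds u hu

/-! #### Reversed lists of the low edges -/

/-- The list stored for `y` in array 8, with its length in array 9. -/
def rev (h : HState) (y : ℕ) : List ℕ := (List.range (h.arr 9 y 0)).map (h.arr 8 y)

theorem rev_length (h : HState) (y : ℕ) : (rev h y).length = h.arr 9 y 0 := by simp [rev]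

theorem rev_congr {h h' : HState} (h8 : h'.arr 8 = h.arr 8) (h9 : h'.arr 9 = h.arr 9) :
    rev h' = rev h := by
  funext y; simp only [rev, h8, h9]

/-- The relation `L` is stored in reverse, with its out-degrees in array 6. -/
structure RevOK (M : ℕ) (h : HState) (L : ℕ → ℕ → Prop) (tot : ℕ) : Prop where
  mem : ∀ y < M, ∀ u, u ∈ rev h y ↔ L u y
  -- Counted with multiplicity in the lists, so that processing one list entry always takes one off
  -- a counter.
  cnt : ∀ u < M, h.arr 6 u 0 = ∑ y ∈ Finset.range M, (rev h y).count u
  tot : ∑ y ∈ Finset.range M, h.arr 9 y 0 ≤ tot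

theorem RevOK.congr {M : ℕ} {h h' : HState} {L L' : ℕ → ℕ → Prop} {tot tot' : ℕ}
    (hR : RevOK M h L tot) (h6 : h'.arr 6 = h.arr 6) (h8 : h'.arr 8 = h.arr 8)
    (h9 : h'.arr 9 = h.arr 9) (hL : ∀ u y, y < M → (L u y ↔ L' u y)) (ht : tot ≤ tot') :
    RevOK M h' L' tot' := by
  refine ⟨fun y hy u => ?_, ?_, ?_⟩
  · rw [rev_congr h8 h9, ← hL u y hy]; exact hR.mem y hy u
  · rw [h6, rev_congr h8 h9]; exact hR.cnt
  · rw [h9]; exact hR.tot.trans ht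

/-- Append variable 16 to the list of variable 15. -/
def pushRev : RamProg := block [
  put 8 (.var 15) (.get 9 (.var 15) 0) (.var 16),
  put 9 (.var 15) 0 (.get 9 (.var 15) 0 + 1),
  put 6 (.var 16) 0 (.get 6 (.var 16) 0 + 1)]

theorem pushRev_spec {M u y tot : ℕ} {h : HState} {L : ℕ → ℕ → Prop} (hu : h.reg 16 = u)
    (hy : h.reg 15 = y) (huM : u < M) (hyM : y < M) (hR : RevOK M h L tot) (hb : tot < C.Bd) :
    Wp C pushRev h fun h' t => t ≤ 4 ∧ Frame h h' [] [6, 8, 9] ∧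
      RevOK M h' (fun a b => L a b ∨ (a = u ∧ b = y)) (tot + 1) := by
  have hlen : h.arr 9 y 0 ≤ tot :=
    (Finset.single_le_sum (f := fun y => h.arr 9 y 0) (fun _ _ => Nat.zero_le _)
      (Finset.mem_range.mpr hyM)).trans hR.tot
  have hcnt : h.arr 6 u 0 ≤ tot := by
    rw [hR.cnt u huM]
    refine le_trans (Finset.sum_le_sum fun y _ => ?_) hR.tot
    exact List.count_le_length.trans (rev_length h y).le
  refine Wp.of_bounds fun hreg harr => ?_
  refine Wp.cons (Wp.put rfl ?_ ?_)
  · simpa using hreg 16 (by norm_num)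
  refine Wp.cons (Wp.put rfl ?_ ?_)
  · simp [hy]; omega
  refine Wp.cons (Wp.put rfl ?_ ?_)
  · simp [hu]; omega
  refine Wp.nil ?_
  simp [hu, hy]
  refine ⟨⟨fun x hx => rfl, fun j hj => ?_⟩, ?_⟩
  · simp at hj
    simp [hj]
  · set h' : HState := (((h.setArr 8 y (h.arr 9 y 0) u).setArr 9 y 0 (h.arr 9 y 0 + 1)).setArr 6 u 0
      (h.arr 6 u 0 + 1)) with hh'
    have hrev : ∀ y', rev h' y' = if y' = y then rev h y ++ [u] else rev h y' := by
      intro y'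
      by_cases hyy : y' = y
      · subst hyy
        simp only [rev, hh', setArr_arr, if_true]
        norm_num [update₂_row, List.range_succ]
        intro a ha
        rw [Function.update_of_ne (by omega)]
      · simp [rev, hh', update₂_row, hyy]
    refine ⟨fun y' hy' u' => ?_, fun u' hu' => ?_, ?_⟩
    · rw [hrev]
      split_ifs with hyy
      · simp [hyy, hR.mem y hyM]
      · simp [hyy, hR.mem y' hy']
    · have h1 : h'.arr 6 u' 0 = h.arr 6 u' 0 + if u' = u then 1 else 0 := by
        simp [hh', update₂_apply]
        split_ifs with e <;> simp [e]
      rw [h1, hR.cnt u' hu']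
      have h2 : ∀ y' ∈ Finset.range M, (rev h' y').count u' =
          (rev h y').count u' + if y' = y then (if u' = u then 1 else 0) else 0 := by
        intro y' _
        rw [hrev]
        by_cases hyy : y' = y
        · by_cases huu : u' = u
          · simp [hyy, huu]
          · simp [hyy, huu, Ne.symm huu]
        · simp [hyy]
      rw [Finset.sum_congr rfl h2, Finset.sum_add_distrib, Finset.sum_ite_eq']
      simp [hyM]
    · have h2 : ∀ y' ∈ Finset.range M, h'.arr 9 y' 0 = h.arr 9 y' 0 + if y' = y then 1 else 0 := by
        intro y' _
        simp [hh', update₂_apply]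
        split_ifs with e <;> simp [e]
      rw [Finset.sum_congr rfl h2, Finset.sum_add_distrib, Finset.sum_ite_eq']
      have := hR.tot
      simp [hyM]
      omega

/-- If the row `row` has at most as many entries as variable 8 says, store the edges between its
entries and the node in variable 13: the entries are put into variable `a` and the node into `b`. -/
def addRow (row : Ex) (a b : ℕ) : RamProg :=
  block [asg 17 row, ite (.get 5 (.var 17) 0) (.var 8 + 1)
    (forLt 14 (.get 5 (.var 17) 0) (block [asg a (.get 3 (.var 17) (.var 14)), asg b (.var 13),
      pushRev]))
    (block [])]

/-- One program serves both kinds of rows: the entries are heads of edges from `u` for `a = 15`, and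
tails of edges to `u` for `a = 16`. A row with more than `k` entries is skipped at constant cost. -/
theorem addRow_spec {M u k tot ρ a b : ℕ} {S : Set ℕ} {row : Ex} {h : HState} {L : ℕ → ℕ → Prop}
    (hab : (a = 15 ∧ b = 16) ∨ (a = 16 ∧ b = 15)) (hu : h.reg 13 = u) (hk : h.reg 8 = k)
    (huM : u < M) (hS : RowIn M h ρ S) (hrow : row.eval C h = ρ) (hwf : row.wf = true)
    (hok : row.Ok C h) (hρ : ρ ≤ C.Bd) (hR : RevOK M h L tot) (hb : tot + M < C.Bd) :
    Wp C (addRow row a b) h fun h' t => t ≤ 11 * k + 10 ∧ Frame h h' [14, 15, 16, 17] [6, 8, 9] ∧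
      RevOK M h' (fun x y => L x y ∨ (h.arr 5 ρ 0 ≤ k ∧
        ((a = 15 ∧ x = u ∧ y ∈ S) ∨ (a = 16 ∧ x ∈ S ∧ y = u)))) (tot + k) := by
  have hdegM := hS.deg_le_bound
  refine Wp.of_bounds fun hreg harr => ?_
  refine Wp.cons (Wp.asg (by simpa using hwf) hok (by rw [hrow]; exact hρ) ?_)
  rw [hrow]
  set h₁ := h.setReg 17 ρ with hh₁
  refine Wp.cons (Wp.ite rfl ⟨⟨trivial, trivial⟩, ⟨trivial, trivial⟩⟩ (fun hc => ?_) (fun hc => ?_))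
  · have hc' : h.arr 5 ρ 0 ≤ k := by
      simp [hh₁, hk] at hc
      omega
    let I : ℕ → HState → Prop := fun p g => g.reg 14 = p ∧ Frame h₁ g [14, 15, 16] [6, 8, 9] ∧
      RevOK M g (fun x y => L x y ∨ ∃ q < p, (a = 15 ∧ x = u ∧ y = h.arr 3 ρ q) ∨
        (a = 16 ∧ x = h.arr 3 ρ q ∧ y = u)) (tot + p)
    have hbody : ∀ i g, i < h.arr 5 ρ 0 → I i g → Wp C (block [asg a (.get 3 (.var 17) (.var 14)),
        asg b (.var 13), pushRev]) g fun g' t =>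
          g'.reg 14 = i ∧ I (i + 1) (g'.setReg 14 (i + 1)) ∧ t ≤ 7 := by
      rintro i g hi ⟨hg14, hgf, hgR⟩
      have g17 : g.reg 17 = ρ := by rw [hgf.1 17 (by decide)]; simp [hh₁]
      have g13 : g.reg 13 = u := by rw [hgf.1 13 (by decide)]; simpa [hh₁] using hu
      have g3 : g.arr 3 = h.arr 3 := by rw [hgf.2 3 (by decide)]; simp [hh₁]
      have hent := (hS.mem i hi).1
      have hentM := hS.lt _ hent
      refine Wp.cons (Wp.asg (by rcases hab with ⟨rfl, rfl⟩ | ⟨rfl, rfl⟩ <;> rfl)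
        ⟨trivial, trivial⟩ ?_ ?_)
      · simp [g17, hg14, g3]; omega
      refine Wp.cons (Wp.asg (by rcases hab with ⟨rfl, rfl⟩ | ⟨rfl, rfl⟩ <;> rfl) trivial ?_ ?_)
      · rcases hab with ⟨rfl, rfl⟩ | ⟨rfl, rfl⟩ <;> simp [g13] <;> omega
      have e13 : 13 ≠ a := by omega
      simp only [Ex.eval_get, Ex.eval_var, g17, hg14, g3, setReg_reg, if_neg e13, g13]
      set g₂ := (g.setReg a (h.arr 3 ρ i)).setReg b u with hg₂
      have hR₂ : RevOK M g₂ _ (tot + i) := hgR.congr rfl rfl rfl (fun _ _ _ => Iff.rfl) le_rfl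
      have hff : Frame h₁ g₂ [14, 15, 16] [6, 8, 9] := by
        refine Frame.setReg (Frame.setReg hgf ?_ _) ?_ _ <;>
          rcases hab with ⟨rfl, rfl⟩ | ⟨rfl, rfl⟩ <;> decide
      have g₂14 : g₂.reg 14 = i := by
        have e1 : 14 ≠ a := by omega
        have e2 : 14 ≠ b := by omega
        simp [hg₂, e1, e2, hg14]
      have main : ∀ x y, g₂.reg 16 = x → g₂.reg 15 = y → x < M → y < M →
          (∀ x' y', (x' = x ∧ y' = y) ↔ (a = 15 ∧ x' = u ∧ y' = h.arr 3 ρ i) ∨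
            (a = 16 ∧ x' = h.arr 3 ρ i ∧ y' = u)) →
          Wp C (block [pushRev]) g₂ fun g' t =>
          g'.reg 14 = i ∧ I (i + 1) (g'.setReg 14 (i + 1)) ∧ 1 + (1 + t) ≤ 7 := by
        intro x y hx hy hxM hyM hiff
        refine Wp.cons ((pushRev_spec hx hy hxM hyM hR₂ (by omega)).mono ?_)
        rintro g₃ t₃ ⟨ht₃, hf₃, hR₃⟩
        refine Wp.nil ⟨?_, ⟨by simp, ?_, ?_⟩, by omega⟩
        · rw [hf₃.1 14 (by decide), g₂14]
        · exact (hff.trans (hf₃.mono (List.nil_subset _) (List.Subset.refl _))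
            (List.Subset.refl _) (List.Subset.refl _)).setReg (by decide) _
        · refine hR₃.congr rfl rfl rfl (fun x' y' _ => ?_) le_rfl
          rw [hiff]
          constructor
          · rintro ((h1 | ⟨q, hq, h1⟩) | h1)
            · exact Or.inl h1
            · exact Or.inr ⟨q, by omega, h1⟩
            · exact Or.inr ⟨i, by omega, h1⟩
          · rintro (h1 | ⟨q, hq, h1⟩)
            · exact Or.inl (Or.inl h1)
            · rcases Nat.lt_or_ge q i with hqi | hqi
              · exact Or.inl (Or.inr ⟨q, hqi, h1⟩)
              · obtain rfl : q = i := by omega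
                exact Or.inr h1
      rcases hab with ⟨rfl, rfl⟩ | ⟨rfl, rfl⟩
      · refine main u (h.arr 3 ρ i) (by simp [hg₂]) (by simp [hg₂]) huM hentM ?_
        simp
      · refine main (h.arr 3 ρ i) u (by simp [hg₂]) (by simp [hg₂]) hentM huM ?_
        simp
    have e14 : ∀ i g, I i g → g.reg 14 = i ∧ (Ex.get 5 (.var 17) 0).eval C g = h.arr 5 ρ 0 := by
      rintro i g ⟨hg14, hgf, -⟩
      refine ⟨hg14, ?_⟩
      have g17 : g.reg 17 = ρ := by rw [hgf.1 17 (by decide)]; simp [hh₁]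
      have g5 : g.arr 5 = h.arr 5 := by rw [hgf.2 5 (by decide)]; simp [hh₁]
      simp [g17, g5]
    refine Wp.forLt I (fun _ => 7) rfl (by omega) e14 ⟨by simp, ?_, ?_⟩ hbody ?_
    · exact (Frame.refl h₁ _ _).setReg (by decide) _
    · exact hR.congr rfl rfl rfl (fun x y _ => by simp) le_rfl
    · rintro g t ⟨hg14, hgf, hgR⟩ ht
      simp only [Finset.sum_const, Finset.card_range, smul_eq_mul] at ht
      refine Wp.nil ⟨by omega, ?_, ?_⟩
      · exact ((Frame.refl h _ _).setReg (x := 17) (by decide) _).trans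
          (hgf.mono (R' := [14, 15, 16, 17]) (by decide) (List.Subset.refl _))
          (List.Subset.refl _) (List.Subset.refl _)
      · refine hgR.congr rfl rfl rfl (fun x y _ => or_congr_right ?_) (by omega)
        constructor
        · rintro ⟨q, hq, ⟨h1, h2, h3⟩ | ⟨h1, h2, h3⟩⟩
          · exact ⟨hc', Or.inl ⟨h1, h2, h3 ▸ (hS.mem q hq).1⟩⟩
          · exact ⟨hc', Or.inr ⟨h1, h2 ▸ (hS.mem q hq).1, h3⟩⟩
        · rintro ⟨-, ⟨h1, h2, h3⟩ | ⟨h1, h2, h3⟩⟩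
          · obtain ⟨q, hq, hqe⟩ := hS.exists_place h3
            exact ⟨q, hq, Or.inl ⟨h1, h2, hqe.symm⟩⟩
          · obtain ⟨q, hq, hqe⟩ := hS.exists_place h2
            exact ⟨q, hq, Or.inr ⟨h1, hqe.symm, h3⟩⟩
  · have hc' : ¬ h.arr 5 ρ 0 ≤ k := by
      simp [hh₁, hk] at hc
      omega
    refine Wp.nil (Wp.nil ⟨by omega, ?_, ?_⟩)
    · exact (Frame.refl h _ _).setReg (by decide) _
    · refine hR.congr rfl rfl rfl (fun x y _ => ?_) (by omega)
      simp [hc']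

end RamProg

namespace RamProg

open HState

variable {C : Layout}

/-! #### Queues with flags -/

/-- The first `tail` entries of the queue `q` are distinct numbers below `M`, those that are
flagged. -/
structure QueueOK (M : ℕ) (q flag : ℕ → ℕ) (tail : ℕ) : Prop where
  entry : ∀ p < tail, q p < M ∧ flag (q p) = 1
  cover : ∀ u < M, flag u ≠ 0 → ∃ p < tail, q p = u
  inj : ∀ p p', p < p' → p' < tail → q p ≠ q p'

theorem QueueOK.tail_le {M : ℕ} {q flag : ℕ → ℕ} {tail : ℕ} (h : QueueOK M q flag tail) :
    tail ≤ M := by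
  have := Finset.card_le_card_of_injOn (s := Finset.range tail) (t := Finset.range M) q
    (fun p hp => by
      have := (h.entry p (by simpa using hp)).1
      simpa using this)
    (fun p hp p' hp' he => by
      simp only [Finset.coe_range, Set.mem_Iio] at hp hp'
      rcases lt_trichotomy p p' with hlt | heq | hlt
      · exact absurd he (h.inj _ _ hlt hp')
      · exact heq
      · exact absurd he.symm (h.inj _ _ hlt hp))
  simpa using this

theorem QueueOK.push {M : ℕ} {q flag q' flag' : ℕ → ℕ} {tail u : ℕ} (h : QueueOK M q flag tail)
    (hu : u < M) (hfl : flag u = 0) (hq' : ∀ p, q' p = if p = tail then u else q p)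
    (hf' : ∀ v, flag' v = if v = u then 1 else flag v) : QueueOK M q' flag' (tail + 1) := by
  have hne : ∀ p < tail, q p ≠ u := fun p hp e => by
    have := (h.entry p hp).2
    rw [e] at this
    omega
  refine ⟨fun p hp => ?_, fun v hv hvf => ?_, fun p p' hlt hp' => ?_⟩
  · rw [hq']
    split_ifs with hpt
    · exact ⟨hu, by rw [hf', if_pos rfl]⟩
    · obtain ⟨h1, h2⟩ := h.entry p (by omega)
      refine ⟨h1, ?_⟩
      rw [hf', h2]
      split_ifs <;> rfl
  · by_cases hvu : v = u
    · exact ⟨tail, by omega, by rw [hq', if_pos rfl, hvu]⟩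
    · rw [hf', if_neg hvu] at hvf
      obtain ⟨p, hp, hpe⟩ := h.cover v hv hvf
      exact ⟨p, by omega, by rw [hq', if_neg (by omega), hpe]⟩
  · rw [hq', hq', if_neg (by omega)]
    split_ifs with hpt
    · exact hne p (by omega)
    · exact h.inj p p' hlt (by omega)

/-- Flag variable 16 in array `jf` and append it to the queue in array `jq` with tail `t`. -/
def enqueue (jf jq t : ℕ) : RamProg :=
  block [put jf (.var 16) 0 1, put jq (.var t) 0 (.var 16), asg t (.var t + 1)]

theorem enqueue_spec {M u tail jf jq t : ℕ} {h : HState}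
    (hj : (jf = 7 ∧ jq = 10 ∧ t = 12) ∨ (jf = 2 ∧ jq = 11 ∧ t = 10)) (hu : h.reg 16 = u)
    (ht : h.reg t = tail) (huM : u < M) (hM : M < C.Bd)
    (hQ : QueueOK M (fun p => h.arr jq p 0) (fun v => h.arr jf v 0) tail) (hfl : h.arr jf u 0 = 0) :
    Wp C (enqueue jf jq t) h fun h' n => n ≤ 4 ∧ Frame h h' [t] [jf, jq] ∧ h'.reg t = tail + 1 ∧
      (∀ p, h'.arr jq p 0 = if p = tail then u else h.arr jq p 0) ∧
      (∀ v, h'.arr jf v 0 = if v = u then 1 else h.arr jf v 0) ∧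
      QueueOK M (fun p => h'.arr jq p 0) (fun v => h'.arr jf v 0) (tail + 1) := by
  have htail := hQ.tail_le
  have hne : jf ≠ jq := by omega
  refine Wp.of_bounds fun hreg harr => ?_
  refine Wp.cons (Wp.put (by rcases hj with ⟨rfl, rfl, rfl⟩ | ⟨rfl, rfl, rfl⟩ <;> rfl) ?_ ?_)
  · simp; omega
  refine Wp.cons (Wp.put (by rcases hj with ⟨rfl, rfl, rfl⟩ | ⟨rfl, rfl, rfl⟩ <;> rfl) ?_ ?_)
  · simpa using hreg 16 (by norm_num)
  refine Wp.cons (Wp.asg (by rcases hj with ⟨rfl, rfl, rfl⟩ | ⟨rfl, rfl, rfl⟩ <;> rfl)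
    ⟨trivial, trivial⟩ ?_ ?_)
  · simp [ht]; omega
  have hq : ∀ p, (((h.setArr jf u 0 1).setArr jq tail 0 u).setReg t (tail + 1)).arr jq p 0 =
      if p = tail then u else h.arr jq p 0 := by
    intro p
    simp [update₂_apply, hne.symm]
  have hf : ∀ v, (((h.setArr jf u 0 1).setArr jq tail 0 u).setReg t (tail + 1)).arr jf v 0 =
      if v = u then 1 else h.arr jf v 0 := by
    intro v
    simp [update₂_apply, hne]
  refine Wp.nil ?_
  simp only [Ex.eval_add, Ex.eval_var, Ex.eval_num, hu, ht, setArr_reg]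
  refine ⟨by omega, ?_, by simp, hq, hf, hQ.push huM hfl hq hf⟩
  exact ((((Frame.refl h [t] [jf, jq]).setArr (by simp) _ _ _).setArr (by simp) _ _ _).setReg
    (by simp) _)

/-! #### The level test -/

/-- The low edges: the edges stored in rows with at most `k` entries. -/
def Low {M : ℕ} (A : Arena M) (deg : ℕ → ℕ) (k : ℕ) (Al : Set ℕ) (u y : ℕ) : Prop :=
  u ∈ Al ∧ y ∈ Al ∧ A.E u y ∧ ((A.own₁ u ∧ deg (2 * u) ≤ k) ∨ (¬ A.own₁ u ∧ deg (2 * y + 1) ≤ k))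

/-- A set off the Büchi set in which player two can stay, when only the edges of `L` count. -/
def EdgeTrap {M : ℕ} (A : Arena M) (L : ℕ → ℕ → Prop) (T : Set ℕ) : Prop :=
  ∀ u ∈ T, u ∉ A.B ∧ (∃ y, L u y) ∧ (A.own₁ u → ∀ y, L u y → y ∈ T) ∧
    (¬ A.own₁ u → ∃ y ∈ T, L u y)

def clearLevel : RamProg :=
  forLt 13 (.var 7) (block [put 6 (.var 13) 0 0, put 7 (.var 13) 0 0, put 9 (.var 13) 0 0])

theorem clearLevel_spec {M : ℕ} {h : HState} (hM : h.reg 7 = M) (hB : M ≤ C.Bd) :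
    Wp C clearLevel h fun h' t => t ≤ 7 * M + 3 ∧ Frame h h' [13] [6, 7, 9] ∧
      ∀ u < M, h'.arr 6 u 0 = 0 ∧ h'.arr 7 u 0 = 0 ∧ h'.arr 9 u 0 = 0 := by
  refine Wp.forLt (fun i g => g.reg 13 = i ∧ Frame h g [13] [6, 7, 9] ∧
    ∀ u < i, g.arr 6 u 0 = 0 ∧ g.arr 7 u 0 = 0 ∧ g.arr 9 u 0 = 0) (fun _ => 4) rfl hB ?_ ?_ ?_ ?_
  · rintro i g ⟨h1, h2, -⟩
    exact ⟨h1, by simp [h2.1 7 (by decide), hM]⟩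
  · exact ⟨by simp, (Frame.refl _ _ _).setReg (by decide) _, by simp⟩
  · rintro i g hi ⟨h1, h2, h3⟩
    refine Wp.cons (Wp.put rfl (by simp) ?_)
    refine Wp.cons (Wp.put rfl (by simp) ?_)
    refine Wp.cons (Wp.put rfl (by simp) ?_)
    refine Wp.nil ⟨by simpa using h1, ⟨by simp, ?_, fun u hu => ?_⟩, by omega⟩
    · exact (((h2.setArr (by decide) _ _ _).setArr (by decide) _ _ _).setArr (by decide) _ _ _).setReg
        (by decide) _
    · have := h3 u
      simp [update₂_apply, h1]
      by_cases hui : u = i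
      · simp [hui]
      · simpa [hui] using this (by omega)
  · rintro g t ⟨-, h2, h3⟩ ht
    simp only [Finset.sum_const, Finset.card_range, smul_eq_mul] at ht
    exact ⟨by omega, h2, h3⟩

def buildRev : RamProg :=
  forLt 13 (.var 7) (ite (.get 2 (.var 13) 0) 1
    (block [addRow (2 * .var 13) 15 16, addRow (2 * .var 13 + 1) 16 15]) (block []))

/-- Each alive node contributes two rows of at most `k` edges, whence the total `2 * k * M`. Edges
of player one are found at their tails and edges of player two at their heads, the rows in which
they are stored. -/
theorem buildRev_spec {M k : ℕ} {A : Arena M} {Al : Set ℕ} {h : HState} (hA : ArenaIn A h Al)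
    (hk : h.reg 8 = k) (hB : 2 * (M + 1) * (k + 1) < C.Bd)
    (h6 : ∀ u < M, h.arr 6 u 0 = 0) (h9 : ∀ u < M, h.arr 9 u 0 = 0) :
    Wp C buildRev h fun h' t => t ≤ 22 * k * M + 30 * M + 3 ∧
      Frame h h' [13, 14, 15, 16, 17] [6, 8, 9] ∧
      RevOK M h' (Low A (fun ρ => h.arr 5 ρ 0) k Al) (2 * k * M) := by
  have hBe : 2 * (M + 1) * (k + 1) = 2 * k * M + 2 * M + 2 * k + 2 := by ring
  refine Wp.forLt (n := M) (fun i g => g.reg 13 = i ∧ Frame h g [13, 14, 15, 16, 17] [6, 8, 9] ∧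
    RevOK M g (fun x y =>
      (x < i ∧ x ∈ Al ∧ y ∈ Al ∧ A.E x y ∧ A.own₁ x ∧ h.arr 5 (2 * x) 0 ≤ k) ∨
      (y < i ∧ x ∈ Al ∧ y ∈ Al ∧ A.E x y ∧ ¬ A.own₁ x ∧ h.arr 5 (2 * y + 1) 0 ≤ k)) (2 * k * i))
    (fun _ => 22 * k + 24) rfl (by omega) ?_ ?_ ?_ ?_
  · rintro i g ⟨h1, h2, -⟩
    exact ⟨h1, by simp [h2.1 7 (by decide), hA.num]⟩
  · refine ⟨by simp, (Frame.refl _ _ _).setReg (by decide) _, ?_⟩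
    refine ⟨fun y hy u => ?_, fun u hu => ?_, ?_⟩
    · simp [rev, h9 y hy]
    · have : ∀ y ∈ Finset.range M, (rev (h.setReg 13 0) y).count u = 0 := by
        intro y hy
        simp [rev, h9 y (by simpa using hy)]
      rw [Finset.sum_congr rfl this]
      simp [h6 u hu]
    · have : ∀ y ∈ Finset.range M, (h.setReg 13 0).arr 9 y 0 = 0 := by
        intro y hy
        simp [h9 y (by simpa using hy)]
      rw [Finset.sum_congr rfl this]
      simp
  · rintro i g hi ⟨h13, hf, hR⟩
    have hAg : ArenaIn A g Al := hA.frame hf (by decide) (by decide)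
    have g5 : g.arr 5 = h.arr 5 := hf.2 5 (by decide)
    have g8 : g.reg 8 = k := by rw [hf.1 8 (by decide), hk]
    have hki : k * i + k ≤ k * M := by
      have : k * (i + 1) ≤ k * M := Nat.mul_le_mul_left _ hi
      rw [mul_add, mul_one] at this
      exact this
    have e1 : 2 * k * i = 2 * (k * i) := by ring
    have e2 : 2 * k * M = 2 * (k * M) := by ring
    refine Wp.ite rfl ⟨⟨trivial, trivial⟩, trivial⟩ (fun hc => ?_) (fun hc => ?_)
    · have hiAl : i ∈ Al := by
        simp [h13] at hc
        exact (hAg.alive i hi).mpr hc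
      refine Wp.cons ((addRow_spec (ρ := 2 * i) (row := 2 * Ex.var 13) (Or.inl ⟨rfl, rfl⟩) h13 g8 hi (hAg.succs i hi)
        (by simp [h13]) rfl ⟨trivial, trivial⟩ (by omega) hR (by omega)).mono ?_)
      rintro g₁ t₁ ⟨ht₁, hf₁, hR₁⟩
      have hAg₁ := hAg.frame hf₁ (by decide) (by decide)
      have g₁13 : g₁.reg 13 = i := by rw [hf₁.1 13 (by decide), h13]
      have g₁8 : g₁.reg 8 = k := by rw [hf₁.1 8 (by decide), g8]
      have g₁5 : g₁.arr 5 = h.arr 5 := by rw [hf₁.2 5 (by decide), g5]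
      refine Wp.cons ((addRow_spec (ρ := 2 * i + 1) (row := 2 * Ex.var 13 + 1) (Or.inr ⟨rfl, rfl⟩) g₁13 g₁8 hi (hAg₁.preds i hi)
        (by simp [g₁13]) rfl ⟨⟨trivial, trivial⟩, trivial⟩ (by omega) hR₁ (by omega)).mono ?_)
      rintro g₂ t₂ ⟨ht₂, hf₂, hR₂⟩
      refine Wp.nil ⟨?_, ⟨by simp, ?_, ?_⟩, by omega⟩
      · rw [hf₂.1 13 (by decide), g₁13]
      · exact ((hf.trans (hf₁.mono (R' := [13, 14, 15, 16, 17]) (by decide) (List.Subset.refl _))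
          (List.Subset.refl _) (List.Subset.refl _)).trans
          (hf₂.mono (R' := [13, 14, 15, 16, 17]) (by decide) (List.Subset.refl _))
          (List.Subset.refl _) (List.Subset.refl _)).setReg (by decide) _
      · refine hR₂.congr rfl rfl rfl (fun x y hy => ?_) (by rw [mul_add]; omega)
        rw [g₁5, g5]
        constructor
        · rintro ((h1 | ⟨h1, h2 | h2⟩) | ⟨h1, h2 | h2⟩)
          · rcases h1 with h1 | h1
            · exact Or.inl ⟨by omega, h1.2⟩
            · exact Or.inr ⟨by omega, h1.2⟩
          · obtain ⟨-, rfl, h3, h4, h5⟩ := h2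
            exact Or.inl ⟨by omega, hiAl, h5, h4, h3, h1⟩
          · omega
          · omega
          · obtain ⟨-, ⟨h3, h4, h5⟩, rfl⟩ := h2
            exact Or.inr ⟨by omega, h5, hiAl, h4, h3, h1⟩
        · rintro (⟨h1, h2, h3, h4, h5, h6⟩ | ⟨h1, h2, h3, h4, h5, h6⟩)
          · rcases Nat.lt_or_ge x i with hlt | hge
            · exact Or.inl (Or.inl (Or.inl ⟨hlt, h2, h3, h4, h5, h6⟩))
            · obtain rfl : x = i := by omega
              exact Or.inl (Or.inr ⟨h6, Or.inl ⟨rfl, rfl, h5, h4, h3⟩⟩)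
          · rcases Nat.lt_or_ge y i with hlt | hge
            · exact Or.inl (Or.inl (Or.inr ⟨hlt, h2, h3, h4, h5, h6⟩))
            · obtain rfl : y = i := by omega
              exact Or.inr ⟨h6, Or.inr ⟨rfl, ⟨h5, h4, h2⟩, rfl⟩⟩
    · have hiAl : i ∉ Al := by
        simp [h13] at hc
        rw [hAg.alive i hi]
        exact hc
      refine Wp.nil ⟨h13, ⟨by simp, hf.setReg (by decide) _, ?_⟩, by omega⟩
      refine hR.congr rfl rfl rfl (fun x y hy => ?_) (by rw [mul_add]; omega)
      refine or_congr ⟨fun h1 => ⟨by omega, h1.2⟩, fun h1 => ⟨?_, h1.2⟩⟩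
        ⟨fun h1 => ⟨by omega, h1.2⟩, fun h1 => ⟨?_, h1.2⟩⟩
      · have : x ≠ i := fun e => hiAl (e ▸ h1.2.1)
        omega
      · have : y ≠ i := fun e => hiAl (e ▸ h1.2.2.1)
        omega
  · rintro g t ⟨-, hf, hR⟩ ht
    simp only [Finset.sum_const, Finset.card_range, smul_eq_mul] at ht
    refine ⟨by nlinarith, hf, ?_⟩
    refine hR.congr rfl rfl rfl (fun x y hy => ?_) le_rfl
    unfold Low
    constructor
    · rintro (⟨-, h1, h2, h3, h4⟩ | ⟨-, h1, h2, h3, h4⟩)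
      · exact ⟨h1, h2, h3, Or.inl h4⟩
      · exact ⟨h1, h2, h3, Or.inr h4⟩
    · rintro ⟨h1, h2, h3, h4 | h4⟩
      · exact Or.inl ⟨hA.alive_lt _ h1, h1, h2, h3, h4⟩
      · exact Or.inr ⟨hA.alive_lt _ h2, h1, h2, h3, h4⟩

/-- Flag the alive nodes that are in the Büchi set or without low edges. -/
def seedQueue : RamProg :=
  block [asg 12 0, forLt 13 (.var 7) (ite (.get 2 (.var 13) 0) 1
    -- The product vanishes exactly if the node is in the Büchi set or has no low edge.
    (ite (.get 6 (.var 13) 0 * (1 - .get 1 (.var 13) 0)) 1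
      (block [asg 16 (.var 13), enqueue 7 10 12]) (block [])) (block []))]

theorem seedQueue_spec {M : ℕ} {A : Arena M} {Al : Set ℕ} {h : HState} (hA : ArenaIn A h Al)
    (hB : M < C.Bd) (h7 : ∀ u < M, h.arr 7 u 0 = 0) :
    Wp C seedQueue h fun h' t => t ≤ 12 * M + 5 ∧ Frame h h' [12, 13, 16] [7, 10] ∧
      QueueOK M (fun p => h'.arr 10 p 0) (fun u => h'.arr 7 u 0) (h'.reg 12) ∧
      ∀ u < M, h'.arr 7 u 0 ≠ 0 ↔ u ∈ Al ∧ (u ∈ A.B ∨ h.arr 6 u 0 = 0) := by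
  refine Wp.cons (Wp.asg rfl trivial (by simp) ?_)
  refine Wp.cons (Wp.forLt (fun i g => g.reg 13 = i ∧ Frame h g [12, 13, 16] [7, 10] ∧
    QueueOK M (fun p => g.arr 10 p 0) (fun u => g.arr 7 u 0) (g.reg 12) ∧
    ∀ u < M, g.arr 7 u 0 ≠ 0 ↔ u < i ∧ u ∈ Al ∧ (u ∈ A.B ∨ h.arr 6 u 0 = 0))
    (fun _ => 9) rfl hB.le ?_ ?_ ?_ ?_)
  · rintro i g ⟨h1, h2, -⟩
    exact ⟨h1, by simp [h2.1 7 (by decide), hA.num]⟩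
  · refine ⟨by simp, ((Frame.refl _ _ _).setReg (by decide) _).setReg (by decide) _, ?_, ?_⟩
    · refine ⟨by simp, fun u hu hne => ?_, by simp⟩
      simp [h7 u hu] at hne
    · intro u hu
      simp [h7 u hu]
  · rintro i g hi ⟨h13, hf, hQ, hfl⟩
    have hAg : ArenaIn A g Al := hA.frame (hf) (by decide) (by decide)
    have g6 : g.arr 6 = h.arr 6 := hf.2 6 (by decide)
    have skip : ¬ (i ∈ Al ∧ (i ∈ A.B ∨ h.arr 6 i 0 = 0)) → ∀ u < M, g.arr 7 u 0 ≠ 0 ↔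
        u < i + 1 ∧ u ∈ Al ∧ (u ∈ A.B ∨ h.arr 6 u 0 = 0) := by
      intro hno u hu
      rw [hfl u hu]
      refine ⟨fun h1 => ⟨by omega, h1.2⟩, fun h1 => ⟨?_, h1.2⟩⟩
      have : u ≠ i := fun e => hno (e ▸ h1.2)
      omega
    refine Wp.ite rfl ⟨⟨trivial, trivial⟩, trivial⟩ (fun hc => ?_) (fun hc => ?_)
    · have hiAl : i ∈ Al := by
        simp [h13] at hc
        exact (hAg.alive i hi).mpr hc
      have hcond : h.arr 6 i 0 * (1 - g.arr 1 i 0) < 1 ↔ (i ∈ A.B ∨ h.arr 6 i 0 = 0) := by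
        by_cases hiB : i ∈ A.B
        · simp [hiB, (hAg.target i hi).1 hiB]
        · simp [hiB, (hAg.target i hi).2 hiB]
      refine Wp.ite rfl ⟨⟨⟨trivial, trivial⟩, trivial, trivial, trivial⟩, trivial⟩ (fun hd => ?_)
        (fun hd => ?_)
      · simp only [Ex.eval_mul, Ex.eval_sub, Ex.eval_get, Ex.eval_var, Ex.eval_num, h13, g6] at hd
        refine Wp.cons (Wp.asg rfl trivial (by simp [h13]; omega) ?_)
        simp only [Ex.eval_var, h13]
        have h0 : g.arr 7 i 0 = 0 := by
          by_contra hne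
          exact lt_irrefl _ ((hfl i hi).mp hne).1
        refine Wp.cons ((enqueue_spec (Or.inl ⟨rfl, rfl, rfl⟩) (u := i) (by simp) rfl hi hB
          (by simpa using hQ) (by simpa using h0)).mono ?_)
        rintro g₁ t₁ ⟨ht₁, hf₁, htl, hq₁, hfl₁, hQ₁⟩
        refine Wp.nil ⟨?_, ⟨by simp, ?_, ?_, fun u hu => ?_⟩, by omega⟩
        · rw [hf₁.1 13 (by decide)]; simpa using h13
        · exact ((hf.setReg (x := 16) (by decide) i).trans
            (hf₁.mono (R' := [12, 13, 16]) (A' := [7, 10]) (by decide) (by decide))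
            (List.Subset.refl _) (List.Subset.refl _)).setReg (by decide) _
        · simp only [setReg_arr, setReg_reg]
          rw [if_neg (by norm_num), htl]
          exact hQ₁
        · simp only [setReg_arr, hfl₁]
          split_ifs with hui
          · simp only [ne_eq, one_ne_zero, not_false_eq_true, true_iff]
            subst hui
            exact ⟨by omega, hiAl, hcond.mp hd⟩
          · rw [hfl u hu]
            refine ⟨fun h1 => ⟨by omega, h1.2⟩, fun h1 => ⟨by omega, h1.2⟩⟩
      · simp only [Ex.eval_mul, Ex.eval_sub, Ex.eval_get, Ex.eval_var, Ex.eval_num, h13, g6] at hd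
        refine Wp.nil ⟨h13, ⟨by simp, hf.setReg (by decide) _, by simpa using hQ, ?_⟩, by omega⟩
        exact skip fun h1 => hd (hcond.mpr h1.2)
    · have hiAl : i ∉ Al := by
        simp [h13] at hc
        rw [hAg.alive i hi]
        exact hc
      refine Wp.nil ⟨h13, ⟨by simp, hf.setReg (by decide) _, by simpa using hQ, ?_⟩, by omega⟩
      exact skip fun h1 => hiAl h1.1
  · rintro g t ⟨-, hf, hQ, hfl⟩ ht
    simp only [Finset.sum_const, Finset.card_range, smul_eq_mul] at ht
    refine Wp.nil ⟨by omega, hf, hQ, fun u hu => ?_⟩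
    rw [hfl u hu]
    exact ⟨fun h1 => h1.2, fun h1 => ⟨hu, h1⟩⟩

end RamProg

/-! ### Backward search for the greatest trap along the low edges -/

namespace RamProg

open HState

variable {C : Layout}

@[simp] theorem rev_setReg (h : HState) (x v : ℕ) : rev (h.setReg x v) = rev h := rfl

/-- The state of the search backwards along `L` from the flagged nodes: `rv` are the lists of
predecessors, `rem` their parts still to be processed, `cnt` counts the occurrences left, the lists
of the queue entries below `lo` have been processed, and those from `hi` on have not been started. -/
structure CloseOK {M : ℕ} (A : Arena M) (Al : Set ℕ) (rv rem : ℕ → List ℕ) (q flag cnt : ℕ → ℕ)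
    (lo hi tail : ℕ) : Prop where
  queue : QueueOK M q flag tail
  lo_le : lo ≤ tail
  sub : ∀ u < M, flag u ≠ 0 → u ∈ Al
  fresh : ∀ y < M, flag y = 0 → rem y = rv y
  pend : ∀ p < tail, hi ≤ p → rem (q p) = rv (q p)
  fin : ∀ p < lo, rem (q p) = []
  rem_sub : ∀ y < M, rem y ⊆ rv y
  count : ∀ u ∈ Al, ¬ A.own₁ u → cnt u = ∑ y ∈ Finset.range M, (rem y).count u
  free : ∀ u ∈ Al, flag u = 0 → u ∉ A.B ∧ (∃ y < M, u ∈ rv y) ∧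
    (A.own₁ u → ∀ y < M, u ∈ rv y → u ∈ rem y) ∧ (¬ A.own₁ u → cnt u ≠ 0)
  safe : ∀ T, EdgeTrap A (fun u y => y < M ∧ u ∈ rv y) T → ∀ u ∈ T, flag u = 0

namespace CloseOK

variable {M : ℕ} {A : Arena M} {Al : Set ℕ} {rv rem : ℕ → List ℕ} {q flag cnt : ℕ → ℕ}
  {lo hi tail : ℕ}

theorem sum_count_pop {z u : ℕ} {rest : List ℕ} (hz : z < M) (hrem : rem z = u :: rest) (x : ℕ) :
    ∑ y ∈ Finset.range M, (rem y).count x =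
      ∑ y ∈ Finset.range M, (Function.update rem z rest y).count x + if x = u then 1 else 0 := by
  have h2 : ∀ y ∈ Finset.range M, (rem y).count x =
      (Function.update rem z rest y).count x + if y = z then (if x = u then 1 else 0) else 0 := by
    intro y _
    by_cases hyz : y = z
    · subst hyz
      rw [hrem, Function.update_self]
      by_cases hxu : x = u
      · simp [hxu]
      · simp [hxu, Ne.symm hxu]
    · simp [hyz]
  rw [Finset.sum_congr rfl h2, Finset.sum_add_distrib, Finset.sum_ite_eq']
  simp [hz]

theorem eq_of_pend (h : CloseOK A Al rv rem q flag cnt lo (lo + 1) tail) (hlo : lo < tail) {p : ℕ}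
    (hp : p < tail) (he : q p = q lo) : p = lo := by
  rcases lt_trichotomy p lo with hlt | heq | hlt
  · exact absurd he (h.queue.inj _ _ hlt hlo)
  · exact heq
  · exact absurd he.symm (h.queue.inj _ _ hlt hp)

/-- No flag is needed if `u` is flagged already, or if it belongs to player two and some entry for
it remains. The lists of other queue entries are untouched because entries of the queue are
distinct. -/
theorem pop (h : CloseOK A Al rv rem q flag cnt lo (lo + 1) tail) (hlo : lo < tail) {u : ℕ}
    {rest : List ℕ} (hrem : rem (q lo) = u :: rest) {cnt' : ℕ → ℕ}
    (hcnt : ∀ v, cnt' v = if v = u then cnt u - 1 else cnt v)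
    (hu : flag u ≠ 0 ∨ (¬ A.own₁ u ∧ cnt u - 1 ≠ 0)) :
    CloseOK A Al rv (Function.update rem (q lo) rest) q flag cnt' lo (lo + 1) tail := by
  obtain ⟨hzM, hzf⟩ := h.queue.entry lo hlo
  refine ⟨h.queue, h.lo_le, h.sub, fun y hy hf => ?_, fun p hp hhi => ?_, fun p hp => ?_,
    fun y hy => ?_, fun x hx hxo => ?_, fun x hx hxf => ?_, h.safe⟩
  · have hne : y ≠ q lo := fun e => by rw [e] at hf; omega
    rw [Function.update_of_ne hne]
    exact h.fresh y hy hf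
  · have hne : q p ≠ q lo := fun e => by
      have := h.eq_of_pend hlo hp e
      omega
    rw [Function.update_of_ne hne]
    exact h.pend p hp hhi
  · have hne : q p ≠ q lo := fun e => by
      have := h.eq_of_pend hlo (hp.trans hlo) e
      omega
    rw [Function.update_of_ne hne]
    exact h.fin p hp
  · by_cases hyz : y = q lo
    · subst hyz
      rw [Function.update_self]
      have := h.rem_sub _ hzM
      rw [hrem] at this
      exact List.Subset.trans (List.subset_cons_self _ _) this
    · rw [Function.update_of_ne hyz]
      exact h.rem_sub y hy
  · have h1 := h.count x hx hxo
    rw [sum_count_pop hzM hrem x] at h1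
    rw [hcnt]
    by_cases hxu : x = u
    · subst hxu
      simp at h1 ⊢
      omega
    · simpa [hxu] using h1
  · obtain ⟨h1, h2, h3, h4⟩ := h.free x hx hxf
    refine ⟨h1, h2, fun hxo y hy hy' => ?_, fun hxo => ?_⟩
    · have hxu : x ≠ u := by
        rintro rfl
        rcases hu with hu | hu
        · exact hu hxf
        · exact hu.1 hxo
      have h5 := h3 hxo y hy hy'
      by_cases hyz : y = q lo
      · subst hyz
        rw [Function.update_self]
        rw [hrem] at h5
        exact (List.mem_cons.mp h5).resolve_left hxu
      · rwa [Function.update_of_ne hyz]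
    · rw [hcnt]
      split_ifs with hxu
      · subst hxu
        rcases hu with hu | hu
        · exact absurd hxf hu
        · exact hu.2
      · exact h4 hxo

/-- A new flag falls on a node of player one with an edge to a flagged node, or on a node of player
two whose counter reaches zero. Neither can lie in a trap: for player one the flagged head would be
in the trap too; for player two an unflagged successor in the trap still has `u` in its unprocessed
list, so the counter would be positive. -/
theorem pop_flag (h : CloseOK A Al rv rem q flag cnt lo (lo + 1) tail) (hlo : lo < tail)
    (hrvAl : ∀ y < M, ∀ u ∈ rv y, u ∈ Al ∧ u < M) {u : ℕ}
    {rest : List ℕ} (hrem : rem (q lo) = u :: rest) {cnt' q' flag' : ℕ → ℕ}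
    (hcnt : ∀ v, cnt' v = if v = u then cnt u - 1 else cnt v)
    (hq' : ∀ p, q' p = if p = tail then u else q p)
    (hf' : ∀ v, flag' v = if v = u then 1 else flag v)
    (hfl : flag u = 0) (hu : A.own₁ u ∨ cnt u - 1 = 0) :
    CloseOK A Al rv (Function.update rem (q lo) rest) q' flag' cnt' lo (lo + 1) (tail + 1) := by
  obtain ⟨hzM, hzf⟩ := h.queue.entry lo hlo
  have hurv : u ∈ rv (q lo) := h.rem_sub _ hzM (by rw [hrem]; simp)
  obtain ⟨huAl, huM⟩ := hrvAl _ hzM u hurv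
  have huz : u ≠ q lo := fun e => by rw [e] at hfl; omega
  have hfne : ∀ y, flag' y = 0 → flag y = 0 ∧ y ≠ u := by
    intro y hy
    rw [hf'] at hy
    split_ifs at hy with e
    exact ⟨hy, e⟩
  refine ⟨h.queue.push huM hfl hq' hf', by have := h.lo_le; omega, fun x hx hxf => ?_,
    fun y hy hf => ?_, fun p hp hhi => ?_, fun p hp => ?_,
    fun y hy => ?_, fun x hx hxo => ?_, fun x hx hxf => ?_, fun T hT x hx => ?_⟩
  · rw [hf'] at hxf
    split_ifs at hxf with e
    · rw [e]; exact huAl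
    · exact h.sub x hx hxf
  · have hf := (hfne y hf).1
    have hne : y ≠ q lo := fun e => by rw [e] at hf; omega
    rw [Function.update_of_ne hne]
    exact h.fresh y hy hf
  · rw [hq']
    split_ifs with e
    · rw [Function.update_of_ne huz]
      exact h.fresh u huM hfl
    · have hne : q p ≠ q lo := fun e => by
        have := h.eq_of_pend hlo (by omega) e
        omega
      rw [Function.update_of_ne hne]
      exact h.pend p (by omega) hhi
  · rw [hq', if_neg (by omega)]
    have hne : q p ≠ q lo := fun e => by
      have := h.eq_of_pend hlo (hp.trans hlo) e
      omega
    rw [Function.update_of_ne hne]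
    exact h.fin p hp
  · by_cases hyz : y = q lo
    · subst hyz
      rw [Function.update_self]
      have := h.rem_sub _ hzM
      rw [hrem] at this
      exact List.Subset.trans (List.subset_cons_self _ _) this
    · rw [Function.update_of_ne hyz]
      exact h.rem_sub y hy
  · have h1 := h.count x hx hxo
    rw [sum_count_pop hzM hrem x] at h1
    rw [hcnt]
    by_cases hxu : x = u
    · subst hxu
      simp at h1 ⊢
      omega
    · simpa [hxu] using h1
  · obtain ⟨hxf, hxu⟩ := hfne x hxf
    obtain ⟨h1, h2, h3, h4⟩ := h.free x hx hxf
    refine ⟨h1, h2, fun hxo y hy hy' => ?_, fun hxo => ?_⟩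
    · have h5 := h3 hxo y hy hy'
      by_cases hyz : y = q lo
      · subst hyz
        rw [Function.update_self]
        rw [hrem] at h5
        exact (List.mem_cons.mp h5).resolve_left hxu
      · rwa [Function.update_of_ne hyz]
    · rw [hcnt, if_neg hxu]
      exact h4 hxo
  · have hxf := h.safe T hT x hx
    rw [hf']
    split_ifs with e
    · subst e
      exfalso
      obtain ⟨-, -, h1, h2⟩ := hT x hx
      by_cases hxo : A.own₁ x
      · have := h.safe T hT _ (h1 hxo _ ⟨hzM, hurv⟩)
        omega
      · obtain ⟨y, hyT, hyM, hxy⟩ := h2 hxo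
        have hyf := h.safe T hT y hyT
        rw [← h.fresh y hyM hyf] at hxy
        have h3 := h.count x huAl hxo
        rw [sum_count_pop hzM hrem x, if_pos rfl] at h3
        have hyz : y ≠ q lo := fun e => by rw [e] at hyf; omega
        have h4 : (Function.update rem (q lo) rest y).count x ≤
            ∑ y ∈ Finset.range M, (Function.update rem (q lo) rest y).count x :=
          Finset.single_le_sum (f := fun y => (Function.update rem (q lo) rest y).count x)
            (fun _ _ => Nat.zero_le _) (Finset.mem_range.mpr hyM)
        rw [Function.update_of_ne hyz] at h4
        have h5 := List.count_pos_iff.mpr hxy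
        have := hu.resolve_left hxo
        omega
    · exact hxf

/-- Once the queue is exhausted, the remaining list entries belong to unflagged heads. So an
unflagged node of player one has only unflagged low successors, and a positive counter shows such a
successor for player two. With `safe`, the alive unflagged nodes are the greatest trap. -/
theorem edgeTrap (h : CloseOK A Al rv rem q flag cnt lo hi tail) (hlo : tail ≤ lo)
    (hrvAl : ∀ y < M, ∀ u ∈ rv y, u ∈ Al ∧ y ∈ Al) :
    EdgeTrap A (fun u y => y < M ∧ u ∈ rv y) {u | u ∈ Al ∧ flag u = 0} := by
  have key : ∀ y < M, ∀ u ∈ rem y, flag y = 0 := by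
    intro y hy u hu
    by_contra hne
    obtain ⟨p, hp, rfl⟩ := h.queue.cover y hy hne
    rw [h.fin p (by omega)] at hu
    simp at hu
  rintro u ⟨huAl, huf⟩
  obtain ⟨h1, h2, h3, h4⟩ := h.free u huAl huf
  refine ⟨h1, h2, fun ho y hy => ?_, fun ho => ?_⟩
  · exact ⟨(hrvAl y hy.1 u hy.2).2, key y hy.1 u (h3 ho y hy.1 hy.2)⟩
  · have h5 := h4 ho
    rw [h.count u huAl ho] at h5
    obtain ⟨y, hy, hne⟩ := Finset.exists_ne_zero_of_sum_ne_zero h5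
    have hyM := Finset.mem_range.mp hy
    have hmem : u ∈ rem y := List.count_pos_iff.mp (Nat.pos_of_ne_zero hne)
    have hmem' := h.rem_sub y hyM hmem
    exact ⟨y, ⟨(hrvAl y hyM u hmem').2, key y hyM u hmem⟩, hyM, hmem'⟩

end CloseOK

def closeStep : RamProg :=
  block [asg 16 (.get 8 (.var 13) (.var 14)), put 6 (.var 16) 0 (.get 6 (.var 16) 0 - 1),
    -- Owner times counter: zero for a node of player one, and for a node of player two without
    -- unprocessed edges.
    ite (.get 0 (.var 16) 0 * .get 6 (.var 16) 0) 1
      (ite (.get 7 (.var 16) 0) 1 (enqueue 7 10 12) (block [])) (block [])]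

/-- Process the entries of the queue. -/
def closeQueue : RamProg :=
  block [asg 11 0, loop (.var 11) (.var 12) (block [asg 13 (.get 10 (.var 11) 0),
    asg 11 (.var 11 + 1), forLt 14 (.get 9 (.var 13) 0) closeStep])]

/-- `CloseOK` for the data in memory. -/
def CloseIn {M : ℕ} (A : Arena M) (Al : Set ℕ) (rem : ℕ → List ℕ) (h : HState) (lo hi : ℕ) : Prop :=
  CloseOK A Al (rev h) rem (fun p => h.arr 10 p 0) (fun u => h.arr 7 u 0) (fun u => h.arr 6 u 0)
    lo hi (h.reg 12)

theorem closeStep_spec {M lo z i : ℕ} {A : Arena M} {Al : Set ℕ} {rem : ℕ → List ℕ} {h : HState}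
    (hA : ArenaIn A h Al) (hM : M < C.Bd)
    (hrvAl : ∀ y < M, ∀ u ∈ rev h y, u ∈ Al ∧ u < M)
    (hI : CloseIn A Al rem h lo (lo + 1)) (hlo : lo < h.reg 12) (hz : h.arr 10 lo 0 = z)
    (h13 : h.reg 13 = z) (h14 : h.reg 14 = i) (hi : i < h.arr 9 z 0)
    (hrem : rem z = (rev h z).drop i) :
    Wp C closeStep h fun h' t => t ≤ 11 ∧ Frame h h' [12, 16] [6, 7, 10] ∧ lo < h'.reg 12 ∧
      h'.arr 10 lo 0 = z ∧
      CloseIn A Al (Function.update rem z ((rev h z).drop (i + 1))) h' lo (lo + 1) := by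
  have hi' : i < (rev h z).length := by rw [rev_length]; exact hi
  set u := h.arr 8 z i with hu
  have hrem' : rem ((fun p => h.arr 10 p 0) lo) = u :: (rev h z).drop (i + 1) := by
    simp only [hz, hrem]
    rw [List.drop_eq_getElem_cons hi']
    simp [rev, hu]
  obtain ⟨hzM, hzf⟩ := hI.queue.entry lo hlo
  simp only [hz] at hzM hzf
  have hurv : u ∈ rev h z := hI.rem_sub _ hzM (by rw [← hz]; change u ∈ rem ((fun p => h.arr 10 p 0) lo); rw [hrem']; simp)
  obtain ⟨huAl, huM⟩ := hrvAl z hzM u hurv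
  refine Wp.of_bounds fun hreg harr => ?_
  refine Wp.cons (Wp.asg rfl ⟨trivial, trivial⟩ (by simp only [Ex.eval_get, Ex.eval_var, h13, h14]; omega) ?_)
  simp only [Ex.eval_get, Ex.eval_var, h13, h14, ← hu]
  refine Wp.cons (Wp.put rfl ?_ ?_)
  · simpa using (Nat.sub_le _ _).trans (harr 6 _ _ (by norm_num))
  simp only [Ex.eval_get, Ex.eval_var, Ex.eval_num, Ex.eval_sub, setReg_reg, if_true, setReg_arr]
  set g := (h.setReg 16 u).setArr 6 u 0 (h.arr 6 u 0 - 1) with hg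
  have hf : Frame h g [12, 16] [6, 7, 10] :=
    ((Frame.refl h _ _).setReg (by decide) _).setArr (by decide) _ _ _
  have g16 : g.reg 16 = u := by simp [hg]
  have g12 : g.reg 12 = h.reg 12 := by simp [hg]
  have g0 : g.arr 0 = h.arr 0 := by simp [hg]
  have g7 : g.arr 7 = h.arr 7 := by simp [hg]
  have g10 : g.arr 10 = h.arr 10 := by simp [hg]
  have g6 : ∀ v, g.arr 6 v 0 = if v = u then h.arr 6 u 0 - 1 else h.arr 6 v 0 := by
    intro v; simp [hg, update₂_apply]
  have grev : rev g = rev h := rev_congr (by simp [hg]) (by simp [hg])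
  have done : (h.arr 7 u 0 ≠ 0 ∨ (¬ A.own₁ u ∧ h.arr 6 u 0 - 1 ≠ 0)) →
      CloseIn A Al (Function.update rem z ((rev h z).drop (i + 1))) g lo (lo + 1) := by
    intro hc
    have := hI.pop hlo hrem' g6 hc
    unfold CloseIn
    rw [grev, g12, g7, g10]
    simpa only [hz] using this
  refine Wp.cons (Wp.ite rfl ⟨⟨⟨trivial, trivial⟩, trivial, trivial⟩, trivial⟩ (fun hc => ?_)
    (fun hc => ?_))
  · simp only [Ex.eval_mul, Ex.eval_get, Ex.eval_var, Ex.eval_num, g16, g0, g6, if_true] at hc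
    have hcu : A.own₁ u ∨ h.arr 6 u 0 - 1 = 0 := by
      by_cases ho : A.own₁ u
      · exact Or.inl ho
      · rw [(hA.own u huM).2 ho] at hc
        exact Or.inr (by omega)
    refine Wp.ite rfl ⟨⟨trivial, trivial⟩, trivial⟩ (fun hd => ?_) (fun hd => ?_)
    · simp only [Ex.eval_get, Ex.eval_var, Ex.eval_num, g16, g7] at hd
      have hd0 : h.arr 7 u 0 = 0 := by omega
      refine (enqueue_spec (M := M) (Or.inl ⟨rfl, rfl, rfl⟩) g16 g12 huM hM
        (by simpa only [g10, g7] using hI.queue) (by rw [g7]; omega)).mono ?_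
      rintro g₁ t₁ ⟨ht₁, hf₁, htl, hq₁, hfl₁, hQ₁⟩
      have e6 : g₁.arr 6 = g.arr 6 := hf₁.2 6 (by decide)
      have erev : rev g₁ = rev h :=
        (rev_congr (hf₁.2 8 (by decide)) (hf₁.2 9 (by decide))).trans grev
      refine Wp.nil ⟨by omega, hf.trans (hf₁.mono (by decide) (by decide)) (List.Subset.refl _)
        (List.Subset.refl _), by omega, ?_, ?_⟩
      · rw [hq₁, if_neg (by omega), g10, hz]
      · have := hI.pop_flag hlo hrvAl hrem' (cnt' := fun u => g₁.arr 6 u 0)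
          (q' := fun p => g₁.arr 10 p 0) (flag' := fun u => g₁.arr 7 u 0)
          (fun v => by simp only [e6, g6]) (fun p => by simp only [hq₁, g10])
          (fun v => by simp only [hfl₁, g7]) hd0 hcu
        unfold CloseIn
        rw [erev, htl]
        simpa only [hz] using this
    · simp only [Ex.eval_get, Ex.eval_var, Ex.eval_num, g16, g7] at hd
      refine Wp.nil (Wp.nil ⟨by omega, hf, by omega, by rw [g10, hz], done (Or.inl (by omega))⟩)
  · simp only [Ex.eval_mul, Ex.eval_get, Ex.eval_var, Ex.eval_num, g16, g0, g6, if_true] at hc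
    refine Wp.nil (Wp.nil ⟨by omega, hf, by omega, by rw [g10, hz], done (Or.inr ⟨fun ho => ?_, fun h0 => ?_⟩)⟩)
    · rw [(hA.own u huM).1 ho] at hc
      simp at hc
    · rw [h0] at hc
      simp at hc

theorem closeQueue_spec {M tot : ℕ} {A : Arena M} {Al : Set ℕ} {L : ℕ → ℕ → Prop} {h : HState}
    (hA : ArenaIn A h Al) (hM : M < C.Bd) (hL : ∀ u y, L u y → u ∈ Al ∧ y ∈ Al)
    (hR : RevOK M h L tot)
    (hQ : QueueOK M (fun p => h.arr 10 p 0) (fun u => h.arr 7 u 0) (h.reg 12))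
    (hs : ∀ u < M, h.arr 7 u 0 ≠ 0 ↔ u ∈ Al ∧ (u ∈ A.B ∨ h.arr 6 u 0 = 0)) :
    Wp C closeQueue h fun h' t => t ≤ 14 * tot + 10 * M + 4 ∧
      Frame h h' [11, 12, 13, 14, 16] [6, 7, 10] ∧
      EdgeTrap A L {u | u ∈ Al ∧ h'.arr 7 u 0 = 0} ∧
      ∀ T, EdgeTrap A L T → ∀ u ∈ T, h'.arr 7 u 0 = 0 := by
  have hLM : ∀ u y, L u y ↔ y < M ∧ u ∈ rev h y := fun u y =>
    ⟨fun hl => ⟨hA.alive_lt _ (hL u y hl).2, (hR.mem y (hA.alive_lt _ (hL u y hl).2) u).mpr hl⟩,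
      fun hl => (hR.mem y hl.1 u).mp hl.2⟩
  have hLe : L = fun u y => y < M ∧ u ∈ rev h y := by
    funext u y; exact propext (hLM u y)
  have hrvAl : ∀ y < M, ∀ u ∈ rev h y, u ∈ Al ∧ y ∈ Al := fun y hy u hu =>
    hL u y ((hR.mem y hy u).mp hu)
  have hrvM : ∀ y < M, ∀ u ∈ rev h y, u ∈ Al ∧ u < M := fun y hy u hu =>
    ⟨(hrvAl y hy u hu).1, hA.alive_lt _ (hrvAl y hy u hu).1⟩
  have hzero : ∀ u < M, h.arr 6 u 0 = 0 ↔ ¬ ∃ y < M, u ∈ rev h y := by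
    intro u hu
    rw [hR.cnt u hu, Finset.sum_eq_zero_iff]
    simp only [Finset.mem_range, List.count_eq_zero]
    push Not
    rfl
  refine Wp.cons (Wp.asg rfl trivial (by simp) ?_)
  set h₀ := h.setReg 11 0 with hh₀
  -- The potential charges 14 for each unprocessed list entry and 10 for each queue entry still
  -- possible. The last summand is constant and only rounds the start value up to `14 * tot + 10 *
  -- M`.
  refine Wp.cons (Wp.loop_ghost (n := 14 * tot + 10 * M) (fun n g => ∃ rem,
    Frame h g [11, 12, 13, 14, 16] [6, 7, 10] ∧ CloseIn A Al rem g (g.reg 11) (g.reg 11) ∧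
    n = 14 * (∑ y ∈ Finset.range M, (rem y).length) + 10 * (M - g.reg 11) +
      (14 * (tot - ∑ y ∈ Finset.range M, h.arr 9 y 0))) rfl ?_ ?_ ?_)
  · refine ⟨rev h, (Frame.refl _ _ _).setReg (by decide) _, ?_, ?_⟩
    · have e : CloseOK A Al (rev h) (rev h) (fun p => h.arr 10 p 0) (fun u => h.arr 7 u 0)
          (fun u => h.arr 6 u 0) 0 0 (h.reg 12) := by
        refine ⟨hQ, Nat.zero_le _, fun u hu hne => ((hs u hu).mp hne).1, fun _ _ _ => rfl,
          fun _ _ _ => rfl, fun _ hp => absurd hp (Nat.not_lt_zero _), fun _ _ => List.Subset.refl _,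
          fun u hu _ => hR.cnt u (hA.alive_lt u hu), fun u hu hne => ?_, fun T hT u hu => ?_⟩
        · have huM := hA.alive_lt u hu
          have h1 := (not_congr (hs u huM)).mp (by simpa using hne)
          rw [not_and, not_or] at h1
          obtain ⟨h2, h3⟩ := h1 hu
          exact ⟨h2, by simpa using (not_congr (hzero u huM)).mp h3, fun _ _ _ h => h, fun _ => h3⟩
        · obtain ⟨h1, ⟨y, hy, hy'⟩, -⟩ := hT u hu
          have huM := (hrvM y hy u hy').2
          by_contra hne
          rcases ((hs u huM).mp hne).2 with h2 | h2
          · exact h1 h2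
          · exact (hzero u huM).mp h2 ⟨y, hy, hy'⟩
      simpa [CloseIn, hh₀] using e
    · simp only [setReg_reg, if_true, rev_length, Ex.eval_num]
      have := hR.tot
      omega
  · rintro n g ⟨rem, hf, hI, hn⟩ hc
    simp only [Ex.eval_var] at hc
    have htl := hI.queue.tail_le
    have hrg : rev g = rev h := rev_congr (hf.2 8 (by decide)) (hf.2 9 (by decide))
    have hAg : ArenaIn A g Al := hA.frame hf (by decide) (by decide)
    set lo := g.reg 11 with hlo
    set z := g.arr 10 lo 0 with hz
    obtain ⟨hzM, hzf⟩ := hI.queue.entry lo hc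
    simp only [← hz] at hzM hzf
    refine Wp.of_bounds fun hreg harr => ?_
    refine Wp.cons (Wp.asg rfl ⟨trivial, trivial⟩ (by simpa using harr 10 _ _ (by norm_num)) ?_)
    refine Wp.cons (Wp.asg rfl ⟨trivial, trivial⟩ (by simp; omega) ?_)
    simp only [Ex.eval_get, Ex.eval_var, Ex.eval_num, Ex.eval_add, setReg_reg, if_neg (show ¬ (11 = 13) by norm_num), ← hlo, ← hz]
    set g₁ := (g.setReg 13 z).setReg 11 (lo + 1) with hg₁
    have hremz : rem z = rev h z := by
      rw [← hrg]
      exact hI.pend lo hc le_rfl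
    have hlen : (rev h z).length = g.arr 9 z 0 := by rw [← hrg, rev_length]
    have hlenB : g.arr 9 z 0 ≤ C.Bd := harr 9 _ _ (by norm_num)
    refine Wp.cons (Wp.forLt (n := g.arr 9 z 0) (fun i g' => g'.reg 14 = i ∧
      Frame g₁ g' [12, 14, 16] [6, 7, 10] ∧ lo < g'.reg 12 ∧ g'.arr 10 lo 0 = z ∧
      CloseIn A Al (Function.update rem z ((rev h z).drop i)) g' lo (lo + 1)) (fun _ => 11) rfl
      hlenB ?_ ?_ ?_ ?_)
    · rintro i g' ⟨h14, hf', -⟩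
      have e13 : g'.reg 13 = z := by rw [hf'.1 13 (by decide)]; simp [hg₁]
      have e9 : g'.arr 9 = g.arr 9 := by rw [hf'.2 9 (by decide)]; simp [hg₁]
      exact ⟨h14, by simp [e13, e9]⟩
    · refine ⟨by simp, (Frame.refl _ _ _).setReg (by decide) _, by simpa [hg₁] using hc,
        by simp [hg₁, hz], ?_⟩
      rw [List.drop_zero, ← hremz, Function.update_eq_self]
      have e : CloseOK A Al (rev g) rem (fun p => g.arr 10 p 0) (fun u => g.arr 7 u 0)
          (fun u => g.arr 6 u 0) lo (lo + 1) (g.reg 12) := by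
        exact ⟨hI.queue, hI.lo_le, hI.sub, hI.fresh, fun p hp hp' => hI.pend p hp (by omega),
          hI.fin, hI.rem_sub, hI.count, hI.free, hI.safe⟩
      simpa [CloseIn, hg₁] using e
    · rintro i g' hi ⟨h14, hf', hlo', hz', hI'⟩
      have e13 : g'.reg 13 = z := by rw [hf'.1 13 (by decide)]; simp [hg₁]
      have e9 : g'.arr 9 = g.arr 9 := by rw [hf'.2 9 (by decide)]; simp [hg₁]
      have hrg' : rev g' = rev h := by
        rw [rev_congr (hf'.2 8 (by decide)) (hf'.2 9 (by decide)), ← hrg]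
        rfl
      have hAg' : ArenaIn A g' Al := by
        refine ArenaIn.frame (h := g) hAg (R := [11, 12, 13, 14, 16]) (As := [6, 7, 10]) ?_
          (by decide) (by decide)
        exact (((Frame.refl g [11, 12, 13, 14, 16] [6, 7, 10]).setReg (by decide) _).setReg
          (by decide) _).trans (hf'.mono (by decide) (by decide)) (List.Subset.refl _)
          (List.Subset.refl _)
      refine (closeStep_spec (i := i) hAg' hM (by rw [hrg']; exact hrvM) hI' hlo' hz' e13 h14
        (by rw [e9]; exact hi) (by rw [Function.update_self, hrg'])).mono ?_
      rintro g₂ t ⟨ht, hf₂, hlo₂, hz₂, hI₂⟩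
      refine ⟨by rw [hf₂.1 14 (by decide), h14], ⟨by simp, ?_, ?_, ?_, ?_⟩, ht⟩
      · exact (hf'.trans (hf₂.mono (R' := [12, 14, 16]) (by decide) (List.Subset.refl _))
          (List.Subset.refl _) (List.Subset.refl _)).setReg (by decide) _
      · simpa using hlo₂
      · simpa using hz₂
      · rw [Function.update_idem, hrg'] at hI₂
        simpa [CloseIn] using hI₂
    · rintro g' t ⟨h14, hf', hlo', hz', hI'⟩ ht
      simp only [Finset.sum_const, Finset.card_range, smul_eq_mul] at ht
      rw [← hlen, List.drop_length] at hI'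
      have e11 : g'.reg 11 = lo + 1 := by rw [hf'.1 11 (by decide)]; simp [hg₁]
      refine Wp.nil ⟨_, ⟨Function.update rem z [], ?_, ?_, rfl⟩, ?_⟩
      · refine hf.trans ?_ (List.Subset.refl _) (List.Subset.refl _)
        exact (((Frame.refl g [11, 12, 13, 14, 16] [6, 7, 10]).setReg (by decide) _).setReg
          (by decide) _).trans (hf'.mono (by decide) (by decide)) (List.Subset.refl _)
          (List.Subset.refl _)
      · rw [e11]
        refine ⟨hI'.queue, hlo', hI'.sub, hI'.fresh, hI'.pend, fun p hp => ?_, hI'.rem_sub, hI'.count,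
          hI'.free, hI'.safe⟩
        rcases Nat.lt_or_ge p lo with hlt | hge
        · exact hI'.fin p hlt
        · obtain rfl : p = lo := by omega
          simp only [hz', Function.update_self]
      · rw [e11]
        have h2 : ∑ y ∈ Finset.range M, (rem y).length =
            ∑ y ∈ Finset.range M, (Function.update rem z [] y).length + g.arr 9 z 0 := by
          have h3 : ∀ y ∈ Finset.range M, (rem y).length =
              (Function.update rem z [] y).length + if y = z then g.arr 9 z 0 else 0 := by
            intro y _
            by_cases hyz : y = z
            · subst hyz; simp [hremz, hlen]
            · simp [hyz]
          rw [Finset.sum_congr rfl h3, Finset.sum_add_distrib, Finset.sum_ite_eq']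
          simp [hzM]
        omega
  · rintro g t n' ⟨rem, hf, hI, hn⟩ hc ht
    simp only [Ex.eval_var, not_lt] at hc
    have hrg : rev g = rev h := rev_congr (hf.2 8 (by decide)) (hf.2 9 (by decide))
    unfold CloseIn at hI
    rw [hrg] at hI
    refine Wp.nil ⟨by omega, hf, ?_, ?_⟩
    · rw [hLe]
      exact hI.edgeTrap hc hrvAl
    · intro T hT
      rw [hLe] at hT
      exact hI.safe T hT

def levelTest : RamProg := block [clearLevel, buildRev, seedQueue, closeQueue]

theorem levelTest_spec {M k : ℕ} {A : Arena M} {Al : Set ℕ} {h : HState} (hA : ArenaIn A h Al)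
    (hk : h.reg 8 = k) (hB : 2 * (M + 1) * (k + 1) < C.Bd) :
    Wp C levelTest h fun h' t => t ≤ 50 * (k * M) + 60 * M + 20 ∧
      Frame h h' [11, 12, 13, 14, 15, 16, 17] [6, 7, 8, 9, 10] ∧
      EdgeTrap A (Low A (fun ρ => h.arr 5 ρ 0) k Al) {u | u ∈ Al ∧ h'.arr 7 u 0 = 0} ∧
      ∀ T, EdgeTrap A (Low A (fun ρ => h.arr 5 ρ 0) k Al) T → ∀ u ∈ T, h'.arr 7 u 0 = 0 := by
  have hM : M < C.Bd := by nlinarith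
  refine Wp.cons ((clearLevel_spec hA.num hM.le).mono ?_)
  rintro h₁ t₁ ⟨ht₁, hf₁, hz₁⟩
  have hA₁ := hA.frame hf₁ (by decide) (by decide)
  refine Wp.cons ((buildRev_spec hA₁ (by rw [hf₁.1 8 (by decide), hk]) hB
    (fun u hu => (hz₁ u hu).1) (fun u hu => (hz₁ u hu).2.2)).mono ?_)
  rintro h₂ t₂ ⟨ht₂, hf₂, hR₂⟩
  rw [hf₁.2 5 (by decide)] at hR₂
  have hA₂ := hA₁.frame hf₂ (by decide) (by decide)
  refine Wp.cons ((seedQueue_spec hA₂ hM (fun u hu => by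
    rw [hf₂.2 7 (by decide)]; exact (hz₁ u hu).2.1)).mono ?_)
  rintro h₃ t₃ ⟨ht₃, hf₃, hQ₃, hs₃⟩
  have hA₃ := hA₂.frame hf₃ (by decide) (by decide)
  have e6 : h₃.arr 6 = h₂.arr 6 := hf₃.2 6 (by decide)
  refine Wp.cons ((closeQueue_spec (L := Low A (fun ρ => h.arr 5 ρ 0) k Al) hA₃ hM
    (fun u y hl => ⟨hl.1, hl.2.1⟩)
    (hR₂.congr e6 (hf₃.2 8 (by decide)) (hf₃.2 9 (by decide)) (fun _ _ _ => Iff.rfl) le_rfl) hQ₃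
    (by rw [e6]; exact hs₃)).mono ?_)
  rintro h₄ t₄ ⟨ht₄, hf₄, hT, hT'⟩
  have e : 2 * k * M = 2 * (k * M) := by ring
  have e' : 22 * k * M = 22 * (k * M) := by ring
  refine Wp.nil ⟨by omega, ?_, hT, hT'⟩
  have F := fun {a b : HState} {R R' A A'} (hf : Frame a b R A) (h1 : R ⊆ R') (h2 : A ⊆ A') => hf.mono h1 h2
  exact ((((Frame.refl h _ _).trans (hf₁.mono (by decide) (by decide)) (List.Subset.refl _)
    (List.Subset.refl _)).trans (hf₂.mono (by decide) (by decide)) (List.Subset.refl _)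
    (List.Subset.refl _)).trans (hf₃.mono (by decide) (by decide)) (List.Subset.refl _)
    (List.Subset.refl _)).trans (hf₄.mono (by decide) (by decide)) (List.Subset.refl _)
    (List.Subset.refl _)

end RamProg

namespace RamProg

open HState

variable {C : Layout}

/-! #### Removing nodes -/

/-- The numbers below `M` that are not among the first `c` entries of `q`. -/
def Left (M : ℕ) (q : ℕ → ℕ) (c : ℕ) : Set ℕ := {x | x < M ∧ ∀ p < c, q p ≠ x}

theorem left_succ (M : ℕ) (q : ℕ → ℕ) (c : ℕ) : Left M q (c + 1) = Left M q c \ {q c} := by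
  ext x
  constructor
  · rintro ⟨h1, h2⟩
    exact ⟨⟨h1, fun p hp => h2 p (by omega)⟩, fun e => h2 c (by omega) e.symm⟩
  · rintro ⟨⟨h1, h2⟩, h3⟩
    refine ⟨h1, fun p hp => ?_⟩
    rcases Nat.lt_or_ge p c with hlt | hge
    · exact h2 p hlt
    · obtain rfl : p = c := by omega
      exact fun e => h3 e.symm

theorem left_congr {M : ℕ} {q q' : ℕ → ℕ} {c : ℕ} (h : ∀ p < c, q' p = q p) :
    Left M q' c = Left M q c := by
  ext x
  exact and_congr_right fun _ => forall₂_congr fun p hp => by rw [h p hp]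

/-- The arena is stored in memory, together with the queue of the dead nodes. The first `c₁ u`
entries of the queue have been removed from the row of successors of `u`, the first `c₂ u` from its
row of predecessors, and their predecessor `u` has been added to the queue for the first `c₃ u`. Player
two wins from the dead nodes if he wins from those in `K`, and the nodes in `X` may have to be added
to the queue because of their successors. -/
structure PurgeOK {M : ℕ} (A : Arena M) (h : HState) (c₁ c₂ c₃ : ℕ → ℕ) (K X : Set ℕ) : Prop where
  num : h.reg 7 = M
  own : ∀ u < M, (A.own₁ u → h.arr 0 u 0 = 0) ∧ (¬ A.own₁ u → h.arr 0 u 0 = 1)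
  target : ∀ u < M, (u ∈ A.B → h.arr 1 u 0 = 1) ∧ (u ∉ A.B → h.arr 1 u 0 = 0)
  queue : QueueOK M (fun p => h.arr 11 p 0) (fun u => h.arr 2 u 0) (h.reg 10)
  le : ∀ u, c₁ u ≤ h.reg 10 ∧ c₂ u ≤ h.reg 10 ∧ c₃ u ≤ h.reg 10
  succs : ∀ u < M, RowIn M h (2 * u)
    {x | A.own₁ u ∧ A.E u x ∧ x ∈ Left M (fun p => h.arr 11 p 0) (c₁ u)}
  preds : ∀ u < M, RowIn M h (2 * u + 1)
    {x | ¬ A.own₁ x ∧ A.E x u ∧ x ∈ Left M (fun p => h.arr 11 p 0) (c₂ u)}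
  pull₁ : ∀ u < M, A.own₁ u → h.arr 2 u 0 = 0 → u ∉ X →
    ∃ x, A.E u x ∧ x ∈ Left M (fun p => h.arr 11 p 0) (c₁ u)
  pull₂ : ∀ u < M, ¬ A.own₁ u → h.arr 2 u 0 = 0 → ∀ p < c₃ u, ¬ A.E u (h.arr 11 p 0)
  wins : WinsCoBuchi A.own₁ A.E A.B ({u | u < M ∧ h.arr 2 u 0 ≠ 0} ∪ K)

namespace PurgeOK

variable {M : ℕ} {A : Arena M} {h h' : HState} {c₁ c₂ c₃ : ℕ → ℕ} {K X : Set ℕ}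

theorem frame (hP : PurgeOK A h c₁ c₂ c₃ K X) {R As : List ℕ} (hf : Frame h h' R As)
    (h7 : 7 ∉ R) (h10 : 10 ∉ R) (hAs : ∀ j < 6, j ∉ As) (h11 : 11 ∉ As) :
    PurgeOK A h' c₁ c₂ c₃ K X := by
  have e := fun j hj => hf.2 j (hAs j hj)
  have e11 := hf.2 11 h11
  have e10 := hf.1 10 h10
  have e2 := e 2 (by norm_num)
  refine ⟨(hf.1 7 h7).trans hP.num, ?_, ?_, ?_, ?_, ?_, ?_, ?_, ?_, ?_⟩
  · rw [e 0 (by norm_num)]; exact hP.own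
  · rw [e 1 (by norm_num)]; exact hP.target
  · rw [e11, e10, e2]; exact hP.queue
  · rw [e10]; exact hP.le
  · intro u hu
    unfold RowIn
    rw [e 3 (by norm_num), e 4 (by norm_num), e 5 (by norm_num), e11]
    exact hP.succs u hu
  · intro u hu
    unfold RowIn
    rw [e 3 (by norm_num), e 4 (by norm_num), e 5 (by norm_num), e11]
    exact hP.preds u hu
  · rw [e2, e11]; exact hP.pull₁
  · rw [e2, e11]; exact hP.pull₂
  · rw [e2]; exact hP.wins

theorem ext_counts (hP : PurgeOK A h c₁ c₂ c₃ K X) {d₁ d₂ d₃ : ℕ → ℕ} (h₁ : ∀ u < M, d₁ u = c₁ u)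
    (h₂ : ∀ u < M, d₂ u = c₂ u) (h₃ : ∀ u < M, d₃ u = c₃ u)
    (hle : ∀ u, d₁ u ≤ h.reg 10 ∧ d₂ u ≤ h.reg 10 ∧ d₃ u ≤ h.reg 10) :
    PurgeOK A h d₁ d₂ d₃ K X := by
  refine ⟨hP.num, hP.own, hP.target, hP.queue, hle, fun u hu => ?_, fun u hu => ?_,
    fun u hu => ?_, fun u hu => ?_, hP.wins⟩
  · rw [h₁ u hu]; exact hP.succs u hu
  · rw [h₂ u hu]; exact hP.preds u hu
  · rw [h₁ u hu]; exact hP.pull₁ u hu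
  · rw [h₃ u hu]; exact hP.pull₂ u hu

theorem arenaIn (hP : PurgeOK A h c₁ c₂ c₃ K X) (h₁ : ∀ u < M, c₁ u = h.reg 10)
    (h₂ : ∀ u < M, c₂ u = h.reg 10) : ArenaIn A h {u | u < M ∧ h.arr 2 u 0 = 0} := by
  have hl : Left M (fun p => h.arr 11 p 0) (h.reg 10) = {u | u < M ∧ h.arr 2 u 0 = 0} := by
    ext x
    refine and_congr_right fun hx => ⟨fun h1 => ?_, fun h1 p hp e => ?_⟩
    · by_contra hne
      obtain ⟨p, hp, he⟩ := hP.queue.cover x hx hne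
      exact h1 p hp he
    · have := (hP.queue.entry p hp).2
      simp only [e, h1] at this
      omega
  refine ⟨hP.num, hP.own, hP.target, fun u hu => hu.1, fun u hu => by simp [hu], fun u hu => ?_,
    fun u hu => ?_⟩
  · have := hP.succs u hu
    rwa [h₁ u hu, hl] at this
  · have := hP.preds u hu
    rwa [h₂ u hu, hl] at this

/-- A node in `K` is already covered by `wins`. Any other node may die only if player two can force
the next node to be dead, and then it extends the co-Büchi certificate. -/
theorem enqueue_spec {u : ℕ} (hM : M < C.Bd) (hP : PurgeOK A h c₁ c₂ c₃ K X)
    (hu : h.reg 16 = u) (huM : u < M) (hfl : h.arr 2 u 0 = 0)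
    (hwin : u ∈ K ∨ u ∈ CPre₂ A.own₁ A.E {u | u < M ∧ h.arr 2 u 0 ≠ 0}) :
    Wp C (enqueue 2 11 10) h fun h' t => t ≤ 4 ∧ Frame h h' [10] [2, 11] ∧
      h'.reg 10 = h.reg 10 + 1 ∧ (∀ v, h'.arr 2 v 0 = if v = u then 1 else h.arr 2 v 0) ∧
      (∀ p < h.reg 10, h'.arr 11 p 0 = h.arr 11 p 0) ∧ PurgeOK A h' c₁ c₂ c₃ K X := by
  refine (RamProg.enqueue_spec (Or.inr ⟨rfl, rfl, rfl⟩) hu rfl huM hM hP.queue hfl).mono ?_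
  rintro g t ⟨ht, hf, h10, hq, hfl', hQ⟩
  have hq' : ∀ p < h.reg 10, g.arr 11 p 0 = h.arr 11 p 0 := fun p hp => by
    rw [hq, if_neg (by omega)]
  have hleft : ∀ c, c ≤ h.reg 10 → Left M (fun p => g.arr 11 p 0) c =
      Left M (fun p => h.arr 11 p 0) c := fun c hc => left_congr fun p hp => hq' p (by omega)
  have e := fun j (hj : j ∉ [2, 11]) => hf.2 j hj
  refine ⟨ht, hf, h10, hfl', hq', (hf.1 7 (by decide)).trans hP.num, ?_, ?_, ?_, ?_, ?_, ?_, ?_, ?_,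
    ?_⟩
  · rw [e 0 (by decide)]; exact hP.own
  · rw [e 1 (by decide)]; exact hP.target
  · rw [h10]; exact hQ
  · intro v
    have := hP.le v
    omega
  · intro v hv
    unfold RowIn
    rw [e 3 (by decide), e 4 (by decide), e 5 (by decide), hleft _ (hP.le v).1]
    exact hP.succs v hv
  · intro v hv
    unfold RowIn
    rw [e 3 (by decide), e 4 (by decide), e 5 (by decide), hleft _ (hP.le v).2.1]
    exact hP.preds v hv
  · intro v hv ho hvf
    rw [hfl'] at hvf
    split_ifs at hvf
    rw [hleft _ (hP.le v).1]
    exact hP.pull₁ v hv ho hvf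
  · intro v hv ho hvf p hp
    rw [hfl'] at hvf
    split_ifs at hvf
    have := hP.le v
    rw [hq' p (by omega)]
    exact hP.pull₂ v hv ho hvf p hp
  · have hset : ({v | v < M ∧ g.arr 2 v 0 ≠ 0} ∪ K) =
        insert u ({v | v < M ∧ h.arr 2 v 0 ≠ 0} ∪ K) := by
      ext v
      simp only [Set.mem_union, Set.mem_ofPred_eq, Set.mem_insert_iff, hfl']
      by_cases hvu : v = u
      · subst hvu; simp [huM]
      · simp [hvu]
    rw [hset]
    rcases hwin with hw | hw
    · rw [Set.insert_eq_of_mem (Set.mem_union_right _ hw)]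
      exact hP.wins
    · exact hP.wins.insert (CPre₂.mono Set.subset_union_left hw)

end PurgeOK

/-- Remove the element in variable 15 from the row in variable 17, if it is there. -/
def purgeElem : RamProg := ite 0 (.get 4 (.var 17) (.var 15)) eraseElem (block [])

theorem purgeElem_spec {M : ℕ} {h : HState} {S : Set ℕ} {ρ z : ℕ} (hρ : h.reg 17 = ρ)
    (hz : h.reg 15 = z) (hzM : z < M) (hS : RowIn M h ρ S) :
    Wp C purgeElem h fun h' t => t ≤ 9 ∧ Frame h h' [18, 19, 20] [3, 4, 5] ∧
      RowIn M h' ρ (S \ {z}) ∧ SameRows h h' ρ := by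
  refine Wp.ite rfl ⟨trivial, trivial, trivial⟩ (fun hc => ?_) (fun hc => ?_)
  · simp only [Ex.eval_get, Ex.eval_var, Ex.eval_num, hρ, hz] at hc
    refine (eraseElem_spec hρ hz hS ((RowOK.pos_iff hS hzM).mp hc)).mono ?_
    rintro h' t ⟨h1, h2⟩
    exact ⟨by omega, h2⟩
  · simp only [Ex.eval_get, Ex.eval_var, Ex.eval_num, hρ, hz] at hc
    have hzS : z ∉ S := fun h => hc ((RowOK.pos_iff hS hzM).mpr h)
    refine Wp.nil ⟨by omega, Frame.refl _ _ _, ?_, fun _ _ => ⟨rfl, rfl, rfl⟩⟩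
    rwa [Set.sdiff_singleton_eq_self hzS]

/-- Remove the node in variable 15 from the rows of the node in variable 14, and add the latter to
the queue if it has to be added because of the former. -/
def purgeStep : RamProg := block [
  asg 16 (.var 14),
  asg 17 (2 * .var 14),
  ite 0 (.get 4 (.var 17) (.var 15)) (block [eraseElem,
    ite (.get 5 (.var 17) 0 + .get 2 (.var 14) 0) 1 (enqueue 2 11 10) (block [])]) (block []),
  asg 17 (2 * .var 14 + 1),
  purgeElem,
  ite 0 (.get 4 (2 * .var 15 + 1) (.var 14) * (1 - .get 2 (.var 14) 0)) (enqueue 2 11 10) (block [])]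

namespace PurgeOK

variable {M : ℕ} {A : Arena M} {h h' : HState} {c₁ c₂ c₃ : ℕ → ℕ} {K X : Set ℕ}

/-- The effect of a change of the row of successors of `i`. -/
theorem update_succs {i z : ℕ} (hP : PurgeOK A h c₁ c₂ c₃ K ∅) (hi : i < M)
    (hz : h.arr 11 (c₁ i) 0 = z) (hlt : c₁ i < h.reg 10)
    {R : List ℕ} (hf : Frame h h' R [3, 4, 5]) (hR7 : 7 ∉ R) (hR10 : 10 ∉ R)
    (hrow : RowIn M h' (2 * i)
      ({x | A.own₁ i ∧ A.E i x ∧ x ∈ Left M (fun p => h.arr 11 p 0) (c₁ i)} \ {z}))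
    (hsame : SameRows h h' (2 * i)) :
    PurgeOK A h' (Function.update c₁ i (c₁ i + 1)) c₂ c₃ K {i} := by
  have e := fun j (hj : j ∉ [3, 4, 5]) => hf.2 j hj
  have e10 := hf.1 10 hR10
  refine ⟨(hf.1 7 hR7).trans hP.num, ?_, ?_, ?_, ?_, ?_, ?_, ?_, ?_, ?_⟩
  · rw [e 0 (by decide)]; exact hP.own
  · rw [e 1 (by decide)]; exact hP.target
  · rw [e 11 (by decide), e10, e 2 (by decide)]; exact hP.queue
  · intro u
    have := hP.le u
    rw [e10, Function.update_apply]
    split_ifs <;> omega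
  · intro u hu
    rw [e 11 (by decide)]
    by_cases hui : u = i
    · subst hui
      rw [Function.update_self, left_succ, hz]
      convert hrow using 1
      ext x
      simp only [Set.mem_ofPred_eq, Set.mem_sdiff]
      tauto
    · rw [Function.update_of_ne hui]
      obtain ⟨a3, a4, a5⟩ := hsame (2 * u) (by omega)
      unfold RowIn
      rw [a3, a4, a5]
      exact hP.succs u hu
  · intro u hu
    rw [e 11 (by decide)]
    obtain ⟨a3, a4, a5⟩ := hsame (2 * u + 1) (by omega)
    unfold RowIn
    rw [a3, a4, a5]
    exact hP.preds u hu
  · rw [e 2 (by decide), e 11 (by decide)]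
    intro u hu ho huf hui
    rw [Function.update_of_ne (by simpa using hui)]
    exact hP.pull₁ u hu ho huf (by simp)
  · rw [e 2 (by decide), e 11 (by decide)]; exact hP.pull₂
  · rw [e 2 (by decide)]; exact hP.wins

theorem update_preds {i z : ℕ} (hP : PurgeOK A h c₁ c₂ c₃ K X) (hi : i < M)
    (hz : h.arr 11 (c₂ i) 0 = z) (hlt : c₂ i < h.reg 10)
    {R : List ℕ} (hf : Frame h h' R [3, 4, 5]) (hR7 : 7 ∉ R) (hR10 : 10 ∉ R)
    (hrow : RowIn M h' (2 * i + 1)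
      ({x | ¬ A.own₁ x ∧ A.E x i ∧ x ∈ Left M (fun p => h.arr 11 p 0) (c₂ i)} \ {z}))
    (hsame : SameRows h h' (2 * i + 1)) :
    PurgeOK A h' c₁ (Function.update c₂ i (c₂ i + 1)) c₃ K X := by
  have e := fun j (hj : j ∉ [3, 4, 5]) => hf.2 j hj
  have e10 := hf.1 10 hR10
  refine ⟨(hf.1 7 hR7).trans hP.num, ?_, ?_, ?_, ?_, ?_, ?_, ?_, ?_, ?_⟩
  · rw [e 0 (by decide)]; exact hP.own
  · rw [e 1 (by decide)]; exact hP.target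
  · rw [e 11 (by decide), e10, e 2 (by decide)]; exact hP.queue
  · intro u
    have := hP.le u
    rw [e10, Function.update_apply]
    split_ifs <;> omega
  · intro u hu
    rw [e 11 (by decide)]
    obtain ⟨a3, a4, a5⟩ := hsame (2 * u) (by omega)
    unfold RowIn
    rw [a3, a4, a5]
    exact hP.succs u hu
  · intro u hu
    rw [e 11 (by decide)]
    by_cases hui : u = i
    · subst hui
      rw [Function.update_self, left_succ, hz]
      convert hrow using 1
      ext x
      simp only [Set.mem_ofPred_eq, Set.mem_sdiff]
      tauto
    · rw [Function.update_of_ne hui]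
      obtain ⟨a3, a4, a5⟩ := hsame (2 * u + 1) (by omega)
      unfold RowIn
      rw [a3, a4, a5]
      exact hP.preds u hu
  · rw [e 2 (by decide), e 11 (by decide)]; exact hP.pull₁
  · rw [e 2 (by decide), e 11 (by decide)]; exact hP.pull₂
  · rw [e 2 (by decide)]; exact hP.wins

/-- While its row of successors is being shortened, `i` may be alive with an empty row. The
exception `X = {i}` suspends `pull₁` until `i` is dead or a successor is seen to remain. -/
theorem drop_exception {i : ℕ} (hP : PurgeOK A h c₁ c₂ c₃ K {i})
    (hi : A.own₁ i → h.arr 2 i 0 = 0 → ∃ x, A.E i x ∧ x ∈ Left M (fun p => h.arr 11 p 0) (c₁ i)) :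
    PurgeOK A h c₁ c₂ c₃ K ∅ := by
  refine ⟨hP.num, hP.own, hP.target, hP.queue, hP.le, hP.succs, hP.preds, fun u hu ho huf _ => ?_,
    hP.pull₂, hP.wins⟩
  by_cases hui : u = i
  · subst hui; exact hi ho huf
  · exact hP.pull₁ u hu ho huf (by simpa using hui)

theorem update_count₃ {i v : ℕ} (hP : PurgeOK A h c₁ c₂ c₃ K X) (hv : v ≤ h.reg 10)
    (hi : ¬ A.own₁ i → h.arr 2 i 0 = 0 → ∀ p < v, ¬ A.E i (h.arr 11 p 0)) :
    PurgeOK A h c₁ c₂ (Function.update c₃ i v) K X := by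
  refine ⟨hP.num, hP.own, hP.target, hP.queue, fun u => ?_, hP.succs, hP.preds, hP.pull₁,
    fun u hu ho huf => ?_, hP.wins⟩
  · have := hP.le u
    rw [Function.update_apply]
    split_ifs <;> omega
  · by_cases hui : u = i
    · subst hui
      rw [Function.update_self]
      exact hi ho huf
    · rw [Function.update_of_ne hui]
      exact hP.pull₂ u hu ho huf

end PurgeOK

theorem purgeStep_spec {M i lo z : ℕ} {A : Arena M} {h : HState} {c₁ c₂ c₃ : ℕ → ℕ}
    (hM : 2 * M < C.Bd) (hP : PurgeOK A h c₁ c₂ c₃ ∅ ∅) (hi : i < M) (h14 : h.reg 14 = i)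
    (h15 : h.reg 15 = z) (hlo : lo < h.reg 10) (hz : h.arr 11 lo 0 = z)
    (hc₁ : c₁ i = lo) (hc₂ : c₂ i = lo) (hc₃ : c₃ i = lo) :
    Wp C purgeStep h fun h' t => t ≤ 36 ∧ Frame h h' [10, 16, 17, 18, 19, 20] [2, 3, 4, 5, 11] ∧
      h.reg 10 ≤ h'.reg 10 ∧ (∀ v, h.arr 2 v 0 ≠ 0 → h'.arr 2 v 0 ≠ 0) ∧
      (∀ p < h.reg 10, h'.arr 11 p 0 = h.arr 11 p 0) ∧
      PurgeOK A h' (Function.update c₁ i (lo + 1)) (Function.update c₂ i (lo + 1))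
        (Function.update c₃ i (lo + 1)) ∅ ∅ := by
  obtain ⟨hzM, hzf⟩ := hP.queue.entry lo hlo
  simp only [hz] at hzM hzf
  refine Wp.of_bounds fun hreg harr => ?_
  refine Wp.cons (Wp.asg rfl trivial (by simp [h14]; omega) ?_)
  refine Wp.cons (Wp.asg rfl ⟨trivial, trivial⟩ (by simp [h14]; omega) ?_)
  simp only [Ex.eval_var, Ex.eval_num, Ex.eval_mul, setReg_reg, if_neg (show ¬ (14 = 16) by norm_num), h14]
  set g := (h.setReg 16 i).setReg 17 (2 * i) with hg
  have hf : Frame h g [10, 16, 17, 18, 19, 20] [2, 3, 4, 5, 11] :=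
    ((Frame.refl h _ _).setReg (by decide) _).setReg (by decide) _
  have gP : PurgeOK A g c₁ c₂ c₃ ∅ ∅ :=
    hP.frame (((Frame.refl h [16, 17] []).setReg (by decide) _).setReg (by decide) _)
      (by decide) (by decide) (by decide) (by decide)
  have g14 : g.reg 14 = i := by simp [hg, h14]
  have g15 : g.reg 15 = z := by simp [hg, h15]
  have g16 : g.reg 16 = i := by simp [hg]
  have g17 : g.reg 17 = 2 * i := by simp [hg]
  have g10 : g.reg 10 = h.reg 10 := by simp [hg]
  have ga : g.arr = h.arr := rfl
  have hleft : Left M (fun p => h.arr 11 p 0) (lo + 1) = Left M (fun p => h.arr 11 p 0) lo \ {z} := by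
    rw [left_succ, hz]
  -- The second half of the program, common to all branches of the first: the row of predecessors,
  -- then the test for nodes of player two.
  have hmid : ∀ g₂ : HState, ∀ t₂ : ℕ, t₂ ≤ 16 →
      Frame h g₂ [10, 16, 17, 18, 19, 20] [2, 3, 4, 5, 11] → g₂.reg 16 = i →
      h.reg 10 ≤ g₂.reg 10 → (∀ v, h.arr 2 v 0 ≠ 0 → g₂.arr 2 v 0 ≠ 0) →
      (∀ p < h.reg 10, g₂.arr 11 p 0 = h.arr 11 p 0) →
      PurgeOK A g₂ (Function.update c₁ i (lo + 1)) c₂ c₃ ∅ ∅ →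
      Wp C (block [asg 17 (2 * .var 14 + 1), purgeElem,
        ite 0 (.get 4 (2 * .var 15 + 1) (.var 14) * (1 - .get 2 (.var 14) 0)) (enqueue 2 11 10) (block [])])
        g₂ fun h' t => 1 + (1 + (t₂ + t)) ≤ 36 ∧
        Frame h h' [10, 16, 17, 18, 19, 20] [2, 3, 4, 5, 11] ∧
        h.reg 10 ≤ h'.reg 10 ∧ (∀ v, h.arr 2 v 0 ≠ 0 → h'.arr 2 v 0 ≠ 0) ∧
        (∀ p < h.reg 10, h'.arr 11 p 0 = h.arr 11 p 0) ∧
        PurgeOK A h' (Function.update c₁ i (lo + 1)) (Function.update c₂ i (lo + 1))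
          (Function.update c₃ i (lo + 1)) ∅ ∅ := by
    intro g₂ t₂ ht₂ hf₂ e16 h10 hfl hq hP₂
    have e14 : g₂.reg 14 = i := by rw [hf₂.1 14 (by decide), h14]
    have e15 : g₂.reg 15 = z := by rw [hf₂.1 15 (by decide), h15]
    refine Wp.cons (Wp.asg rfl ⟨⟨trivial, trivial⟩, trivial⟩ (by simp [e14]; omega) ?_)
    simp only [Ex.eval_var, Ex.eval_num, Ex.eval_mul, Ex.eval_add, e14]
    set g₃ := g₂.setReg 17 (2 * i + 1) with hg₃
    have hP₃ : PurgeOK A g₃ (Function.update c₁ i (lo + 1)) c₂ c₃ ∅ ∅ :=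
      hP₂.frame ((Frame.refl g₂ [17] []).setReg (by decide) _) (by decide) (by decide) (by decide)
        (by decide)
    refine Wp.cons ((purgeElem_spec (ρ := 2 * i + 1) (by simp [hg₃]) (by simpa [hg₃] using e15) hzM
      (hP₃.preds i hi)).mono ?_)
    rintro g₄ t₄ ⟨ht₄, hf₄, hrow, hsame⟩
    have hP₄ := hP₃.update_preds (z := z) hi (by rw [hc₂]; exact (hq lo hlo).trans hz)
      (by rw [hc₂]; exact lt_of_lt_of_le hlo h10) hf₄ (by decide) (by decide) hrow hsame
    rw [hc₂] at hP₄
    have k16 : g₄.reg 16 = i := by rw [hf₄.1 16 (by decide)]; simpa [hg₃] using e16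
    have k15 : g₄.reg 15 = z := by rw [hf₄.1 15 (by decide)]; simpa [hg₃] using e15
    have k14 : g₄.reg 14 = i := by rw [hf₄.1 14 (by decide)]; simpa [hg₃] using e14
    have k10 : g₄.reg 10 = g₂.reg 10 := by rw [hf₄.1 10 (by decide)]; simp [hg₃]
    have k2 : g₄.arr 2 = g₂.arr 2 := by rw [hf₄.2 2 (by decide)]; simp [hg₃]
    have k11 : g₄.arr 11 = g₂.arr 11 := by rw [hf₄.2 11 (by decide)]; simp [hg₃]
    have kf : Frame h g₄ [10, 16, 17, 18, 19, 20] [2, 3, 4, 5, 11] :=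
      (hf₂.setReg (by decide) _).trans (hf₄.mono (by decide) (by decide)) (List.Subset.refl _)
        (List.Subset.refl _)
    have kz2 : g₄.arr 2 z 0 ≠ 0 := by rw [k2]; exact hfl z (by omega)
    have kq : g₄.arr 11 lo 0 = z := by rw [k11, hq lo hlo, hz]
    have hlt10 : lo + 1 ≤ g₄.reg 10 := by omega
    -- Only dead nodes have been removed from the row of `z`, so for an alive `i` it still tells
    -- whether player two owns `i` and can move to `z`.
    have key : g₄.arr 2 i 0 = 0 → (0 < g₄.arr 4 (2 * z + 1) i ↔ ¬ A.own₁ i ∧ A.E i z) := by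
      intro h0
      rw [RowOK.pos_iff (hP₄.preds z hzM) hi]
      refine ⟨fun hx => ⟨hx.1, hx.2.1⟩, fun hx => ⟨hx.1, hx.2, hi, fun p hp e => ?_⟩⟩
      have h1 := hP₄.le z
      have := (hP₄.queue.entry p (lt_of_lt_of_le hp h1.2.1)).2
      simp only [e, h0] at this
      omega
    refine Wp.cons (Wp.ite rfl ⟨trivial, ⟨⟨⟨trivial, trivial⟩, trivial⟩, trivial⟩, trivial, trivial, trivial⟩
      (fun hd => ?_) (fun hd => ?_))
    · simp only [Ex.eval_get, Ex.eval_var, Ex.eval_num, Ex.eval_add, Ex.eval_mul,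
        Ex.eval_sub, k14, k15] at hd
      have h0 : g₄.arr 2 i 0 = 0 := by
        by_contra hne
        rw [show 1 - g₄.arr 2 i 0 = 0 by omega, mul_zero] at hd
        exact lt_irrefl _ hd
      rw [h0, Nat.sub_zero, mul_one] at hd
      obtain ⟨ho, hE⟩ := (key h0).mp hd
      refine (hP₄.enqueue_spec (by omega) k16 hi h0 (Or.inr ⟨fun h => absurd h ho, fun _ =>
        ⟨z, hE, hzM, kz2⟩⟩)).mono ?_
      rintro g₅ t₅ ⟨ht₅, hf₅, k10', hfl₅, hq₅, hP₅⟩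
      refine Wp.nil ⟨by omega, kf.trans (hf₅.mono (by decide) (by decide)) (List.Subset.refl _)
        (List.Subset.refl _), by omega, fun v hv => ?_, fun p hp => ?_, ?_⟩
      · rw [hfl₅]
        split_ifs
        · exact one_ne_zero
        · rw [k2]; exact hfl v hv
      · rw [hq₅ p (by omega), k11, hq p hp]
      · refine hP₅.update_count₃ (by omega) fun _ h1 => ?_
        rw [hfl₅, if_pos rfl] at h1
        omega
    · simp only [Ex.eval_get, Ex.eval_var, Ex.eval_num, Ex.eval_add, Ex.eval_mul,
        Ex.eval_sub, k14, k15] at hd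
      refine Wp.nil (Wp.nil ⟨by omega, kf, by omega, fun v hv => by rw [k2]; exact hfl v hv,
        fun p hp => by rw [k11, hq p hp], ?_⟩)
      refine hP₄.update_count₃ hlt10 fun ho h0 p hp => ?_
      rcases Nat.lt_or_ge p lo with hlt | hge
      · exact hP₄.pull₂ i hi ho h0 p (by rw [hc₃]; exact hlt)
      · obtain rfl : p = lo := by omega
        rw [kq]
        intro hE
        have := (key h0).mpr ⟨ho, hE⟩
        rw [h0, Nat.sub_zero, mul_one] at hd
        exact hd this
  refine Wp.cons (Wp.ite rfl ⟨trivial, trivial, trivial⟩ (fun hd => ?_) (fun hd => ?_))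
  · simp only [Ex.eval_get, Ex.eval_var, Ex.eval_num, g17, g15] at hd
    have hzS := (RowOK.pos_iff (gP.succs i hi) hzM).mp hd
    refine Wp.cons ((eraseElem_spec g17 g15 (gP.succs i hi) hzS).mono ?_)
    rintro g₁ t₁ ⟨ht₁, hf₁, hrow, hsame⟩
    have hP₁ := gP.update_succs (z := z) hi (by rw [hc₁]; exact hz) (by rw [hc₁, g10]; exact hlo) hf₁
      (by decide) (by decide) hrow hsame
    rw [hc₁] at hP₁
    have k17 : g₁.reg 17 = 2 * i := by rw [hf₁.1 17 (by decide), g17]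
    have k16 : g₁.reg 16 = i := by rw [hf₁.1 16 (by decide), g16]
    have k14 : g₁.reg 14 = i := by rw [hf₁.1 14 (by decide), g14]
    have k10 : g₁.reg 10 = h.reg 10 := by rw [hf₁.1 10 (by decide), g10]
    have k2 : g₁.arr 2 = h.arr 2 := by rw [hf₁.2 2 (by decide), ga]
    have k11 : g₁.arr 11 = h.arr 11 := by rw [hf₁.2 11 (by decide), ga]
    have kf : Frame h g₁ [10, 16, 17, 18, 19, 20] [2, 3, 4, 5, 11] :=
      hf.trans (hf₁.mono (by decide) (by decide)) (List.Subset.refl _) (List.Subset.refl _)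
    have hdeg := RowOK.deg_pos (hP₁.succs i hi)
    refine Wp.cons (Wp.ite rfl ⟨⟨⟨trivial, trivial⟩, trivial, trivial⟩, trivial⟩ (fun hd' => ?_)
      (fun hd' => ?_))
    · simp only [Ex.eval_get, Ex.eval_var, Ex.eval_num, Ex.eval_add, k17, k14] at hd'
      have hempty : ∀ x, A.E i x → x < M ∧ g₁.arr 2 x 0 ≠ 0 := by
        intro x hx
        refine ⟨(A.lt i x hx).2, fun h0 => ?_⟩
        have : 0 < g₁.arr 5 (2 * i) 0 := by
          refine hdeg.mpr ⟨x, hzS.1, hx, (A.lt i x hx).2, fun p hp e => ?_⟩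
          have h1 := hP₁.le i
          have := (hP₁.queue.entry p (lt_of_lt_of_le hp h1.1)).2
          simp only [e, h0] at this
          omega
        omega
      refine (hP₁.enqueue_spec (by omega) k16 hi (by omega) (Or.inr ⟨fun _ x hx => hempty x hx,
        fun h => absurd hzS.1 h⟩)).mono ?_
      rintro g₂ t₂ ⟨ht₂, hf₂, k10', hfl₂, hq₂, hP₂⟩
      refine Wp.nil ?_
      refine hmid g₂ _ (by omega) (kf.trans (hf₂.mono (by decide) (by decide)) (List.Subset.refl _)
        (List.Subset.refl _)) (by rw [hf₂.1 16 (by decide), k16]) (by omega) (fun v hv => ?_)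
        (fun p hp => ?_) ?_
      · rw [hfl₂]
        split_ifs
        · exact one_ne_zero
        · rw [k2]; exact hv
      · rw [hq₂ p (by omega), k11]
      · refine hP₂.drop_exception fun _ h1 => ?_
        rw [hfl₂, if_pos rfl] at h1
        omega
    · simp only [Ex.eval_get, Ex.eval_var, Ex.eval_num, Ex.eval_add, k17, k14] at hd'
      refine Wp.nil (Wp.nil ?_)
      refine hmid g₁ _ (by omega) kf k16 (by omega) (fun v hv => by rw [k2]; exact hv)
        (fun p hp => by rw [k11]) (hP₁.drop_exception fun _ h1 => ?_)
      obtain ⟨x, hx⟩ := hdeg.mp (by omega)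
      exact ⟨x, hx.2⟩
  · simp only [Ex.eval_get, Ex.eval_var, Ex.eval_num, g17, g15] at hd
    have hzS := fun hm => hd ((RowOK.pos_iff (gP.succs i hi) hzM).mpr hm)
    refine Wp.nil ?_
    refine hmid g _ (by omega) hf g16 (by omega) (fun v hv => hv) (fun p hp => rfl) ?_
    have hP₁ := gP.update_succs (z := z) hi (by rw [hc₁]; exact hz) (by rw [hc₁, g10]; exact hlo)
      (Frame.refl g [] _) (by decide) (by decide)
      (by rw [Set.sdiff_singleton_eq_self hzS]; exact gP.succs i hi) (fun _ _ => ⟨rfl, rfl, rfl⟩)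
    rw [hc₁] at hP₁
    refine hP₁.drop_exception fun ho h1 => ?_
    obtain ⟨x, hx, hxl⟩ := gP.pull₁ i hi ho h1 (by simp)
    rw [hc₁] at hxl hzS
    refine ⟨x, hx, ?_⟩
    rw [Function.update_self]
    change x ∈ Left M (fun p => h.arr 11 p 0) (lo + 1)
    rw [hleft]
    refine ⟨hxl, fun e => hzS ?_⟩
    rw [Set.mem_singleton_iff] at e
    exact ⟨ho, e ▸ hx, e ▸ hxl⟩

end RamProg

namespace RamProg

open HState

variable {C : Layout}

/-- Process the queue of the dead nodes. -/
def purge : RamProg :=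
  loop (.var 9) (.var 10) (block [asg 15 (.get 11 (.var 9) 0), asg 9 (.var 9 + 1),
    forLt 14 (.var 7) purgeStep])

theorem purge_spec {M : ℕ} {A : Arena M} {h : HState} (hM : 2 * M < C.Bd)
    (hP : PurgeOK A h (fun _ => h.reg 9) (fun _ => h.reg 9) (fun _ => h.reg 9) ∅ ∅)
    (hle : h.reg 9 ≤ h.reg 10) :
    Wp C purge h fun h' t => t ≤ (h'.reg 10 - h.reg 9) * (39 * M + 10) + 1 ∧
      Frame h h' [9, 10, 14, 15, 16, 17, 18, 19, 20] [2, 3, 4, 5, 11] ∧ h'.reg 9 = h'.reg 10 ∧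
      (∀ v, h.arr 2 v 0 ≠ 0 → h'.arr 2 v 0 ≠ 0) ∧
      (∀ p < h.reg 10, h'.arr 11 p 0 = h.arr 11 p 0) ∧ h.reg 10 ≤ h'.reg 10 ∧
      PurgeOK A h' (fun _ => h'.reg 10) (fun _ => h'.reg 10) (fun _ => h'.reg 10) ∅ ∅ := by
  -- Each queue entry is charged `39 * M + 10`. As a node enters the queue at most once, all
  -- removals together take quadratic time.
  refine Wp.loop_ghost (n := (M - h.reg 9) * (39 * M + 10)) (fun n g =>
    n = (M - g.reg 9) * (39 * M + 10) ∧
    Frame h g [9, 10, 14, 15, 16, 17, 18, 19, 20] [2, 3, 4, 5, 11] ∧ h.reg 9 ≤ g.reg 9 ∧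
    g.reg 9 ≤ g.reg 10 ∧ (∀ v, h.arr 2 v 0 ≠ 0 → g.arr 2 v 0 ≠ 0) ∧
    (∀ p < h.reg 10, g.arr 11 p 0 = h.arr 11 p 0) ∧ h.reg 10 ≤ g.reg 10 ∧
    PurgeOK A g (fun _ => g.reg 9) (fun _ => g.reg 9) (fun _ => g.reg 9) ∅ ∅) rfl ?_ ?_ ?_
  · exact ⟨rfl, Frame.refl _ _ _, le_rfl, hle, fun _ h => h, fun _ _ => rfl, le_rfl, hP⟩
  · rintro n g ⟨hn, hf, h9, h910, hfl, hq, h10, hPg⟩ hc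
    simp only [Ex.eval_var] at hc
    set lo := g.reg 9 with hlo
    set z := g.arr 11 lo 0 with hz
    have htl := hPg.queue.tail_le
    refine Wp.of_bounds fun hreg harr => ?_
    refine Wp.cons (Wp.asg rfl ⟨trivial, trivial⟩ (by simpa using harr 11 _ _ (by norm_num)) ?_)
    refine Wp.cons (Wp.asg rfl ⟨trivial, trivial⟩ (by simp; omega) ?_)
    simp only [Ex.eval_get, Ex.eval_var, Ex.eval_num, Ex.eval_add, setReg_reg,
      if_neg (show ¬ (9 = 15) by norm_num), ← hlo, ← hz]
    set g₁ := (g.setReg 15 z).setReg 9 (lo + 1) with hg₁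
    have hfg : Frame g g₁ [9, 15] [] :=
      ((Frame.refl g _ _).setReg (by decide) _).setReg (by decide) _
    have hP₁ : PurgeOK A g₁ (fun _ => lo) (fun _ => lo) (fun _ => lo) ∅ ∅ :=
      hPg.frame hfg (by decide) (by decide) (by decide) (by decide)
    refine Wp.cons (Wp.forLt (n := M) (fun i g' => g'.reg 14 = i ∧
      Frame g₁ g' [10, 14, 16, 17, 18, 19, 20] [2, 3, 4, 5, 11] ∧
      (∀ v, g.arr 2 v 0 ≠ 0 → g'.arr 2 v 0 ≠ 0) ∧
      (∀ p < g.reg 10, g'.arr 11 p 0 = g.arr 11 p 0) ∧ g.reg 10 ≤ g'.reg 10 ∧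
      PurgeOK A g' (fun u => if u < i then lo + 1 else lo) (fun u => if u < i then lo + 1 else lo)
        (fun u => if u < i then lo + 1 else lo) ∅ ∅) (fun _ => 36) rfl (by omega) ?_ ?_ ?_ ?_)
    · rintro i g' ⟨h14, hf', -, -, -, hP'⟩
      exact ⟨h14, hP'.num⟩
    · refine ⟨by simp, (Frame.refl _ _ _).setReg (by decide) _, fun _ h => h, fun _ _ => rfl,
        by simp [hg₁], ?_⟩
      simpa using hP₁.frame ((Frame.refl g₁ [14] []).setReg (x := 14) (by decide) 0) (by decide)
        (by decide) (by decide) (by decide)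
    · rintro i g' hi ⟨h14, hf', hfl', hq', h10', hP'⟩
      have e15 : g'.reg 15 = z := by rw [hf'.1 15 (by decide)]; simp [hg₁]
      refine (purgeStep_spec (i := i) (lo := lo) (z := z) hM hP' hi h14 e15 (by omega)
        (hq' lo hc) (by simp) (by simp) (by simp)).mono ?_
      rintro g₂ t ⟨ht, hf₂, h10₂, hfl₂, hq₂, hP₂⟩
      refine ⟨by rw [hf₂.1 14 (by decide), h14], ⟨by simp, ?_, fun v hv => hfl₂ v (hfl' v hv),
        fun p hp => ?_, ?_, ?_⟩, ht⟩
      · exact (hf'.trans (hf₂.mono (R' := [10, 14, 16, 17, 18, 19, 20]) (by decide)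
          (List.Subset.refl _)) (List.Subset.refl _) (List.Subset.refl _)).setReg (by decide) _
      · exact (hq₂ p (by omega)).trans (hq' p hp)
      · simp only [setReg_reg]
        rw [if_neg (by norm_num)]
        omega
      · have e : ∀ u < M, (if u < i + 1 then lo + 1 else lo) =
            Function.update (fun u => if u < i then lo + 1 else lo) i (lo + 1) u := by
          intro u _
          by_cases hui : u = i
          · subst hui; simp
          · rw [Function.update_of_ne hui]
            have : u < i + 1 ↔ u < i := by omega
            simp only [this]
        refine (hP₂.ext_counts e e e fun u => ?_).frame
          ((Frame.refl g₂ [14] []).setReg (by decide) _) (by decide) (by decide) (by decide)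
          (by decide)
        split_ifs <;> omega
    · rintro g' t ⟨h14, hf', hfl', hq', h10', hP'⟩ ht
      simp only [Finset.sum_const, Finset.card_range, smul_eq_mul] at ht
      have e9 : g'.reg 9 = lo + 1 := by rw [hf'.1 9 (by decide)]; simp [hg₁]
      refine Wp.nil ⟨_, ⟨rfl, ?_, by omega, by omega, fun v hv => hfl' v (hfl v hv),
        fun p hp => (hq' p (by omega)).trans (hq p hp), by omega, ?_⟩, ?_⟩
      · exact (hf.trans (hfg.mono (by decide) (by decide)) (List.Subset.refl _)
          (List.Subset.refl _)).trans (hf'.mono (by decide) (List.Subset.refl _))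
          (List.Subset.refl _) (List.Subset.refl _)
      · rw [e9]
        exact hP'.ext_counts (fun u hu => by simp [hu]) (fun u hu => by simp [hu])
          (fun u hu => by simp [hu]) (fun u => by omega)
      · rw [e9, hn]
        have : M - lo = M - (lo + 1) + 1 := by omega
        rw [this, add_mul]
        omega
  · rintro g t n' ⟨hn, hf, h9, h910, hfl, hq, h10, hPg⟩ hc ht
    simp only [Ex.eval_var, not_lt] at hc
    have heq : g.reg 9 = g.reg 10 := le_antisymm h910 hc
    have htl := hPg.queue.tail_le
    refine ⟨?_, hf, heq, hfl, hq, h10, heq ▸ hPg⟩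
    have : M - h.reg 9 = (M - g.reg 9) + (g.reg 10 - h.reg 9) := by omega
    rw [this, add_mul] at ht
    omega

/-- Add the unflagged alive nodes to the queue of the dead nodes. -/
def seedPurge : RamProg :=
  forLt 13 (.var 7) (ite (.get 2 (.var 13) 0 + .get 7 (.var 13) 0) 1
    (block [asg 16 (.var 13), enqueue 2 11 10]) (block []))

/-- The whole trap is put into `K` beforehand, because its nodes are won together: a node of it need
not be able to force a move to nodes added before it. At the end all of `K` is dead and the
exception is dropped. -/
theorem seedPurge_spec {M : ℕ} {A : Arena M} {h : HState} {c : ℕ → ℕ} (hM : M < C.Bd)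
    (hP : PurgeOK A h c c c {u | u < M ∧ h.arr 2 u 0 = 0 ∧ h.arr 7 u 0 = 0} ∅) :
    Wp C seedPurge h fun h' t => t ≤ 10 * M + 3 ∧ Frame h h' [10, 13, 16] [2, 11] ∧
      (∀ v, h.arr 2 v 0 ≠ 0 → h'.arr 2 v 0 ≠ 0) ∧
      (∀ p < h.reg 10, h'.arr 11 p 0 = h.arr 11 p 0) ∧ h.reg 10 ≤ h'.reg 10 ∧
      (∀ u < M, h.arr 2 u 0 = 0 → h.arr 7 u 0 = 0 → h'.arr 2 u 0 ≠ 0) ∧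
      (h'.reg 10 ≠ h.reg 10 → ∃ u < M, h.arr 2 u 0 = 0 ∧ h.arr 7 u 0 = 0) ∧
      PurgeOK A h' c c c ∅ ∅ := by
  refine Wp.forLt (n := M) (fun i g => g.reg 13 = i ∧ Frame h g [10, 13, 16] [2, 11] ∧
      (∀ v, h.arr 2 v 0 ≠ 0 → g.arr 2 v 0 ≠ 0) ∧
      (∀ p < h.reg 10, g.arr 11 p 0 = h.arr 11 p 0) ∧ h.reg 10 ≤ g.reg 10 ∧
      (∀ u < M, u < i → h.arr 2 u 0 = 0 → h.arr 7 u 0 = 0 → g.arr 2 u 0 ≠ 0) ∧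
      (∀ u < M, i ≤ u → g.arr 2 u 0 = h.arr 2 u 0) ∧
      (g.reg 10 ≠ h.reg 10 → ∃ u < M, h.arr 2 u 0 = 0 ∧ h.arr 7 u 0 = 0) ∧
      PurgeOK A g c c c {u | u < M ∧ h.arr 2 u 0 = 0 ∧ h.arr 7 u 0 = 0} ∅) (fun _ => 7) rfl hM.le
      ?_ ?_ ?_ ?_
  · rintro i g ⟨h13, -, -, -, -, -, -, -, hPg⟩
    exact ⟨h13, hPg.num⟩
  · exact ⟨by simp, (Frame.refl _ _ _).setReg (by decide) _, fun _ h => h, fun _ _ => rfl,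
      by simp, fun u _ hu => absurd hu (Nat.not_lt_zero _), fun _ _ _ => rfl, fun h => absurd rfl h,
      hP.frame ((Frame.refl h [13] []).setReg (by decide) _) (by decide) (by decide) (by decide)
      (by decide)⟩
  · rintro i g hi ⟨h13, hf, hfl, hq, h10, hin, hout, hne, hPg⟩
    have e7 : g.arr 7 = h.arr 7 := hf.2 7 (by decide)
    have e2 := hout i hi le_rfl
    refine Wp.ite rfl ⟨⟨⟨trivial, trivial⟩, trivial, trivial⟩, trivial⟩ (fun hc => ?_) (fun hc => ?_)
    · simp only [Ex.eval_add, Ex.eval_get, Ex.eval_var, Ex.eval_num, h13, e7, e2] at hc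
      refine Wp.cons (Wp.asg rfl trivial (by simp [h13]; omega) ?_)
      simp only [Ex.eval_var, h13]
      have hP₁ : PurgeOK A (g.setReg 16 i) c c c {u | u < M ∧ h.arr 2 u 0 = 0 ∧ h.arr 7 u 0 = 0} ∅ :=
        hPg.frame ((Frame.refl g [16] []).setReg (by decide) _) (by decide) (by decide) (by decide)
          (by decide)
      refine Wp.cons ((hP₁.enqueue_spec (u := i) hM (by simp) hi (by simp only [setReg_arr]; omega)
        (Or.inl ⟨hi, by omega, by omega⟩)).mono ?_)
      rintro g₁ t₁ ⟨ht₁, hf₁, h10₁, hfl₁, hq₁, hP₂⟩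
      simp only [setReg_arr, setReg_reg, if_neg (show ¬ (10 = 16) by norm_num)] at h10₁ hfl₁ hq₁
      refine Wp.nil ⟨?_, ⟨by simp, ?_, fun v hv => ?_, fun p hp => ?_, ?_, fun u hu hui h1 h2 => ?_,
        fun u hu hui => ?_, fun _ => ⟨i, hi, by omega, by omega⟩, ?_⟩, by omega⟩
      · rw [hf₁.1 13 (by decide)]; simpa using h13
      · exact ((hf.setReg (x := 16) (by decide) i).trans (hf₁.mono (R' := [10, 13, 16])
          (by decide) (List.Subset.refl _)) (List.Subset.refl _) (List.Subset.refl _)).setReg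
          (by decide) _
      · simp only [setReg_arr, hfl₁]
        split_ifs
        · exact one_ne_zero
        · exact hfl v hv
      · exact (hq₁ p (by omega)).trans (hq p hp)
      · simp only [setReg_reg]
        rw [if_neg (by norm_num)]
        omega
      · simp only [setReg_arr, hfl₁]
        split_ifs with e
        · exact one_ne_zero
        · exact hin u hu (by omega) h1 h2
      · simp only [setReg_arr, hfl₁]
        rw [if_neg (by omega)]
        exact hout u hu (by omega)
      · exact hP₂.frame ((Frame.refl g₁ [13] []).setReg (by decide) _) (by decide) (by decide)
          (by decide) (by decide)
    · simp only [Ex.eval_add, Ex.eval_get, Ex.eval_var, Ex.eval_num, h13, e7, e2] at hc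
      refine Wp.nil ⟨h13, ⟨by simp, hf.setReg (by decide) _, hfl, hq, by simpa using h10,
        fun u hu hui h1 h2 => ?_, fun u hu hui => hout u hu (by omega), by simpa using hne, ?_⟩, by omega⟩
      · rcases Nat.lt_or_ge u i with hlt | hge
        · exact hin u hu hlt h1 h2
        · obtain rfl : u = i := by omega
          omega
      · exact hPg.frame ((Frame.refl g [13] []).setReg (by decide) _) (by decide) (by decide)
          (by decide) (by decide)
  · rintro g t ⟨h13, hf, hfl, hq, h10, hin, hout, hne, hPg⟩ ht
    simp only [Finset.sum_const, Finset.card_range, smul_eq_mul] at ht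
    have hin' := fun u hu => hin u hu hu
    refine ⟨by omega, hf, hfl, hq, h10, hin', hne, hPg.num, hPg.own, hPg.target, hPg.queue, hPg.le,
      hPg.succs, hPg.preds, hPg.pull₁, hPg.pull₂, ?_⟩
    convert hPg.wins using 1
    rw [Set.union_empty, eq_comm, Set.union_eq_left]
    rintro u ⟨hu, h1, h2⟩
    exact ⟨hu, hin' u hu h1 h2⟩

/-! #### Solving Büchi games -/

/-- There is no trap that is contained, together with the alive predecessors of player two, in a set
with at most `k / 2` elements. -/
def NoTrap {M : ℕ} (A : Arena M) (Al : Set ℕ) (k : ℕ) : Prop :=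
  ∀ (T : Set ℕ) (D : Finset ℕ), EdgeTrap A (fun u y => u ∈ Al ∧ y ∈ Al ∧ A.E u y) T → T ⊆ D →
    (∀ u ∈ Al, ¬ A.own₁ u → ∀ y ∈ T, A.E u y → u ∈ D) → 2 * D.card ≤ k → T = ∅

/-- All alive successors of a player-one node in `T` lie in `T`, and all alive player-two
predecessors of a node in `T` lie in `D`. Hence the rows holding the edges that matter for `T` have
at most `D.card` entries, and the trap survives the restriction to low edges. -/
theorem EdgeTrap.low {M k : ℕ} {A : Arena M} {Al T : Set ℕ} {h : HState} (hA : ArenaIn A h Al)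
    (hT : EdgeTrap A (fun u y => u ∈ Al ∧ y ∈ Al ∧ A.E u y) T) {D : Finset ℕ} (hTD : T ⊆ D)
    (hD : ∀ u ∈ Al, ¬ A.own₁ u → ∀ y ∈ T, A.E u y → u ∈ D) (hk : D.card ≤ k) :
    EdgeTrap A (Low A (fun ρ => h.arr 5 ρ 0) k Al) T := by
  intro u hu
  obtain ⟨h1, ⟨y, hy⟩, h3, h4⟩ := hT u hu
  have huM := hA.alive_lt u hy.1
  by_cases ho : A.own₁ u
  · have hdeg : h.arr 5 (2 * u) 0 ≤ k :=
      (RowOK.deg_le (hA.succs u huM) D fun x hx => hTD (h3 ho x ⟨hy.1, hx.2.2, hx.2.1⟩)).trans hk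
    exact ⟨h1, ⟨y, hy.1, hy.2.1, hy.2.2, Or.inl ⟨ho, hdeg⟩⟩,
      fun _ x hx => h3 ho x ⟨hx.1, hx.2.1, hx.2.2.1⟩, fun hn => absurd ho hn⟩
  · obtain ⟨y, hyT, hy⟩ := h4 ho
    have hyM := hA.alive_lt y hy.2.1
    have hdeg : h.arr 5 (2 * y + 1) 0 ≤ k :=
      (RowOK.deg_le (hA.preds y hyM) D fun x hx => hD x hx.2.2 hx.1 y hyT hx.2.1).trans hk
    have hlow : Low A (fun ρ => h.arr 5 ρ 0) k Al u y := ⟨hy.1, hy.2.1, hy.2.2, Or.inr ⟨ho, hdeg⟩⟩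
    exact ⟨h1, ⟨y, hlow⟩, fun hn => absurd hn ho, fun _ => ⟨y, hyT, hlow⟩⟩

/-- Solve the Büchi game in memory. -/
def solveLoop : RamProg := block [asg 8 1, loop (.var 8) (2 * .var 7) (block [levelTest, seedPurge,
  ite (.var 9) (.var 10) (block [purge, asg 8 1]) (block [asg 8 (.var 8 + .var 8)])])]

theorem solveLoop_spec {M : ℕ} {A : Arena M} {h : HState} (hB : 4 * (M + 1) * (M + 1) < C.Bd)
    (hP : PurgeOK A h (fun _ => h.reg 10) (fun _ => h.reg 10) (fun _ => h.reg 10) ∅ ∅)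
    (h910 : h.reg 9 = h.reg 10) :
    Wp C solveLoop h fun h' t => t ≤ 2000 * ((M + 1) * (M + 1)) ∧
      Frame h h' [8, 9, 10, 11, 12, 13, 14, 15, 16, 17, 18, 19, 20] [2, 3, 4, 5, 6, 7, 8, 9, 10, 11] ∧
      (∃ ρ, BuchiCert A.own₁ A.E A.B {u | u < M ∧ h'.arr 2 u 0 = 0} ρ) ∧
      WinsCoBuchi A.own₁ A.E A.B {u | u < M ∧ h'.arr 2 u 0 ≠ 0} := by
  have hBe : 4 * (M + 1) * (M + 1) = 4 * (M * M) + 8 * M + 4 := by ring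
  have hle : M ≤ M * M := Nat.le_mul_self M
  refine Wp.cons (Wp.asg rfl trivial (by simp; omega) ?_)
  refine Wp.cons (Wp.loop (fun g => 0 < g.reg 8 ∧ g.reg 8 ≤ 4 * M + 1 ∧
    Frame h g [8, 9, 10, 11, 12, 13, 14, 15, 16, 17, 18, 19, 20] [2, 3, 4, 5, 6, 7, 8, 9, 10, 11] ∧
    g.reg 9 = g.reg 10 ∧
    PurgeOK A g (fun _ => g.reg 10) (fun _ => g.reg 10) (fun _ => g.reg 10) ∅ ∅ ∧
    NoTrap A {u | u < M ∧ g.arr 2 u 0 = 0} (g.reg 8))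
    -- An unsuccessful test at level `k` is paid by the doubling of `k` in the second term. After a
    -- successful one `k` falls back to 1, but more than `k / 2` nodes have died, and the drop of
    -- the first term pays for this, for the test and for the removals.
    (fun g => 900 * (M * (M - g.reg 10)) + 180 * (M * (4 * M + 1 - g.reg 8))) rfl ?_ ?_ ?_)
  · refine ⟨by simp, by simp, (Frame.refl _ _ _).setReg (by decide) _, by simpa using h910,
      ?_, fun T D hT hTD hD hk => ?_⟩
    · exact hP.frame ((Frame.refl h [8] []).setReg (by decide) _) (by decide) (by decide) (by decide)
        (by decide)
    · simp at hk
      have : D.card = 0 := by omega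
      rw [Finset.card_eq_zero] at this
      subst this
      simpa using hTD
  · rintro g ⟨hk0, hk, hf, h9, hPg, hNo⟩ hc
    simp only [Ex.eval_mul, Ex.eval_num, Ex.eval_var, hPg.num] at hc
    set k := g.reg 8 with hkdef
    set Al := {u | u < M ∧ g.arr 2 u 0 = 0} with hAl
    have hAg : ArenaIn A g Al := hPg.arenaIn (fun _ _ => rfl) (fun _ _ => rfl)
    have hkB : 2 * (M + 1) * (k + 1) < C.Bd := by
      have : 2 * (M + 1) * (k + 1) ≤ 2 * (M + 1) * (2 * M) := Nat.mul_le_mul_left _ hc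
      have e : 2 * (M + 1) * (2 * M) = 4 * (M * M) + 4 * M := by ring
      omega
    refine Wp.cons ((levelTest_spec hAg rfl hkB).mono ?_)
    rintro g₁ t₁ ⟨ht₁, hf₁, hT, hmax⟩
    rw [← hkdef] at ht₁ hT hmax
    have e2 : g₁.arr 2 = g.arr 2 := hf₁.2 2 (by decide)
    have e11 : g₁.arr 11 = g.arr 11 := hf₁.2 11 (by decide)
    have e10 : g₁.reg 10 = g.reg 10 := hf₁.1 10 (by decide)
    have e9 : g₁.reg 9 = g.reg 9 := hf₁.1 9 (by decide)
    have e8 : g₁.reg 8 = k := hf₁.1 8 (by decide)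
    set T := {u | u ∈ Al ∧ g₁.arr 7 u 0 = 0} with hTdef
    have hTset : {u | u < M ∧ g₁.arr 2 u 0 = 0 ∧ g₁.arr 7 u 0 = 0} = T := by
      ext u
      simp only [hTdef, hAl, e2, Set.mem_ofPred_eq, and_assoc]
    -- A trap for the low edges is a trap for all edges: a node of player one in it has some low
    -- edge, so its whole row is low, and its dead successors are won by player two anyway.
    have hwins : WinsCoBuchi A.own₁ A.E A.B ({u | u < M ∧ g.arr 2 u 0 ≠ 0} ∪ T) := by
      have hw := hPg.wins
      rw [Set.union_empty] at hw
      refine hw.union fun u hu => ?_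
      obtain ⟨h1, ⟨y, hy⟩, h3, h4⟩ := hT u hu
      refine ⟨h1, fun ho x hx => ?_, fun ho => ?_⟩
      · have hxM := (A.lt u x hx).2
        by_cases hx0 : g.arr 2 x 0 = 0
        · refine Or.inr (h3 ho x ⟨hy.1, ⟨hxM, hx0⟩, hx, Or.inl ⟨ho, ?_⟩⟩)
          rcases hy.2.2.2 with h5 | h5
          · exact h5.2
          · exact absurd ho h5.1
        · exact Or.inl ⟨hxM, hx0⟩
      · obtain ⟨y, hyT, hy⟩ := h4 ho
        exact ⟨y, hy.2.2.1, Or.inr hyT⟩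
    have hP₁' := hPg.frame hf₁ (by decide) (by decide) (by decide) (by decide)
    have hP₁ : PurgeOK A g₁ (fun _ => g.reg 10) (fun _ => g.reg 10) (fun _ => g.reg 10)
        {u | u < M ∧ g₁.arr 2 u 0 = 0 ∧ g₁.arr 7 u 0 = 0} ∅ := by
      refine ⟨hP₁'.num, hP₁'.own, hP₁'.target, hP₁'.queue, hP₁'.le, hP₁'.succs, hP₁'.preds,
        hP₁'.pull₁, hP₁'.pull₂, ?_⟩
      rw [hTset, e2]
      exact hwins
    have hMB : M < C.Bd := by omega
    refine Wp.cons ((seedPurge_spec hMB hP₁).mono ?_)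
    rintro g₂ t₂ ⟨ht₂, hf₂, hfl₂, hq₂, h10₂, hseed, hne₂, hP₂⟩
    rw [e10] at h10₂ hq₂ hne₂
    have f9 : g₂.reg 9 = g.reg 10 := by rw [hf₂.1 9 (by decide), e9, h9]
    have f8 : g₂.reg 8 = k := by rw [hf₂.1 8 (by decide), e8]
    have hfr₂ : Frame h g₂ [8, 9, 10, 11, 12, 13, 14, 15, 16, 17, 18, 19, 20]
        [2, 3, 4, 5, 6, 7, 8, 9, 10, 11] :=
      (hf.trans (hf₁.mono (by decide) (by decide)) (List.Subset.refl _) (List.Subset.refl _)).trans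
        (hf₂.mono (by decide) (by decide)) (List.Subset.refl _) (List.Subset.refl _)
    have htl := hPg.queue.tail_le
    have hkM : M ≤ k * M := Nat.le_mul_of_pos_left _ hk0
    have hM1 : 1 ≤ k * M := Nat.mul_pos hk0 (by omega)
    have hcomm : M * k = k * M := Nat.mul_comm _ _
    refine Wp.cons (Wp.ite rfl ⟨trivial, trivial⟩ (fun hd => ?_) (fun hd => ?_))
    · simp only [Ex.eval_var, f9] at hd
      refine Wp.cons ((purge_spec (A := A) (by omega) (by rw [f9]; exact hP₂) (by omega)).mono ?_)
      rintro g₃ t₃ ⟨ht₃, hf₃, h9₃, hfl₃, hq₃, h10₃, hP₃⟩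
      rw [f9] at ht₃
      refine Wp.cons (Wp.asg rfl trivial (by simp; omega) (Wp.nil (Wp.nil ?_)))
      simp only [Ex.eval_num, setReg_reg, setReg_arr, if_true,
        if_neg (show ¬ (9 = 8) by norm_num), if_neg (show ¬ (10 = 8) by norm_num)]
      have htl₃ := hP₃.queue.tail_le
      -- Let `D` be the nodes that have just died. It contains the trap and, thanks to `pull₂`, the
      -- alive player-two predecessors of the trap. With at most `k / 2` elements it would
      -- contradict the absence of such traps that earlier levels have established.
      have hrem : k < 2 * (g₃.reg 10 - g.reg 10) := by
        by_contra hcon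
        push Not at hcon
        set D := (Finset.Ico (g.reg 10) (g₃.reg 10)).image (fun p => g₃.arr 11 p 0) with hDdef
        have hDc : 2 * D.card ≤ k := by
          have : D.card ≤ g₃.reg 10 - g.reg 10 := by
            refine Finset.card_image_le.trans ?_
            simp
          omega
        have hmemD : ∀ u < M, g.arr 2 u 0 = 0 → g₃.arr 2 u 0 ≠ 0 → u ∈ D := by
          intro u hu h0 h1
          obtain ⟨p, hp, hpe⟩ := hP₃.queue.cover u hu h1
          refine Finset.mem_image.mpr ⟨p, Finset.mem_Ico.mpr ⟨?_, hp⟩, hpe⟩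
          by_contra hlt
          push Not at hlt
          have h2 := (hPg.queue.entry p hlt).2
          rw [hq₃ p (by omega), hq₂ p hlt, e11] at hpe
          rw [hpe] at h2
          omega
        have hTdead : ∀ u ∈ T, g₃.arr 2 u 0 ≠ 0 := fun u hu =>
          hfl₃ u (hseed u hu.1.1 (by rw [e2]; exact hu.1.2) hu.2)
        have hTe := hNo T D (fun u hu => ?_) (fun u hu => hmemD u hu.1.1 hu.1.2 (hTdead u hu))
          (fun u hu ho y hy hE => ?_) hDc
        · obtain ⟨u, hu, h1, h2⟩ := hne₂ (by omega)
          have : u ∈ T := ⟨⟨hu, e2 ▸ h1⟩, h2⟩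
          rw [hTe] at this
          exact this
        · obtain ⟨h1, ⟨y, hy⟩, h3, h4⟩ := hT u hu
          refine ⟨h1, ⟨y, hy.1, hy.2.1, hy.2.2.1⟩, fun ho x hx => h3 ho x ⟨hx.1, hx.2.1, hx.2.2, ?_⟩,
            fun ho => ?_⟩
          · refine Or.inl ⟨ho, ?_⟩
            rcases hy.2.2.2 with h5 | h5
            · exact h5.2
            · exact absurd ho h5.1
          · obtain ⟨y, hyT, hy⟩ := h4 ho
            exact ⟨y, hyT, hy.1, hy.2.1, hy.2.2.1⟩
        · refine hmemD u hu.1 hu.2 fun h0 => ?_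
          obtain ⟨p, hp, hpe⟩ := hP₃.queue.cover y hy.1.1 (hTdead y hy)
          have := hP₃.pull₂ u hu.1 ho h0 p hp
          rw [hpe] at this
          exact this hE
      refine ⟨⟨one_pos, by omega, ?_, h9₃, ?_, fun T' D hT' hTD hD hk' => ?_⟩, ?_⟩
      · exact (hfr₂.trans (hf₃.mono (by decide) (by decide)) (List.Subset.refl _)
          (List.Subset.refl _)).setReg (by decide) _
      · exact hP₃.frame ((Frame.refl g₃ [8] []).setReg (by decide) _) (by decide) (by decide)
          (by decide) (by decide)
      · have : D.card = 0 := by omega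
        rw [Finset.card_eq_zero] at this
        subst this
        simpa using hTD
      · obtain ⟨r, hr⟩ : ∃ r, g₃.reg 10 = g.reg 10 + r := ⟨g₃.reg 10 - g.reg 10, by omega⟩
        have a1 : M - g.reg 10 = (M - g₃.reg 10) + r := by omega
        have a2 : 4 * M + 1 - 1 + 1 = (4 * M + 1 - k) + k := by omega
        have a3 : M * (4 * M + 1 - 1) + M = M * (4 * M + 1 - k) + M * k := by
          rw [← mul_add, ← a2, mul_add, mul_one]
        have a4 : M * (M - g.reg 10) = M * (M - g₃.reg 10) + M * r := by rw [a1, mul_add]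
        have a5 : k * M + M ≤ 2 * (M * r) := by
          have : (k + 1) * M ≤ (2 * r) * M := Nat.mul_le_mul_right _ (by omega)
          have e : (2 * r) * M = 2 * (M * r) := by ring
          rw [e, add_mul, one_mul] at this
          exact this
        have a6 : (g₃.reg 10 - g.reg 10) * (39 * M + 10) = 39 * (M * r) + 10 * r := by
          rw [show g₃.reg 10 - g.reg 10 = r by omega]; ring
        have a7 : r ≤ M * r := Nat.le_mul_of_pos_left _ (by omega)
        rw [a6] at ht₃
        rw [a4]
        omega
    · simp only [Ex.eval_var, f9, not_lt] at hd
      have heq : g₂.reg 10 = g.reg 10 := le_antisymm hd h10₂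
      refine Wp.cons (Wp.asg rfl ⟨trivial, trivial⟩ (by simp [f8]; omega) (Wp.nil (Wp.nil ?_)))
      simp only [Ex.eval_add, Ex.eval_var, setReg_reg, setReg_arr, if_true, f8, f9,
        if_neg (show ¬ (9 = 8) by norm_num), if_neg (show ¬ (10 = 8) by norm_num), heq]
      have hflag : ∀ u < M, g₂.arr 2 u 0 = 0 ↔ g.arr 2 u 0 = 0 := by
        intro u hu
        refine ⟨fun h0 => ?_, fun h0 => ?_⟩
        · by_contra hne
          exact hfl₂ u (by rw [e2]; exact hne) h0
        · by_contra hne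
          obtain ⟨p, hp, hpe⟩ := hP₂.queue.cover u hu hne
          rw [hq₂ p (by omega), e11] at hpe
          have h2 := (hPg.queue.entry p (by omega)).2
          simp only [hpe] at h2
          omega
      have hAl₂ : {u | u < M ∧ g₂.arr 2 u 0 = 0} = Al := by
        ext u
        exact and_congr_right fun hu => hflag u hu
      have hTe : ∀ u, u ∉ T := fun u hu => hseed u hu.1.1 (by rw [e2]; exact hu.1.2) hu.2
        ((hflag u hu.1.1).mpr hu.1.2)
      refine ⟨⟨by omega, by omega, hfr₂.setReg (by decide) _, trivial, ?_,
        fun T' D hT' hTD hD hk' => ?_⟩, ?_⟩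
      · exact hP₂.frame ((Frame.refl g₂ [8] []).setReg (by decide) _) (by decide) (by decide)
          (by decide) (by decide)
      · rw [hAl₂] at hT' hD
        -- A trap within `(k + k) / 2` nodes would be visible among the low edges of level `k`,
        -- whose test found nothing.
        have hlow := hT'.low hAg hTD hD (k := k) (by omega)
        refine Set.eq_empty_iff_forall_notMem.mpr fun u hu => hTe u ⟨?_, hmax T' hlow u hu⟩
        obtain ⟨-, ⟨y, hy⟩, -⟩ := hT' u hu
        exact hy.1
      · have a2 : 4 * M + 1 - k = (4 * M + 1 - (k + k)) + k := by omega
        have a3 : M * (4 * M + 1 - k) = M * (4 * M + 1 - (k + k)) + M * k := by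
          rw [← mul_add, ← a2]
        rw [a3]
        omega
  · rintro g t ⟨hk0, hk, hf, h9, hPg, hNo⟩ hc ht
    simp only [Ex.eval_mul, Ex.eval_num, Ex.eval_var, hPg.num, not_lt] at hc
    set Al := {u | u < M ∧ g.arr 2 u 0 = 0} with hAl
    have hw := hPg.wins
    rw [Set.union_empty] at hw
    have hall₂ : ∀ u ∈ Al, ¬ A.own₁ u → ∀ x, A.E u x → x ∈ Al := by
      intro u hu ho x hx
      refine ⟨(A.lt u x hx).2, ?_⟩
      by_contra hne
      obtain ⟨p, hp, hpe⟩ := hPg.queue.cover x (A.lt u x hx).2 hne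
      exact hPg.pull₂ u hu.1 ho hu.2 p hp (hpe ▸ hx)
    have hall₁ : ∀ u ∈ Al, A.own₁ u → ∃ x, A.E u x ∧ x ∈ Al := by
      intro u hu ho
      obtain ⟨x, hx, hxl⟩ := hPg.pull₁ u hu.1 ho hu.2 (by simp)
      refine ⟨x, hx, hxl.1, ?_⟩
      by_contra hne
      obtain ⟨p, hp, hpe⟩ := hPg.queue.cover x hxl.1 hne
      exact hxl.2 p hp hpe
    refine Wp.nil ⟨?_, hf, ?_, hw⟩
    · simp only [setReg_reg, if_true, if_neg (show ¬ (10 = 8) by norm_num), Ex.eval_num] at ht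
      have b1 : M * (M - h.reg 10) ≤ M * M := Nat.mul_le_mul_left _ (Nat.sub_le _ _)
      have b2 : M * (4 * M + 1 - 1) = 4 * (M * M) := by
        rw [Nat.add_sub_cancel]; ring
      have b3 : (M + 1) * (M + 1) = M * M + 2 * M + 1 := by ring
      rw [b2] at ht
      omega
    -- With `2 * M ≤ k` every set of nodes is small, so no trap is left among the alive nodes. They
    -- are closed under the moves of player two and player one can stay in them.
    · refine exists_buchiCert ((Set.finite_lt_nat M).subset fun u hu => hu.1)
        (fun u hu => ⟨hall₁ u hu, hall₂ u hu⟩) fun T hTA hT => ?_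
      refine hNo T (Finset.range M) (fun u hu => ?_) (fun u hu => by simpa using (hTA hu).1.1)
        (fun u hu _ _ _ _ => by simpa using hu.1) (by simpa using hc)
      obtain ⟨huA, huB⟩ := hTA hu
      obtain ⟨h1, h2⟩ := hT hu
      have key : ∀ x, x ∈ Al → x ∈ Alᶜ ∪ T → x ∈ T := fun x hx h => h.resolve_left fun hn => hn hx
      refine ⟨huB, ?_, fun ho x hx => key x hx.2.1 (h1 ho x hx.2.2), fun ho => ?_⟩
      · by_cases ho : A.own₁ u
        · obtain ⟨x, hx, hxl⟩ := hall₁ u huA ho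
          exact ⟨x, huA, hxl, hx⟩
        · obtain ⟨x, hx, -⟩ := h2 ho
          exact ⟨x, huA, hall₂ u huA ho x hx, hx⟩
      · obtain ⟨x, hx, hxT⟩ := h2 ho
        have hxA := hall₂ u huA ho x hx
        exact ⟨x, key x hxA hxT, huA, hxA, hx⟩

end RamProg

/-! ### The product game on numbers -/

namespace RamProg

open HState GameStructure

/-- The arena on the numbers below `M` that is isomorphic to the given game along `e`. -/
def Arena.ofEquiv {Q : Type*} {M : ℕ} (e : Q ≃ Fin M) (own₁ : Q → Prop) (E : Q → Q → Prop)
    (B : Set Q) (hE : ∀ q, ∃ x, E q x) : Arena M where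
  own₁ u := ∃ q, (e q : ℕ) = u ∧ own₁ q
  E u x := ∃ q y, (e q : ℕ) = u ∧ (e y : ℕ) = x ∧ E q y
  B := {u | ∃ q ∈ B, (e q : ℕ) = u}
  lt := by
    rintro u x ⟨q, y, rfl, rfl, -⟩
    exact ⟨(e q).2, (e y).2⟩
  exists_succ u hu := by
    obtain ⟨y, hy⟩ := hE (e.symm ⟨u, hu⟩)
    exact ⟨_, _, y, by simp, rfl, hy⟩

section Transfer

variable {Q : Type*} {M : ℕ} (e : Q ≃ Fin M) {own₁ : Q → Prop} {E : Q → Q → Prop} {B : Set Q}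
  (hE : ∀ q, ∃ x, E q x)

theorem val_equiv_inj {q y : Q} : (e q : ℕ) = e y ↔ q = y := by
  rw [Fin.val_inj, e.apply_eq_iff_eq]

theorem Arena.own₁_ofEquiv (q : Q) : (Arena.ofEquiv e own₁ E B hE).own₁ (e q) ↔ own₁ q :=
  ⟨fun ⟨_, hy, ho⟩ => (val_equiv_inj e).mp hy ▸ ho, fun h => ⟨q, rfl, h⟩⟩

theorem Arena.edge_ofEquiv (q : Q) (x : ℕ) :
    (Arena.ofEquiv e own₁ E B hE).E (e q) x ↔ ∃ y, (e y : ℕ) = x ∧ E q y :=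
  ⟨fun ⟨_, y, hq, hy, h⟩ => ⟨y, hy, (val_equiv_inj e).mp hq ▸ h⟩, fun ⟨y, hy, h⟩ => ⟨q, y, rfl, hy, h⟩⟩

theorem Arena.target_ofEquiv (q : Q) : (e q : ℕ) ∈ (Arena.ofEquiv e own₁ E B hE).B ↔ q ∈ B :=
  ⟨fun ⟨_, hy, h⟩ => (val_equiv_inj e).mp h ▸ hy, fun h => ⟨q, h, rfl⟩⟩

/-- Only nodes in the range of `e` occur as successors, so an implication from `X` to `Y` along `e`
is enough; this carries certificates on numbers back to the product. -/
theorem cpre₁_ofEquiv {X : Set ℕ} {Y : Set Q} {q : Q} (h : ∀ y, (e y : ℕ) ∈ X → y ∈ Y)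
    (hq : (e q : ℕ) ∈ CPre₁ (Arena.ofEquiv e own₁ E B hE).own₁ (Arena.ofEquiv e own₁ E B hE).E X) :
    q ∈ CPre₁ own₁ E Y := by
  refine ⟨fun ho => ?_, fun ho y hy => ?_⟩
  · obtain ⟨x, hx, hX⟩ := hq.1 ((Arena.own₁_ofEquiv e hE q).mpr ho)
    obtain ⟨y, rfl, hy⟩ := (Arena.edge_ofEquiv e hE q x).mp hx
    exact ⟨y, hy, h y hX⟩
  · exact h y (hq.2 (fun hn => ho ((Arena.own₁_ofEquiv e hE q).mp hn)) _
      ((Arena.edge_ofEquiv e hE q _).mpr ⟨y, rfl, hy⟩))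

theorem cpre₂_ofEquiv {X : Set ℕ} {Y : Set Q} {q : Q} (h : ∀ y, (e y : ℕ) ∈ X → y ∈ Y)
    (hq : (e q : ℕ) ∈ CPre₂ (Arena.ofEquiv e own₁ E B hE).own₁ (Arena.ofEquiv e own₁ E B hE).E X) :
    q ∈ CPre₂ own₁ E Y := by
  refine ⟨fun ho y hy => ?_, fun ho => ?_⟩
  · exact h y (hq.1 ((Arena.own₁_ofEquiv e hE q).mpr ho) _
      ((Arena.edge_ofEquiv e hE q _).mpr ⟨y, rfl, hy⟩))
  · obtain ⟨x, hx, hX⟩ := hq.2 (fun hn => ho ((Arena.own₁_ofEquiv e hE q).mp hn))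
    obtain ⟨y, rfl, hy⟩ := (Arena.edge_ofEquiv e hE q x).mp hx
    exact ⟨y, hy, h y hX⟩

theorem buchiSolution_ofEquiv {Al : Set ℕ} {D : Set ℕ} (hD : ∀ u < M, u ∈ D ↔ u ∉ Al)
    (h₁ : ∃ ρ, BuchiCert (Arena.ofEquiv e own₁ E B hE).own₁ (Arena.ofEquiv e own₁ E B hE).E
      (Arena.ofEquiv e own₁ E B hE).B Al ρ)
    (h₂ : WinsCoBuchi (Arena.ofEquiv e own₁ E B hE).own₁ (Arena.ofEquiv e own₁ E B hE).E
      (Arena.ofEquiv e own₁ E B hE).B D) :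
    BuchiSolution own₁ E B {q | (e q : ℕ) ∈ Al} := by
  obtain ⟨ρ, hρ⟩ := h₁
  obtain ⟨κ, -, hκ, -⟩ := h₂
  refine ⟨⟨fun q => ρ (e q), fun q hq => ?_⟩, fun q => κ (e q), fun q hq => ?_⟩
  · refine cpre₁_ofEquiv e hE ?_ (hρ _ hq)
    rintro y ⟨h1, h2⟩
    exact ⟨h1, fun h => h2 fun hn => h ((Arena.target_ofEquiv e hE q).mp hn)⟩
  · refine cpre₂_ofEquiv e hE ?_ (hκ _ ((hD _ (e q).2).mpr hq))
    rintro y ⟨h1, h2, h3⟩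
    exact ⟨(hD _ (e y).2).mp h1, h2, fun h => h3 ((Arena.target_ofEquiv e hE q).mpr h)⟩

end Transfer

/-! #### Numbers of the nodes of the product -/

section Codes

variable {N r : ℕ}

/-- The number of a set of pending requests. -/
def setCode (S : Fin r → Fin 2) : ℕ := finFunctionFinEquiv S

theorem setCode_lt (S : Fin r → Fin 2) : setCode S < 2 ^ r := (finFunctionFinEquiv S).2

theorem setCode_eq_sum (S : Fin r → Fin 2) : setCode S = ∑ i, (S i : ℕ) * 2 ^ (i : ℕ) :=
  finFunctionFinEquiv_apply S

theorem setCode_bit (S : Fin r → Fin 2) (i : Fin r) : setCode S / 2 ^ (i : ℕ) % 2 = S i := by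
  conv_rhs => rw [← finFunctionFinEquiv.symm_apply_apply S]
  rfl

/-- The numbering of the nodes of the product. -/
def nodeEquiv (N r : ℕ) : RRNode (Fin N) r ≃ Fin (N * (2 ^ r * r)) :=
  ((Equiv.refl _).prodCongr ((finFunctionFinEquiv.prodCongr (Equiv.refl _)).trans
    finProdFinEquiv)).trans finProdFinEquiv

theorem nodeEquiv_val (q : RRNode (Fin N) r) :
    (nodeEquiv N r q : ℕ) = q.2.2 + r * (setCode q.2.1 + 2 ^ r * q.1) := by
  have : (nodeEquiv N r q : ℕ) = (q.2.2 + r * setCode q.2.1) + 2 ^ r * r * q.1 := rfl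
  rw [this]
  ring

theorem nodeEquiv_div (q : RRNode (Fin N) r) :
    (nodeEquiv N r q : ℕ) / r = setCode q.2.1 + 2 ^ r * q.1 := by
  rw [nodeEquiv_val, Nat.add_mul_div_left _ _ (Fin.pos q.2.2), Nat.div_eq_of_lt q.2.2.2, zero_add]

theorem nodeEquiv_div_div (q : RRNode (Fin N) r) : (nodeEquiv N r q : ℕ) / r / 2 ^ r = q.1 := by
  rw [nodeEquiv_div, Nat.add_mul_div_left _ _ (Nat.two_pow_pos r),
    Nat.div_eq_of_lt (setCode_lt _), zero_add]

end Codes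

end RamProg

/-! ### The product game in memory -/

namespace RamProg

open HState GameStructure

variable {C : Layout} {N : ℕ} {G : MultiGame (Fin N)}

/-- The input is the description of the game `G`. -/
structure InputIn (C : Layout) (G : MultiGame (Fin N)) : Prop where
  base : C.base = N + N * N + G.n * N
  owner : ∀ v : Fin N, (G.owner v = .one → C.inp v = 0) ∧ (G.owner v ≠ .one → C.inp v = 1)
  edge : ∀ v w : Fin N, 0 < C.inp (N + v * N + w) ↔ G.E v w
  prio : ∀ (m : Fin G.n) (v : Fin N), C.inp (N + N * N + m * N + v) = G.p m v

/-- The parameters of the product are stored in the variables 5 to 7, the powers of two in array 13,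
and the changes of the pending requests at the vertices in array 12. -/
structure TablesIn (h : HState) (G : MultiGame (Fin N)) : Prop where
  vertices : h.reg 0 = N
  requests : h.reg 5 = G.r
  sets : h.reg 6 = 2 ^ G.r
  nodes : h.reg 7 = N * (2 ^ G.r * G.r)
  powers : ∀ i < G.r, h.arr 13 i 0 = 2 ^ i
  table : ∀ (w : Fin N) (S : Fin G.r → Fin 2),
    h.arr 12 w (setCode S) = setCode (pendingAt G.rq G.rp w S)

theorem TablesIn.frame {h h' : HState} (hT : TablesIn h G) {R As : List ℕ} (hf : Frame h h' R As)
    (hR : ∀ x < 8, x ∉ R) (h12 : 12 ∉ As) (h13 : 13 ∉ As) : TablesIn h' G := by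
  have e := fun x hx => hf.1 x (hR x hx)
  refine ⟨(e 0 (by norm_num)).trans hT.vertices, (e 5 (by norm_num)).trans hT.requests,
    (e 6 (by norm_num)).trans hT.sets, (e 7 (by norm_num)).trans hT.nodes, ?_, ?_⟩
  · rw [hf.2 13 h13]; exact hT.powers
  · rw [hf.2 12 h12]; exact hT.table

/-- The edges of the relation `F` are stored in the rows. -/
def EdgesIn (M : ℕ) (own₁ : ℕ → Prop) (F : ℕ → ℕ → Prop) (h : HState) : Prop :=
  ∀ y < M, RowIn M h (2 * y) {x | own₁ y ∧ F y x} ∧ RowIn M h (2 * y + 1) {x | ¬ own₁ x ∧ F x y}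

theorem EdgesIn.frame {M : ℕ} {own₁ : ℕ → Prop} {F : ℕ → ℕ → Prop} {h h' : HState}
    (hE : EdgesIn M own₁ F h) {R As : List ℕ} (hf : Frame h h' R As) (h3 : 3 ∉ As) (h4 : 4 ∉ As)
    (h5 : 5 ∉ As) : EdgesIn M own₁ F h' := by
  intro y hy
  unfold RowIn
  rw [hf.2 3 h3, hf.2 4 h4, hf.2 5 h5]
  exact hE y hy

theorem EdgesIn.congr {M : ℕ} {own₁ : ℕ → Prop} {F F' : ℕ → ℕ → Prop} {h : HState}
    (hE : EdgesIn M own₁ F h) (hF : ∀ x y, F x y ↔ F' x y) : EdgesIn M own₁ F' h := by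
  have : F = F' := by
    funext x y; exact propext (hF x y)
  exact this ▸ hE

theorem RowIn.of_same {M ρ ρ' : ℕ} {h h' : HState} {S S' : Set ℕ} (hS : RowIn M h ρ S)
    (hsame : SameRows h h' ρ') (hne : ρ ≠ ρ') (hSS : ∀ x, x ∈ S' ↔ x ∈ S) : RowIn M h' ρ S' := by
  obtain ⟨a3, a4, a5⟩ := hsame ρ hne
  unfold RowIn
  rw [a3, a4, a5, Set.ext hSS]
  exact hS

/-- Store the edge from the node in variable 13, with owner in variable 25, to that in variable 29. -/
def addEdge : RamProg := ite (.var 25) 1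
  (block [asg 15 (.var 29), asg 17 (2 * .var 13), insertElem])
  (block [asg 15 (.var 13), asg 17 (2 * .var 29 + 1), insertElem])

theorem addEdge_spec {M u x : ℕ} {own₁ : ℕ → Prop} {F : ℕ → ℕ → Prop} {h : HState}
    (hM : 2 * M < C.Bd) (hE : EdgesIn M own₁ F h) (h13 : h.reg 13 = u) (h29 : h.reg 29 = x)
    (hu : u < M) (hx : x < M) (ho : own₁ u ↔ h.reg 25 < 1) :
    Wp C addEdge h fun h' t => t ≤ 10 ∧ Frame h h' [15, 17, 18] [3, 4, 5] ∧
      EdgesIn M own₁ (fun y z => F y z ∨ (y = u ∧ z = x)) h' := by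
  refine Wp.ite rfl ⟨trivial, trivial⟩ (fun hc => ?_) (fun hc => ?_)
  · have hu₁ := ho.mpr hc
    refine Wp.cons (Wp.asg rfl trivial (by simp [h29]; omega) ?_)
    refine Wp.cons (Wp.asg rfl ⟨trivial, trivial⟩ (by simp [h13]; omega) ?_)
    simp only [Ex.eval_var, Ex.eval_num, Ex.eval_mul, setReg_reg,
      if_neg (show ¬ (13 = 15) by norm_num), h13, h29]
    have hE₁ := hE.frame (((Frame.refl h [15, 17] []).setReg (x := 15) (by decide) x).setReg (x := 17)
      (by decide) (2 * u)) (by decide) (by decide) (by decide)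
    refine Wp.cons ((insertElem_spec (by omega) (ρ := 2 * u) (z := x) (by simp) (by simp)
      (hE₁ u hu).1 hx).mono ?_)
    rintro g t ⟨ht, hf, hrow, hsame⟩
    refine Wp.nil ⟨by omega, ?_, fun y hy => ⟨?_, ?_⟩⟩
    · exact (((Frame.refl h [15, 17, 18] [3, 4, 5]).setReg (by decide) _).setReg (by decide) _).trans
        (hf.mono (by decide) (List.Subset.refl _)) (List.Subset.refl _) (List.Subset.refl _)
    · by_cases hyu : y = u
      · subst hyu
        convert hrow using 1
        ext z
        simp only [Set.mem_ofPred_eq, Set.mem_insert_iff]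
        tauto
      · refine RowIn.of_same ((hE₁ y hy).1) hsame (by omega) fun z => ?_
        simp [hyu]
    · refine RowIn.of_same ((hE₁ y hy).2) hsame (by omega) fun z => ?_
      simp only [Set.mem_ofPred_eq]
      refine and_congr_right fun hz => or_iff_left fun h => hz (h.1 ▸ hu₁)
  · have hu₁ := fun h => hc (ho.mp h)
    refine Wp.cons (Wp.asg rfl trivial (by simp [h13]; omega) ?_)
    refine Wp.cons (Wp.asg rfl ⟨⟨trivial, trivial⟩, trivial⟩ (by simp [h29]; omega) ?_)
    simp only [Ex.eval_var, Ex.eval_num, Ex.eval_mul, Ex.eval_add, setReg_reg,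
      if_neg (show ¬ (29 = 15) by norm_num), h13, h29]
    have hE₁ := hE.frame (((Frame.refl h [15, 17] []).setReg (x := 15) (by decide) u).setReg (x := 17)
      (by decide) (2 * x + 1)) (by decide) (by decide) (by decide)
    refine Wp.cons ((insertElem_spec (by omega) (ρ := 2 * x + 1) (z := u) (by simp) (by simp)
      (hE₁ x hx).2 hu).mono ?_)
    rintro g t ⟨ht, hf, hrow, hsame⟩
    refine Wp.nil ⟨by omega, ?_, fun y hy => ⟨?_, ?_⟩⟩
    · exact (((Frame.refl h [15, 17, 18] [3, 4, 5]).setReg (by decide) _).setReg (by decide) _).trans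
        (hf.mono (by decide) (List.Subset.refl _)) (List.Subset.refl _) (List.Subset.refl _)
    · refine RowIn.of_same ((hE₁ y hy).1) hsame (by omega) fun z => ?_
      simp only [Set.mem_ofPred_eq]
      refine and_congr_right fun hz => or_iff_left fun h => hu₁ (h.1 ▸ hz)
    · by_cases hyx : y = x
      · subst hyx
        convert hrow using 1
        ext z
        simp only [Set.mem_ofPred_eq, Set.mem_insert_iff]
        constructor
        · rintro ⟨h1, h2 | h2⟩
          · exact Or.inr ⟨h1, h2⟩
          · exact Or.inl h2.1
        · rintro (rfl | h2)
          · exact ⟨hu₁, Or.inr (by simp)⟩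
          · exact ⟨h2.1, Or.inl h2.2⟩
      · refine RowIn.of_same ((hE₁ y hy).2) hsame (by omega) fun z => ?_
        simp [hyx]

/-- Forget the old arena. -/
def clearArena : RamProg := block [asg 9 0, asg 10 0, forLt 13 (.var 7) (block [put 2 (.var 13) 0 0,
  put 5 (2 * .var 13) 0 0, put 5 (2 * .var 13 + 1) 0 0, forLt 14 (.var 7) (block [
    put 4 (2 * .var 13) (.var 14) 0, put 4 (2 * .var 13 + 1) (.var 14) 0])])]

/-- The undirect game stores a new arena in every round, so old rows have to go. Resetting all
places costs `O(M ^ 2)`, which is within the budget of one solution. -/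
theorem clearArena_spec {M : ℕ} {h : HState} (own₁ : ℕ → Prop) (h7 : h.reg 7 = M) (hM : M ≤ C.Bd) :
    Wp C clearArena h fun h' t => t ≤ 6 * (M * M) + 12 * M + 6 ∧
      Frame h h' [9, 10, 13, 14] [2, 4, 5] ∧ h'.reg 9 = 0 ∧ h'.reg 10 = 0 ∧
      (∀ u < M, h'.arr 2 u 0 = 0) ∧ EdgesIn M own₁ (fun _ _ => False) h' := by
  refine Wp.cons (Wp.asg rfl trivial (by simp) ?_)
  refine Wp.cons (Wp.asg rfl trivial (by simp) ?_)
  refine Wp.cons (Wp.forLt (n := M) (fun i g => g.reg 13 = i ∧ Frame h g [9, 10, 13, 14] [2, 4, 5] ∧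
    g.reg 9 = 0 ∧ g.reg 10 = 0 ∧ ∀ u < i, g.arr 2 u 0 = 0 ∧ g.arr 5 (2 * u) 0 = 0 ∧
      g.arr 5 (2 * u + 1) 0 = 0 ∧ ∀ x < M, g.arr 4 (2 * u) x = 0 ∧ g.arr 4 (2 * u + 1) x = 0)
    (fun _ => 6 * M + 7) rfl hM ?_ ?_ ?_ ?_)
  · rintro i g ⟨h1, h2, -⟩
    exact ⟨h1, by simp [h2.1 7 (by decide), h7]⟩
  · refine ⟨by simp, ?_, by simp, by simp, fun u hu => absurd hu (Nat.not_lt_zero _)⟩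
    exact (((Frame.refl _ _ _).setReg (by decide) _).setReg (by decide) _).setReg (by decide) _
  · rintro i g hi ⟨h13, hf, h9, h10, hz⟩
    refine Wp.cons (Wp.put rfl (by simp) ?_)
    refine Wp.cons (Wp.put rfl (by simp) ?_)
    refine Wp.cons (Wp.put rfl (by simp) ?_)
    simp only [Ex.eval_var, Ex.eval_num, Ex.eval_mul, Ex.eval_add, setArr_reg, h13]
    set g₁ := ((g.setArr 2 i 0 0).setArr 5 (2 * i) 0 0).setArr 5 (2 * i + 1) 0 0 with hg₁
    refine Wp.cons (Wp.forLt (n := M) (fun x g' => g'.reg 14 = x ∧ Frame g₁ g' [14] [4] ∧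
      (∀ y < x, g'.arr 4 (2 * i) y = 0 ∧ g'.arr 4 (2 * i + 1) y = 0) ∧
      ∀ u < i, g'.arr 4 (2 * u) = g.arr 4 (2 * u) ∧ g'.arr 4 (2 * u + 1) = g.arr 4 (2 * u + 1))
      (fun _ => 3) rfl hM ?_ ?_ ?_ ?_)
    · rintro x g' ⟨h1, h2, -⟩
      refine ⟨h1, ?_⟩
      have : g₁.reg 7 = M := by
        simp [hg₁, hf.1 7 (by decide), h7]
      simp [h2.1 7 (by decide), this]
    · refine ⟨by simp, (Frame.refl _ _ _).setReg (by decide) _,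
        fun u hu => absurd hu (Nat.not_lt_zero _), fun u _ => ?_⟩
      simp [hg₁]
    · rintro x g' hx ⟨h14, hf', hz', hsame⟩
      have e13 : g'.reg 13 = i := by rw [hf'.1 13 (by decide)]; simp [hg₁, h13]
      refine Wp.cons (Wp.put rfl (by simp) ?_)
      refine Wp.cons (Wp.put rfl (by simp) ?_)
      simp only [Ex.eval_var, Ex.eval_num, Ex.eval_mul, Ex.eval_add, setArr_reg, e13, h14]
      refine Wp.nil ⟨by simpa using h14, ⟨by simp, ?_, fun y hy => ?_, fun u hu => ?_⟩, by omega⟩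
      · exact ((hf'.setArr (by decide) _ _ _).setArr (by decide) _ _ _).setReg (by decide) _
      · have := hz' y
        simp only [setReg_arr, setArr_arr, if_true, update₂_apply]
        by_cases hyx : y = x
        · simp [hyx]
        · simpa [hyx] using this (by omega)
      · have e1 : 2 * u ≠ 2 * i := by omega
        have e2 : 2 * u ≠ 2 * i + 1 := by omega
        have e3 : 2 * u + 1 ≠ 2 * i := by omega
        have e4 : 2 * u + 1 ≠ 2 * i + 1 := by omega
        simp only [setReg_arr, setArr_arr, if_true, update₂_row, if_neg e1, if_neg e2, if_neg e3,
          if_neg e4]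
        exact hsame u hu
    · rintro g' t ⟨h14, hf', hz', hsame⟩ ht
      simp only [Finset.sum_const, Finset.card_range, smul_eq_mul] at ht
      have e := fun x (hx : x ∉ [14]) => hf'.1 x hx
      refine Wp.nil ⟨by rw [e 13 (by decide)]; simpa [hg₁] using h13, ⟨by simp, ?_, ?_, ?_,
        fun u hu => ?_⟩, by omega⟩
      · exact ((((hf.setArr (by decide) _ _ _).setArr (by decide) _ _ _).setArr (by decide) _ _ _).trans
          (hf'.mono (by decide) (by decide)) (List.Subset.refl _) (List.Subset.refl _)).setReg
          (by decide) _
      · simp [e 9 (by decide), hg₁, h9]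
      · simp [e 10 (by decide), hg₁, h10]
      · simp only [setReg_arr, hf'.2 2 (by decide), hf'.2 5 (by decide)]
        by_cases hui : u = i
        · subst hui
          refine ⟨by simp [hg₁, update₂_apply], by simp [hg₁, update₂_apply],
            by simp [hg₁, update₂_apply], fun x hx => hz' x hx⟩
        · obtain ⟨a1, a2, a3, a4⟩ := hz u (by omega)
          obtain ⟨b1, b2⟩ := hsame u (by omega)
          have e1 : 2 * u ≠ 2 * i + 1 := by omega
          have e2 : 2 * u + 1 ≠ 2 * i := by omega
          rw [b1, b2]
          refine ⟨by simp [hg₁, update₂_apply, hui, a1], by simp [hg₁, update₂_apply, hui, a2, e1],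
            by simp [hg₁, update₂_apply, hui, a3, e2], a4⟩
  · rintro g t ⟨h13, hf, h9, h10, hz⟩ ht
    simp only [Finset.sum_const, Finset.card_range, smul_eq_mul] at ht
    have e : M * (6 * M + 7 + 3) = 6 * (M * M) + 10 * M := by ring
    refine Wp.nil ⟨by omega, hf, h9, h10, fun u hu => (hz u hu).1, fun y hy => ⟨?_, ?_⟩⟩
    · obtain ⟨-, a2, a3, a4⟩ := hz y hy
      unfold RowIn
      rw [a2]
      simpa using RowOK.empty M _ fun x hx => (a4 x hx).1
    · obtain ⟨-, a2, a3, a4⟩ := hz y hy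
      unfold RowIn
      rw [a3]
      simpa using RowOK.empty M _ fun x hx => (a4 x hx).2

end RamProg

namespace RamProg

open HState GameStructure

variable {C : Layout} {N : ℕ} {G : MultiGame (Fin N)} [NeZero G.r]

theorem exists_productEdge {r : ℕ} [NeZero r] {V : Type*} {Rq Rp : Fin r → Set V}
    {G : GameStructure V} (W : Set V) (q : RRNode V r) : ∃ x, ProductEdge Rq Rp G W q x := by
  by_cases hq : q.1 ∈ W
  · exact ⟨q, Or.inl ⟨hq, rfl⟩⟩
  · obtain ⟨w, hw⟩ := G.no_deadlock q.1
    exact ⟨_, Or.inr ⟨hq, w, hw, rfl⟩⟩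

/-- The product game on numbers. -/
def productArena (G : MultiGame (Fin N)) [NeZero G.r] (W : Set (Fin N)) :
    Arena (N * (2 ^ G.r * G.r)) :=
  Arena.ofEquiv (nodeEquiv N G.r) (fun q => G.owner q.1 = .one)
    (ProductEdge G.rq G.rp G.toGameStructure W) (productTarget W) (exists_productEdge W)

/-- Compute the vertex, the pending requests, the awaited request and its bit, the owner and the next
awaited request of the node in variable 13. -/
def decodeNode : RamProg := block [
  asg 21 (.var 13 / .var 5),
  asg 22 (.var 13 - .var 5 * .var 21),
  asg 23 (.var 21 / .var 6),
  asg 24 (.var 21 - .var 6 * .var 23),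
  asg 25 (.word (.var 23)),
  asg 26 (.var 24 / .get 13 (.var 22) 0),
  asg 26 (.var 26 - 2 * (.var 26 / 2)),
  asg 27 (.var 22),
  ite (.var 26) 1 (ite (.var 22 + 1) (.var 5) (asg 27 (.var 22 + 1)) (asg 27 0)) (block [])]

theorem decodeNode_spec {h : HState} (hI : InputIn C G) (hT : TablesIn h G)
    (hM : 2 * (N * (2 ^ G.r * G.r)) < C.Bd) (q : RRNode (Fin N) G.r)
    (h13 : h.reg 13 = nodeEquiv N G.r q) :
    Wp C decodeNode h fun h' t => t ≤ 14 ∧ Frame h h' [21, 22, 23, 24, 25, 26, 27] [] ∧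
      h'.reg 23 = q.1 ∧ h'.reg 24 = setCode q.2.1 ∧
      (G.owner q.1 = .one → h'.reg 25 = 0) ∧ (G.owner q.1 ≠ .one → h'.reg 25 = 1) ∧
      h'.reg 26 = q.2.1 q.2.2 ∧ h'.reg 27 = nextAwaited q.2.1 q.2.2 := by
  have hlt := (nodeEquiv N G.r q).2
  have hdiv := nodeEquiv_div q
  have hdd := nodeEquiv_div_div q
  have hval := nodeEquiv_val q
  set u := (nodeEquiv N G.r q : ℕ) with hu
  have hS := setCode_lt q.2.1
  have hi := q.2.2.2
  have hv := q.1.2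
  have hle1 : u / G.r ≤ u := Nat.div_le_self _ _
  have hle2 : u / G.r / 2 ^ G.r ≤ u / G.r := Nat.div_le_self _ _
  -- The number of a node is `i + r * (S + 2 ^ r * v)`; its digits are recovered by division, a
  -- remainder being the number minus divisor times quotient.
  have e1 : u - G.r * (u / G.r) = q.2.2 := by
    rw [hdiv]; omega
  have e2 : u / G.r - 2 ^ G.r * (u / G.r / 2 ^ G.r) = setCode q.2.1 := by
    rw [hdd, hdiv]; omega
  have hw : (q.1 : ℕ) < C.base := by rw [hI.base]; omega
  have hinp : C.inp q.1 ≤ C.Bd := C.inp_le _ hw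
  have hbit := setCode_bit q.2.1 q.2.2
  have e3 : setCode q.2.1 / 2 ^ (q.2.2 : ℕ) - 2 * (setCode q.2.1 / 2 ^ (q.2.2 : ℕ) / 2) = q.2.1 q.2.2 := by
    rw [← hbit]; omega
  have hle3 : setCode q.2.1 / 2 ^ (q.2.2 : ℕ) ≤ setCode q.2.1 := Nat.div_le_self _ _
  have hle4 : (q.2.1 q.2.2 : ℕ) < 2 := (q.2.1 q.2.2).2
  have hle5 : setCode q.2.1 ≤ u := by omega
  have hle6 : (q.2.2 : ℕ) ≤ u := by omega
  refine Wp.cons (Wp.asg rfl ⟨trivial, trivial⟩ (by simp [h13, hT.requests]; omega) ?_)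
  simp only [Ex.eval_div, Ex.eval_var, h13, hT.requests]
  refine Wp.cons (Wp.asg rfl ⟨trivial, trivial, trivial⟩ (by simp [h13, hT.requests, e1]; omega) ?_)
  simp only [Ex.eval_sub, Ex.eval_mul, Ex.eval_var, setReg_reg, if_true,
    if_neg (show ¬ (13 = 21) by norm_num), if_neg (show ¬ (5 = 21) by norm_num), h13, hT.requests, e1]
  refine Wp.cons (Wp.asg rfl ⟨trivial, trivial⟩ (by simp [hT.sets]; omega) ?_)
  simp only [Ex.eval_div, Ex.eval_var, setReg_reg, if_true,
    if_neg (show ¬ (21 = 22) by norm_num), if_neg (show ¬ (6 = 22) by norm_num),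
    if_neg (show ¬ (6 = 21) by norm_num), hT.sets, hdd]
  refine Wp.cons (Wp.asg rfl ⟨trivial, trivial, trivial⟩ ?_ ?_)
  · simp [hT.sets]; omega
  simp only [Ex.eval_sub, Ex.eval_mul, Ex.eval_var, setReg_reg, if_true,
    if_neg (show ¬ (21 = 22) by norm_num), if_neg (show ¬ (6 = 22) by norm_num),
    if_neg (show ¬ (6 = 21) by norm_num), if_neg (show ¬ (6 = 23) by norm_num),
    if_neg (show ¬ (21 = 23) by norm_num), hT.sets]
  rw [← hdd, e2, hdd]
  refine Wp.cons (Wp.asg rfl ⟨trivial, by simpa using hw⟩ (by simpa using hinp) ?_)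
  refine Wp.cons (Wp.asg rfl ⟨trivial, trivial, trivial⟩ ?_ ?_)
  · simp [hT.powers _ hi]; omega
  simp only [Ex.eval_div, Ex.eval_word, Ex.eval_get, Ex.eval_var, Ex.eval_num, setReg_reg, setReg_arr, if_true,
    if_neg (show ¬ (23 = 24) by norm_num), if_neg (show ¬ (24 = 25) by norm_num),
    if_neg (show ¬ (22 = 25) by norm_num), if_neg (show ¬ (22 = 24) by norm_num),
    if_neg (show ¬ (22 = 23) by norm_num), hT.powers _ hi]
  refine Wp.cons (Wp.asg rfl ⟨trivial, trivial, trivial, trivial⟩ ?_ ?_)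
  · simp [e3]; omega
  simp only [Ex.eval_div, Ex.eval_sub, Ex.eval_mul, Ex.eval_var, Ex.eval_num, setReg_reg, if_true, e3]
  refine Wp.cons (Wp.asg rfl trivial (by simp; omega) ?_)
  simp only [Ex.eval_var, setReg_reg, if_true, if_neg (show ¬ (22 = 26) by norm_num),
    if_neg (show ¬ (22 = 25) by norm_num), if_neg (show ¬ (22 = 24) by norm_num),
    if_neg (show ¬ (22 = 23) by norm_num)]
  set g := ((((((((h.setReg 21 (u / G.r)).setReg 22 q.2.2).setReg 23 q.1).setReg 24
    (setCode q.2.1)).setReg 25 (C.inp q.1)).setReg 26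
    (setCode q.2.1 / 2 ^ (q.2.2 : ℕ))).setReg 26 (q.2.1 q.2.2)).setReg 27 q.2.2) with hg
  have hf : Frame h g [21, 22, 23, 24, 25, 26, 27] [] :=
    ((((((((Frame.refl h _ _).setReg (by decide) _).setReg (by decide) _).setReg (by decide) _).setReg
      (by decide) _).setReg (by decide) _).setReg (by decide) _).setReg (by decide) _).setReg
      (by decide) _
  have g22 : g.reg 22 = q.2.2 := by simp [hg]
  have g26 : g.reg 26 = q.2.1 q.2.2 := by simp [hg]
  have g5 : g.reg 5 = G.r := by simp [hg, hT.requests]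
  have fin : ∀ g' : HState, Frame g g' [27] [] → g'.reg 27 = nextAwaited q.2.1 q.2.2 → ∀ t ≤ 13,
      1 + t ≤ 14 ∧ Frame h g' [21, 22, 23, 24, 25, 26, 27] [] ∧
      g'.reg 23 = q.1 ∧ g'.reg 24 = setCode q.2.1 ∧
      (G.owner q.1 = .one → g'.reg 25 = 0) ∧ (G.owner q.1 ≠ .one → g'.reg 25 = 1) ∧
      g'.reg 26 = q.2.1 q.2.2 ∧ g'.reg 27 = nextAwaited q.2.1 q.2.2 := by
    intro g' hf' h27 t ht
    refine ⟨by omega, hf.trans (hf'.mono (by decide) (List.Subset.refl _)) (List.Subset.refl _)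
      (List.Subset.refl _), ?_, ?_, ?_, ?_, ?_, h27⟩
    · rw [hf'.1 23 (by decide)]; simp [hg]
    · rw [hf'.1 24 (by decide)]; simp [hg]
    · rw [hf'.1 25 (by decide)]
      simpa [hg] using (hI.owner q.1).1
    · rw [hf'.1 25 (by decide)]
      simpa [hg] using (hI.owner q.1).2
    · rw [hf'.1 26 (by decide)]; simp [hg]
  have hnext0 : ¬ ((q.2.1 q.2.2 : ℕ) < 1) → nextAwaited q.2.1 q.2.2 = q.2.2 := by
    intro hc
    unfold nextAwaited
    rw [if_neg]
    intro h0
    rw [h0] at hc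
    simp at hc
  have hnext1 : (q.2.1 q.2.2 : ℕ) < 1 → nextAwaited q.2.1 q.2.2 = q.2.2 + 1 := by
    intro hc
    unfold nextAwaited
    rw [if_pos]
    apply Fin.ext
    simp
    omega
  have hsucc : ((q.2.2 + 1 : Fin G.r) : ℕ) = if (q.2.2 : ℕ) + 1 < G.r then (q.2.2 : ℕ) + 1 else 0 := by
    rw [Fin.val_add, Fin.val_one', Nat.add_mod_mod]
    split_ifs with hc
    · exact Nat.mod_eq_of_lt hc
    · rw [show (q.2.2 : ℕ) + 1 = G.r by omega, Nat.mod_self]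
  refine Wp.cons (Wp.ite rfl ⟨trivial, trivial⟩ (fun hc => ?_) (fun hc => ?_))
  · simp only [Ex.eval_var, Ex.eval_num, g26] at hc
    rw [hnext1 hc, hsucc] at fin
    refine Wp.ite rfl ⟨⟨trivial, trivial⟩, trivial⟩ (fun hd => ?_) (fun hd => ?_)
    · simp only [Ex.eval_add, Ex.eval_var, Ex.eval_num, g22, g5] at hd
      rw [if_pos hd] at fin
      refine Wp.asg rfl ⟨trivial, trivial⟩ (by simp [g22]; omega) (Wp.nil ?_)
      rw [hnext1 hc, hsucc, if_pos hd]
      exact fin _ ((Frame.refl g _ _).setReg (by decide) _) (by simp [g22]) _ (by norm_num)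
    · simp only [Ex.eval_add, Ex.eval_var, Ex.eval_num, g22, g5] at hd
      rw [if_neg hd] at fin
      refine Wp.asg rfl trivial (by simp) (Wp.nil ?_)
      rw [hnext1 hc, hsucc, if_neg hd]
      exact fin _ ((Frame.refl g _ _).setReg (by decide) _) (by simp) _ (by norm_num)
  · simp only [Ex.eval_var, Ex.eval_num, g26] at hc
    refine Wp.nil (Wp.nil ?_)
    exact fin g (Frame.refl _ _ _) (by rw [hnext0 hc]; simp [hg]) _ (by norm_num)

end RamProg

namespace RamProg

open HState GameStructure

variable {C : Layout} {N : ℕ} {G : MultiGame (Fin N)} [NeZero G.r]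

/-- The set `W` is stored in array 14. -/
def MarkIn (h : HState) (W : Set (Fin N)) : Prop :=
  ∀ v : Fin N, (v ∈ W → h.arr 14 v 0 = 1) ∧ (v ∉ W → h.arr 14 v 0 = 0)

/-- Store the owner, the target bit and the outgoing edges of the node in variable 13. -/
def fillNode : RamProg := block [decodeNode, put 0 (.var 13) 0 (.var 25),
  ite (.get 14 (.var 23) 0) 1
    (block [put 1 (.var 13) 0 (1 - .var 26), forLt 28 (.var 0)
      (ite 0 (.word (.var 0 + .var 23 * .var 0 + .var 28)) (block [
        asg 29 (.var 27 + .var 5 * (.get 12 (.var 28) (.var 24) + .var 6 * .var 28)), addEdge])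
        (block []))])
    (block [put 1 (.var 13) 0 1, asg 29 (.var 13), addEdge])]

theorem fillNode_spec {h : HState} {W : Set (Fin N)} (hI : InputIn C G) (hT : TablesIn h G)
    (hW : MarkIn h W) (hM : 2 * (N * (2 ^ G.r * G.r)) < C.Bd) (q : RRNode (Fin N) G.r)
    (h13 : h.reg 13 = nodeEquiv N G.r q)
    (hE : EdgesIn (N * (2 ^ G.r * G.r)) (productArena G W).own₁
      (fun y x => y < nodeEquiv N G.r q ∧ (productArena G W).E y x) h) :
    Wp C fillNode h fun h' t => t ≤ 16 * N + 33 ∧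
      Frame h h' [15, 17, 18, 21, 22, 23, 24, 25, 26, 27, 28, 29] [0, 1, 3, 4, 5] ∧
      (∀ y, y ≠ (nodeEquiv N G.r q : ℕ) → h'.arr 0 y 0 = h.arr 0 y 0 ∧ h'.arr 1 y 0 = h.arr 1 y 0) ∧
      (G.owner q.1 = .one → h'.arr 0 (nodeEquiv N G.r q) 0 = 0) ∧
      (G.owner q.1 ≠ .one → h'.arr 0 (nodeEquiv N G.r q) 0 = 1) ∧
      (q ∈ productTarget W → h'.arr 1 (nodeEquiv N G.r q) 0 = 1) ∧
      (q ∉ productTarget W → h'.arr 1 (nodeEquiv N G.r q) 0 = 0) ∧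
      EdgesIn (N * (2 ^ G.r * G.r)) (productArena G W).own₁
        (fun y x => y < (nodeEquiv N G.r q : ℕ) + 1 ∧ (productArena G W).E y x) h' := by
  have hedge := Arena.edge_ofEquiv (nodeEquiv N G.r) (own₁ := fun q => G.owner q.1 = .one)
    (B := productTarget W) (exists_productEdge (Rq := G.rq) (Rp := G.rp) (G := G.toGameStructure) W) q
  have hown := Arena.own₁_ofEquiv (nodeEquiv N G.r) (own₁ := fun q => G.owner q.1 = .one)
    (B := productTarget W) (exists_productEdge (Rq := G.rq) (Rp := G.rp) (G := G.toGameStructure) W) q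
  change ∀ x, (productArena G W).E (nodeEquiv N G.r q) x ↔ _ at hedge
  change (productArena G W).own₁ (nodeEquiv N G.r q) ↔ _ at hown
  have hlt := (nodeEquiv N G.r q).2
  set u := (nodeEquiv N G.r q : ℕ) with hu
  set M := N * (2 ^ G.r * G.r) with hMdef
  refine Wp.cons ((decodeNode_spec hI hT hM q h13).mono ?_)
  rintro g t₀ ⟨ht₀, hf, e23, e24, e25, e25', e26, e27⟩
  have g13 : g.reg 13 = u := by rw [hf.1 13 (by decide), h13]
  refine Wp.of_bounds fun hreg harr => ?_
  refine Wp.cons (Wp.put rfl (by simpa using hreg 25 (by norm_num)) ?_)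
  simp only [Ex.eval_var, Ex.eval_num, g13]
  set g₁ := g.setArr 0 u 0 (g.reg 25) with hg₁
  have hf₁ : Frame h g₁ [15, 17, 18, 21, 22, 23, 24, 25, 26, 27, 28, 29] [0, 1, 3, 4, 5] :=
    (hf.mono (by decide) (by decide)).setArr (by decide) _ _ _
  have hE₁ : EdgesIn M (productArena G W).own₁ (fun y x => y < u ∧ (productArena G W).E y x) g₁ :=
    hE.frame ((hf.mono (R' := [21, 22, 23, 24, 25, 26, 27]) (A' := [0]) (by decide)
      (by decide)).setArr (by decide) _ _ _) (by decide) (by decide) (by decide)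
  have hT₁ : TablesIn g₁ G := hT.frame hf₁ (by decide) (by decide) (by decide)
  have hown' : (productArena G W).own₁ u ↔ g.reg 25 < 1 := by
    rw [hown]
    by_cases ho : G.owner q.1 = .one
    · simp [ho, e25 ho]
    · simp [ho, e25' ho]
  have g14 : g₁.arr 14 = h.arr 14 := hf₁.2 14 (by decide)
  have hbit := (q.2.1 q.2.2).2
  -- Common end of the two cases, a vertex outside or inside `W`; `b` is the Büchi bit of the node.
  have finish : ∀ b : ℕ, b ≤ 1 → (q ∈ productTarget W → b = 1) → (q ∉ productTarget W → b = 0) →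
      ∀ g' : HState, ∀ t', t' ≤ 16 * N + 17 → Frame (g₁.setArr 1 u 0 b) g' [15, 17, 18, 28, 29] [3, 4, 5] →
      EdgesIn M (productArena G W).own₁ (fun y x => y < u + 1 ∧ (productArena G W).E y x) g' →
      t₀ + (1 + (t' + 1)) ≤ 16 * N + 33 ∧
      Frame h g' [15, 17, 18, 21, 22, 23, 24, 25, 26, 27, 28, 29] [0, 1, 3, 4, 5] ∧
      (∀ y, y ≠ u → g'.arr 0 y 0 = h.arr 0 y 0 ∧ g'.arr 1 y 0 = h.arr 1 y 0) ∧
      (G.owner q.1 = .one → g'.arr 0 u 0 = 0) ∧ (G.owner q.1 ≠ .one → g'.arr 0 u 0 = 1) ∧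
      (q ∈ productTarget W → g'.arr 1 u 0 = 1) ∧ (q ∉ productTarget W → g'.arr 1 u 0 = 0) ∧
      EdgesIn M (productArena G W).own₁ (fun y x => y < u + 1 ∧ (productArena G W).E y x) g' := by
    intro b hb hb1 hb0 g' t' ht' hf' hE'
    have a0 : g'.arr 0 = update₂ (g.arr 0) u 0 (g.reg 25) := by
      rw [hf'.2 0 (by decide)]; simp [hg₁]
    have a1 : g'.arr 1 = update₂ (g.arr 1) u 0 b := by
      rw [hf'.2 1 (by decide)]; simp [hg₁]
    refine ⟨by omega, (hf₁.setArr (by decide) _ _ _).trans (hf'.mono (by decide) (by decide))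
      (List.Subset.refl _) (List.Subset.refl _), fun y hy => ?_, fun ho => ?_, fun ho => ?_,
      fun ho => ?_, fun ho => ?_, hE'⟩
    · rw [a0, a1, hf.2 0 (by decide), hf.2 1 (by decide)]
      simp [update₂_apply, hy]
    · rw [a0]; simp [update₂_apply, e25 ho]
    · rw [a0]; simp [update₂_apply, e25' ho]
    · rw [a1]; simp [update₂_apply, hb1 ho]
    · rw [a1]; simp [update₂_apply, hb0 ho]
  refine Wp.cons (Wp.ite rfl ⟨⟨trivial, trivial⟩, trivial⟩ (fun hc => ?_) (fun hc => ?_))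
  · simp only [Ex.eval_get, Ex.eval_var, Ex.eval_num, g14] at hc
    have e23' : g₁.reg 23 = q.1 := by simpa [hg₁] using e23
    rw [e23'] at hc
    have hqW : q.1 ∉ W := fun h => by rw [(hW q.1).1 h] at hc; omega
    refine Wp.cons (Wp.put rfl (by simp; omega) ?_)
    have e26' : g₁.reg 26 = q.2.1 q.2.2 := by simpa [hg₁] using e26
    have e13' : g₁.reg 13 = u := by simpa [hg₁] using g13
    simp only [Ex.eval_sub, Ex.eval_var, Ex.eval_num, e26', e13']
    set g₂ := g₁.setArr 1 u 0 (1 - (q.2.1 q.2.2 : ℕ)) with hg₂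
    have hT₂ : TablesIn g₂ G := hT₁.frame ((Frame.refl g₁ [] [1]).setArr (by decide) _ _ _)
      (by decide) (by decide) (by decide)
    have hE₂ : EdgesIn M (productArena G W).own₁ (fun y x => y < u ∧ (productArena G W).E y x) g₂ :=
      hE₁.frame ((Frame.refl g₁ [] [1]).setArr (by decide) _ _ _) (by decide) (by decide) (by decide)
    have hNM : N ≤ M := Nat.le_mul_of_pos_right _ (Nat.mul_pos (Nat.two_pow_pos _)
      (Nat.pos_of_ne_zero (NeZero.ne _)))
    refine Wp.cons (Wp.forLt (n := N) (fun i g' => g'.reg 28 = i ∧ Frame g₂ g' [15, 17, 18, 28, 29] [3, 4, 5] ∧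
      EdgesIn M (productArena G W).own₁ (fun y x => (y < u ∧ (productArena G W).E y x) ∨
        (y = u ∧ ∃ w : Fin N, (w : ℕ) < i ∧ G.E q.1 w ∧ x = nodeEquiv N G.r (rrSucc G.rq G.rp q w))) g')
      (fun _ => 13) rfl (by omega) ?_ ?_ ?_ ?_)
    · rintro i g' ⟨h1, h2, -⟩
      exact ⟨h1, by simp [h2.1 0 (by decide), hT₂.vertices]⟩
    · refine ⟨by simp, (Frame.refl _ _ _).setReg (by decide) _, ?_⟩
      refine (hE₂.frame ((Frame.refl g₂ [28] []).setReg (by decide) _) (by decide) (by decide)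
        (by decide)).congr fun x y => ?_
      simp
    · rintro i g' hi ⟨h28, hf', hE'⟩
      have hT' : TablesIn g' G := hT₂.frame hf' (by decide) (by decide) (by decide)
      have k23 : g'.reg 23 = q.1 := by rw [hf'.1 23 (by decide)]; simpa [hg₂] using e23'
      have k24 : g'.reg 24 = setCode q.2.1 := by
        rw [hf'.1 24 (by decide)]; simpa [hg₂, hg₁] using e24
      have k27 : g'.reg 27 = nextAwaited q.2.1 q.2.2 := by
        rw [hf'.1 27 (by decide)]; simpa [hg₂, hg₁] using e27
      have k25 : g'.reg 25 = g.reg 25 := by rw [hf'.1 25 (by decide)]; simp [hg₂, hg₁]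
      have k13 : g'.reg 13 = u := by rw [hf'.1 13 (by decide)]; simpa [hg₂] using e13'
      have haddr : N + q.1 * N + i < C.base := by
        rw [hI.base]
        have : ((q.1 : ℕ) + 1) * N ≤ N * N := Nat.mul_le_mul_right _ q.1.2
        rw [add_mul, one_mul] at this
        omega
      have hedge' := hI.edge q.1 ⟨i, hi⟩
      simp only at hedge'
      have hstep : ∀ w : Fin N, ((w : ℕ) < i + 1 ↔ (w : ℕ) < i ∨ w = ⟨i, hi⟩) := by
        intro w
        rw [Fin.ext_iff]
        simp only
        omega
      refine Wp.ite rfl ⟨trivial, ⟨⟨trivial, trivial, trivial⟩, trivial⟩, ?_⟩ (fun hd => ?_)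
        (fun hd => ?_)
      · simpa [hT'.vertices, k23, h28] using haddr
      · simp only [Ex.eval_word, Ex.eval_add, Ex.eval_mul, Ex.eval_var, Ex.eval_num, hT'.vertices, k23,
          h28] at hd
        have hGE := hedge'.mp hd
        set x := (nodeEquiv N G.r (rrSucc G.rq G.rp q ⟨i, hi⟩) : ℕ) with hx
        have hxM : x < M := (nodeEquiv N G.r (rrSucc G.rq G.rp q ⟨i, hi⟩)).2
        have hxval : (nextAwaited q.2.1 q.2.2 : ℕ) + G.r * (g'.arr 12 i (setCode q.2.1) + 2 ^ G.r * i) = x := by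
          rw [hx, nodeEquiv_val]
          have := hT'.table ⟨i, hi⟩ q.2.1
          simp only at this
          rw [this]
          rfl
        refine Wp.cons (Wp.asg rfl ⟨trivial, trivial, ⟨trivial, trivial⟩, trivial, trivial⟩ ?_ ?_)
        · simp only [Ex.eval_add, Ex.eval_mul, Ex.eval_get, Ex.eval_var, k27, h28, k24, hT'.requests,
            hT'.sets, hxval]
          omega
        simp only [Ex.eval_add, Ex.eval_mul, Ex.eval_get, Ex.eval_var, k27, h28, k24, hT'.requests,
            hT'.sets, hxval]
        have hE'' := hE'.frame ((Frame.refl g' [29] []).setReg (x := 29) (by decide) x) (by decide)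
          (by decide) (by decide)
        refine Wp.cons ((addEdge_spec (u := u) (x := x) hM hE'' (by simpa using k13) (by simp) hlt hxM
          (by simpa [k25] using hown')).mono ?_)
        rintro g₃ t₃ ⟨ht₃, hf₃, hE₃⟩
        refine Wp.nil ⟨by rw [hf₃.1 28 (by decide)]; simpa using h28, ⟨by simp, ?_, ?_⟩, by omega⟩
        · exact ((hf'.setReg (x := 29) (by decide) x).trans (hf₃.mono (by decide) (List.Subset.refl _))
            (List.Subset.refl _) (List.Subset.refl _)).setReg (by decide) _
        · refine (hE₃.frame ((Frame.refl g₃ [28] []).setReg (by decide) _) (by decide) (by decide)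
            (by decide)).congr fun y z => ?_
          constructor
          · rintro ((h1 | ⟨h1, w, h2, h3⟩) | ⟨h1, h2⟩)
            · exact Or.inl h1
            · exact Or.inr ⟨h1, w, by omega, h3⟩
            · exact Or.inr ⟨h1, ⟨i, hi⟩, Nat.lt_succ_self i, hGE, h2⟩
          · rintro (h1 | ⟨h1, w, h2, h3⟩)
            · exact Or.inl (Or.inl h1)
            · rcases (hstep w).mp h2 with h4 | rfl
              · exact Or.inl (Or.inr ⟨h1, w, h4, h3⟩)
              · exact Or.inr ⟨h1, h3.2⟩
      · simp only [Ex.eval_word, Ex.eval_add, Ex.eval_mul, Ex.eval_var, Ex.eval_num, hT'.vertices, k23,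
          h28] at hd
        have hGE := fun h => hd (hedge'.mpr h)
        refine Wp.nil ⟨h28, ⟨by simp, hf'.setReg (by decide) _, ?_⟩, by omega⟩
        refine (hE'.frame ((Frame.refl g' [28] []).setReg (by decide) _) (by decide) (by decide)
            (by decide)).congr fun y z => ?_
        refine or_congr_right (and_congr_right fun _ => exists_congr fun w => ?_)
        constructor
        · rintro ⟨h1, h2⟩
          exact ⟨by omega, h2⟩
        · rintro ⟨h1, h2⟩
          rcases (hstep w).mp h1 with h4 | rfl
          · exact ⟨h4, h2⟩
          · exact absurd h2.1 hGE
    · rintro g' t ⟨h28, hf', hE'⟩ ht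
      simp only [Finset.sum_const, Finset.card_range, smul_eq_mul] at ht
      refine Wp.nil (Wp.nil ?_)
      have := finish (1 - (q.2.1 q.2.2 : ℕ)) (by omega) ?_ ?_ g' (t + 3) (by omega) hf' ?_
      · exact ⟨by omega, this.2⟩
      · rintro (h | h)
        · exact absurd h hqW
        · simp [h]
      · intro h
        have : (q.2.1 q.2.2 : ℕ) ≠ 0 := fun h0 => h (Or.inr (Fin.ext h0))
        omega
      · refine hE'.congr fun y z => ?_
        constructor
        · rintro (⟨h1, h2⟩ | ⟨rfl, w, h2, h3, rfl⟩)
          · exact ⟨by omega, h2⟩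
          · exact ⟨by omega, (hedge _).mpr ⟨_, rfl, productEdge_of_not_mem hqW h3⟩⟩
        · rintro ⟨h1, h2⟩
          rcases Nat.lt_or_ge y u with hlt' | hge
          · exact Or.inl ⟨hlt', h2⟩
          · obtain rfl : y = u := by omega
            obtain ⟨x, rfl, hx⟩ := (hedge z).mp h2
            obtain ⟨w, hw, rfl⟩ := exists_of_productEdge hqW hx
            exact Or.inr ⟨rfl, w, w.2, hw, rfl⟩
  · simp only [Ex.eval_get, Ex.eval_var, Ex.eval_num, g14] at hc
    have e23' : g₁.reg 23 = q.1 := by simpa [hg₁] using e23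
    rw [e23'] at hc
    have hqW : q.1 ∈ W := by
      by_contra h
      rw [(hW q.1).2 h] at hc
      omega
    refine Wp.cons (Wp.put rfl (by simp; omega) ?_)
    have e13' : g₁.reg 13 = u := by simpa [hg₁] using g13
    simp only [Ex.eval_var, Ex.eval_num, e13']
    set g₂ := g₁.setArr 1 u 0 1 with hg₂
    refine Wp.cons (Wp.asg rfl trivial (by simp [hg₂, e13']; omega) ?_)
    have e13'' : g₂.reg 13 = u := e13'
    simp only [Ex.eval_var, e13'']
    have hE₂ : EdgesIn M (productArena G W).own₁ (fun y x => y < u ∧ (productArena G W).E y x)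
        (g₂.setReg 29 u) :=
      hE₁.frame (((Frame.refl g₁ [29] [1]).setArr (by decide) _ _ _).setReg (by decide) _)
        (by decide) (by decide) (by decide)
    refine Wp.cons ((addEdge_spec (u := u) (x := u) hM hE₂ (by simpa using e13'') (by simp) hlt hlt
      (by simpa [hg₂, hg₁] using hown')).mono ?_)
    rintro g₃ t₃ ⟨ht₃, hf₃, hE₃⟩
    refine Wp.nil (Wp.nil ?_)
    have := finish 1 le_rfl (fun _ => rfl) (fun h => absurd (Or.inl hqW) h) g₃ (t₃ + 4) (by omega)
      (((Frame.refl g₂ _ _).setReg (by decide) _).trans (hf₃.mono (by decide) (List.Subset.refl _))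
        (List.Subset.refl _) (List.Subset.refl _)) ?_
    · exact ⟨by omega, this.2⟩
    -- Over `W` the loop just stored is the only edge of the node.
    · refine hE₃.congr fun y z => ?_
      constructor
      · rintro (⟨h1, h2⟩ | ⟨rfl, rfl⟩)
        · exact ⟨by omega, h2⟩
        · exact ⟨by omega, (hedge _).mpr ⟨q, rfl, Or.inl ⟨hqW, rfl⟩⟩⟩
      · rintro ⟨h1, h2⟩
        rcases Nat.lt_or_ge y u with hlt' | hge
        · exact Or.inl ⟨hlt', h2⟩
        · obtain rfl : y = u := by omega
          obtain ⟨x, rfl, hx⟩ := (hedge z).mp h2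
          rcases hx with ⟨-, rfl⟩ | ⟨h3, -⟩
          · exact Or.inr ⟨rfl, rfl⟩
          · exact absurd hqW h3

end RamProg

/-! ### Building and solving the product -/

namespace RamProg

open HState GameStructure

variable {C : Layout} {N : ℕ} {G : MultiGame (Fin N)} [NeZero G.r]

/-- Store the product arena. -/
def buildArena : RamProg := block [clearArena, forLt 13 (.var 7) fillNode]

/-- A node is filled in time `O(N)` and `N ≤ M`, so `M` nodes take quadratic time. All counts of
`PurgeOK` are 0 as no node is dead yet, and `pull₁` holds because the product has no deadlock. -/
theorem buildArena_spec {h : HState} {W : Set (Fin N)} (hI : InputIn C G) (hT : TablesIn h G)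
    (hW : MarkIn h W) (hM : 2 * (N * (2 ^ G.r * G.r)) < C.Bd) :
    Wp C buildArena h fun h' t =>
      t ≤ 60 * ((N * (2 ^ G.r * G.r) + 1) * (N * (2 ^ G.r * G.r) + 1)) ∧
      Frame h h' [9, 10, 13, 14, 15, 17, 18, 21, 22, 23, 24, 25, 26, 27, 28, 29] [0, 1, 2, 3, 4, 5] ∧
      h'.reg 9 = 0 ∧ h'.reg 10 = 0 ∧
      PurgeOK (productArena G W) h' (fun _ => 0) (fun _ => 0) (fun _ => 0) ∅ ∅ := by
  have hown := Arena.own₁_ofEquiv (nodeEquiv N G.r) (own₁ := fun q => G.owner q.1 = .one)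
    (B := productTarget W) (exists_productEdge (Rq := G.rq) (Rp := G.rp) (G := G.toGameStructure) W)
  have htar := Arena.target_ofEquiv (nodeEquiv N G.r) (own₁ := fun q => G.owner q.1 = .one)
    (B := productTarget W) (exists_productEdge (Rq := G.rq) (Rp := G.rp) (G := G.toGameStructure) W)
  change ∀ q, (productArena G W).own₁ (nodeEquiv N G.r q) ↔ _ at hown
  change ∀ q, (nodeEquiv N G.r q : ℕ) ∈ (productArena G W).B ↔ _ at htar
  have hNM : N ≤ N * (2 ^ G.r * G.r) := Nat.le_mul_of_pos_right _ (Nat.mul_pos (Nat.two_pow_pos _)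
      (Nat.pos_of_ne_zero (NeZero.ne _)))
  have hM7 := hT.nodes
  have hnode : ∀ u < N * (2 ^ G.r * G.r), ∃ q, (nodeEquiv N G.r q : ℕ) = u := fun u hu =>
    ⟨(nodeEquiv N G.r).symm ⟨u, hu⟩, by simp⟩
  set M := N * (2 ^ G.r * G.r) with hMdef
  refine Wp.cons ((clearArena_spec (productArena G W).own₁ hM7 (by omega)).mono ?_)
  rintro h₁ t₁ ⟨ht₁, hf₁, h9, h10, hz, hE₁⟩
  have hT₁ := hT.frame hf₁ (by decide) (by decide) (by decide)
  refine Wp.cons (Wp.forLt (n := M) (fun i g => g.reg 13 = i ∧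
    Frame h₁ g [13, 15, 17, 18, 21, 22, 23, 24, 25, 26, 27, 28, 29] [0, 1, 3, 4, 5] ∧
    (∀ u < i, ((productArena G W).own₁ u → g.arr 0 u 0 = 0) ∧ (¬ (productArena G W).own₁ u → g.arr 0 u 0 = 1) ∧
      (u ∈ (productArena G W).B → g.arr 1 u 0 = 1) ∧ (u ∉ (productArena G W).B → g.arr 1 u 0 = 0)) ∧
    EdgesIn M (productArena G W).own₁ (fun y x => y < i ∧ (productArena G W).E y x) g)
    (fun _ => 16 * N + 33) rfl (by omega) ?_ ?_ ?_ ?_)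
  · rintro i g ⟨h1, h2, -⟩
    exact ⟨h1, by simp [h2.1 7 (by decide), hT₁.nodes, hMdef]⟩
  · refine ⟨by simp, (Frame.refl _ _ _).setReg (by decide) _, fun u hu => absurd hu (Nat.not_lt_zero _), ?_⟩
    refine (hE₁.frame ((Frame.refl h₁ [13] []).setReg (by decide) _) (by decide) (by decide)
      (by decide)).congr fun x y => ?_
    simp
  · rintro i g hi ⟨h13, hf, hu, hE⟩
    have hTg := hT₁.frame hf (by decide) (by decide) (by decide)
    have hWg : MarkIn g W := by
      intro v
      rw [hf.2 14 (by decide), hf₁.2 14 (by decide)]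
      exact hW v
    obtain ⟨q, rfl⟩ := hnode i hi
    refine (fillNode_spec hI hTg hWg hM q h13 hE).mono ?_
    rintro g₁ t ⟨ht, hf', hsame, ho₁, ho₂, hb₁, hb₂, hE'⟩
    refine ⟨by rw [hf'.1 13 (by decide), h13], ⟨by simp, ?_, fun u hu' => ?_, ?_⟩, ht⟩
    · exact (hf.trans (hf'.mono (by decide) (List.Subset.refl _)) (List.Subset.refl _)
        (List.Subset.refl _)).setReg (by decide) _
    · simp only [setReg_arr]
      by_cases hui : u = (nodeEquiv N G.r q : ℕ)
      · rw [hui, hown, htar]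
        exact ⟨ho₁, ho₂, hb₁, hb₂⟩
      · obtain ⟨a0, a1⟩ := hsame u hui
        rw [a0, a1]
        exact hu u (by omega)
    · exact hE'.frame ((Frame.refl g₁ [13] []).setReg (by decide) _) (by decide) (by decide) (by decide)
  · rintro g t ⟨h13, hf, hu, hE⟩ ht
    simp only [Finset.sum_const, Finset.card_range, smul_eq_mul] at ht
    have e10 : g.reg 10 = 0 := by rw [hf.1 10 (by decide), h10]
    have e2 : g.arr 2 = h₁.arr 2 := hf.2 2 (by decide)
    have b1 : M * (16 * N + 33 + 3) = 16 * (M * N) + 36 * M := by ring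
    have b2 : M * N ≤ M * M := Nat.mul_le_mul_left _ hNM
    have b3 : (M + 1) * (M + 1) = M * M + 2 * M + 1 := by ring
    have hleft : Left M (fun p => g.arr 11 p 0) 0 = {x | x < M} := by
      ext x; simp [Left]
    refine Wp.nil ⟨by rw [← hMdef]; omega, ?_, by rw [hf.1 9 (by decide), h9], e10, ?_⟩
    · exact (hf₁.mono (by decide) (by decide)).trans (hf.mono (by decide) (by decide))
        (List.Subset.refl _) (List.Subset.refl _)
    refine ⟨?_, fun u hu' => ⟨(hu u hu').1, (hu u hu').2.1⟩, fun u hu' => ⟨(hu u hu').2.2.1, (hu u hu').2.2.2⟩,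
      ?_, fun u => by simp, fun u hu' => ?_, fun u hu' => ?_, fun u hu' ho _ _ => ?_,
      fun u hu' ho _ p hp => absurd hp (Nat.not_lt_zero _), ?_⟩
    · rw [hf.1 7 (by decide), hT₁.nodes]
    · rw [e10, e2]
      refine ⟨fun p hp => absurd hp (Nat.not_lt_zero _), fun u hu' hne => absurd (hz u hu') hne,
        fun p p' _ hp' => absurd hp' (Nat.not_lt_zero _)⟩
    · rw [hleft]
      convert (hE u hu').1 using 1
      ext x
      have := (productArena G W).lt u x
      simp only [Set.mem_ofPred_eq]
      tauto
    · rw [hleft]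
      convert (hE u hu').2 using 1
      ext x
      have := (productArena G W).lt x u
      simp only [Set.mem_ofPred_eq]
      tauto
    · obtain ⟨x, hx⟩ := (productArena G W).exists_succ u hu'
      exact ⟨x, hx, by rw [hleft]; exact ((productArena G W).lt u x hx).2⟩
    · convert winsCoBuchi_empty
      rw [Set.union_empty, e2, Set.eq_empty_iff_forall_notMem]
      rintro u ⟨hu', hne⟩
      exact hne (hz u hu')

/-- Solve the product game. -/
def solveProduct : RamProg := block [buildArena, solveLoop]

theorem solveProduct_spec {h : HState} {W : Set (Fin N)} (hI : InputIn C G) (hT : TablesIn h G)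
    (hW : MarkIn h W)
    (hB : 4 * (N * (2 ^ G.r * G.r) + 1) * (N * (2 ^ G.r * G.r) + 1) < C.Bd) :
    Wp C solveProduct h fun h' t =>
      t ≤ 2061 * ((N * (2 ^ G.r * G.r) + 1) * (N * (2 ^ G.r * G.r) + 1)) ∧
      Frame h h' [8, 9, 10, 11, 12, 13, 14, 15, 16, 17, 18, 19, 20, 21, 22, 23, 24, 25, 26, 27, 28, 29]
        [0, 1, 2, 3, 4, 5, 6, 7, 8, 9, 10, 11] ∧
      ProductSolution G.rq G.rp G.toGameStructure W {q | h'.arr 2 (nodeEquiv N G.r q) 0 = 0} := by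
  have hM : 2 * (N * (2 ^ G.r * G.r)) < C.Bd := by
    generalize N * (2 ^ G.r * G.r) = M at *
    nlinarith
  refine Wp.cons ((buildArena_spec hI hT hW hM).mono ?_)
  rintro h₁ t₁ ⟨ht₁, hf₁, h9, h10, hP⟩
  refine Wp.cons ((solveLoop_spec hB (by rw [h10]; exact hP) (by rw [h9, h10])).mono ?_)
  rintro h₂ t₂ ⟨ht₂, hf₂, hc₁, hc₂⟩
  have hpos : 1 ≤ (N * (2 ^ G.r * G.r) + 1) * (N * (2 ^ G.r * G.r) + 1) := Nat.mul_pos (by omega) (by omega)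
  refine Wp.nil ⟨by omega, ?_, ?_⟩
  · exact (hf₁.mono (by decide) (by decide)).trans (hf₂.mono (by decide) (by decide))
      (List.Subset.refl _) (List.Subset.refl _)
  · have := buchiSolution_ofEquiv (nodeEquiv N G.r)
      (exists_productEdge (Rq := G.rq) (Rp := G.rp) (G := G.toGameStructure) W) (fun u hu => ?_) hc₁ hc₂
    · unfold ProductSolution
      convert this using 1
      ext q
      simp
    · simp [hu]

end RamProg

/-! ### The tables of the product game -/

namespace RamProg

open HState GameStructure

variable {C : Layout} {N : ℕ} {G : MultiGame (Fin N)}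

/-- Compute the powers of two below that of variable 5, and the number of nodes. -/
def makePowers : RamProg := block [asg 6 1, forLt 13 (.var 5) (block [put 13 (.var 13) 0 (.var 6),
  asg 6 (2 * .var 6)]), asg 7 (.var 0 * (.var 6 * .var 5))]

theorem makePowers_spec {h : HState} {r : ℕ} (h0 : h.reg 0 = N) (h5 : h.reg 5 = r)
    (hr : r ≤ C.Bd) (hB : 2 ^ r ≤ C.Bd) (hM : N * (2 ^ r * r) ≤ C.Bd) :
    Wp C makePowers h fun h' t => t ≤ 6 * r + 6 ∧ Frame h h' [6, 7, 13] [13] ∧ h'.reg 6 = 2 ^ r ∧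
      h'.reg 7 = N * (2 ^ r * r) ∧ ∀ i < r, h'.arr 13 i 0 = 2 ^ i := by
  have hpos : 0 < 2 ^ r := Nat.two_pow_pos r
  refine Wp.cons (Wp.asg rfl trivial (by simp; omega) ?_)
  refine Wp.cons (Wp.forLt (n := r) (fun i g => g.reg 13 = i ∧ Frame h g [6, 7, 13] [13] ∧
    g.reg 6 = 2 ^ i ∧ ∀ j < i, g.arr 13 j 0 = 2 ^ j) (fun _ => 3) rfl hr ?_ ?_ ?_ ?_)
  · rintro i g ⟨h1, h2, -⟩
    exact ⟨h1, by simp [h2.1 5 (by decide), h5]⟩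
  · exact ⟨by simp, ((Frame.refl _ _ _).setReg (by decide) _).setReg (by decide) _, by simp,
      fun j hj => absurd hj (Nat.not_lt_zero _)⟩
  · rintro i g hi ⟨h13, hf, h6, hp⟩
    have hpow : 2 * 2 ^ i ≤ 2 ^ r := by
      rw [← pow_succ']
      exact Nat.pow_le_pow_right (by norm_num) hi
    refine Wp.cons (Wp.put rfl (by simp [h6]; omega) ?_)
    simp only [Ex.eval_var, Ex.eval_num, h13, h6]
    refine Wp.cons (Wp.asg rfl ⟨trivial, trivial⟩ (by simp [h6]; omega) ?_)
    simp only [Ex.eval_var, Ex.eval_num, Ex.eval_mul, setArr_reg, h6]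
    refine Wp.nil ⟨by simpa using h13, ⟨by simp, ?_, by simp [pow_succ'], fun j hj => ?_⟩, by omega⟩
    · exact ((hf.setArr (by decide) _ _ _).setReg (by decide) _).setReg (by decide) _
    · simp only [setReg_arr, setArr_arr, if_true, update₂_apply, and_true]
      split_ifs with hji
      · rw [hji]
      · exact hp j (by omega)
  · rintro g t ⟨h13, hf, h6, hp⟩ ht
    simp only [Finset.sum_const, Finset.card_range, smul_eq_mul] at ht
    have g0 : g.reg 0 = N := by rw [hf.1 0 (by decide), h0]
    have g5 : g.reg 5 = r := by rw [hf.1 5 (by decide), h5]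
    refine Wp.cons (Wp.asg rfl ⟨trivial, trivial, trivial⟩ (by simpa [g0, g5, h6] using hM) ?_)
    refine Wp.nil ⟨by omega, hf.setReg (by decide) _, by simpa using h6, by simp [g0, g5, h6], ?_⟩
    simpa using hp

/-- Add to variable 15 the value of the pair in variable 16, when the vertex in variable 13 is visited
with the pending requests in variable 14. -/
def tableStep : RamProg := block [
  asg 17 (.var 16 / .var 4),
  asg 18 (.var 16 - .var 4 * .var 17),
  asg 19 (.word (.var 0 + .var 0 * .var 0 + .var 17 * .var 0 + .var 13)),
  asg 20 (.var 14 / .get 13 (.var 16) 0),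
  asg 20 (.var 20 - 2 * (.var 20 / 2)),
  ite (.var 19 - 2 * (.var 19 / 2)) 1
    (ite (.var 19) (2 * .var 18 + 2) (asg 20 0) (block []))
    -- A test for equality: the two truncated differences vanish together exactly if the numbers are
    -- equal.
    (ite ((.var 19 - (2 * .var 18 + 1)) + ((2 * .var 18 + 1) - .var 19)) 1 (asg 20 1) (block [])),
  asg 15 (.var 15 + .var 20 * .get 13 (.var 16) 0)]

/-- The form that `tableStep` tests: an even number is at most `2 * c + 1` iff it is below `2 * c +
2`. -/
theorem pendingAt_val (w : Fin N) (S : Fin G.r → Fin 2) (i : Fin G.r) :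
    (pendingAt G.rq G.rp w S i : ℕ) =
      if G.p (finProdFinEquiv.symm i).1 w % 2 = 0 then
        if G.p (finProdFinEquiv.symm i).1 w < 2 * (finProdFinEquiv.symm i).2 + 2 then 0 else S i
      else if G.p (finProdFinEquiv.symm i).1 w = 2 * (finProdFinEquiv.symm i).2 + 1 then 1 else S i := by
  have hrp : w ∈ G.rp i ↔ Even (G.p (finProdFinEquiv.symm i).1 w) ∧
      G.p (finProdFinEquiv.symm i).1 w ≤ 2 * (finProdFinEquiv.symm i).2 + 1 := Iff.rfl
  have hrq : w ∈ G.rq i ↔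
      G.p (finProdFinEquiv.symm i).1 w = 2 * (finProdFinEquiv.symm i).2 + 1 := Iff.rfl
  unfold pendingAt
  rw [hrp, hrq, Nat.even_iff]
  generalize G.p (finProdFinEquiv.symm i).1 w = p
  generalize ((finProdFinEquiv.symm i).2 : ℕ) = c
  by_cases h1 : p % 2 = 0
  · by_cases h2 : p ≤ 2 * c + 1
    · rw [if_pos ⟨h1, h2⟩, if_pos h1, if_pos (by omega)]
    · rw [if_neg (fun h => h2 h.2), if_neg (by omega), if_pos h1, if_neg (by omega)]
  · rw [if_neg (fun h => h1 h.1), if_neg h1]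
    split_ifs <;> rfl

theorem tableStep_spec {h : HState} (hI : InputIn C G) (h0 : h.reg 0 = N) (h4 : h.reg 4 = G.d / 2)
    (hpw : ∀ i < G.r, h.arr 13 i 0 = 2 ^ i) (hB : 2 ^ G.r ≤ C.Bd) (hr : G.r ≤ C.Bd)
    (hB2 : 2 ≤ C.Bd) (w : Fin N) (S : Fin G.r → Fin 2) (i : Fin G.r)
    (h13 : h.reg 13 = w) (h14 : h.reg 14 = setCode S) (h16 : h.reg 16 = i)
    (hsum : h.reg 15 + (pendingAt G.rq G.rp w S i : ℕ) * 2 ^ (i : ℕ) ≤ C.Bd) :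
    Wp C tableStep h fun h' t => t ≤ 12 ∧ Frame h h' [15, 17, 18, 19, 20] [] ∧
      h'.reg 15 = h.reg 15 + (pendingAt G.rq G.rp w S i : ℕ) * 2 ^ (i : ℕ) := by
  have hi := i.2
  set m := (finProdFinEquiv.symm i).1 with hm
  set c := (finProdFinEquiv.symm i).2 with hc
  -- Pairs are numbered dimension by dimension, so quotient and remainder by `d / 2` give the
  -- dimension and the index of the odd priority.
  have em : (i : ℕ) / (G.d / 2) = m := rfl
  have ec : (i : ℕ) - G.d / 2 * m = c := by
    have h1 : (c : ℕ) = i % (G.d / 2) := rfl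
    have h2 := Nat.mod_add_div (i : ℕ) (G.d / 2)
    rw [em] at h2
    omega
  have hmi : (m : ℕ) ≤ i := em ▸ Nat.div_le_self _ _
  have hS := setCode_lt S
  have hw : N + N * N + m * N + w < C.base := by
    rw [hI.base]
    have : ((m : ℕ) + 1) * N ≤ G.n * N := Nat.mul_le_mul_right _ m.2
    rw [add_mul, one_mul] at this
    have := w.2
    omega
  have hp := hI.prio m w
  have hpB : G.p m w ≤ C.Bd := hp ▸ C.inp_le _ hw
  have hbit := setCode_bit S i
  have e3 : setCode S / 2 ^ (i : ℕ) - 2 * (setCode S / 2 ^ (i : ℕ) / 2) = S i := by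
    rw [← hbit]; omega
  have hle3 : setCode S / 2 ^ (i : ℕ) ≤ setCode S := Nat.div_le_self _ _
  have hle4 := (S i).2
  have hval := pendingAt_val w S i
  rw [← hm, ← hc] at hval
  refine Wp.cons (Wp.asg rfl ⟨trivial, trivial⟩ (by simp [h16, h4, em]; omega) ?_)
  simp only [Ex.eval_div, Ex.eval_var, h16, h4, em]
  refine Wp.cons (Wp.asg rfl ⟨trivial, trivial, trivial⟩ (by simp [h16, h4, ec]; omega) ?_)
  simp only [Ex.eval_sub, Ex.eval_mul, Ex.eval_var, setReg_reg, if_true,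
    if_neg (show ¬ (16 = 17) by norm_num), if_neg (show ¬ (4 = 17) by norm_num), h16, h4, ec]
  refine Wp.cons (Wp.asg rfl ⟨⟨⟨⟨trivial, trivial, trivial⟩, trivial, trivial⟩, trivial⟩, ?_⟩ ?_ ?_)
  · simpa [h0, h13] using hw
  · simpa [h0, h13, hp] using hpB
  simp only [Ex.eval_word, Ex.eval_add, Ex.eval_mul, Ex.eval_var, setReg_reg, if_true,
    if_neg (show ¬ (0 = 18) by norm_num), if_neg (show ¬ (0 = 17) by norm_num),
    if_neg (show ¬ (13 = 18) by norm_num), if_neg (show ¬ (13 = 17) by norm_num),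
    if_neg (show ¬ (17 = 18) by norm_num), h0, h13, hp]
  refine Wp.cons (Wp.asg rfl ⟨trivial, trivial, trivial⟩ ?_ ?_)
  · simp [h14, h16, hpw _ hi]; omega
  simp only [Ex.eval_div, Ex.eval_get, Ex.eval_var, Ex.eval_num, setReg_reg, setReg_arr,
    if_neg (show ¬ (14 = 19) by norm_num), if_neg (show ¬ (14 = 18) by norm_num),
    if_neg (show ¬ (14 = 17) by norm_num), if_neg (show ¬ (16 = 19) by norm_num),
    if_neg (show ¬ (16 = 18) by norm_num), if_neg (show ¬ (16 = 17) by norm_num),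
    h14, h16, hpw _ hi]
  refine Wp.cons (Wp.asg rfl ⟨trivial, trivial, trivial, trivial⟩ ?_ ?_)
  · simp [e3]; omega
  simp only [Ex.eval_div, Ex.eval_sub, Ex.eval_mul, Ex.eval_var, Ex.eval_num, setReg_reg, if_true, e3]
  set g := (((((h.setReg 17 m).setReg 18 c).setReg 19 (G.p m w)).setReg 20
    (setCode S / 2 ^ (i : ℕ))).setReg 20 (S i)) with hg
  have hf : Frame h g [15, 17, 18, 19, 20] [] :=
    (((((Frame.refl h _ _).setReg (by decide) _).setReg (by decide) _).setReg (by decide) _).setReg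
      (by decide) _).setReg (by decide) _
  have g19 : g.reg 19 = G.p m w := by simp [hg]
  have g18 : g.reg 18 = c := by simp [hg]
  have g20 : g.reg 20 = S i := by simp [hg]
  have fin : ∀ g' : HState, Frame g g' [20] [] → g'.reg 20 = pendingAt G.rq G.rp w S i →
      ∀ t' ≤ 5, Wp C (block [asg 15 (.var 15 + .var 20 * .get 13 (.var 16) 0)]) g' fun h' t =>
      1 + (1 + (1 + (1 + (1 + (t' + t))))) ≤ 12 ∧ Frame h h' [15, 17, 18, 19, 20] [] ∧
      h'.reg 15 = h.reg 15 + (pendingAt G.rq G.rp w S i : ℕ) * 2 ^ (i : ℕ) := by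
    intro g' hf' h20 t' ht'
    have k16 : g'.reg 16 = i := by rw [hf'.1 16 (by decide)]; simpa [hg] using h16
    have k15 : g'.reg 15 = h.reg 15 := by rw [hf'.1 15 (by decide)]; simp [hg]
    have k13 : g'.arr 13 = h.arr 13 := by rw [hf'.2 13 (by decide)]; simp [hg]
    refine Wp.cons (Wp.asg rfl ⟨trivial, trivial, trivial, trivial⟩ ?_ (Wp.nil ⟨by omega, ?_, ?_⟩))
    · simpa [k15, h20, k13, k16, hpw _ hi] using hsum
    · exact (hf.trans (hf'.mono (by decide) (List.Subset.refl _)) (List.Subset.refl _)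
        (List.Subset.refl _)).setReg (by decide) _
    · simp [k15, h20, k13, k16, hpw _ hi]
  refine Wp.cons (Wp.ite rfl ⟨⟨trivial, trivial, trivial, trivial⟩, trivial⟩ (fun hd => ?_) (fun hd => ?_))
  · simp only [Ex.eval_sub, Ex.eval_mul, Ex.eval_div, Ex.eval_var, Ex.eval_num, g19] at hd
    rw [if_pos (by omega)] at hval
    refine Wp.ite rfl ⟨trivial, ⟨trivial, trivial⟩, trivial⟩ (fun he => ?_) (fun he => ?_)
    · simp only [Ex.eval_add, Ex.eval_mul, Ex.eval_var, Ex.eval_num, g19, g18] at he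
      rw [if_pos he] at hval
      refine Wp.asg rfl trivial (by simp) ?_
      exact fin _ ((Frame.refl g _ _).setReg (by decide) _) (by simp [hval]) _ (by norm_num)
    · simp only [Ex.eval_add, Ex.eval_mul, Ex.eval_var, Ex.eval_num, g19, g18] at he
      rw [if_neg he] at hval
      exact Wp.nil (fin g (Frame.refl _ _ _) (by rw [g20, hval]) _ (by norm_num))
  · simp only [Ex.eval_sub, Ex.eval_mul, Ex.eval_div, Ex.eval_var, Ex.eval_num, g19] at hd
    rw [if_neg (by omega)] at hval
    refine Wp.ite rfl ⟨⟨⟨trivial, ⟨trivial, trivial⟩, trivial⟩, ⟨⟨trivial, trivial⟩, trivial⟩, trivial⟩,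
      trivial⟩ (fun he => ?_) (fun he => ?_)
    · simp only [Ex.eval_add, Ex.eval_sub, Ex.eval_mul, Ex.eval_var, Ex.eval_num, g19, g18] at he
      rw [if_pos (by omega)] at hval
      refine Wp.asg rfl trivial (by simp; omega) ?_
      exact fin _ ((Frame.refl g _ _).setReg (by decide) _) (by simp [hval]) _ (by norm_num)
    · simp only [Ex.eval_add, Ex.eval_sub, Ex.eval_mul, Ex.eval_var, Ex.eval_num, g19, g18] at he
      rw [if_neg (by omega)] at hval
      exact Wp.nil (fin g (Frame.refl _ _ _) (by rw [g20, hval]) _ (by norm_num))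

/-- Tabulate the changes of the pending requests. -/
def makeTable : RamProg := forLt 13 (.var 0) (forLt 14 (.var 6) (block [asg 15 0,
  forLt 16 (.var 5) tableStep, put 12 (.var 13) (.var 14) (.var 15)]))

/-- The table makes the update of a pending set a single lookup; otherwise every edge of the product
would cost a further factor `r`. It is computed once, in time `O(N * 2 ^ r * r)` when `r` is
positive. -/
theorem makeTable_spec {h : HState} (hI : InputIn C G) (h0 : h.reg 0 = N) (h4 : h.reg 4 = G.d / 2)
    (h5 : h.reg 5 = G.r) (h6 : h.reg 6 = 2 ^ G.r) (h7 : h.reg 7 = N * (2 ^ G.r * G.r))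
    (hpw : ∀ i < G.r, h.arr 13 i 0 = 2 ^ i) (hB : 2 ^ G.r ≤ C.Bd) (hr : G.r ≤ C.Bd)
    (hN : N ≤ C.Bd) (hB2 : 2 ≤ C.Bd) :
    Wp C makeTable h fun h' t => t ≤ N * (2 ^ G.r * (15 * G.r + 9) + 6) + 3 ∧
      Frame h h' [13, 14, 15, 16, 17, 18, 19, 20] [12] ∧ TablesIn h' G := by
  have hcode : ∀ s < 2 ^ G.r, ∃ S : Fin G.r → Fin 2, setCode S = s := fun s hs =>
    ⟨finFunctionFinEquiv.symm ⟨s, hs⟩, by simp [setCode]⟩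
  have hinj : ∀ S S' : Fin G.r → Fin 2, setCode S = setCode S' ↔ S = S' := fun S S' => by
    rw [setCode, setCode, Fin.val_inj, finFunctionFinEquiv.apply_eq_iff_eq]
  refine Wp.forLt (n := N) (fun i g => g.reg 13 = i ∧
    Frame h g [13, 14, 15, 16, 17, 18, 19, 20] [12] ∧
    ∀ w : Fin N, (w : ℕ) < i → ∀ S : Fin G.r → Fin 2,
      g.arr 12 w (setCode S) = setCode (pendingAt G.rq G.rp w S))
    (fun _ => 2 ^ G.r * (15 * G.r + 9) + 3) rfl hN ?_ ?_ ?_ ?_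
  · rintro i g ⟨h1, h2, -⟩
    exact ⟨h1, by simp [h2.1 0 (by decide), h0]⟩
  · exact ⟨by simp, (Frame.refl _ _ _).setReg (by decide) _, fun w hw => absurd hw (Nat.not_lt_zero _)⟩
  · rintro i g hi ⟨h13, hf, htab⟩
    refine Wp.forLt (n := 2 ^ G.r) (fun s g' => g'.reg 14 = s ∧
      Frame g g' [14, 15, 16, 17, 18, 19, 20] [12] ∧
      (∀ w : Fin N, (w : ℕ) < i → ∀ S : Fin G.r → Fin 2,
        g'.arr 12 w (setCode S) = setCode (pendingAt G.rq G.rp w S)) ∧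
      ∀ S : Fin G.r → Fin 2, setCode S < s →
        g'.arr 12 i (setCode S) = setCode (pendingAt G.rq G.rp ⟨i, hi⟩ S))
      (fun _ => 15 * G.r + 6) rfl hB ?_ ?_ ?_ ?_
    · rintro s g' ⟨h1, h2, -⟩
      exact ⟨h1, by simp [h2.1 6 (by decide), hf.1 6 (by decide), h6]⟩
    · exact ⟨by simp, (Frame.refl _ _ _).setReg (by decide) _, htab,
        fun S hS => absurd hS (Nat.not_lt_zero _)⟩
    · rintro s g' hs ⟨h14, hf', htab', hrow⟩
      obtain ⟨S, rfl⟩ := hcode s hs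
      have hfg := hf.trans (hf'.mono (R' := [13, 14, 15, 16, 17, 18, 19, 20]) (by decide)
        (List.Subset.refl _)) (List.Subset.refl _) (List.Subset.refl _)
      set f : ℕ → ℕ := fun j => if hj : j < G.r then
        (pendingAt G.rq G.rp ⟨i, hi⟩ S ⟨j, hj⟩ : ℕ) * 2 ^ j else 0 with hfdef
      have hsum : ∑ j ∈ Finset.range G.r, f j = setCode (pendingAt G.rq G.rp ⟨i, hi⟩ S) := by
        rw [setCode_eq_sum, Finset.sum_range]
        exact Finset.sum_congr rfl fun j _ => by simp [hfdef]
      have hlt := setCode_lt (pendingAt G.rq G.rp ⟨i, hi⟩ S)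
      -- The code is summed bit by bit; partial sums stay within the word bound because they are at
      -- most the full code.
      have hpart : ∀ j ≤ G.r, ∑ j ∈ Finset.range j, f j ≤ C.Bd := fun j hj => by
        refine le_trans ?_ (hlt.le.trans hB)
        rw [← hsum]
        exact Finset.sum_le_sum_of_subset (Finset.range_subset_range.mpr hj)
      refine Wp.cons (Wp.asg rfl trivial (by simp) ?_)
      refine Wp.cons (Wp.forLt (n := G.r) (fun j k => k.reg 16 = j ∧
        Frame g' k [15, 16, 17, 18, 19, 20] [] ∧ k.reg 15 = ∑ j ∈ Finset.range j, f j)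
        (fun _ => 12) rfl hr ?_ ?_ ?_ ?_)
      · rintro j k ⟨h1, h2, -⟩
        exact ⟨h1, by simp [h2.1 5 (by decide), hfg.1 5 (by decide), h5]⟩
      · exact ⟨by simp, ((Frame.refl _ _ _).setReg (by decide) _).setReg (by decide) _, by simp⟩
      · rintro j k hj ⟨h16, hfk, h15⟩
        have hfk' := hfg.trans (hfk.mono (R' := [13, 14, 15, 16, 17, 18, 19, 20]) (by decide)
          (List.nil_subset _)) (List.Subset.refl _) (List.Subset.refl _)
        have hfj : f j = (pendingAt G.rq G.rp ⟨i, hi⟩ S ⟨j, hj⟩ : ℕ) * 2 ^ j := by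
          simp [hfdef, hj]
        refine (tableStep_spec hI (by rw [hfk'.1 0 (by decide), h0])
          (by rw [hfk'.1 4 (by decide), h4]) (by rw [hfk'.2 13 (by decide)]; exact hpw) hB hr hB2
          ⟨i, hi⟩ S ⟨j, hj⟩ (by rw [hfk.1 13 (by decide), hf'.1 13 (by decide), h13])
          (by rw [hfk.1 14 (by decide), h14]) h16 ?_).mono ?_
        · have := hpart (j + 1) hj
          rw [Finset.sum_range_succ, hfj] at this
          rwa [h15]
        · rintro k' t ⟨ht, hf₂, hk'⟩
          refine ⟨by rw [hf₂.1 16 (by decide), h16], ⟨by simp, ?_, ?_⟩, ht⟩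
          · exact (hfk.trans (hf₂.mono (by decide) (List.Subset.refl _)) (List.Subset.refl _)
              (List.Subset.refl _)).setReg (by decide) _
          · rw [Finset.sum_range_succ, hfj]
            simp only [setReg_reg]
            rw [if_neg (by norm_num), hk', h15]
      · rintro k t ⟨h16, hfk, h15⟩ ht
        simp only [Finset.sum_const, Finset.card_range, smul_eq_mul] at ht
        rw [hsum] at h15
        have k13 : k.reg 13 = i := by rw [hfk.1 13 (by decide), hf'.1 13 (by decide), h13]
        have k14 : k.reg 14 = setCode S := by rw [hfk.1 14 (by decide), h14]
        have k12 : k.arr 12 = g'.arr 12 := hfk.2 12 (by decide)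
        refine Wp.cons (Wp.put rfl (by simp [h15]; omega) ?_)
        simp only [Ex.eval_var, k13, k14, h15]
        refine Wp.nil ⟨by simpa using k14, ⟨by simp, ?_, fun w hw S' => ?_, fun S' hS' => ?_⟩, by omega⟩
        · exact ((hf'.trans (hfk.mono (by decide) (List.nil_subset _)) (List.Subset.refl _)
            (List.Subset.refl _)).setArr (by decide) _ _ _).setReg (by decide) _
        · simp only [setReg_arr, setArr_arr, if_true, update₂_apply]
          rw [if_neg (by omega), k12]
          exact htab' w hw S'
        · simp only [setReg_arr, setArr_arr, if_true, update₂_apply, true_and]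
          split_ifs with he
          · rw [(hinj _ _).mp he]
          · rw [k12]
            exact hrow S' (by omega)
    · rintro g' t ⟨h14, hf', htab', hrow⟩ ht
      simp only [Finset.sum_const, Finset.card_range, smul_eq_mul] at ht
      refine ⟨by rw [hf'.1 13 (by decide), h13], ⟨by simp, ?_, fun w hw S => ?_⟩, ht⟩
      · exact (hf.trans (hf'.mono (by decide) (List.Subset.refl _)) (List.Subset.refl _)
          (List.Subset.refl _)).setReg (by decide) _
      · simp only [setReg_arr]
        rcases Nat.lt_or_ge w i with hlt | hge
        · exact htab' w hlt S
        · obtain rfl : w = ⟨i, hi⟩ := Fin.ext (by simp only; omega)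
          exact hrow S (setCode_lt S)
  · rintro g t ⟨h13, hf, htab⟩ ht
    simp only [Finset.sum_const, Finset.card_range, smul_eq_mul] at ht
    refine ⟨ht, hf, by rw [hf.1 0 (by decide), h0], by rw [hf.1 5 (by decide), h5],
      by rw [hf.1 6 (by decide), h6], by rw [hf.1 7 (by decide), h7], ?_, fun w S => htab w w.2 S⟩
    rw [hf.2 13 (by decide)]
    exact hpw

end RamProg

/-! ### The input of the machine -/

namespace MultiGame

variable {N : ℕ} (G : MultiGame (Fin N))

theorem length_inputWords : G.inputWords.length = N + N * N + G.n * N := by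
  simp [inputWords, Nat.add_assoc]

theorem inputWords_owner (v : Fin N) :
    G.inputWords.getD v 0 = match G.owner v with
      | .one => 0
      | .two => 1 := by
  rw [inputWords, List.getD_eq_getElem?_getD,
    List.getElem?_append_left (by simp only [List.length_append, List.length_ofFn]; have := v.2; omega),
    List.getElem?_append_left (by simp)]
  cases hv : G.owner v <;> simp [hv]

theorem val_finProdFinEquiv_lt {a b : ℕ} (i : Fin a) (j : Fin b) : i * b + j < a * b := by
  have := (finProdFinEquiv (i, j)).2
  rw [finProdFinEquiv_apply_val, Nat.mul_comm b] at this
  simpa [Nat.add_comm] using this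

theorem finProdFinEquiv_mk {a b : ℕ} (i : Fin a) (j : Fin b) (h : i * b + j < a * b) :
    finProdFinEquiv.symm ⟨i * b + j, h⟩ = (i, j) := by
  rw [Equiv.symm_apply_eq]
  ext
  simp [Nat.add_comm, Nat.mul_comm]

open Classical in
theorem inputWords_edge (v w : Fin N) :
    G.inputWords.getD (N + v * N + w) 0 = if G.E v w then 1 else 0 := by
  have h := val_finProdFinEquiv_lt v w
  rw [inputWords, List.getD_eq_getElem?_getD,
    List.getElem?_append_left (by simp only [List.length_append, List.length_ofFn]; omega),
    List.getElem?_append_right (by simp only [List.length_ofFn]; omega), List.length_ofFn,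
    show N + v * N + w - N = v * N + w by omega, List.getElem?_ofFn, dif_pos h, finProdFinEquiv_mk]
  rfl

theorem inputWords_prio (m : Fin G.n) (v : Fin N) :
    G.inputWords.getD (N + N * N + m * N + v) 0 = G.p m v := by
  have h := val_finProdFinEquiv_lt m v
  rw [inputWords, List.getD_eq_getElem?_getD,
    List.getElem?_append_right (by simp only [List.length_append, List.length_ofFn]; omega),
    List.length_append, List.length_ofFn, List.length_ofFn,
    show N + N * N + m * N + v - (N + N * N) = m * N + v by omega, List.getElem?_ofFn,
    dif_pos h, finProdFinEquiv_mk]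
  rfl

theorem inputWords_le (a : ℕ) : G.inputWords.getD a 0 ≤ G.d + 1 := by
  rcases lt_or_ge a G.inputWords.length with h | h
  · have hmem : G.inputWords.getD a 0 ∈ G.inputWords := by
      rw [List.getD_eq_getElem _ _ h]
      exact List.getElem_mem h
    generalize G.inputWords.getD a 0 = x at hmem
    simp only [inputWords, List.mem_append, List.mem_ofFn] at hmem
    rcases hmem with (⟨v, rfl⟩ | ⟨e, rfl⟩) | ⟨e, rfl⟩
    · split <;> omega
    · split_ifs <;> omega
    · exact (G.p_le _ _).trans (Nat.le_succ _)
  · rw [List.getD_eq_default _ _ h]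
    omega

/-- The bound on the size of the words. -/
noncomputable def scale : ℕ := G.size + G.b + 2

theorem size_fin : G.size = N + G.n + G.d := by simp [size]

theorem b_fin : G.b = N * (2 ^ G.r * G.r) := by simp [b, Nat.mul_assoc]

theorem base_le : N + N * N + G.n * N ≤ G.scale ^ 2 := by
  have h : N + G.n + 2 ≤ G.scale := by rw [scale, size_fin]; omega
  refine le_trans ?_ (Nat.pow_le_pow_left h 2)
  nlinarith

/-- The exponent of the bound on the words. -/
def wordExponent : ℕ := 8 * 2 ^ 10

/-- The memory layout for the game. -/
noncomputable def layout (hN : 0 < N) : RamProg.Layout where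
  W := G.scale ^ wordExponent
  Bd := G.scale ^ 4
  base := N + N * N + G.n * N
  inp a := G.inputWords.getD a 0
  pow_le := by
    have h3 : 3 ≤ G.scale := by rw [scale, size_fin]; omega
    have h4 : 3 ^ 4 ≤ G.scale ^ 4 := Nat.pow_le_pow_left h3 4
    -- This explains the exponent `8 * 2 ^ 10` of the word bound: `Bd + 32` is at most the eighth
    -- power of a scale of at least 3.
    have h8 : G.scale ^ 4 + 32 ≤ G.scale ^ 8 := by
      rw [show G.scale ^ 8 = G.scale ^ 4 * G.scale ^ 4 by ring]
      nlinarith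
    refine (Nat.pow_le_pow_left h8 _).trans (le_of_eq ?_)
    rw [← pow_mul]
    rfl
  base_le := G.base_le.trans (Nat.pow_le_pow_right (by rw [scale]; omega) (by norm_num))
  inp_le a _ := by
    refine (G.inputWords_le a).trans (le_trans ?_ (Nat.le_self_pow (by norm_num) _))
    rw [scale, size_fin]
    omega

theorem inputIn_layout (hN : 0 < N) : RamProg.InputIn (G.layout hN) G where
  base := rfl
  owner v := by
    refine ⟨fun h => ?_, fun h => ?_⟩
    · exact (G.inputWords_owner v).trans (by rw [h])
    · refine (G.inputWords_owner v).trans ?_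
      cases hv : G.owner v
      · exact absurd hv h
      · rfl
  edge v w := by
    change 0 < G.inputWords.getD _ 0 ↔ _
    rw [inputWords_edge]
    split_ifs with h <;> simp [h]
  prio m v := G.inputWords_prio m v

/-- The initial values of the variables and arrays. -/
def startState (v₀ : Fin N) : RamProg.HState where
  reg x := [N, G.n, G.d, v₀.1].getD x 0
  arr _ _ _ := 0

end MultiGame

/-! ### From verified programs to deciding the winner -/

namespace RamProg

open HState GameStructure

/-- Compute the length of the input. -/
def prelude : RamProg :=
  seq (op .mul 41 0 0) (seq (op .mul 42 1 0) (seq (op .add 40 0 41) (op .add 40 40 42)))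

theorem prelude_runs {N : ℕ} (G : MultiGame (Fin N)) (hN : 0 < N) (v₀ : Fin N) :
    ∃ s, RamRuns (G.scale ^ MultiGame.wordExponent) prelude (G.input v₀) s 4 ∧ Sim (G.layout hN) (G.startState v₀) s := by
  have hW : N + N * N + G.n * N ≤ G.scale ^ MultiGame.wordExponent :=
    G.base_le.trans (Nat.pow_le_pow_right (by rw [MultiGame.scale]; omega) (by norm_num [MultiGame.wordExponent]))
  have hBd : G.scale ≤ G.scale ^ 4 := Nat.le_self_pow (by norm_num) _
  have hsc : N + G.n + G.d ≤ G.scale := by rw [MultiGame.scale, G.size_fin]; omega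
  have hv := v₀.2
  have hreg : ∀ x, (G.input v₀).reg x = [N, G.n, G.d, v₀.1].getD x 0 := fun _ => rfl
  refine ⟨_, .seq (t₁ := 1) (t₂ := 3) (.op _ _ _ _ _ ?_) (.seq (t₁ := 1) (t₂ := 2) (.op _ _ _ _ _ ?_)
    (.seq (t₁ := 1) (t₂ := 1) (.op _ _ _ _ _ ?_) (.op _ _ _ _ _ ?_))), ?_⟩
  · simp [ArithOp.eval, hreg]
    omega
  · simp [ArithOp.eval, hreg]
    omega
  · simp [ArithOp.eval, hreg]
    omega
  · simp [ArithOp.eval, hreg]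
    omega
  · refine ⟨fun x hx => ?_, ?_, fun a ha => rfl, fun j hj a b => ?_, fun x hx => ?_, fun j hj a b => Nat.zero_le _⟩
    · have h1 : x ≠ 40 := by omega
      have h2 : x ≠ 41 := by omega
      have h3 : x ≠ 42 := by omega
      simp only [Function.update_of_ne h1, Function.update_of_ne h2, Function.update_of_ne h3]
      rfl
    · simp [ArithOp.eval, hreg, MultiGame.layout]
    -- Array entries lie beyond the input, where memory is zero; so all arrays start as zero.
    · change G.inputWords.getD _ 0 = 0
      refine List.getD_eq_default _ _ ?_
      rw [G.length_inputWords]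
      change _ ≤ 16 * _ + (N + N * N + G.n * N) + j
      omega
    · change [N, G.n, G.d, v₀.1].getD x 0 ≤ G.scale ^ 4
      refine le_trans ?_ (hsc.trans hBd)
      match x with
      | 0 => simp; omega
      | 1 => simp; omega
      | 2 => simp
      | 3 => simp; omega
      | x + 4 => simp

/-- The verdict in variable 0 is correct. -/
def Verdict {N : ℕ} (G : MultiGame (Fin N)) (Obj : Set (ℕ → Fin N)) (v₀ : Fin N) (h : HState) : Prop :=
  (h.reg 0 = 1 ∧ ∃ σ : G.Strategy .one, Winning₁ Obj v₀ σ) ∨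
    (h.reg 0 = 0 ∧ ∃ σ : G.Strategy .two, Winning₂ Obj v₀ σ)

/-- Prepare the tables and run `Q`, unless player one wins trivially. -/
def withTables (Q : RamProg) : RamProg := block [asg 4 (.var 2 / 2), asg 5 (.var 1 * .var 4),
  ite (.var 5) 1 (asg 0 1) (block [makePowers, makeTable, Q])]

/-- The word bound needed by `solveLoop_spec`. As `G.b + 3 ≤ G.scale`, the left side is at most four
times the square of the scale, and the fourth power has a factor 9 to spare. -/
theorem four_mul_sq_lt_scale {N : ℕ} (G : MultiGame (Fin N)) (hN : 0 < N) :
    4 * (N * (2 ^ G.r * G.r) + 1) * (N * (2 ^ G.r * G.r) + 1) < G.scale ^ 4 := by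
  rw [← G.b_fin]
  have h : G.b + 3 ≤ G.scale := by rw [MultiGame.scale, G.size_fin]; omega
  generalize G.scale = s at *
  generalize G.b = b at *
  have h1 : (b + 1) * (b + 1) ≤ s * s := Nat.mul_le_mul (by omega) (by omega)
  have h2 : 3 * 3 ≤ s * s := Nat.mul_le_mul (by omega) (by omega)
  have h3 : (3 * 3) * (s * s) ≤ (s * s) * (s * s) := Nat.mul_le_mul_right _ h2
  have h4 : s ^ 4 = (s * s) * (s * s) := by ring
  nlinarith

/-- For `r = 0` there is no product and the verdict is immediate. Otherwise `b` is positive, the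
tables cost `O(b)`, and `b ≤ b ^ 2 ≤ T`. -/
theorem withTables_spec {N : ℕ} {G : MultiGame (Fin N)} {v₀ : Fin N} {Obj : Set (ℕ → Fin N)} {Q : RamProg}
    {c T : ℕ} (hN : 0 < N) (hT : G.b ^ 2 ≤ T)
    (h0 : G.r = 0 → ∃ σ : G.Strategy .one, Winning₁ Obj v₀ σ)
    (hQ : ∀ [NeZero G.r] (h : HState), TablesIn h G → MarkIn h (∅ : Set (Fin N)) → h.reg 3 = v₀ →
      Wp (G.layout hN) Q h fun h' t => t ≤ c * (T + 1) ∧ Verdict G Obj v₀ h') :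
    Wp (G.layout hN) (withTables Q) (G.startState v₀) fun h' t =>
      t ≤ (c + 60) * (T + 1) ∧ Verdict G Obj v₀ h' := by
  have hBd : (G.layout hN).Bd = G.scale ^ 4 := rfl
  have hsc : N + G.n + G.d + 2 ≤ G.scale := by rw [MultiGame.scale, G.size_fin]; omega
  have hscl : G.scale ≤ G.scale ^ 4 := Nat.le_self_pow (by norm_num) _
  have hr2 : G.r ≤ G.scale ^ 4 := by
    refine (Nat.mul_le_mul (show G.n ≤ G.scale by omega)
      ((Nat.div_le_self G.d 2).trans (show G.d ≤ G.scale by omega))).trans ?_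
    rw [← pow_two]
    exact Nat.pow_le_pow_right (by omega) (by norm_num)
  refine Wp.cons (Wp.asg rfl ⟨trivial, trivial⟩ ?_ ?_)
  · exact le_trans (Nat.div_le_self _ _) (show G.d ≤ G.scale ^ 4 by omega)
  have e4 : Ex.eval (G.layout hN) (G.startState v₀) (.var 2 / 2) = G.d / 2 := rfl
  rw [e4]
  refine Wp.cons (Wp.asg rfl ⟨trivial, trivial⟩ hr2 ?_)
  have e5 : Ex.eval (G.layout hN) ((G.startState v₀).setReg 4 (G.d / 2)) (.var 1 * .var 4) = G.r := rfl
  rw [e5]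
  set h := ((G.startState v₀).setReg 4 (G.d / 2)).setReg 5 G.r with hh
  have g0 : h.reg 0 = N := rfl
  have g3 : h.reg 3 = v₀ := rfl
  have g4 : h.reg 4 = G.d / 2 := rfl
  have g5 : h.reg 5 = G.r := rfl
  refine Wp.cons (Wp.ite rfl ⟨trivial, trivial⟩ (fun hc => ?_) (fun hc => ?_))
  · simp only [Ex.eval_var, Ex.eval_num, g5] at hc
    refine Wp.asg rfl trivial (by rw [hBd]; simp; omega) (Wp.nil ⟨?_, Or.inl ⟨by simp, h0 (by omega)⟩⟩)
    nlinarith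
  · simp only [Ex.eval_var, Ex.eval_num, g5] at hc
    have : NeZero G.r := ⟨by omega⟩
    have hlt := four_mul_sq_lt_scale G hN
    have hb : N * (2 ^ G.r * G.r) = G.b := G.b_fin.symm
    have hp : 2 ^ G.r ≤ G.b := by
      rw [← hb]
      nlinarith [Nat.two_pow_pos G.r, Nat.mul_le_mul_right (2 ^ G.r * G.r) hN,
        Nat.mul_le_mul_left (2 ^ G.r) (show 1 ≤ G.r by omega)]
    have hrb : G.r ≤ G.b := (Nat.lt_two_pow_self.le).trans hp
    have hbs : G.b ≤ G.scale ^ 4 := by rw [hb] at hlt; nlinarith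
    refine Wp.cons ((makePowers_spec (N := N) g0 g5 hr2 (hp.trans hbs) (hb.le.trans hbs)).mono ?_)
    rintro h₁ t₁ ⟨ht₁, hf₁, h6, h7, hpw⟩
    refine Wp.cons ((makeTable_spec (G.inputIn_layout hN) (by rw [hf₁.1 0 (by decide), g0])
      (by rw [hf₁.1 4 (by decide), g4]) (by rw [hf₁.1 5 (by decide), g5]) h6 h7 hpw (hp.trans hbs) hr2
      (show N ≤ G.scale ^ 4 by omega) (show 2 ≤ G.scale ^ 4 by omega)).mono ?_)
    rintro h₂ t₂ ⟨ht₂, hf₂, hTab⟩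
    refine Wp.cons ((hQ h₂ hTab (fun v => ⟨fun hv => absurd hv (Set.notMem_empty _), fun _ => ?_⟩)
      (by rw [hf₂.1 3 (by decide), hf₁.1 3 (by decide), g3])).mono ?_)
    · rw [hf₂.2 14 (by decide), hf₁.2 14 (by decide)]
      rfl
    rintro h₃ t₃ ⟨ht₃, hv⟩
    refine Wp.nil (Wp.nil ⟨?_, hv⟩)
    have b1 : N * (2 ^ G.r * (15 * G.r + 9) + 6) + 3 ≤ 30 * G.b + 3 := by
      have : 2 ^ G.r * (15 * G.r + 9) + 6 ≤ 30 * (2 ^ G.r * G.r) := by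
        nlinarith [Nat.two_pow_pos G.r, Nat.mul_le_mul_left (2 ^ G.r) (show 1 ≤ G.r by omega)]
      have := Nat.mul_le_mul_left N this
      rw [← hb]
      linarith
    have b2 : G.b ≤ G.b ^ 2 := Nat.le_self_pow (by norm_num) _
    have b3 : (c + 60) * (T + 1) = c * (T + 1) + 60 * T + 60 := by ring
    rw [b3]
    omega

/-- A given initial vertex makes `N` positive, as `layout` requires. The constant is 2000 machine
steps per unit of time plus the 4 steps of `prelude`. -/
theorem winnerDecidableInTime_of_wp {Obj : ∀ {N : ℕ}, MultiGame (Fin N) → Set (ℕ → Fin N)}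
    {time : ∀ {N : ℕ}, MultiGame (Fin N) → ℕ} (P : RamProg) (c : ℕ)
    (hP : ∀ {N : ℕ} (G : MultiGame (Fin N)) (hN : 0 < N) (v₀ : Fin N),
      Wp (G.layout hN) P (G.startState v₀) fun h' t => t ≤ c * (time G + 1) ∧ Verdict G (Obj G) v₀ h') :
    WinnerDecidableInTime Obj time := by
  refine ⟨seq prelude P, 2000 * c + 4, MultiGame.wordExponent, fun N G v₀ => ?_⟩
  have hN : 0 < N := Fin.pos v₀
  obtain ⟨s, hr, hs⟩ := prelude_runs G hN v₀
  obtain ⟨s', n, h', t, hr', hn, hs', ht, hv⟩ := hP G hN v₀ s hs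
  refine ⟨s', _, .seq hr hr', ?_, ?_⟩
  · nlinarith
  · rw [hs'.reg 0 (by norm_num)]
    exact hv

section Solve

variable {N : ℕ} {G : MultiGame (Fin N)}

/-- Put the vertex of the node in variable 31 into the set in array 14 if player one wins from it. -/
def markNode : RamProg := ite (.get 2 (.var 31) 0) 1
  (block [asg 32 (.var 31 / .var 5 / .var 6),
    ite (.get 14 (.var 32) 0) 1 (block [put 14 (.var 32) 0 1, asg 30 1]) (block [])])
  (block [])

open Classical in
theorem markNode_spec {C : Layout} {h : HState} {W : Set (Fin N)} (hT : TablesIn h G) (hW : MarkIn h W)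
    (hB : N * (2 ^ G.r * G.r) < C.Bd) (q : RRNode (Fin N) G.r) (h31 : h.reg 31 = nodeEquiv N G.r q) :
    Wp C markNode h fun h' t => t ≤ 8 ∧ Frame h h' [30, 32] [14] ∧
      MarkIn h' (W ∪ {v | h.arr 2 (nodeEquiv N G.r q) 0 = 0 ∧ q.1 = v}) ∧
      h'.reg 30 = if h.arr 2 (nodeEquiv N G.r q) 0 = 0 ∧ q.1 ∉ W then 1 else h.reg 30 := by
  have hdiv := nodeEquiv_div_div q
  have hq := (nodeEquiv N G.r q).2
  have hBp : 1 ≤ C.Bd := by omega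
  refine Wp.ite rfl ⟨⟨trivial, trivial⟩, trivial⟩ (fun hc => ?_) (fun hc => ?_)
  · simp only [Ex.eval_get, Ex.eval_var, Ex.eval_num, h31, Nat.lt_one_iff] at hc
    have hq1 : (q.1 : ℕ) ≤ nodeEquiv N G.r q := by
      rw [← hdiv]
      exact (Nat.div_le_self _ _).trans (Nat.div_le_self _ _)
    refine Wp.cons (Wp.asg rfl ⟨⟨trivial, trivial⟩, trivial⟩ ?_ ?_)
    · simp only [Ex.eval_div, Ex.eval_var, h31, hT.requests, hT.sets, hdiv]
      omega
    simp only [Ex.eval_div, Ex.eval_var, h31, hT.requests, hT.sets, hdiv]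
    refine Wp.cons (Wp.ite rfl ⟨⟨trivial, trivial⟩, trivial⟩ (fun hd => ?_) (fun hd => ?_))
    · simp only [Ex.eval_get, Ex.eval_var, Ex.eval_num, setReg_reg, setReg_arr, if_true] at hd
      have hnW : q.1 ∉ W := fun hm => by
        rw [(hW q.1).1 hm] at hd
        omega
      refine Wp.cons (Wp.put rfl hBp ?_)
      simp only [Ex.eval_var, Ex.eval_num, setReg_reg, if_true]
      refine Wp.cons (Wp.asg rfl trivial hBp (Wp.nil (Wp.nil ⟨by omega, ?_, fun v => ?_, ?_⟩)))
      · exact (((Frame.refl h _ _).setReg (by decide) _).setArr (by decide) _ _ _).setReg (by decide) _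
      · simp only [setReg_arr, setArr_arr, if_true, update₂_apply, and_true, Set.mem_union,
          Set.mem_ofPred_eq, hc, true_and]
        by_cases hv : q.1 = v
        · simp [hv]
        · rw [if_neg (fun h => hv (Fin.ext h.symm))]
          simpa [hv] using hW v
      · simp [hc, hnW]
    · simp only [Ex.eval_get, Ex.eval_var, Ex.eval_num, setReg_reg, setReg_arr, if_true] at hd
      have hnW : q.1 ∈ W := by
        by_contra hm
        rw [(hW q.1).2 hm] at hd
        omega
      refine Wp.nil (Wp.nil ⟨by omega, (Frame.refl h _ _).setReg (by decide) _, fun v => ?_, ?_⟩)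
      · have : v ∈ W ∪ {v | h.arr 2 (nodeEquiv N G.r q) 0 = 0 ∧ q.1 = v} ↔ v ∈ W :=
          or_iff_left_of_imp fun h => h.2 ▸ hnW
        rw [this]
        exact hW v
      · simp [hnW]
  · simp only [Ex.eval_get, Ex.eval_var, Ex.eval_num, h31, Nat.lt_one_iff] at hc
    refine Wp.nil ⟨by omega, Frame.refl _ _ _, fun v => ?_, ?_⟩
    · have : v ∈ W ∪ {v | h.arr 2 (nodeEquiv N G.r q) 0 = 0 ∧ q.1 = v} ↔ v ∈ W :=
        or_iff_left_of_imp fun h => absurd h.1 hc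
      rw [this]
      exact hW v
    · simp [hc]

variable [NeZero G.r] {hN : 0 < N} {v₀ : Fin N}

/-! ### The direct game -/

/-- Solve the product game and read off the winner of the direct game. -/
def solveDirect : RamProg := block [solveProduct,
  -- The number of the initial node: request 0 is awaited, and the pending set results from the
  -- empty set, whose code is 0.
  ite (.get 2 (.var 5 * (.get 12 (.var 3) 0 + .var 6 * .var 3)) 0) 1 (asg 0 1) (asg 0 0)]

theorem solveDirect_spec {h : HState} (hT : TablesIn h G) (hW : MarkIn h (∅ : Set (Fin N)))
    (h3 : h.reg 3 = v₀) :
    Wp (G.layout hN) solveDirect h fun h' t => t ≤ 4130 * (G.b ^ 2 + 1) ∧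
      Verdict G (G.DirBndRR G.rq G.rp) v₀ h' := by
  have h2 : 2 ≤ (G.layout hN).Bd := by
    have := four_mul_sq_lt_scale G hN
    change 2 ≤ G.scale ^ 4
    generalize N * (2 ^ G.r * G.r) = M at this
    nlinarith
  refine Wp.cons ((solveProduct_spec (G.inputIn_layout hN) hT hW (four_mul_sq_lt_scale G hN)).mono ?_)
  rintro h₁ t₁ ⟨ht₁, hf, hA⟩
  have hT₁ := hT.frame hf (by decide) (by decide) (by decide)
  have g3 : h₁.reg 3 = v₀ := by rw [hf.1 3 (by decide), h3]
  rw [← G.b_fin] at ht₁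
  have hz : setCode (0 : Fin G.r → Fin 2) = 0 := by
    rw [setCode_eq_sum]
    simp
  have htab := hT₁.table v₀ 0
  rw [hz] at htab
  have hnode := nodeEquiv_val (N := N) (r := G.r) (v₀, pendingAt G.rq G.rp v₀ 0, 0)
  simp only [Fin.val_zero, zero_add] at hnode
  have htime : t₁ + 4 ≤ 4130 * (G.b ^ 2 + 1) := by
    have : 2 * G.b ≤ G.b ^ 2 + 1 := by nlinarith [sq_nonneg ((G.b : ℤ) - 1)]
    nlinarith
  refine Wp.cons (Wp.ite rfl ⟨⟨⟨trivial, ⟨trivial, trivial⟩, trivial, trivial⟩, trivial⟩, trivial⟩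
    (fun hc => ?_) (fun hc => ?_))
  · simp only [Ex.eval_get, Ex.eval_mul, Ex.eval_add, Ex.eval_var, Ex.eval_num, g3, hT₁.requests, hT₁.sets,
      htab, ← hnode] at hc
    refine Wp.asg rfl trivial (by simp; omega) (Wp.nil ⟨by omega, Or.inl ⟨by simp, ?_⟩⟩)
    obtain ⟨σ, hσ, -⟩ := hA.exists_winning₁_dirBndRR (Nat.lt_one_iff.mp hc)
    exact ⟨σ, hσ⟩
  · simp only [Ex.eval_get, Ex.eval_mul, Ex.eval_add, Ex.eval_var, Ex.eval_num, g3, hT₁.requests, hT₁.sets,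
      htab, ← hnode] at hc
    refine Wp.asg rfl trivial (Nat.zero_le _) (Wp.nil ⟨by omega, Or.inr ⟨by simp, ?_⟩⟩)
    obtain ⟨σ, hσ, -⟩ := hA.exists_winning₂_dirBndRR (fun h => hc (Nat.lt_one_iff.mpr h))
    exact ⟨σ, hσ⟩

/-! ### The undirect game -/

/-- Mark the vertices over which player one wins somewhere in the product, and record in variable 30
whether a new one is found. -/
def markRound : RamProg := block [solveProduct, asg 30 0, forLt 31 (.var 7) markNode]

theorem markRound_spec {h : HState} {W : Set (Fin N)} (hT : TablesIn h G) (hW : MarkIn h W) :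
    Wp (G.layout hN) markRound h fun h' t => t ≤ 5000 * (G.b ^ 2 + 1) ∧
      TablesIn h' G ∧ h'.reg 3 = h.reg 3 ∧ ∃ A, ProductSolution G.rq G.rp G.toGameStructure W A ∧
        MarkIn h' (W ∪ {v | ∃ x ∈ A, x.1 = v}) ∧
        (h'.reg 30 = 0 → ∀ x ∈ A, x.1 ∈ W) ∧ (h'.reg 30 ≠ 0 → ∃ x ∈ A, x.1 ∉ W) := by
  have hB := four_mul_sq_lt_scale G hN
  have hBd : (G.layout hN).Bd = G.scale ^ 4 := rfl
  refine Wp.cons ((solveProduct_spec (G.inputIn_layout hN) hT hW hB).mono ?_)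
  rintro h₁ t₁ ⟨ht₁, hf₁, hA⟩
  have hM : N * (2 ^ G.r * G.r) < (G.layout hN).Bd := by rw [hBd]; nlinarith
  have hT₁ := hT.frame hf₁ (by decide) (by decide) (by decide)
  set A := {q | h₁.arr 2 (nodeEquiv N G.r q) 0 = 0} with hAdef
  set M := N * (2 ^ G.r * G.r) with hMdef
  have hnode : ∀ u < M, ∃ q, (nodeEquiv N G.r q : ℕ) = u := fun u hu =>
    ⟨(nodeEquiv N G.r).symm ⟨u, hu⟩, by simp⟩
  refine Wp.cons (Wp.asg rfl trivial (Nat.zero_le _) ?_)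
  refine Wp.cons (Wp.forLt (n := M) (fun i g => g.reg 31 = i ∧ Frame h₁ g [30, 31, 32] [14] ∧
    MarkIn g (W ∪ {v | ∃ x ∈ A, (nodeEquiv N G.r x : ℕ) < i ∧ x.1 = v}) ∧
    (g.reg 30 = 0 → ∀ x ∈ A, (nodeEquiv N G.r x : ℕ) < i → x.1 ∈ W) ∧
    (g.reg 30 ≠ 0 → ∃ x ∈ A, x.1 ∉ W)) (fun _ => 8) rfl hM.le ?_ ?_ ?_ ?_)
  · rintro i g ⟨h1, h2, -⟩
    exact ⟨h1, by simp [h2.1 7 (by decide), hT₁.nodes, hMdef]⟩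
  · refine ⟨by simp, ((Frame.refl _ _ _).setReg (by decide) _).setReg (by decide) _, fun v => ?_,
      fun _ x _ hx => absurd hx (Nat.not_lt_zero _), fun hne => absurd (by simp) hne⟩
    simp only [setReg_arr, Nat.not_lt_zero, false_and, and_false, exists_false]
    rw [hf₁.2 14 (by decide)]
    simpa using hW v
  · rintro i g hi ⟨h31, hf, hmark, hz, hnz⟩
    obtain ⟨q, rfl⟩ := hnode i hi
    have g2 : g.arr 2 = h₁.arr 2 := hf.2 2 (by decide)
    refine (markNode_spec (hT₁.frame hf (by decide) (by decide) (by decide)) hmark hM q h31).mono ?_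
    rintro g' t ⟨ht, hf', hmark', h30⟩
    rw [g2] at hmark' h30
    have hlt : ∀ x : RRNode (Fin N) G.r, (nodeEquiv N G.r x : ℕ) < nodeEquiv N G.r q + 1 ↔
        (nodeEquiv N G.r x : ℕ) < nodeEquiv N G.r q ∨ x = q := fun x => by
      rw [Nat.lt_succ_iff_lt_or_eq, val_equiv_inj]
    refine ⟨by rw [hf'.1 31 (by decide), h31], ⟨by simp, ?_, ?_, ?_, ?_⟩, ht⟩
    · exact (hf.trans (hf'.mono (by decide) (List.Subset.refl _)) (List.Subset.refl _)
        (List.Subset.refl _)).setReg (by decide) _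
    · have hset : W ∪ {v | ∃ x ∈ A, (nodeEquiv N G.r x : ℕ) < nodeEquiv N G.r q + 1 ∧ x.1 = v} =
          W ∪ {v | ∃ x ∈ A, (nodeEquiv N G.r x : ℕ) < nodeEquiv N G.r q ∧ x.1 = v} ∪
            {v | h₁.arr 2 (nodeEquiv N G.r q) 0 = 0 ∧ q.1 = v} := by
        ext v
        simp only [Set.mem_union, Set.mem_ofPred_eq, hlt]
        constructor
        · rintro (h | ⟨x, hx, h | rfl, rfl⟩)
          · exact Or.inl (Or.inl h)
          · exact Or.inl (Or.inr ⟨x, hx, h, rfl⟩)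
          · exact Or.inr ⟨hx, rfl⟩
        · rintro ((h | ⟨x, hx, h, rfl⟩) | ⟨hx, rfl⟩)
          · exact Or.inl h
          · exact Or.inr ⟨x, hx, Or.inl h, rfl⟩
          · exact Or.inr ⟨q, hx, Or.inr rfl, rfl⟩
      rw [hset]
      exact hmark'
    · simp only [setReg_reg]
      rw [if_neg (by norm_num), h30]
      split_ifs with hc
      · intro h
        simp at h
      · intro h0 x hx hxi
        rcases (hlt x).mp hxi with hxi | rfl
        · exact hz h0 x hx hxi
        -- The mark is tested against the set grown so far; but while variable 30 is 0, nothing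
        -- outside `W` has been added to it.
        · by_contra hxW
          refine hc ⟨hx, ?_⟩
          rintro (h | ⟨y, hy, hyi, hyx⟩)
          · exact hxW h
          · exact hxW (hyx ▸ hz h0 y hy hyi)
    · simp only [setReg_reg]
      rw [if_neg (by norm_num), h30]
      split_ifs with hc
      · exact fun _ => ⟨q, hc.1, fun h => hc.2 (Or.inl h)⟩
      · exact hnz
  · rintro g t ⟨h31, hf, hmark, hz, hnz⟩ ht
    simp only [Finset.sum_const, Finset.card_range, smul_eq_mul] at ht
    have hall : ∀ x : RRNode (Fin N) G.r, (nodeEquiv N G.r x : ℕ) < M := fun x => (nodeEquiv N G.r x).2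
    refine Wp.nil ⟨?_, hT₁.frame hf (by decide) (by decide) (by decide), ?_, A, hA, ?_, ?_, hnz⟩
    · rw [G.b_fin, ← hMdef]
      have : 2 * M ≤ M ^ 2 + 1 := by nlinarith [sq_nonneg ((M : ℤ) - 1)]
      nlinarith
    · rw [hf.1 3 (by decide), hf₁.1 3 (by decide)]
    · simpa only [hall, true_and] using hmark
    · exact fun h0 x hx => hz h0 x hx (hall x)

/-- Iterate until no new vertices are found, and read off the winner of the undirect game. -/
def solveUndirect : RamProg := block [asg 30 1, loop 0 (.var 30) markRound,
  ite (.get 14 (.var 3) 0) 1 (asg 0 0) (asg 0 1)]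

theorem solveUndirect_spec {h : HState} (hT : TablesIn h G) (hW : MarkIn h (∅ : Set (Fin N)))
    (h3 : h.reg 3 = v₀) :
    Wp (G.layout hN) solveUndirect h fun h' t => t ≤ 22000 * (N * G.b ^ 2 + 1) ∧
      Verdict G (G.BndRR G.rq G.rp) v₀ h' := by
  have h2 : 2 ≤ (G.layout hN).Bd := by
    have := four_mul_sq_lt_scale G hN
    change 2 ≤ G.scale ^ 4
    generalize N * (2 ^ G.r * G.r) = M at this
    nlinarith
  set c := 5000 * (G.b ^ 2 + 1) + 1 with hc
  refine Wp.cons (Wp.asg rfl trivial (by simp; omega) ?_)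
  rw [Ex.eval_num]
  refine Wp.cons (Wp.loop (fun g => TablesIn g G ∧ g.reg 3 = v₀ ∧ ∃ W, MarkIn g W ∧
      HasLayers G.toGameStructure G.rq G.rp W ∧
      (g.reg 30 = 0 → ∃ A, ProductSolution G.rq G.rp G.toGameStructure W A ∧ ∀ x ∈ A, x.1 ∈ W))
    -- A round that leaves variable 30 nonzero has enlarged `W`, and any other round is the last. So
    -- there are at most `N + 1` rounds, each charged `c`.
    (fun g => c * ((if g.reg 30 = 0 then 0 else 1) + (N - {v : Fin N | g.arr 14 v 0 = 1}.ncard)))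
    rfl ?_ ?_ ?_)
  · refine ⟨hT.frame ((Frame.refl h [30] []).setReg (by decide) 1) (by decide) (by decide) (by decide),
      h3, ∅, hW, hasLayers_empty, fun h0 => ?_⟩
    simp at h0
  · rintro g ⟨hTg, hg3, W, hWg, hL, -⟩ hlt
    simp only [Ex.eval_var, Ex.eval_num] at hlt
    have hset : ∀ {g' : HState} {W' : Set (Fin N)}, MarkIn g' W' → {v : Fin N | g'.arr 14 v 0 = 1} = W' :=
      fun {g' W'} hm => by
        ext v
        simp only [Set.mem_ofPred_eq]
        refine ⟨fun h1 => ?_, (hm v).1⟩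
        by_contra hv
        rw [(hm v).2 hv] at h1
        exact zero_ne_one h1
    refine (markRound_spec hTg hWg).mono ?_
    rintro g' t ⟨ht, hTg', hg3', A, hA, hWg', hz, hnz⟩
    have hne : ¬ g.reg 30 = 0 := by omega
    simp only [hset hWg, hset hWg', if_neg hne]
    refine ⟨⟨hTg', hg3'.trans hg3, _, hWg', hL.union hA, fun h0 => ?_⟩, ?_⟩
    · have hAW : W ∪ {v | ∃ x ∈ A, x.1 = v} = W :=
        Set.union_eq_left.mpr (by rintro v ⟨x, hx, rfl⟩; exact hz h0 x hx)
      rw [hAW]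
      exact ⟨A, hA, hz h0⟩
    · have hle : ∀ S : Set (Fin N), S.ncard ≤ N := fun S => by
        simpa using Set.ncard_le_card S
      by_cases h0 : g'.reg 30 = 0
      · have hAW : W ∪ {v | ∃ x ∈ A, x.1 = v} = W :=
          Set.union_eq_left.mpr (by rintro v ⟨x, hx, rfl⟩; exact hz h0 x hx)
        rw [hAW, if_pos h0, Nat.mul_add, Nat.mul_add]
        omega
      · obtain ⟨x, hx, hxW⟩ := hnz h0
        have hss : W ⊂ W ∪ {v | ∃ x ∈ A, x.1 = v} :=
          ⟨Set.subset_union_left, fun hsub => hxW (hsub (Or.inr ⟨x, hx, rfl⟩))⟩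
        have hcard := Set.ncard_lt_ncard hss (Set.toFinite _)
        have := hle (W ∪ {v | ∃ x ∈ A, x.1 = v})
        rw [if_neg h0]
        obtain ⟨k, hk⟩ : ∃ k, N - W.ncard = k + 1 + (N - (W ∪ {v | ∃ x ∈ A, x.1 = v}).ncard) :=
          ⟨(W ∪ {v | ∃ x ∈ A, x.1 = v}).ncard - W.ncard - 1, by omega⟩
        rw [hk]
        nlinarith
  · rintro g t ⟨hTg, hg3, W, hWg, hL, hfin⟩ hnlt ht
    simp only [Ex.eval_var, Ex.eval_num, not_lt, Nat.le_zero] at hnlt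
    have htime : t + 6 ≤ 22000 * (N * G.b ^ 2 + 1) := by
      have hlate : t ≤ c * (1 + N) + 1 := by
        refine (Nat.le_add_left _ _).trans (ht.trans (Nat.add_le_add_right (Nat.mul_le_mul_left _ ?_) 1))
        simp
      -- As `b` and `N` are positive, both `N` and `G.b ^ 2` are at most `N * G.b ^ 2`, which
      -- absorbs the lower-order terms of `c * (1 + N)`.
      have hb : 1 ≤ G.b ^ 2 := by
        rw [G.b_fin]
        exact Nat.pow_pos (Nat.mul_pos hN (Nat.mul_pos (Nat.two_pow_pos _)
          (Nat.pos_of_ne_zero (NeZero.ne _))))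
      have hNb : N * 1 ≤ N * G.b ^ 2 := Nat.mul_le_mul_left _ hb
      have hNb' : 1 * G.b ^ 2 ≤ N * G.b ^ 2 := Nat.mul_le_mul_right _ hN
      rw [show c * (1 + N) = 5000 * (N * G.b ^ 2) + 5000 * G.b ^ 2 + 5001 * N + 5001 by rw [hc]; ring]
        at hlate
      omega
    obtain ⟨A, hA, hAW⟩ := hfin hnlt
    refine Wp.cons (Wp.ite rfl ⟨⟨trivial, trivial⟩, trivial⟩ (fun hd => ?_) (fun hd => ?_))
    · simp only [Ex.eval_get, Ex.eval_var, Ex.eval_num, hg3] at hd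
      have hv : v₀ ∉ W := fun hm => by
        rw [(hWg v₀).1 hm] at hd
        omega
      exact Wp.asg rfl trivial (Nat.zero_le _) (Wp.nil ⟨by omega, Or.inr ⟨by simp,
        hA.exists_winning₂_bndRR hAW hv⟩⟩)
    · simp only [Ex.eval_get, Ex.eval_var, Ex.eval_num, hg3] at hd
      have hv : v₀ ∈ W := by
        by_contra hm
        rw [(hWg v₀).2 hm] at hd
        omega
      obtain ⟨σ, hσ, -⟩ := hL.exists_winning₁_bndRR hv
      exact Wp.asg rfl trivial (by simp; omega) (Wp.nil ⟨by omega, Or.inl ⟨by simp, σ, hσ⟩⟩)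

end Solve

end RamProg

/-! ### The decision procedures for both objectives -/

namespace MultiGame

theorem winnerDecidable_dirBnd (X : ObjKind) :
    WinnerDecidableInTime (fun G => G.DirBndObj X) (fun G => G.b ^ 2) := by
  refine RamProg.winnerDecidableInTime_of_wp (RamProg.withTables RamProg.solveDirect) (4130 + 60)
    fun {N} G hN v₀ => RamProg.withTables_spec hN le_rfl (fun h0 => ?_) fun h hT hW h3 => ?_
  · rw [G.dirBndObj_eq_plays X h0]
    obtain ⟨σ, -⟩ := GameStructure.nonempty_strategy G.toGameStructure .one
    exact ⟨σ, winning₁_plays σ⟩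
  · rw [G.dirBndObj_eq_rr X]
    exact RamProg.solveDirect_spec hT hW h3

theorem winnerDecidable_bnd (X : ObjKind) :
    WinnerDecidableInTime (fun G => G.BndObj X) (fun {N} G => N * G.b ^ 2) := by
  refine RamProg.winnerDecidableInTime_of_wp (RamProg.withTables RamProg.solveUndirect) (22000 + 60)
    fun {N} G hN v₀ => RamProg.withTables_spec hN (Nat.le_mul_of_pos_left _ hN) (fun h0 => ?_)
      fun h hT hW h3 => ?_
  · rw [G.bndObj_eq_plays X h0]
    obtain ⟨σ, -⟩ := GameStructure.nonempty_strategy G.toGameStructure .one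
    exact ⟨σ, winning₁_plays σ⟩
  · rw [G.bndObj_eq_rr X]
    exact RamProg.solveUndirect_spec hT hW h3

end MultiGame

theorem lemma4 (X : ObjKind) :
    -- the games are (direct) bounded request-response games with `n * (d / 2)` pairs
    (∀ (V : Type*) [Finite V] (G : MultiGame V),
      Nat.card (Fin G.n × Fin (G.d / 2)) = G.n * (G.d / 2) ∧
      G.DirBndObj X = G.DirBndRR G.request G.response ∧
      G.BndObj X = G.BndRR G.request G.response) ∧
    -- direct objectives: the winner is decidable in time `O(b ^ 2)`
    WinnerDecidableInTime (fun G => G.DirBndObj X) (fun G => G.b ^ 2) ∧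
    -- direct objectives: exponential memory suffices for both players
    (∃ q : Polynomial ℕ, ∀ (V : Type*) [Finite V] (G : MultiGame V) (v₀ : V),
      ((∃ σ : G.Strategy .one, GameStructure.Winning₁ (G.DirBndObj X) v₀ σ) →
        ∃ σ : G.Strategy .one, GameStructure.Winning₁ (G.DirBndObj X) v₀ σ ∧
          σ.HasMemory (2 ^ q.eval G.size)) ∧
      ((∃ σ : G.Strategy .two, GameStructure.Winning₂ (G.DirBndObj X) v₀ σ) →
        ∃ σ : G.Strategy .two, GameStructure.Winning₂ (G.DirBndObj X) v₀ σ ∧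
          σ.HasMemory (2 ^ q.eval G.size))) ∧
    -- undirect objectives: the winner is decidable in time `O(|V| * b ^ 2)`
    WinnerDecidableInTime (fun G => G.BndObj X) (fun {N} G => N * G.b ^ 2) ∧
    -- undirect objectives: exponential memory suffices for player one
    (∃ q : Polynomial ℕ, ∀ (V : Type*) [Finite V] (G : MultiGame V) (v₀ : V),
      (∃ σ : G.Strategy .one, GameStructure.Winning₁ (G.BndObj X) v₀ σ) →
        ∃ σ : G.Strategy .one, GameStructure.Winning₁ (G.BndObj X) v₀ σ ∧
          σ.HasMemory (2 ^ q.eval G.size)) ∧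
    -- undirect objectives: player two needs infinite memory, in every number of dimensions
    (∀ n : ℕ, 1 ≤ n → ∃ (N : ℕ) (G : MultiGame (Fin N)) (v₀ : Fin N), G.n = n ∧ G.d = 2 ∧
      (∃ σ : G.Strategy .two, GameStructure.Winning₂ (G.BndObj X) v₀ σ) ∧
      ∀ σ : G.Strategy .two, σ.FiniteMemory → ¬ GameStructure.Winning₂ (G.BndObj X) v₀ σ) := by
  refine ⟨fun V _ G => ⟨by simp, G.dirBndObj_eq X, G.bndObj_eq X⟩, MultiGame.winnerDecidable_dirBnd X,
    ⟨MultiGame.memoryPoly, fun V _ G v₀ => G.dirBnd_memory X v₀⟩, MultiGame.winnerDecidable_bnd X,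
    ⟨MultiGame.memoryPoly, fun V _ G v₀ h => G.bnd_memory X v₀ h⟩,
    MultiGame.exists_infinite_memory_game X⟩
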